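/- For $k\in\mathbf R$ let $$A_k(x)=\begin{bmatrix}1& k\,\mathrm{sgn}(x)\\ -k\,\mathrm{sgn}(x)&1\end{bmatrix},$$ and consider $\mathrm{div}\,A_k(x)\nabla U(t,x)=0$ in $\mathbf R^2_+=\{(t,x): t>0\}$, where $\nabla=(\partial_t,\partial_x)$, with Dirichlet data $U(0,\cdot)=u$. For $\alpha\in(-2,1)$, $t>0$, $x,y\in\mathbf R$ put $$P_\alpha(t,x;y)=\frac1\pi\,\frac{2xty+|y|^{-\alpha}\,\mathrm{Im}\{(|x|+it)^{\alpha+1}(y^2-(|x|-it)^2)\}}{(t^2+(x-y)^2)(t^2+(x+y)^2)},\qquad U(t,x)=\int_{\mathbf R}P_\alpha(t,x;y)u(y)\,dy .$$ Let $1<p<\infty$ and $1/p+1/q=1$. (a) Let $\alpha\in(1/q-2,1/q)$, $\alpha\ne-1$, $k=\tan(\pi\alpha/2)$. There is $C<\infty$ such that for every $u\in L_p(\mathbf R;\mathbf C)$ the integral defining $U$ converges absolutely at every $(t,x)\in\mathbf R^2_+$, $U$ is a weak solution of $\mathrm{div}\,A_k\nabla U=0$ in $\mathbf R^2_+$, $\sup_{t>0}\|U(t,\cdot)\|_p\le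 C\|u\|_p$, and $\|U(t,\cdot)-u\|_p\to0$ as $t\to0^+$. Moreover $U$ is the solution constructed by the boundary equation method: with $$Kf(x)=\frac{\mathrm{sgn}(x)}\pi\,\mathrm{p.v.}\!\int\frac{f(y)}{x-y}dy-\frac1\pi\int\frac{f(y)}{|x|+|y|}dy,$$ the equation $u=\frac12(I+kK)^*\psi$ has exactly one solution $\psi\in L_p(\mathbf R;\mathbf C)$, and, for this $\psi$, $U=e_0\cdot C_k^+[\psi,\ k\,\mathrm{sgn}(x)\psi]^t$, that is, $$U(t,x)=\frac1{2\pi}\int_{\mathbf R}\Big(\frac{t-(x-y)k\,\mathrm{sgn}(y)}{t^2+(x-y)^2}-k\frac{|x|+|y|}{t^2+(|x|+|y|)^2}\Big)\psi(y)\,dy .$$ Here $e_0\cdot F$ denotes the $t$-component of $F$, and $C_k^+h(t,\cdot)=e^{-t|T_k|}\chi_+(T_k)h$, $t>0$, is the Cauchy extension for the operator $T_k$ for which $\partial_tF+T_kF=0$ is the system $\mathrm{div}\,A_kF=0$, $\mathrm{curl}\,F=0$. In other words, $C_k^+h$ is the solution $F$ of this system in $t>0$, bounded in $t$ with values in $L_p$,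 whose $L_p$ trace at $t=0$ is $h_+$, where $h=h_++h_-$ and $h_-$ is the trace of such a solution in $t<0$. (b) Let $\alpha\in(-1,1)$ and $k=\tan(\pi\alpha/2)$. Then $P_\alpha(t,x;y)\ge0$ for all $t>0$ and $x,y\in\mathbf R$ (at $y=0$ the factor $|y|^{-\alpha}$ is, for $\alpha\neq 0$, read as $0$). For every $u\in C_0^\infty(\mathbf R;\mathbf C)$ the integral defining $U$ converges absolutely at every $(t,x)\in\mathbf R^2_+$, $U$ is a weak solution of $\mathrm{div}\,A_k\nabla U=0$ in $\mathbf R^2_+$, $\iint_{\mathbf R^2_+}|\nabla U|^2\,dt\,dx<\infty$, and $U$ is the $\dot H^1$ (Lax--Milgram) solution of the Dirichlet problem: $U=U_1-U_2$, where $U_1\in C_0^\infty(\mathbf R^2)$, $U_1(0,\cdot)=u$, and $U_2\in\dot H^1_0(\mathbf R^2_+)$ (the closure of $C_0^\infty(\mathbf R^2_+)$ in the norm $\|\nabla\cdot\|_2$) satisfies $\iint(A_k\nabla U_2,\nabla\psi)\,dt\,dx=\iint(A_k\nabla U_1,\nabla\psi)\,dt\,dx$ for all $\psi\in\dot H^1_0(\mathbf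 R^2_+)$. -/

import Mathlib

open Set Filter Topology MeasureTheory
open scoped ENNReal NNReal Matrix ContDiff

namespace HarmonicMeasure

noncomputable section

/-! Points of the plane are `z = (t, x)`; index `0` is the vertical (`t`) direction and index `1` the
horizontal (`x`) direction. -/

/-- The upper half plane `t > 0`. -/
def halfPlane : Set (ℝ × ℝ) := {z | 0 < z.1}

/-- The coefficient matrix `A_k(x) = [1, k sgn x; -k sgn x, 1]`. -/
def coeff (k x : ℝ) : Matrix (Fin 2) (Fin 2) ℂ :=
  !![1, ((k * Real.sign x : ℝ) : ℂ); ((-(k * Real.sign x) : ℝ) : ℂ), 1]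

/-- The classical gradient `(∂_t φ, ∂_x φ)`. -/
def grad (φ : ℝ × ℝ → ℂ) (z : ℝ × ℝ) : Fin 2 → ℂ :=
  ![fderiv ℝ φ z (1, 0), fderiv ℝ φ z (0, 1)]

/-- Complex valued test functions: the class `C_0^∞(Ω)`. -/
def IsTest (Ω : Set (ℝ × ℝ)) (φ : ℝ × ℝ → ℂ) : Prop :=
  ContDiff ℝ ∞ φ ∧ HasCompactSupport φ ∧ tsupport φ ⊆ Ω

/-- `G` is the weak (distributional) gradient of `U` in the upper half plane. -/
def HasWeakGrad (U : ℝ × ℝ → ℂ) (G : ℝ × ℝ → Fin 2 → ℂ) : Prop :=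
  LocallyIntegrableOn U halfPlane volume ∧ LocallyIntegrableOn G halfPlane volume ∧
    ∀ φ, IsTest halfPlane φ → ∀ i : Fin 2,
      ∫ z in halfPlane, U z * grad φ z i = -∫ z in halfPlane, G z i * φ z

/-- `U` is a weak solution of `div A_k ∇U = 0` in the upper half plane: it has a locally square
integrable weak gradient `G`, and `div (A_k G) = 0` in the sense of distributions. -/
def IsWeakSolution (k : ℝ) (U : ℝ × ℝ → ℂ) : Prop :=
  ∃ G : ℝ × ℝ → Fin 2 → ℂ, HasWeakGrad U G ∧
    (∀ K : Set (ℝ × ℝ), IsCompact K → K ⊆ halfPlane → MemLp G 2 (volume.restrict K)) ∧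
    ∀ φ, IsTest halfPlane φ →
      ∫ z in halfPlane, (coeff k z.2 *ᵥ G z) ⬝ᵥ grad φ z = 0

/-- `∬ |G|² dt dx` over the upper half plane. -/
def energy (G : ℝ × ℝ → Fin 2 → ℂ) : ℝ≥0∞ :=
  ∫⁻ z in halfPlane, (‖G z 0‖ₑ ^ 2 + ‖G z 1‖ₑ ^ 2)

/-! ### The Poisson kernel -/

/-- The Poisson kernel `P_α(t, x; y)`. The power is the principal one; for `t > 0` the argument of
`|x| + i t` lies in `(0, π/2]`. -/
def jumpPoissonKernel (α t x y : ℝ) : ℝ :=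
  (1 / Real.pi) *
    ((2 * x * t * y +
        |y| ^ (-α) *
          ((((|x| : ℝ) : ℂ) + Complex.I * (t : ℂ)) ^ ((α : ℂ) + 1) *
            ((y : ℂ) ^ 2 - (((|x| : ℝ) : ℂ) - Complex.I * (t : ℂ)) ^ 2)).im) /
      ((t ^ 2 + (x - y) ^ 2) * (t ^ 2 + (x + y) ^ 2)))

/-- `U(t, x) = ∫ P_α(t, x; y) u(y) dy`. -/
def poissonIntegral (α : ℝ) (u : ℝ → ℂ) (z : ℝ × ℝ) : ℂ :=
  ∫ y, (jumpPoissonKernel α z.1 z.2 y : ℂ) * u y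

/-! ### The boundary equation method -/

/-- The kernel, truncated at distance `ε` from the diagonal, of the double layer potential type
operator `K f(x) = sgn(x) (1/π) p.v.∫ f(y)/(x-y) dy - (1/π) ∫ f(y)/(|x|+|y|) dy`. -/
def doubleLayerKernel (ε x y : ℝ) : ℝ :=
  (1 / Real.pi) * ((if ε < |x - y| then Real.sign x / (x - y) else 0) - 1 / (|x| + |y|))

/-- The boundary equation `u = ½ (I + k K)^* ψ` in `L_p`. The kernel of `K` is real, so that `K^*` has
the transposed kernel; the principal value is taken in the sense of convergence in `L_p`. -/
def BoundaryEquation (k : ℝ) (p : ℝ≥0∞) (u ψ : ℝ → ℂ) : Prop :=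
  Tendsto
    (fun ε : ℝ => eLpNorm
      (fun x => (1 / 2 : ℂ) * (ψ x + (k : ℂ) * ∫ y, (doubleLayerKernel ε y x : ℂ) * ψ y) - u x)
      p volume)
    (𝓝[>] 0) (𝓝 0)

/-- The vector field `F` satisfies `div A_k F = 0` and `curl F = 0` in `Ω` in the sense of distributions,
that is, the first order system `∂_t F + T_k F = 0`, where
`T_k = [k (sgn(x) ∂_x - ∂_x sgn(x)), ∂_x; -∂_x, 0]`. -/
def IsFirstOrderSolution (k : ℝ) (Ω : Set (ℝ × ℝ)) (F : ℝ × ℝ → Fin 2 → ℂ) : Prop :=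
  LocallyIntegrableOn F Ω volume ∧
    ∀ φ, IsTest Ω φ →
      (∫ z in Ω, (coeff k z.2 *ᵥ F z) ⬝ᵥ grad φ z = 0) ∧
      (∫ z in Ω, (F z 1 * grad φ z 0 - F z 0 * grad φ z 1) = 0)

/-- `F` solves `∂_t F + T_k F = 0` in the half plane `σ t > 0` (`σ = 1` or `σ = -1`), is bounded in `t`
with values in `L_p`, and has trace `h` on `t = 0` in `L_p`. The traces with `σ = 1` (`σ = -1`) form the
Hardy space that is the range of `χ_+(T_k)` (of `χ_-(T_k)`), and then `F(t, ·) = e^{-σ t |T_k|} h`. -/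
structure IsHardyField (σ k : ℝ) (p : ℝ≥0∞) (F : ℝ × ℝ → Fin 2 → ℂ) (h : ℝ → Fin 2 → ℂ) :
    Prop where
  solves : IsFirstOrderSolution k {z : ℝ × ℝ | 0 < σ * z.1} F
  slice_memLp : ∀ t : ℝ, 0 < t → MemLp (fun x => F (σ * t, x)) p volume
  bounded : ∃ C : ℝ≥0, ∀ t : ℝ, 0 < t → eLpNorm (fun x => F (σ * t, x)) p volume ≤ C
  trace_memLp : MemLp h p volume
  trace : Tendsto (fun t : ℝ => eLpNorm (fun x => F (σ * t, x) - h x) p volume) (𝓝[>] 0) (𝓝 0)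

/-- `F` is the Cauchy extension `C_k^+ h = e^{-t |T_k|} χ_+(T_k) h` of `h`: in the splitting
`h = h₊ + h₋`, `h₊ = χ_+(T_k) h`, `h₋ = χ_-(T_k) h`, of `h` into traces from the upper and from the lower
half plane, `F` is the field in the upper half plane with trace `h₊`. The splitting is unique, as `T_k`
is self-adjoint and injective: if `h = 0`, then `F` and `-G` fit together to a solution of
`∂_t H + T_k H = 0` that is bounded for all `t ∈ ℝ`, hence zero. -/
def IsCauchyExtension (k : ℝ) (p : ℝ≥0∞) (h : ℝ → Fin 2 → ℂ) (F : ℝ × ℝ → Fin 2 → ℂ) : Prop :=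
  ∃ (hp hm : ℝ → Fin 2 → ℂ) (G : ℝ × ℝ → Fin 2 → ℂ),
    IsHardyField 1 k p F hp ∧ IsHardyField (-1) k p G hm ∧ h =ᵐ[volume] hp + hm

/-- The ansatz `[ψ, k sgn(x) ψ]^t` for the Dirichlet problem. -/
def dirichletAnsatz (k : ℝ) (ψ : ℝ → ℂ) (x : ℝ) : Fin 2 → ℂ :=
  ![ψ x, ((k * Real.sign x : ℝ) : ℂ) * ψ x]

/-- The kernel of the map `ψ ↦ e_0 · C_k^+ [ψ, k sgn(x) ψ]^t`. -/
def dirichletCauchyKernel (k t x y : ℝ) : ℝ :=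
  1 / (2 * Real.pi) *
    ((t - (x - y) * (k * Real.sign y)) / (t ^ 2 + (x - y) ^ 2) -
      k * ((|x| + |y|) / (t ^ 2 + (|x| + |y|) ^ 2)))

/-! ### The Lax--Milgram method -/

/-- `W ∈ Ḣ¹_0(ℝ²_+)`, with weak gradient `G`: the closure of `C_0^∞(ℝ²_+)` in the norm `‖∇ · ‖_2`. (By
Hardy's inequality, convergence of gradients in `L_2` forces convergence of the functions in `L_2` on
compact subsets, which identifies the elements of the closure as functions.) -/
def IsHDotZero (W : ℝ × ℝ → ℂ) (G : ℝ × ℝ → Fin 2 → ℂ) : Prop :=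
  AEStronglyMeasurable W (volume.restrict halfPlane) ∧ MemLp G 2 (volume.restrict halfPlane) ∧
    ∃ φ : ℕ → ℝ × ℝ → ℂ, (∀ n, IsTest halfPlane (φ n)) ∧
      (∀ K : Set (ℝ × ℝ), IsCompact K → K ⊆ halfPlane →
        Tendsto (fun n => eLpNorm (φ n - W) 2 (volume.restrict K)) atTop (𝓝 0)) ∧
      Tendsto (fun n => eLpNorm (grad (φ n) - G) 2 (volume.restrict halfPlane)) atTop (𝓝 0)

/-- `∬ (A_k V, Ψ) dt dx` over the upper half plane, for vector fields `V`, `Ψ`, with the Hermitian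
inner product of `ℂ²`. -/
def form (k : ℝ) (V Ψ : ℝ × ℝ → Fin 2 → ℂ) : ℂ :=
  ∫ z in halfPlane, (coeff k z.2 *ᵥ V z) ⬝ᵥ star (Ψ z)

/-- `U` is the `Ḣ¹` (Lax--Milgram) solution of the Dirichlet problem for `A_k` with data `u`:
`U = U₁ - U₂`, where `U₁ ∈ C_0^∞(ℝ²)` extends `u`, and `U₂ ∈ Ḣ¹_0(ℝ²_+)` satisfies
`∬ (A_k ∇U₂, ∇ψ) = ∬ (A_k ∇U₁, ∇ψ)` for all `ψ ∈ Ḣ¹_0(ℝ²_+)`. -/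
def IsHDotSolution (k : ℝ) (u : ℝ → ℂ) (U : ℝ × ℝ → ℂ) : Prop :=
  ∃ U₁ U₂ : ℝ × ℝ → ℂ, ∃ G₂ : ℝ × ℝ → Fin 2 → ℂ,
    ContDiff ℝ ∞ U₁ ∧ HasCompactSupport U₁ ∧ (∀ x, U₁ (0, x) = u x) ∧
    IsHDotZero U₂ G₂ ∧
    (∀ ψ Ψ, IsHDotZero ψ Ψ → form k G₂ Ψ = form k (grad U₁) Ψ) ∧
    ∀ z ∈ halfPlane, U z = U₁ z - U₂ z

end

end HarmonicMeasure

open HarmonicMeasure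

namespace HarmonicMeasure

open Real (cos cos_abs cos_pos_of_mem_Ioo dist_eq div_rpow inv_rpow mul_rpow norm_eq_abs norm_of_nonneg pi_ne_zero pi_pos rpow_add rpow_le_rpow_of_nonpos rpow_neg rpow_neg_one rpow_nonneg rpow_two rpow_zero sign sign_of_neg sign_of_pos smoothTransition tan zero_rpow)
open ENNReal (coe_lt_top coe_mul coe_ne_top coe_ofNat coe_rpow_of_nonneg coe_toNNReal mul_div_le mul_lt_top mul_ne_top mul_rpow_of_nonneg ofReal ofReal_le_ofReal ofReal_lt_top ofReal_mul ofReal_ne_top ofReal_ofNat ofReal_rpow_of_nonneg ofReal_toReal pow_lt_top rpow_le_rpow rpow_mul rpow_ne_top_of_nonneg rpow_one toReal_ofReal toReal_pos)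
open Complex (I I_im I_re I_sq abs_im_le_norm abs_re_le_norm add_im add_re continuous_im cpow_add cpow_def_of_ne_zero cpow_one cpow_zero div_im exp exp_add exp_log exp_mul_I exp_pi_mul_I im im_ofReal_mul inv_I inv_im inv_re log log_exp log_im mul_im mul_re neg_im neg_re normSq normSq_apply normSq_eq_norm_sq norm_I norm_cpow_real norm_real ofReal_cos ofReal_cpow ofReal_div ofReal_im ofReal_neg ofReal_one ofReal_pow ofReal_re ofReal_sin ofReal_sub ofReal_zero re re_le_norm real_smul sin slitPlane star_def sub_im sub_re)
open MeasureTheory.Measure (measurePreserving_neg prod_restrict restrict_le_self restrict_mono restrict_univ volume_eq_prod)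
open intervalIntegral (integral_Iic_add_Ioi integral_of_le intervalIntegrable_rpow')
open Metric (ball mem_ball mem_closedBall)
open Matrix (cons_val_one cons_val_zero)
open scoped Real

noncomputable section

variable {μ : Measure (ℝ × ℝ)} {K Ω : Set (ℝ × ℝ)} {ζ z Z Y : ℂ} {m n : ℂ → ℂ} {p q δ R M t L k s
  x₀ ε σ a b β r c y x γ α : ℝ} {g f U V φ D : ℝ × ℝ → ℂ} {S w v H T S' ψ u : ℝ → ℂ} {κ : ℝ → ℝ} {C
  : ℝ≥0} {A B P : ℝ≥0∞}
  (hpq : p.HolderConjugate q)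
  (hα : α ∈ Ioo (1 / q - 2) (1 / q)) (hβ : β ∈ Ioo (1 / q - 2) (1 / q))

local notation "𝔭" => ENNReal.ofReal p

local notation "PInt" v:max => Integrable (fun y : ℝ => ‖v y‖ / (1 + |y|))

local notation:max y:max " ⁻^ " β:max => ((y ^ (-β) : ℝ) : ℂ)

lemma tendsto_zero_of_le {ι : Type*} {l : Filter ι} {f g : ι → ℝ≥0∞} (hg : Tendsto g l (𝓝 0)) (h : ∀ᶠ i in l, f i ≤ g i) :
    Tendsto f l (𝓝 0) := tendsto_of_tendsto_of_tendsto_of_le_of_le' tendsto_const_nhds hg (by simp) h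

section LpTools

variable {X Y : Type*} [MeasurableSpace X] [MeasurableSpace Y]

include hpq in
/-- Schur's test with weights. -/
lemma lintegral_schur {μ : Measure X} {ν : Measure Y} [SFinite μ] [SFinite ν]
 {N : X → Y → ℝ≥0∞} (hN : Measurable (Function.uncurry N))
    {w' : X → ℝ≥0∞} {w : Y → ℝ≥0∞} (hw' : Measurable w') (hw : Measurable w)
    (hw0 : ∀ᵐ y ∂ν, w y ≠ 0 ∧ w y ≠ ⊤)
    (h1 : ∀ᵐ x ∂μ, ∫⁻ y, N x y * w y ^ q ∂ν ≤ A * w' x ^ q)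
    (h2 : ∀ᵐ y ∂ν, ∫⁻ x, N x y * w' x ^ p ∂μ ≤ B * w y ^ p)
    {f : Y → ℝ≥0∞} (hf : AEMeasurable f ν) :
    ∫⁻ x, (∫⁻ y, N x y * f y ∂ν) ^ p ∂μ ≤ A ^ (p / q) * B * ∫⁻ y, f y ^ p ∂ν := by
  have hp := hpq.pos
  have hq := hpq.symm.pos
  wlog hfm : Measurable f generalizing f
  · have hh := this hf.measurable_mk.aemeasurable hf.measurable_mk
    have e1 : ∀ x, ∫⁻ y, N x y * f y ∂ν = ∫⁻ y, N x y * hf.mk f y ∂ν := fun x =>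
      lintegral_congr_ae (by filter_upwards [hf.ae_eq_mk] with y hy; rw [hy])
    have e2 : ∫⁻ y, f y ^ p ∂ν = ∫⁻ y, hf.mk f y ^ p ∂ν :=
      lintegral_congr_ae (by filter_upwards [hf.ae_eq_mk] with y hy; rw [hy])
    simp_all
  have key : ∀ᵐ x ∂μ, (∫⁻ y, N x y * f y ∂ν) ^ p ≤
      A ^ (p / q) * ∫⁻ y, N x y * w' x ^ p * (f y ^ p * (w y ^ p)⁻¹) ∂ν := by
    filter_upwards [h1] with x hx
    have hH := ENNReal.lintegral_mul_le_Lp_mul_Lq ν hpq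
      (f := fun y => N x y ^ (1 / p) * (f y * (w y)⁻¹)) (g := fun y => N x y ^ (1 / q) * w y)
      (by fun_prop) (by fun_prop)
    have e0 : ∫⁻ y, N x y * f y ∂ν = ∫⁻ y, ((fun y => N x y ^ (1 / p) * (f y * (w y)⁻¹)) *
        (fun y => N x y ^ (1 / q) * w y)) y ∂ν := by
      refine lintegral_congr_ae ?_
      filter_upwards [hw0] with y hy
      simp
      have : N x y ^ (1 / p) * N x y ^ (1 / q) = N x y := by
        rw [← ENNReal.rpow_add_of_nonneg _ _ (by positivity) (by positivity)]
        rw [one_div, one_div, hpq.inv_add_inv_eq_one, rpow_one]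
      calc N x y * f y = (N x y ^ (1 / p) * N x y ^ (1 / q)) * f y * ((w y)⁻¹ * w y) := by
            rw [this, ENNReal.inv_mul_cancel hy.1 hy.2, mul_one]
        _ = _ := by ring
    rw [e0]
    have e1 : ∀ y, (N x y ^ (1 / p) * (f y * (w y)⁻¹)) ^ p = N x y * (f y ^ p * (w y ^ p)⁻¹) := by
      intro y
      rw [mul_rpow_of_nonneg _ _ hp.le, mul_rpow_of_nonneg _ _ hp.le,
        ← rpow_mul, one_div, inv_mul_cancel₀ hp.ne', rpow_one, ENNReal.inv_rpow]
    have e2 : ∀ y, (N x y ^ (1 / q) * w y) ^ q = N x y * w y ^ q := by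
      intro y
      rw [mul_rpow_of_nonneg _ _ hq.le,
        ← rpow_mul, one_div, inv_mul_cancel₀ hq.ne', rpow_one]
    simp_rw [e1, e2] at hH
    calc _ ≤ ((∫⁻ y, N x y * (f y ^ p * (w y ^ p)⁻¹) ∂ν) ^ (1 / p) *
          (A * w' x ^ q) ^ (1 / q)) ^ p := by
          refine rpow_le_rpow (hH.trans ?_) hp.le
          gcongr
      _ = (∫⁻ y, N x y * (f y ^ p * (w y ^ p)⁻¹) ∂ν) * (A ^ (p / q) * w' x ^ p) := by
          rw [mul_rpow_of_nonneg _ _ hp.le, ← rpow_mul, ← rpow_mul,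
            one_div, inv_mul_cancel₀ hp.ne', rpow_one,
            mul_rpow_of_nonneg _ _ (by positivity), ← rpow_mul]
          grind
      _ = A ^ (p / q) * ((∫⁻ y, N x y * (f y ^ p * (w y ^ p)⁻¹) ∂ν) * w' x ^ p) := by ring
      _ ≤ _ := by
          gcongr
          rw [← lintegral_mul_const _ (by fun_prop)]
          exact (lintegral_congr fun y => by ring).le
  calc _ ≤ ∫⁻ x, A ^ (p / q) * ∫⁻ y, N x y * w' x ^ p * (f y ^ p * (w y ^ p)⁻¹) ∂ν ∂μ :=
        lintegral_mono_ae key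
    _ = A ^ (p / q) * ∫⁻ y, ∫⁻ x, N x y * w' x ^ p * (f y ^ p * (w y ^ p)⁻¹) ∂μ ∂ν := by
        have hm : Measurable (fun z : X × Y => N z.1 z.2 * w' z.1 ^ p * (f z.2 ^ p * (w z.2 ^ p)⁻¹)) := by fun_prop
        rw [lintegral_const_mul _ hm.lintegral_prod_right', lintegral_lintegral_swap hm.aemeasurable]
    _ ≤ A ^ (p / q) * ∫⁻ y, B * f y ^ p ∂ν := by
        gcongr 1
        refine lintegral_mono_ae ?_
        filter_upwards [h2, hw0] with y hy hwy
        rw [lintegral_mul_const _ (by fun_prop)]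
        have a0 : w y ^ p ≠ 0 := by simp_all
        have a1 : w y ^ p ≠ ⊤ := by simp_all
        calc _ ≤ B * w y ^ p * (f y ^ p * (w y ^ p)⁻¹) := by gcongr
          _ = B * f y ^ p * ((w y ^ p)⁻¹ * w y ^ p) := by ring
          _ = _ := by rw [ENNReal.inv_mul_cancel a0 a1, mul_one]
    _ = _ := by rw [lintegral_const_mul _ (by fun_prop), mul_assoc]

include hpq in
/-- Schur's test for integral operators dominated by a positive kernel. -/
lemma eLpNorm_schur {μ : Measure X} {ν : Measure Y} [SFinite μ] [SFinite ν]
 {N : X → Y → ℝ≥0∞} (hN : Measurable (Function.uncurry N))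
    {w' : X → ℝ≥0∞} {w : Y → ℝ≥0∞} (hw' : Measurable w') (hw : Measurable w)
    (hw0 : ∀ᵐ y ∂ν, w y ≠ 0 ∧ w y ≠ ⊤)
    (h1 : ∀ᵐ x ∂μ, ∫⁻ y, N x y * w y ^ q ∂ν ≤ A * w' x ^ q)
    (h2 : ∀ᵐ y ∂ν, ∫⁻ x, N x y * w' x ^ p ∂μ ≤ B * w y ^ p)
    {f : Y → ℂ} (hf : AEStronglyMeasurable f ν) {g : X → ℂ}
    (hg : ∀ᵐ x ∂μ, ‖g x‖ₑ ≤ ∫⁻ y, N x y * ‖f y‖ₑ ∂ν) :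
    eLpNorm g 𝔭 μ ≤ A ^ (1 / q) * B ^ (1 / p) * eLpNorm f 𝔭 ν := by
  have hp := hpq.pos
  have h0 : ofReal p ≠ 0 := by simpa using hp
  rw [eLpNorm_eq_lintegral_rpow_enorm_toReal h0 ofReal_ne_top,
    eLpNorm_eq_lintegral_rpow_enorm_toReal h0 ofReal_ne_top, toReal_ofReal hp.le]
  have hs := lintegral_schur hpq hN hw' hw hw0 h1 h2 hf.enorm
  calc _ ≤ (∫⁻ x, (∫⁻ y, N x y * ‖f y‖ₑ ∂ν) ^ p ∂μ) ^ (1 / p) := by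
        refine rpow_le_rpow (lintegral_mono_ae ?_) (by positivity)
        filter_upwards [hg] with x hx
        gcongr
    _ ≤ (A ^ (p / q) * B * ∫⁻ y, ‖f y‖ₑ ^ p ∂ν) ^ (1 / p) :=
        rpow_le_rpow hs (by positivity)
    _ = _ := by
        rw [mul_rpow_of_nonneg _ _ (by positivity),
          mul_rpow_of_nonneg _ _ (by positivity), ← rpow_mul]
        grind

/-- Dominated convergence in `L_p`. -/
lemma tendsto_eLpNorm_of_dominated {ι E : Type*} [NormedAddCommGroup E] {μ : Measure X}
    {l : Filter ι} [l.IsCountablyGenerated]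
    (hp : 0 < p) {F : ι → X → E} {g : X → ℝ≥0∞}
    (hF : ∀ᶠ n in l, AEStronglyMeasurable (F n) μ)
    (hg : ∫⁻ x, g x ^ p ∂μ ≠ ⊤) (hb : ∀ᶠ n in l, ∀ᵐ x ∂μ, ‖F n x‖ₑ ≤ g x)
    (hlim : ∀ᵐ x ∂μ, Tendsto (fun n => F n x) l (𝓝 0)) :
    Tendsto (fun n => eLpNorm (F n) 𝔭 μ) l (𝓝 0) := by
  have h0 : ofReal p ≠ 0 := by simpa using hp
  simp_rw [eLpNorm_eq_lintegral_rpow_enorm_toReal h0 ofReal_ne_top,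
    toReal_ofReal hp.le]
  have : Tendsto (fun n => ∫⁻ x, ‖F n x‖ₑ ^ p ∂μ) l (𝓝 (∫⁻ _, 0 ∂μ)) := by
    refine tendsto_lintegral_filter_of_dominated_convergence' (fun x => g x ^ p) ?_ ?_ hg ?_
    · filter_upwards [hF] with n hn using hn.enorm.pow_const p
    · filter_upwards [hb] with n hn
      filter_upwards [hn] with x hx using rpow_le_rpow hx hp.le
    · filter_upwards [hlim] with x hx
      have h1 : Tendsto (fun n => ‖F n x‖ₑ) l (𝓝 0) := by simpa using hx.enorm
      have := (ENNReal.continuous_rpow_const (y := p)).tendsto (0 : ℝ≥0∞)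
      rw [ENNReal.zero_rpow_of_pos hp] at this
      exact this.comp h1
  rw [lintegral_zero] at this
  have h2 := (ENNReal.continuous_rpow_const (y := 1 / p)).tendsto 0
  rw [ENNReal.zero_rpow_of_pos (by positivity)] at h2
  exact h2.comp this

/-- Strong convergence of a uniformly bounded family of operators needs checking on a dense class
only. -/
lemma exists_tendsto_of_dense {ι : Type*} {μ : Measure X} {ν : Measure Y} {l : Filter ι} [l.NeBot]
    {p : ℝ≥0∞} (hp : 1 ≤ p) {T : ι → (Y → ℂ) → X → ℂ}
    (hsub : ∀ᶠ t in l, ∀ v w, MemLp v p ν → MemLp w p ν → T t (v - w) =ᵐ[μ] T t v - T t w)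
    (hbd : ∀ᶠ t in l, ∀ v, MemLp v p ν →
      MemLp (T t v) p μ ∧ eLpNorm (T t v) p μ ≤ C * eLpNorm v p ν)
    (hd : ∀ v, MemLp v p ν → ∀ ε : ℝ≥0∞, ε ≠ 0 → ∃ g, MemLp g p ν ∧ eLpNorm (v - g) p ν ≤ ε ∧
      ∃ S, MemLp S p μ ∧ Tendsto (fun t => eLpNorm (T t g - S) p μ) l (𝓝 0))
    {v : Y → ℂ} (hv : MemLp v p ν) :
    ∃ S, MemLp S p μ ∧ Tendsto (fun t => eLpNorm (T t v - S) p μ) l (𝓝 0) := by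
  classical
  have : Fact (1 ≤ p) := ⟨hp⟩
  let F : ι → Lp ℂ p μ := fun t => if h : MemLp (T t v) p μ then h.toLp else 0
  have hF : ∀ᶠ t in l, ∃ h : MemLp (T t v) p μ, F t = h.toLp := by
    filter_upwards [hbd] with t ht
    grind
  have hc : ∀ ε : ℝ≥0∞, ε ≠ 0 → ∃ S0 : Lp ℂ p μ, ∀ᶠ t in l, edist (F t) S0 ≤ ε := by
    intro ε hε
    obtain ⟨g, hg, hvg, S, hS, hlim⟩ := hd v hv (ε / 2 / (C + 1))
      (ENNReal.div_ne_zero.2 ⟨(ENNReal.half_pos hε).ne', by simp⟩)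
    refine ⟨hS.toLp, ?_⟩
    have h3 : ∀ᶠ t in l, eLpNorm (T t g - S) p μ ≤ ε / 2 :=
      hlim.eventually (ge_mem_nhds (ENNReal.half_pos hε))
    filter_upwards [hF, hbd, hsub, h3] with t ⟨h, ht⟩ hb hs h3
    rw [ht, Lp.edist_toLp_toLp]
    have e : T t v - S =ᵐ[μ] T t (v - g) + (T t g - S) := by
      filter_upwards [hs v g hv hg] with x hx
      simp [hx]
    rw [eLpNorm_congr_ae e]
    calc _ ≤ eLpNorm (T t (v - g)) p μ + eLpNorm (T t g - S) p μ :=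
          eLpNorm_add_le (hb _ (hv.sub hg)).1.1 ((hb _ hg).1.sub hS).1 hp
      _ ≤ C * (ε / 2 / (C + 1)) + ε / 2 := by
          gcongr
          exact (hb _ (hv.sub hg)).2.trans (by gcongr)
      _ ≤ ε / 2 + ε / 2 := by
          gcongr
          calc (C : ℝ≥0∞) * (ε / 2 / (C + 1)) ≤ (C + 1) * (ε / 2 / (C + 1)) := by bound
            _ ≤ _ := mul_div_le
      _ = ε := ENNReal.add_halves ε
  have hcau : Cauchy (map F l) := by
    rw [EMetric.cauchy_iff]
    refine ⟨(inferInstance : (map F l).NeBot).ne, fun ε hε => ?_⟩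
    obtain ⟨S0, h0⟩ := hc (ε / 3) (ENNReal.div_pos hε.ne' (by simp)).ne'
    refine ⟨_, image_mem_map h0, ?_⟩
    rintro _ ⟨a, ha, rfl⟩ _ ⟨b, hb, rfl⟩
    by_cases htop : ε = ⊤
    · subst htop
      exact edist_lt_top _ _
    calc _ ≤ edist (F a) S0 + edist (F b) S0 := edist_triangle_right _ _ _
      _ ≤ ε / 3 + ε / 3 := add_le_add ha hb
      _ < ε / 3 + ε / 3 + ε / 3 := ENNReal.lt_add_right
          (by finiteness) (ENNReal.div_pos hε.ne' (by simp)).ne'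
      _ = ε := ENNReal.add_thirds ε
  obtain ⟨S0, hS0⟩ := CompleteSpace.complete hcau
  refine ⟨S0, Lp.memLp S0, ?_⟩
  have h4 : Tendsto (fun t => edist (F t) S0) l (𝓝 0) := tendsto_iff_edist_tendsto_0.1 hS0
  refine h4.congr' ?_
  filter_upwards [hF] with t ⟨h, ht⟩
  rw [ht, Lp.edist_def]
  refine eLpNorm_congr_ae ?_
  filter_upwards [h.coeFn_toLp] with x hx
  simp [hx]

lemma tendsto_zero_of_dense {ι : Type*} {μ : Measure X} {ν : Measure Y} {l : Filter ι}
    {p : ℝ≥0∞} (hp : 1 ≤ p) {T : ι → (Y → ℂ) → X → ℂ}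
    (hsub : ∀ᶠ t in l, ∀ v w, MemLp v p ν → MemLp w p ν → T t (v - w) =ᵐ[μ] T t v - T t w)
    (hbd : ∀ᶠ t in l, ∀ v, MemLp v p ν →
      MemLp (T t v) p μ ∧ eLpNorm (T t v) p μ ≤ C * eLpNorm v p ν)
    (hd : ∀ v, MemLp v p ν → ∀ ε : ℝ≥0∞, ε ≠ 0 → ∃ g, MemLp g p ν ∧ eLpNorm (v - g) p ν ≤ ε ∧
      Tendsto (fun t => eLpNorm (T t g) p μ) l (𝓝 0))
    {v : Y → ℂ} (hv : MemLp v p ν) : Tendsto (fun t => eLpNorm (T t v) p μ) l (𝓝 0) := by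
  rcases l.eq_or_neBot with rfl | hl
  · simp
  refine ENNReal.tendsto_nhds_zero.2 fun ε hε => ?_
  obtain ⟨g, hg, hvg, hlim⟩ := hd v hv (ε / 2 / (C + 1))
      (ENNReal.div_ne_zero.2 ⟨(ENNReal.half_pos hε.ne').ne', by simp⟩)
  have h3 : ∀ᶠ t in l, eLpNorm (T t g) p μ ≤ ε / 2 :=
      hlim.eventually (ge_mem_nhds (ENNReal.half_pos hε.ne'))
  filter_upwards [hbd, hsub, h3] with t hb hs h3
  have e : T t v =ᵐ[μ] T t (v - g) + T t g := by
    filter_upwards [hs v g hv hg] with x hx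
    simp [hx]
  rw [eLpNorm_congr_ae e]
  calc _ ≤ eLpNorm (T t (v - g)) p μ + eLpNorm (T t g) p μ :=
        eLpNorm_add_le (hb _ (hv.sub hg)).1.1 (hb _ hg).1.1 hp
    _ ≤ C * (ε / 2 / (C + 1)) + ε / 2 := by
        gcongr
        exact (hb _ (hv.sub hg)).2.trans (by gcongr)
    _ ≤ ε / 2 + ε / 2 := by
        gcongr
        calc C * (ε / 2 / (C + 1)) ≤ (C + 1) * (ε / 2 / (C + 1)) := by bound
          _ ≤ _ := mul_div_le
    _ = ε := ENNReal.add_halves ε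

end LpTools

section CauchyIntegral

variable {Y : Type*} [MeasurableSpace Y]

lemma one_add_norm_le_mul_norm_sub {S : Set ℂ} (hδ : 0 < δ)
    (h : ∀ s ∈ S, δ ≤ ‖s - ζ‖) {s : ℂ} (hs : s ∈ S) :
    1 + ‖s‖ ≤ ((1 + ‖ζ‖) / δ + 1) * ‖s - ζ‖ := by
  have h1 : ‖s‖ ≤ ‖s - ζ‖ + ‖ζ‖ := by simpa using norm_add_le (s - ζ) ζ
  have h2 : 1 + ‖ζ‖ ≤ (1 + ‖ζ‖) / δ * ‖s - ζ‖ := by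
    rw [div_mul_eq_mul_div, le_div_iff₀ hδ]
    bound
  linarith

lemma integrable_cauchy {μ : Measure Y} {S : Set ℂ} {φ : Y → ℂ}
    (hφ : Measurable φ) (hS : ∀ᵐ y ∂μ, φ y ∈ S) {v : Y → ℂ} (hv : AEStronglyMeasurable v μ)
    (hvi : Integrable (fun y => ‖v y‖ / (1 + ‖φ y‖)) μ) (hδ : 0 < δ)
    (h : ∀ s ∈ S, δ ≤ ‖s - ζ‖) :
    Integrable (fun y => v y / (φ y - ζ)) μ := by
  refine (hvi.const_mul ((1 + ‖ζ‖) / δ + 1)).mono'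
    ((hv.aemeasurable.div (hφ.sub_const ζ).aemeasurable).aestronglyMeasurable) ?_
  filter_upwards [hS] with y hy
  have h1 := one_add_norm_le_mul_norm_sub hδ h hy
  have h2 : 0 < ‖φ y - ζ‖ := hδ.trans_le (h _ hy)
  rw [norm_div, div_le_iff₀ h2, ← mul_div_assoc, div_mul_eq_mul_div, le_div_iff₀ (by positivity)]
  nlinarith [norm_nonneg (v y)]

/-- Cauchy integrals `∫ v / (φ - ζ)` are holomorphic off a closed set that contains the values
of `φ`. -/
lemma hasDerivAt_cauchy {μ : Measure Y} {S : Set ℂ} (hScl : IsClosed S) {φ : Y → ℂ}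
    (hφ : Measurable φ) (hS : ∀ᵐ y ∂μ, φ y ∈ S) {v : Y → ℂ} (hv : AEStronglyMeasurable v μ)
    (hvi : Integrable (fun y => ‖v y‖ / (1 + ‖φ y‖)) μ) (hζ : ζ ∉ S) :
    HasDerivAt (fun ζ => ∫ y, v y / (φ y - ζ) ∂μ) (∫ y, v y / (φ y - ζ) ^ 2 ∂μ) ζ := by
  obtain ⟨ε, hε, hb⟩ := Metric.isOpen_iff.1 hScl.isOpen_compl ζ hζ
  set δ := ε / 2 with hδ
  have hδ0 : 0 < δ := by positivity
  have hdist : ∀ ζ' ∈ ball ζ δ, ∀ s ∈ S, δ ≤ ‖s - ζ'‖ := by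
    intro ζ' hζ' s hs
    by_contra! hlt
    refine hb ?_ hs
    rw [mem_ball, dist_eq_norm] at hζ' ⊢
    calc ‖s - ζ‖ ≤ ‖s - ζ'‖ + ‖ζ' - ζ‖ := norm_sub_le_norm_sub_add_norm_sub _ _ _
      _ < ε := by linarith
  have hm : ∀ ζ', AEStronglyMeasurable (fun y => v y / (φ y - ζ')) μ := fun ζ' =>
    (hv.aemeasurable.div (hφ.sub_const ζ').aemeasurable).aestronglyMeasurable
  refine (hasDerivAt_integral_of_dominated_loc_of_deriv_le
    (F' := fun ζ y => v y / (φ y - ζ) ^ 2)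
    (bound := fun y => ((1 + (‖ζ‖ + δ)) / δ + 1) / δ * (‖v y‖ / (1 + ‖φ y‖)))
    (Metric.ball_mem_nhds ζ hδ0) (by simp_all)
    (integrable_cauchy hφ hS hv hvi hδ0 (by simp_all))
    ((hv.aemeasurable.div ((hφ.sub_const ζ).pow_const 2).aemeasurable).aestronglyMeasurable)
    ?_ (hvi.const_mul _) ?_).2
  · filter_upwards [hS] with y hy ζ' hζ'
    have h0 := hdist ζ' hζ' _ hy
    have h1 := one_add_norm_le_mul_norm_sub hδ0 (hdist ζ' hζ') hy
    have h3 : ‖ζ'‖ ≤ ‖ζ‖ + δ := by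
      have := norm_add_le ζ (ζ' - ζ)
      rw [add_sub_cancel] at this
      rw [mem_ball, dist_eq_norm] at hζ'
      linarith
    have h4 : 1 + ‖φ y‖ ≤ ((1 + (‖ζ‖ + δ)) / δ + 1) * ‖φ y - ζ'‖ := h1.trans (by gcongr)
    have h2 : 0 < ‖φ y - ζ'‖ := hδ0.trans_le h0
    rw [norm_div, norm_pow, div_le_iff₀ (by positivity)]
    set D := ‖φ y - ζ'‖
    set K := (1 + (‖ζ‖ + δ)) / δ + 1
    have : 1 ≤ K / δ * (1 / (1 + ‖φ y‖)) * D ^ 2 := by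
      rw [div_mul_div_comm, div_mul_eq_mul_div, le_div_iff₀ (by positivity)]
      calc 1 * (δ * (1 + ‖φ y‖)) ≤ D * (K * D) := by
            rw [one_mul]; gcongr
        _ = _ := by ring
    calc ‖v y‖ = ‖v y‖ * 1 := by ring
      _ ≤ ‖v y‖ * (K / δ * (1 / (1 + ‖φ y‖)) * D ^ 2) := by gcongr
      _ = _ := by ring
  · filter_upwards [hS] with y hy ζ' hζ'
    have h2 : φ y - ζ' ≠ 0 := norm_pos_iff.1 (by grind)
    have h5 : HasDerivAt (fun ζ' => φ y - ζ') (-1) ζ' := by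
      simpa using (hasDerivAt_id ζ').const_sub (φ y)
    simpa using (hasDerivAt_const ζ' (v y)).fun_div h5 h2

end CauchyIntegral

/-- The Cauchy transform of a function on the real line. -/
def cauchyT (v : ℝ → ℂ) (w : ℂ) : ℂ := ∫ y, v y / ((y : ℂ) - w)

lemma le_norm_ofReal_sub (y : ℝ) (w : ℂ) : |w.im| ≤ ‖(y : ℂ) - w‖ := by
  simpa using abs_im_le_norm ((y : ℂ) - w)

lemma abs_sub_le_norm_ofReal_sub (y : ℝ) (w : ℂ) : |y - w.re| ≤ ‖(y : ℂ) - w‖ := by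
  simpa using abs_re_le_norm ((y : ℂ) - w)

lemma ofReal_sub_ne_zero (y : ℝ) {w : ℂ} (hw : w.im ≠ 0) : (y : ℂ) - w ≠ 0 :=
  norm_pos_iff.1 ((abs_pos.2 hw).trans_le (le_norm_ofReal_sub y w))

lemma cauchyT_aux {w : ℂ} : ∀ s ∈ {s : ℂ | s.im = 0}, |w.im| ≤ ‖s - w‖ := by
  intro s hs
  have : s.im = 0 := hs
  simpa [this] using abs_im_le_norm (s - w)

lemma integrable_cauchyT (hv : AEStronglyMeasurable v)
    (hvi : PInt v) {w : ℂ} (hw : w.im ≠ 0) :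
    Integrable (fun y : ℝ => v y / ((y : ℂ) - w)) :=
  integrable_cauchy Complex.measurable_ofReal (by simp) hv (by simpa using hvi)
    (abs_pos.2 hw) cauchyT_aux

lemma differentiableAt_cauchyT (hv : AEStronglyMeasurable v)
    (hvi : PInt v) {w : ℂ} (hw : w.im ≠ 0) :
    DifferentiableAt ℂ (cauchyT v) w :=
  (hasDerivAt_cauchy (isClosed_eq continuous_im continuous_const)
    Complex.measurable_ofReal (by simp) hv (by simpa using hvi) hw).differentiableAt

/-- Bounded measurable functions with compact support. -/
structure IsBddCpt (R M : ℝ) (v : ℝ → ℂ) : Prop where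
  meas : AEStronglyMeasurable v
  bdd : ∀ x, ‖v x‖ ≤ M
  supp : ∀ x, R < |x| → v x = 0

lemma IsBddCpt.memLp (h : IsBddCpt R M v) (p : ℝ≥0∞) :
    MemLp v p := by
  have h1 : MemLp v p (volume.restrict (Icc (-R) R)) :=
    MemLp.of_bound h.meas.restrict M (.of_forall h.bdd)
  rw [← memLp_indicator_iff_restrict measurableSet_Icc] at h1
  convert h1 using 1
  ext x
  by_cases hx : x ∈ Icc (-R) R
  · simp [hx]
  · rw [indicator_of_notMem hx]
    refine h.supp x ?_
    grind

lemma IsBddCpt.integrable (h : IsBddCpt R M v) : Integrable v :=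
  memLp_one_iff_integrable.1 (h.memLp 1)

lemma Integrable.div_one_add_abs (h : Integrable v) :
    PInt v := by
  refine h.norm.mono' ((h.1.norm.aemeasurable.div (by fun_prop)).aestronglyMeasurable)
    (.of_forall fun y => ?_)
  rw [norm_of_nonneg (by positivity)]
  bound

lemma norm_cauchyT_le (hi : Integrable v) {w : ℂ} {d : ℝ} (hd : 0 < d)
    (h : ∀ y, v y ≠ 0 → d ≤ ‖(y : ℂ) - w‖) : ‖cauchyT v w‖ ≤ (∫ y, ‖v y‖) / d := by
  rw [cauchyT, ← integral_div]
  refine norm_integral_le_of_norm_le (hi.norm.div_const d) (.of_forall fun y => ?_)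
  rw [norm_div]
  by_cases hy : v y = 0
  · simp [hy]
  bound

/-- Decay of Cauchy transforms of compactly supported functions on horizontal lines. -/
lemma IsBddCpt.norm_cauchyT_le (h : IsBddCpt R M v) (hR : 0 ≤ R) {w : ℂ}
    (hw : w.im ≠ 0) :
    ‖cauchyT v w‖ ≤ (∫ y, ‖v y‖) * ((1 + R) / |w.im| + 1) / (1 + |w.re|) := by
  have ht := abs_pos.2 hw
  have h1 := HarmonicMeasure.norm_cauchyT_le h.integrable
    (d := (1 + |w.re|) / ((1 + R) / |w.im| + 1)) (by positivity) (fun y hy => by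
      rw [div_le_iff₀ (by positivity)]
      have hyR : |y| ≤ R := by by_contra! hc; exact hy (h.supp y hc)
      have h2 := le_norm_ofReal_sub y w
      have h3 := abs_sub_le_norm_ofReal_sub y w
      have h4 : |w.re| ≤ |y| + |y - w.re| := by grind
      have h5 : 1 + R ≤ (1 + R) / |w.im| * ‖(y : ℂ) - w‖ := by
        rw [div_mul_eq_mul_div, le_div_iff₀ ht]; gcongr
      linarith)
  linarith

lemma rpow_norm_le_of_re_pos (hp1 : 1 < p) (hp2 : p ≤ 2) :
    ∃ A B : ℝ, 0 ≤ A ∧ 0 ≤ B ∧ ∀ w : ℂ, 0 < w.re →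
      ‖w‖ ^ p ≤ A * w.re ^ p - B * (w ^ (p : ℂ)).re := by
  set θ₀ := π * (1 + 1 / p) / 4 with hθ₀
  have hp0 : 0 < p := by linarith
  have hpθ : p * θ₀ = π * (p + 1) / 4 := by grind
  have hθpos : 0 < θ₀ := by positivity
  have hθlt : θ₀ < π / 2 := by nlinarith
  have hcp : cos (p * θ₀) < 0 := by
    apply Real.cos_neg_of_pi_div_two_lt_of_lt
    · nlinarith
    nlinarith
  have hc : 0 < cos θ₀ := cos_pos_of_mem_Ioo ⟨by linarith, hθlt⟩
  set B := 1 / (-cos (p * θ₀)) with hB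
  have hB0 : 0 < B := by simp_all
  set A := (1 + B) / cos θ₀ ^ p with hA
  have hA0 : 0 < A := by positivity
  refine ⟨A, B, hA0.le, hB0.le, fun w hw => ?_⟩
  have harg : |w.arg| < π / 2 := by simp_all
  have hn : 0 ≤ ‖w‖ := norm_nonneg w
  have hre : w.re = ‖w‖ * cos |w.arg| := by simp
  have hre2 : (w ^ (p : ℂ)).re = ‖w‖ ^ p * cos (p * |w.arg|) := by
    rw [Complex.cpow_ofReal_re, ← cos_abs (w.arg * p), abs_mul, abs_of_pos hp0, mul_comm p]
  have hcn : 0 < cos |w.arg| := cos_pos_of_mem_Ioo ⟨by linarith [abs_nonneg w.arg], harg⟩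
  rw [hre2, hre, mul_rpow hn hcn.le]
  suffices h : 1 ≤ A * cos |w.arg| ^ p - B * cos (p * |w.arg|) by
    have := mul_le_mul_of_nonneg_left h (rpow_nonneg hn p)
    linarith
  rcases le_total |w.arg| θ₀ with h | h
  · have h1 : cos θ₀ ≤ cos |w.arg| :=
      Real.cos_le_cos_of_nonneg_of_le_pi (abs_nonneg _) (by linarith) h
    have h2 : 1 + B ≤ A * cos |w.arg| ^ p := by
      rw [hA, div_mul_eq_mul_div, le_div_iff₀ (by positivity)]
      gcongr
    have h3 := Real.cos_le_one (p * |w.arg|)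
    nlinarith
  · have h1 : cos (p * |w.arg|) ≤ cos (p * θ₀) :=
      Real.cos_le_cos_of_nonneg_of_le_pi (by positivity) (by nlinarith) (by gcongr)
    have h2 : 1 ≤ -(B * cos (p * |w.arg|)) := by
      have : B * (-cos (p * θ₀)) = 1 := by grind
      nlinarith
    have : 0 ≤ A * cos |w.arg| ^ p := by positivity
    linarith

lemma integrable_poisson (ht : t ≠ 0) (x : ℝ) :
    Integrable (fun y : ℝ => |t| / ((y - x) ^ 2 + t ^ 2)) ∧
      ∫ y : ℝ, |t| / ((y - x) ^ 2 + t ^ 2) = π := by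
  have e : (fun y => |t| / ((y - x) ^ 2 + t ^ 2)) =
      fun y => (fun s => |t|⁻¹ * (1 + (s / |t|) ^ 2)⁻¹) (y - x) := by grind
  have hi : Integrable (fun s => |t|⁻¹ * (1 + (s / |t|) ^ 2)⁻¹) :=
    (integrable_inv_one_add_sq.comp_div (abs_ne_zero.2 ht)).const_mul _
  rw [e]
  refine ⟨hi.comp_sub_right x, ?_⟩
  rw [integral_sub_right_eq_self (fun s => |t|⁻¹ * (1 + (s / |t|) ^ 2)⁻¹) x,
    integral_const_mul, Measure.integral_comp_div (fun s => (1 + s ^ 2)⁻¹),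
    integral_univ_inv_one_add_sq, abs_abs, smul_eq_mul, inv_mul_cancel_left₀ (abs_ne_zero.2 ht)]

lemma lintegral_poisson (ht : t ≠ 0) (x : ℝ) :
    ∫⁻ y : ℝ, ofReal (|t| / ((y - x) ^ 2 + t ^ 2)) = ofReal π := by
  rw [← (integrable_poisson ht x).2, ofReal_integral_eq_lintegral_ofReal (integrable_poisson ht x).1]
  exact .of_forall fun y => by positivity

include hpq in
/-- Operators dominated by `π` times the Poisson kernel are bounded on `L_p`. -/
lemma eLpNorm_le_of_le_poisson (ht : t ≠ 0)
    {f : ℝ → ℂ} (hf : AEStronglyMeasurable f) {g : ℝ → ℂ}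
    (hg : ∀ᵐ x, ‖g x‖ₑ ≤ ∫⁻ y, ofReal (|t| / ((y - x) ^ 2 + t ^ 2)) * ‖f y‖ₑ) :
    eLpNorm g 𝔭 ≤ ofReal π * eLpNorm f 𝔭 := by
  have h := eLpNorm_schur (μ := volume) (ν := volume) hpq
    (N := fun x y : ℝ => ofReal (|t| / ((y - x) ^ 2 + t ^ 2)))
    (by fun_prop) (w' := fun _ => 1) (w := fun _ => 1) measurable_const
    measurable_const (by simp) (A := ofReal π) (B := ofReal π)
    (ae_of_all _ fun x => by simp [lintegral_poisson ht])
    (ae_of_all _ fun y => by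
      have := lintegral_poisson ht y
      simp_rw [sub_sq_comm _ y] at this
      simp [this]) hf hg
  rw [← ENNReal.rpow_add_of_nonneg _ _ (one_div_nonneg.2 hpq.symm.nonneg)
    (one_div_nonneg.2 hpq.nonneg), one_div, one_div, add_comm, hpq.inv_add_inv_eq_one,
    rpow_one] at h
  exact h

/-- The point `x + i t` of the complex plane. -/
def cpt (x t : ℝ) : ℂ := (x : ℂ) + (t : ℂ) * I

@[simp] lemma cpt_re (x t : ℝ) : (cpt x t).re = x := by simp [cpt]
@[simp] lemma cpt_im (x t : ℝ) : (cpt x t).im = t := by simp [cpt]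

lemma norm_ofReal_sub_cpt_sq (y x t : ℝ) : ‖(y : ℂ) - cpt x t‖ ^ 2 = (y - x) ^ 2 + t ^ 2 := by
  rw [← normSq_eq_norm_sq, normSq_apply]; simp; ring

lemma im_div_ofReal_sub (g y x t : ℝ) :
    ((g : ℂ) / ((y : ℂ) - cpt x t)).im = g * (t / ((y - x) ^ 2 + t ^ 2)) := by
  rw [div_im, normSq_eq_norm_sq, norm_ofReal_sub_cpt_sq]
  simp
  ring

lemma cauchyT_congr_ae (h : v =ᵐ[volume] w) (z : ℂ) : cauchyT v z = cauchyT w z :=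
  integral_congr_ae (by filter_upwards [h] with y hy; rw [hy])

lemma continuous_cauchyT_line (hv : AEStronglyMeasurable v)
    (hvi : PInt v) (ht : t ≠ 0) :
    Continuous (fun x : ℝ => cauchyT v (cpt x t)) := by
  rw [continuous_iff_continuousAt]
  intro x
  have := (differentiableAt_cauchyT hv hvi (w := cpt x t) (by simpa)).continuousAt
  exact ContinuousAt.comp (f := fun x : ℝ => cpt x t) this (by unfold cpt; fun_prop)

lemma integrable_one_add_abs_rpow (hp : 1 < p) :
    Integrable (fun x : ℝ => (1 + |x|) ^ (-p)) := by
  have := integrable_one_add_norm (E := ℝ) (μ := volume) (r := p) (by simpa using hp)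
  simpa using this

lemma IsBddCpt.integrable_cauchyT_rpow (h : IsBddCpt R M v) (hR : 0 ≤ R)
    (hp : 1 < p) (ht : t ≠ 0) :
    Integrable (fun x : ℝ => ‖cauchyT v (cpt x t)‖ ^ p) := by
  set K := (∫ y, ‖v y‖) * ((1 + R) / |t| + 1) with hK
  have hK0 : 0 ≤ K := by positivity
  refine ((integrable_one_add_abs_rpow hp).const_mul (K ^ p)).mono'
    (((continuous_cauchyT_line h.meas (Integrable.div_one_add_abs h.integrable) ht).norm.rpow_const (by grind)).aestronglyMeasurable)
    (.of_forall fun x => ?_)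
  have h1 := h.norm_cauchyT_le hR (w := cpt x t) (by simpa)
  simp only [cpt_re, cpt_im] at h1
  rw [norm_of_nonneg (by positivity), rpow_neg (by positivity), ← div_eq_mul_inv,
    ← div_rpow hK0 (by positivity)]
  gcongr

/-- Cauchy's theorem in the upper half plane for powers of Cauchy transforms. -/
lemma IsBddCpt.integral_cpow_eq_zero (h : IsBddCpt R M v) (hR : 0 ≤ R)
    (hpos : ∀ z : ℂ, 0 < z.im → 0 < (-I * cauchyT v z).re)
    (hp : 1 < p) (ht : 0 < t) :
    ∫ x : ℝ, (-I * cauchyT v (cpt x t)) ^ (p : ℂ) = 0 := by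
  set G : ℂ → ℂ := fun z => (-I * cauchyT v z) ^ (p : ℂ) with hG
  have hp0 : 0 < p := by linarith
  have hdiff : ∀ z, 0 < z.im → DifferentiableAt ℂ G z := by
    intro z hz
    have h1 := differentiableAt_cauchyT h.meas (Integrable.div_one_add_abs h.integrable) hz.ne'
    exact (h1.const_mul _).cpow_const (Or.inl (hpos z hz))
  have hnorm : ∀ z, 0 < z.im → ‖G z‖ = ‖cauchyT v z‖ ^ p := by simp_all
  set N := ∫ y, ‖v y‖ with hN
  have hfar : ∀ r, 2 * R < r → ∀ z, 0 < z.im → r ≤ ‖z‖ → ‖G z‖ ≤ (2 * N / r) ^ p := by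
    intro r hr z hz hzr
    rw [hnorm z hz]
    refine Real.rpow_le_rpow (norm_nonneg _) ?_ hp0.le
    have := HarmonicMeasure.norm_cauchyT_le h.integrable (w := z) (d := r / 2) (by linarith) (fun y hy => by
      have hyR : |y| ≤ R := by by_contra! hc; exact hy (h.supp y hc)
      have h3 : ‖z‖ - ‖(y : ℂ)‖ ≤ ‖(y : ℂ) - z‖ := by
        rw [norm_sub_rev]; exact norm_sub_norm_le _ _
      rw [norm_real, norm_eq_abs] at h3
      linarith)
    refine this.trans (le_of_eq ?_)
    grind
  have hint : Integrable (fun x => G (cpt x t)) := by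
    refine (h.integrable_cauchyT_rpow hR hp ht.ne').mono' ?_
      (by simp_all)
    refine Continuous.aestronglyMeasurable (continuous_iff_continuousAt.2 fun x => ?_)
    exact ContinuousAt.comp (f := fun x : ℝ => cpt x t) (hdiff (cpt x t) (by simpa)).continuousAt
      (by unfold cpt; fun_prop)
  have hlim1 : Tendsto (fun r => ∫ x in (-r)..r, G (cpt x t)) atTop (𝓝 (∫ x, G (cpt x t))) :=
    intervalIntegral_tendsto_integral hint tendsto_neg_atTop_atBot tendsto_id
  have hbound : ∀ᶠ r in atTop, ‖∫ x in (-r)..r, G (cpt x t)‖ ≤ 4 * (2 * N) ^ p * r ^ (1 - p) := by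
    filter_upwards [eventually_gt_atTop (2 * R), eventually_gt_atTop t, eventually_gt_atTop 0] with r hr1 hr2 hr0
    have hrect := Complex.integral_boundary_rect_eq_zero_of_differentiableOn G (cpt (-r) t) (cpt r r) (by
      intro z hz
      have him := hz.2
      simp at him
      rw [uIcc_of_le hr2.le] at him
      exact (hdiff z (ht.trans_le him.1)).differentiableWithinAt)
    simp only [cpt_re, cpt_im] at hrect
    set D := (2 * N / r) ^ p
    have b1 : ‖∫ x : ℝ in (-r)..r, G (x + r * I)‖ ≤ D * |r - -r| := by
      refine intervalIntegral.norm_integral_le_of_norm_le_const fun x _ => ?_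
      refine hfar r hr1 _ (by simpa) ?_
      have := abs_im_le_norm (x + r * I : ℂ)
      simp [abs_of_pos hr0] at this
      exact this
    have b2 : ∀ s : ℝ, |s| = r → ‖∫ y : ℝ in t..r, G (s + y * I)‖ ≤ D * |r - t| := by
      intro s hs
      refine intervalIntegral.norm_integral_le_of_norm_le_const fun y hy => ?_
      rw [uIoc_of_le hr2.le] at hy
      refine hfar r hr1 _ (by simpa using ht.trans hy.1) ?_
      have := abs_re_le_norm (s + y * I : ℂ)
      simp [hs] at this
      exact this
    have b3 := b2 r (abs_of_pos hr0)
    have b4 := b2 (-r) (by grind)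
    have e : ∫ x in (-r)..r, G (cpt x t) = (∫ x : ℝ in (-r)..r, G (x + r * I))
        - I • (∫ y : ℝ in t..r, G (r + y * I))
        + I • (∫ y : ℝ in t..r, G ((-r : ℝ) + y * I)) := by
      simp only [cpt]
      grind
    rw [e]
    have hD : D = (2 * N) ^ p * r ^ (-p) := by
      rw [rpow_neg hr0.le, ← div_eq_mul_inv]; exact div_rpow (by positivity) hr0.le p
    calc _ ≤ D * |r - -r| + D * |r - t| + D * |r - t| := by
          refine (norm_add_le _ _).trans (add_le_add ((norm_sub_le _ _).trans (add_le_add b1 ?_)) ?_)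
          · rw [norm_smul, norm_I, one_mul]; exact b3
          · rw [norm_smul, norm_I, one_mul]; exact b4
      _ ≤ D * (2 * r) + D * r + D * r := by
          rw [abs_of_pos (by linarith : 0 < r - -r), abs_of_pos (by linarith : 0 < r - t)]
          gcongr <;> linarith
      _ = 4 * (2 * N) ^ p * (r ^ (-p) * r ^ (1 : ℝ)) := by rw [hD, Real.rpow_one]; ring
      _ = _ := by rw [← rpow_add hr0]; ring_nf
  have hlim2 : Tendsto (fun r => 4 * (2 * N) ^ p * r ^ (1 - p)) atTop (𝓝 0) := by
    have := (tendsto_rpow_neg_atTop (y := p - 1) (by linarith)).const_mul (4 * (2 * N) ^ p)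
    simpa using this
  exact tendsto_nhds_unique hlim1 (squeeze_zero_norm' hbound hlim2)

include hpq in
lemma riesz_nonneg (hp2 : p ≤ 2) :
    ∃ C : ℝ≥0, ∀ (R M : ℝ) (g : ℝ → ℝ), (∀ x, 0 ≤ g x) → 0 ≤ R → IsBddCpt R M (fun x => (g x : ℂ)) →
      ∀ t : ℝ, 0 < t → eLpNorm (fun x => cauchyT (fun x => (g x : ℂ)) (cpt x t)) 𝔭
        ≤ C * eLpNorm (fun x => (g x : ℂ)) 𝔭 volume := by
  have hp1 := hpq.lt
  have hp0 : 0 < p := hpq.pos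
  obtain ⟨A, B, hA, hB, hAB⟩ := rpow_norm_le_of_re_pos hp1 hp2
  refine ⟨(A ^ (1 / p)).toNNReal * (π).toNNReal, fun R M g hg hR h t ht => ?_⟩
  set v : ℝ → ℂ := fun x => (g x : ℂ) with hv
  by_cases hv0 : v =ᵐ[volume] 0
  · have : ∀ z, cauchyT v z = 0 := fun z => by rw [cauchyT_congr_ae hv0]; simp [cauchyT]
    simp [this]
  have him : ∀ z : ℂ, 0 < z.im → (cauchyT v z).im = ∫ y, g y * (z.im / ((y - z.re) ^ 2 + z.im ^ 2)) := by
    intro z hz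
    have hi := integrable_cauchyT h.meas (Integrable.div_one_add_abs h.integrable) hz.ne'
    rw [cauchyT, ← Complex.imCLM_apply, ← Complex.imCLM.integral_comp_comm hi]
    refine integral_congr_ae (ae_of_all _ fun y => ?_)
    have hz' : z = cpt z.re z.im := by apply Complex.ext <;> simp
    have := im_div_ofReal_sub (g y) y z.re z.im
    rw [← hz'] at this
    bound
  have hpos : ∀ z : ℂ, 0 < z.im → 0 < (-I * cauchyT v z).re := by
    intro z hz
    have e : (-I * cauchyT v z).re = (cauchyT v z).im := by simp
    rw [e, him z hz]
    have hi := integrable_cauchyT h.meas (Integrable.div_one_add_abs h.integrable) hz.ne'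
    have hi2 : Integrable (fun y => g y * (z.im / ((y - z.re) ^ 2 + z.im ^ 2))) := by
      refine hi.im.congr (ae_of_all _ fun y => ?_)
      have hz' : z = cpt z.re z.im := by apply Complex.ext <;> simp
      have := im_div_ofReal_sub (g y) y z.re z.im
      rw [← hz'] at this
      bound
    rw [integral_pos_iff_support_of_nonneg (fun y => by have := hg y; positivity) hi2]
    rw [pos_iff_ne_zero]
    intro h0
    refine hv0 ?_
    have hs : volume (Function.support g) = 0 := by
      convert h0 using 2
      ext y
      have : z.im / ((y - z.re) ^ 2 + z.im ^ 2) ≠ 0 := by positivity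
      simp_all
    rw [Measure.measure_support_eq_zero_iff (μ := volume)] at hs
    filter_upwards [hs] with y hy
    simp [hv, hy]
  set c : ℝ → ℂ := fun x => cauchyT v (cpt x t) with hc
  have hcont : Continuous c := continuous_cauchyT_line h.meas (Integrable.div_one_add_abs h.integrable) ht.ne'
  have hint : Integrable (fun x : ℝ => ‖c x‖ ^ p) := h.integrable_cauchyT_rpow hR hp1 ht.ne'
  have hcpos : ∀ x, 0 < (c x).im := fun x => by
    have := hpos (cpt x t) (by simpa)
    simpa using this
  have hint2 : Integrable (fun x : ℝ => (c x).im ^ p) := by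
    refine hint.mono' ((Complex.continuous_im.comp hcont).rpow_const
      (fun _ => Or.inr hp0.le)).aestronglyMeasurable (ae_of_all _ fun x => ?_)
    rw [norm_of_nonneg (by have := hcpos x; positivity)]
    exact Real.rpow_le_rpow (hcpos x).le ((le_abs_self _).trans (abs_im_le_norm _)) hp0.le
  have hz := h.integral_cpow_eq_zero hR hpos hp1 ht
  have hnorm : ∀ x, ‖(-I * c x) ^ (p : ℂ)‖ = ‖c x‖ ^ p := by simp
  have hint3 : Integrable (fun x : ℝ => (-I * c x) ^ (p : ℂ)) := by
    refine hint.mono' ?_ (by simp)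
    refine Continuous.aestronglyMeasurable ?_
    refine Continuous.cpow (by fun_prop) continuous_const (fun x => Or.inl ?_)
    simp_all
  have hre0 : ∫ x : ℝ, ((-I * c x) ^ (p : ℂ)).re = 0 := by
    have := Complex.reCLM.integral_comp_comm hint3
    simp_all
  have hineq : ∫ x, ‖c x‖ ^ p ≤ A * ∫ x, (c x).im ^ p := by
    calc _ ≤ ∫ x, (A * (c x).im ^ p - B * ((-I * c x) ^ (p : ℂ)).re) := by
          refine integral_mono hint ((hint2.const_mul A).sub (hint3.re.const_mul B)) fun x => ?_
          have := hAB (-I * c x) (by simp_all)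
          simpa using this
      _ = _ := by
          have hint4 : Integrable (fun x => ((-I * c x) ^ (p : ℂ)).re) := hint3.re
          rw [integral_sub (hint2.const_mul A) (hint4.const_mul B), integral_const_mul,
            integral_const_mul, hre0]
          ring
  have h0 : ofReal p ≠ 0 := by simpa using hp0
  have hP : eLpNorm (fun x => ((c x).im : ℂ)) 𝔭 ≤
      ofReal π * eLpNorm v 𝔭 := by
    refine eLpNorm_le_of_le_poisson hpq ht.ne' h.meas (ae_of_all _ fun x => ?_)
    have := him (cpt x t) (by simpa)
    simp only [cpt_re, cpt_im] at this
    rw [this, ← enorm_norm, norm_real, enorm_norm]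
    refine (enorm_integral_le_lintegral_enorm _).trans (lintegral_mono fun y => ?_)
    rw [enorm_mul, mul_comm, Real.enorm_eq_ofReal (by positivity), abs_of_pos ht]
    simp [hv, ← ofReal_norm]
  have e1 : ∫⁻ x, ‖c x‖ₑ ^ p = ofReal (∫ x, ‖c x‖ ^ p) := by
    rw [ofReal_integral_eq_lintegral_ofReal hint (.of_forall fun x => by positivity)]
    refine lintegral_congr fun x => ?_
    rw [← ofReal_norm, ofReal_rpow_of_nonneg (norm_nonneg _) hp0.le]
  have e2 : ∫⁻ x, ‖((c x).im : ℂ)‖ₑ ^ p = ofReal (∫ x, (c x).im ^ p) := by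
    rw [ofReal_integral_eq_lintegral_ofReal hint2
      (.of_forall fun x => by have := hcpos x; positivity)]
    refine lintegral_congr fun x => ?_
    rw [← ofReal_norm, ofReal_rpow_of_nonneg (norm_nonneg _) hp0.le, norm_real,
      norm_of_nonneg (hcpos x).le]
  have e3 : eLpNorm c 𝔭 ≤
      ofReal (A ^ (1 / p)) * eLpNorm (fun x => ((c x).im : ℂ)) 𝔭 := by
    rw [eLpNorm_eq_lintegral_rpow_enorm_toReal h0 ofReal_ne_top,
      eLpNorm_eq_lintegral_rpow_enorm_toReal h0 ofReal_ne_top, toReal_ofReal hp0.le,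
      e1, e2, ← ofReal_rpow_of_nonneg hA (by positivity),
      ← mul_rpow_of_nonneg _ _ (by positivity), ← ofReal_mul hA]
    gcongr
  calc _ ≤ _ := e3
    _ ≤ ofReal (A ^ (1 / p)) * (ofReal π * eLpNorm v 𝔭) := by
        gcongr
    _ = _ := by
        rw [← mul_assoc]; congr 1

lemma one_le_ofReal (h : p.HolderConjugate q) : 1 ≤ ofReal p := by
  simpa using h.lt.le

lemma memLp_inv_one_add_abs (hq : 1 < q) :
    MemLp (fun y : ℝ => (1 + |y|)⁻¹) (ofReal q) := by
  have hq0 : 0 < q := by linarith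
  have hm : AEStronglyMeasurable (fun y : ℝ => (1 + |y|)⁻¹) := by fun_prop
  rw [← integrable_norm_rpow_iff hm (by simpa using hq0) ofReal_ne_top, toReal_ofReal hq0.le]
  refine (integrable_one_add_abs_rpow hq).congr (.of_forall fun y => ?_)
  have h1 : 0 ≤ 1 + |y| := by positivity
  simp only []
  rw [norm_of_nonneg (by positivity), rpow_neg h1, inv_rpow h1]

include hpq in
lemma MemLp.integrable_div_one_add_abs
    (hv : MemLp v 𝔭) : PInt v := by
  have := hpq.ennrealOfReal
  exact hv.norm.integrable_mul (memLp_inv_one_add_abs hpq.symm.lt)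

lemma cauchyT_add (hv : AEStronglyMeasurable v)
    (hvi : PInt v) (hw : AEStronglyMeasurable w)
    (hwi : PInt w) (hz : z.im ≠ 0) :
    cauchyT (v + w) z = cauchyT v z + cauchyT w z := by
  rw [cauchyT, cauchyT, cauchyT, ← integral_add (integrable_cauchyT hv hvi hz) (integrable_cauchyT hw hwi hz)]
  simp [add_div]

lemma cauchyT_smul (c : ℂ) (v : ℝ → ℂ) (z : ℂ) : cauchyT (c • v) z = c * cauchyT v z := by
  rw [cauchyT, cauchyT, ← integral_const_mul]
  simp [mul_div_assoc]

lemma cauchyT_conj (v : ℝ → ℂ) (z : ℂ) :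
    cauchyT v (star z) = star (cauchyT (fun y => star (v y)) z) := by
  have : ∀ z, star (cauchyT (fun y => star (v y)) z) = ∫ y, star (star (v y) / ((y : ℂ) - z)) := fun z =>
    integral_conj.symm
  rw [this, cauchyT]
  simp

lemma IsBddCpt.add {M' : ℝ} (hv : IsBddCpt R M v) (hw : IsBddCpt R M' w) :
    IsBddCpt R (M + M') (v + w) :=
  ⟨hv.meas.add hw.meas, fun x => norm_add_le_of_le (hv.bdd x) (hw.bdd x), fun x hx => by
    simp [hv.supp x hx, hw.supp x hx]⟩

lemma IsBddCpt.const_smul (c : ℂ) (hv : IsBddCpt R M v) :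
    IsBddCpt R (‖c‖ * M) (c • v) :=
  ⟨hv.meas.const_smul c, fun x => by
    simp; gcongr; exact hv.bdd x, fun x hx => by simp [hv.supp x hx]⟩

include hpq in
lemma riesz_bddCpt_of_le_two (hp2 : p ≤ 2) :
    ∃ C : ℝ≥0, ∀ (R M : ℝ) (v : ℝ → ℂ), 0 ≤ R → IsBddCpt R M v →
      ∀ t : ℝ, 0 < t → eLpNorm (fun x => cauchyT v (cpt x t)) 𝔭
        ≤ C * eLpNorm v 𝔭 := by
  obtain ⟨C, hC⟩ := riesz_nonneg hpq hp2
  refine ⟨4 * C, fun R M v hR h t ht => ?_⟩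
  have key : ∀ φ : ℂ → ℝ, Continuous φ → (∀ z, 0 ≤ φ z) → (∀ z, φ z ≤ ‖z‖) →
      IsBddCpt R M (fun x => (φ (v x) : ℂ)) ∧
      ∀ c : ℂ, ‖c‖ = 1 → eLpNorm (fun x => cauchyT (c • fun x => (φ (v x) : ℂ)) (cpt x t)) 𝔭
        ≤ C * eLpNorm v 𝔭 := by
    intro φ hφ h0 h1
    have hb : IsBddCpt R M (fun x => (φ (v x) : ℂ)) := by
      refine ⟨(Complex.continuous_ofReal.comp hφ).comp_aestronglyMeasurable h.meas, fun x => ?_, fun x hx => ?_⟩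
      · rw [norm_real, norm_of_nonneg (h0 _)]
        exact (h1 _).trans (h.bdd x)
      · have := h1 (v x)
        rw [h.supp x hx, norm_zero] at this
        rw [h.supp x hx, le_antisymm this (h0 0)]; simp
    refine ⟨hb, fun c hc => ?_⟩
    have e : (fun x => cauchyT (c • fun x => (φ (v x) : ℂ)) (cpt x t)) =
        c • (fun x => cauchyT (fun x => (φ (v x) : ℂ)) (cpt x t)) := by
      ext x; rw [cauchyT_smul]; rfl
    rw [e, eLpNorm_const_smul, ← ofReal_norm, hc, ENNReal.ofReal_one, one_mul]
    refine (hC R M (fun x => φ (v x)) (fun x => h0 _) hR hb t ht).trans ?_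
    gcongr
    refine eLpNorm_mono fun x => ?_
    rw [norm_real, norm_of_nonneg (h0 _)]
    exact h1 _
  obtain ⟨b1, k1⟩ := key (fun z => max z.re 0) (by fun_prop) (by simp)
    (fun z => max_le ((le_abs_self _).trans (abs_re_le_norm z)) (norm_nonneg z))
  obtain ⟨b2, k2⟩ := key (fun z => max (-z.re) 0) (by fun_prop) (by simp)
    (fun z => max_le ((neg_le_abs _).trans (abs_re_le_norm z)) (norm_nonneg z))
  obtain ⟨b3, k3⟩ := key (fun z => max z.im 0) (by fun_prop) (by simp)
    (fun z => max_le ((le_abs_self _).trans (abs_im_le_norm z)) (norm_nonneg z))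
  obtain ⟨b4, k4⟩ := key (fun z => max (-z.im) 0) (by fun_prop) (by simp)
    (fun z => max_le ((neg_le_abs _).trans (abs_im_le_norm z)) (norm_nonneg z))
  have b1' := b1.const_smul 1
  have b2' := b2.const_smul (-1)
  have b3' := b3.const_smul I
  have b4' := b4.const_smul (-I)
  have hmax : ∀ a : ℝ, a = max a 0 - max (-a) 0 := by simp
  have hsum : v = ((((1 : ℂ) • fun x => ((max (v x).re 0 : ℝ) : ℂ)) + ((-1 : ℂ) • fun x => ((max (-(v x).re) 0 : ℝ) : ℂ)))
      + (I • fun x => ((max (v x).im 0 : ℝ) : ℂ))) + ((-I) • fun x => ((max (-(v x).im) 0 : ℝ) : ℂ)) := by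
    ext x
    have h1 := hmax (v x).re
    have h2 := hmax (v x).im
    apply Complex.ext
    · simp; linarith
    · simp; linarith
  have hc : ∀ {M'} {w : ℝ → ℂ}, IsBddCpt R M' w → AEStronglyMeasurable (fun x => cauchyT w (cpt x t)) :=
    fun hw => (continuous_cauchyT_line hw.meas (Integrable.div_one_add_abs hw.integrable) ht.ne').aestronglyMeasurable
  have hadd : ∀ {M' M''} {w w' : ℝ → ℂ}, IsBddCpt R M' w → IsBddCpt R M'' w' →
      eLpNorm (fun x => cauchyT (w + w') (cpt x t)) 𝔭 ≤
      eLpNorm (fun x => cauchyT w (cpt x t)) 𝔭 +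
      eLpNorm (fun x => cauchyT w' (cpt x t)) 𝔭 := by
    intro M' M'' w w' hw hw'
    have e : (fun x => cauchyT (w + w') (cpt x t)) = (fun x => cauchyT w (cpt x t)) + (fun x => cauchyT w' (cpt x t)) := by
      ext x
      exact cauchyT_add hw.meas (Integrable.div_one_add_abs hw.integrable) hw'.meas
        (Integrable.div_one_add_abs hw'.integrable) (by simpa using ht.ne')
    rw [e]
    exact eLpNorm_add_le (hc hw) (hc hw') (one_le_ofReal hpq)
  conv_lhs => rw [hsum]
  refine (hadd ((b1'.add b2').add b3') b4').trans ?_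
  refine (add_le_add_left ((hadd (b1'.add b2') b3').trans (add_le_add_left (hadd b1' b2') _)) _).trans ?_
  refine (add_le_add (add_le_add (add_le_add (k1 1 (by simp)) (k2 (-1) (by simp))) (k3 I (by simp)))
    (k4 (-I) (by simp))).trans (le_of_eq ?_)
  push_cast
  ring

/-- Uniform boundedness of the Cauchy transforms on lines, for bounded functions of compact
support. -/
def RieszBound (p : ℝ) (C : ℝ≥0) : Prop := ∀ (R M : ℝ) (v : ℝ → ℂ), 0 ≤ R → IsBddCpt R M v →
      ∀ t, t ≠ 0 → eLpNorm (fun x => cauchyT v (cpt x t)) (ofReal p)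
        ≤ C * eLpNorm v (ofReal p)

lemma cpt_neg (x t : ℝ) : cpt x (-t) = star (cpt x t) := by
  apply Complex.ext <;> simp

include hpq in
lemma exists_rieszBound_of_le_two (hp2 : p ≤ 2) :
    ∃ C : ℝ≥0, RieszBound p C := by
  obtain ⟨C, hC⟩ := riesz_bddCpt_of_le_two hpq hp2
  refine ⟨C, fun R M v hR h t ht => ?_⟩
  rcases lt_or_gt_of_ne ht with ht | ht
  · have h' : IsBddCpt R M (fun y => star (v y)) :=
      ⟨h.meas.star, fun x => by simpa using h.bdd x, fun x hx => by simp [h.supp x hx]⟩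
    have := hC R M _ hR h' (-t) (by linarith)
    have e1 : eLpNorm (fun y => star (v y)) 𝔭 = eLpNorm v 𝔭 :=
      eLpNorm_congr_norm_ae (by simp)
    rw [e1] at this
    refine le_trans (le_of_eq (eLpNorm_congr_norm_ae (.of_forall fun x => ?_))) this
    have h2 := cauchyT_conj v (cpt x (-t))
    rw [← cpt_neg, neg_neg] at h2
    simp_all
  grind

include hpq in
/-- Cauchy transforms on lines, for general functions in `L_p`, by approximation. -/
lemma RieszBound.memLp (hC : RieszBound p C)
    (hv : MemLp v 𝔭) (ht : t ≠ 0) :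
    MemLp (fun x => cauchyT v (cpt x t)) 𝔭 ∧
      eLpNorm (fun x => cauchyT v (cpt x t)) 𝔭
        ≤ C * eLpNorm v 𝔭 := by
  have hvi := MemLp.integrable_div_one_add_abs hpq hv
  have hbd : eLpNorm (fun x => cauchyT v (cpt x t)) 𝔭
        ≤ C * eLpNorm v 𝔭 := by
    set v' := hv.1.mk v with hv'
    have hvv' : v =ᵐ[volume] v' := hv.1.ae_eq_mk
    have hm : StronglyMeasurable v' := by fun_prop
    let s : ℕ → Set ℝ := fun n => {x | ‖v' x‖ ≤ n ∧ |x| ≤ n}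
    have hs : ∀ n, MeasurableSet (s n) := fun n =>
      (measurableSet_le hm.norm.measurable measurable_const).inter
        (measurableSet_le measurable_id.abs measurable_const)
    let w : ℕ → ℝ → ℂ := fun n => (s n).indicator v'
    have hwle : ∀ n x, ‖w n x‖ ≤ ‖v' x‖ := fun n x => norm_indicator_le_norm_self _ _
    have hwb : ∀ n : ℕ, IsBddCpt n n (w n) := by
      intro n
      refine ⟨(hm.indicator (hs n)).aestronglyMeasurable, fun x => ?_, fun x hx => ?_⟩
      · by_cases h : x ∈ s n
        · simp only [w, indicator_of_mem h]; exact h.1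
        · simp [w, indicator_of_notMem h]
      · exact indicator_of_notMem (by grind) _
    have hvi' : Integrable (fun y => ‖v' y‖ / (1 + |y|)) :=
      hvi.congr (by filter_upwards [hvv'] with y hy; rw [hy])
    have hlim : ∀ x, Tendsto (fun n => cauchyT (w n) (cpt x t)) atTop (𝓝 (cauchyT v (cpt x t))) := by
      intro x
      rw [cauchyT_congr_ae hvv']
      have hi := integrable_cauchyT hm.aestronglyMeasurable hvi' (w := cpt x t) (by simpa)
      refine tendsto_integral_of_dominated_convergence (fun y => ‖v' y / ((y : ℂ) - cpt x t)‖) ?_ hi.norm ?_ ?_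
      · intro n
        exact ((hm.indicator (hs n)).measurable.div (by fun_prop)).aestronglyMeasurable
      · intro n
        refine .of_forall fun y => ?_
        rw [norm_div, norm_div]
        bound
      · refine .of_forall fun y => tendsto_const_nhds.congr' ?_
        filter_upwards [eventually_ge_atTop ⌈max ‖v' y‖ |y|⌉₊] with n hn
        have : y ∈ s n := by
          have := Nat.ceil_le.1 hn
          grind
        simp [w, this]
    refine (Lp.eLpNorm_lim_le_liminf_eLpNorm (f := fun n x => cauchyT (w n) (cpt x t)) (fun n =>
      (continuous_cauchyT_line (hwb n).meas (Integrable.div_one_add_abs (hwb n).integrable) ht).aestronglyMeasurable)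
      _ (by simp_all)).trans ?_
    refine liminf_le_of_le (by isBoundedDefault) fun b hb => ?_
    obtain ⟨n, hn⟩ := hb.exists
    refine hn.trans ((hC n n _ (by positivity) (hwb n) t ht).trans ?_)
    rw [eLpNorm_congr_ae hvv']
    gcongr
    exact eLpNorm_mono (hwle n)
  refine ⟨⟨(continuous_cauchyT_line hv.1 hvi ht).aestronglyMeasurable, hbd.trans_lt ?_⟩, hbd⟩
  exact mul_lt_top coe_lt_top hv.2

lemma integral_mul_cauchyT {h : ℝ → ℂ} (hv : Integrable v) (hh : Integrable h)
    (ht : t ≠ 0) :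
    ∫ x, h x * cauchyT v (cpt x t) = -∫ y, v y * cauchyT h (cpt y (-t)) := by
  have hint : Integrable (Function.uncurry fun x y : ℝ => h x * (v y / ((y : ℂ) - cpt x t))) (volume.prod volume) := by
    have h1 : Integrable (fun z : ℝ × ℝ => h z.1 * v z.2) (volume.prod volume) := hh.mul_prod hv
    have hm : Measurable (fun z : ℝ × ℝ => ((z.2 : ℂ) - cpt z.1 t)⁻¹) := by
      unfold cpt; fun_prop
    refine (h1.bdd_mul (c := |t|⁻¹) hm.aestronglyMeasurable (ae_of_all _ fun z => ?_)).congr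
      (.of_forall fun z => ?_)
    · rw [norm_inv]
      have := le_norm_ofReal_sub z.2 (cpt z.1 t)
      rw [cpt_im] at this
      gcongr
    grind
  calc ∫ x, h x * cauchyT v (cpt x t) = ∫ x, ∫ y, h x * (v y / ((y : ℂ) - cpt x t)) := by
        simp only [cauchyT, ← integral_const_mul]
    _ = ∫ y, ∫ x, h x * (v y / ((y : ℂ) - cpt x t)) := integral_integral_swap hint
    _ = ∫ y, -(v y * cauchyT h (cpt y (-t))) := by
        refine integral_congr_ae (.of_forall fun y => ?_)
        simp only [cauchyT, ← integral_const_mul, ← integral_neg]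
        refine integral_congr_ae (ae_of_all _ fun x => ?_)
        have e : (y : ℂ) - cpt x t = -((x : ℂ) - cpt y (-t)) := by simp [cpt]; ring
        grind
    _ = _ := integral_neg _

include hpq in
lemma exists_rieszBound_of_two_lt (hp2 : 2 < p) :
    ∃ C : ℝ≥0, RieszBound p C := by
  have hp0 := hpq.pos
  have hq0 := hpq.symm.pos
  have hq2 : q ≤ 2 := by
    rw [hpq.conjugate_eq, div_le_iff₀ (by linarith)]; linarith
  obtain ⟨C, hC⟩ := exists_rieszBound_of_le_two hpq.symm hq2
  refine ⟨C, fun R M v hR hv t ht => ?_⟩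
  set g : ℝ → ℂ := fun x => cauchyT v (cpt x t) with hg
  have hgc : Continuous g := continuous_cauchyT_line hv.meas (Integrable.div_one_add_abs hv.integrable) ht
  have hgi : Integrable (fun x => ‖g x‖ ^ p) := hv.integrable_cauchyT_rpow hR (by linarith) ht
  have hgi' : Integrable (fun x => ‖g x‖ ^ (p - 1)) := hv.integrable_cauchyT_rpow hR (by linarith) ht
  set h : ℝ → ℂ := fun x => star (g x) * ((‖g x‖ ^ (p - 2) : ℝ) : ℂ) with hh
  have hnorm : ∀ x, ‖h x‖ = ‖g x‖ ^ (p - 1) := by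
    intro x
    rw [hh]
    simp only [norm_mul, norm_star, norm_real]
    rw [norm_of_nonneg (by positivity)]
    rcases eq_or_ne (g x) 0 with h0 | h0
    · rw [h0, norm_zero, zero_mul, zero_rpow (by linarith)]
    · have : 0 < ‖g x‖ := norm_pos_iff.2 h0
      rw [show p - 1 = 1 + (p - 2) by ring, rpow_add this, Real.rpow_one]
  have hhc : Continuous h := by
    refine (continuous_star.comp hgc).mul (Complex.continuous_ofReal.comp ?_)
    exact hgc.norm.rpow_const (by grind)
  have hhi : Integrable h := hgi'.mono' hhc.aestronglyMeasurable (by simp_all)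
  have hmul : ∀ x, h x * g x = ((‖g x‖ ^ p : ℝ) : ℂ) := by
    intro x
    have : star (g x) * g x = ((‖g x‖ ^ (2 : ℝ) : ℝ) : ℂ) := by
      rw [← starRingEnd_apply, Complex.conj_mul']; norm_cast
    rcases eq_or_ne (g x) 0 with h0 | h0
    · rw [h0, norm_zero, zero_rpow (by linarith)]; simp
    · have h1 : 0 < ‖g x‖ := norm_pos_iff.2 h0
      calc star (g x) * ((‖g x‖ ^ (p - 2) : ℝ) : ℂ) * g x = (star (g x) * g x) * ((‖g x‖ ^ (p - 2) : ℝ) : ℂ) := by ring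
        _ = _ := by
          rw [this, ← Complex.ofReal_mul, ← rpow_add h1]; ring
  have hpq1 : (p - 1) * q = p := hpq.sub_one_mul_conj
  have hhq : ∫⁻ x, ‖h x‖ₑ ^ q = ∫⁻ x, ‖g x‖ₑ ^ p := by
    refine lintegral_congr fun x => ?_
    rw [← ofReal_norm, hnorm, ← ofReal_norm, ofReal_rpow_of_nonneg (by positivity) hq0.le,
      ofReal_rpow_of_nonneg (by positivity) hp0.le, ← Real.rpow_mul (norm_nonneg _), hpq1]
  have hfin : ∫⁻ x, ‖g x‖ₑ ^ p = ofReal (∫ x, ‖g x‖ ^ p) := by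
    rw [ofReal_integral_eq_lintegral_ofReal hgi (.of_forall fun x => by positivity)]
    refine lintegral_congr fun x => ?_
    rw [← ofReal_norm, ofReal_rpow_of_nonneg (norm_nonneg _) hp0.le]
  have hp0' : ofReal p ≠ 0 := by simpa using hp0
  have hq0' : ofReal q ≠ 0 := by simpa using hq0
  set a := eLpNorm g (ofReal p) with ha
  have ha1 : a = (∫⁻ x, ‖g x‖ₑ ^ p) ^ (1 / p) := by
    rw [ha, eLpNorm_eq_lintegral_rpow_enorm_toReal hp0' ofReal_ne_top, toReal_ofReal hp0.le]
  have hatop : a ≠ ⊤ := by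
    rw [ha1, hfin]; exact rpow_ne_top_of_nonneg (by positivity) ofReal_ne_top
  have hap : ∫⁻ x, ‖g x‖ₑ ^ p = a ^ p := by
    rw [ha1, ← rpow_mul, one_div, inv_mul_cancel₀ hp0.ne', rpow_one]
  have hhnorm : eLpNorm h (ofReal q) = a ^ (p - 1) := by
    rw [eLpNorm_eq_lintegral_rpow_enorm_toReal hq0' ofReal_ne_top, toReal_ofReal hq0.le,
      hhq, hap, ← rpow_mul]
    grind
  have hhL : MemLp h (ofReal q) :=
    ⟨hhc.aestronglyMeasurable, by rw [hhnorm]; exact (rpow_ne_top_of_nonneg (by linarith) hatop).lt_top⟩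
  obtain ⟨hT1, hT2⟩ := hC.memLp hpq.symm hhL (t := -t) (by simpa using ht)
  have hdual := integral_mul_cauchyT hv.integrable hhi ht
  have hH := ENNReal.lintegral_mul_le_Lp_mul_Lq volume hpq (hv.meas.enorm) (hT1.1.enorm)
  have main : a ^ p ≤ eLpNorm v (ofReal p) * (C * a ^ (p - 1)) := by
    rw [← hap, hfin]
    have e1 : ((∫ x, ‖g x‖ ^ p : ℝ) : ℂ) = ∫ x, h x * g x := by
      simp_rw [hmul]; exact integral_ofReal.symm
    have e2 : ∫ x, ‖g x‖ ^ p = ‖∫ y, v y * cauchyT h (cpt y (-t))‖ := by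
      rw [← norm_neg, ← hdual, ← e1, norm_real, norm_of_nonneg (by positivity)]
    rw [e2, ofReal_norm]
    refine (enorm_integral_le_lintegral_enorm _).trans ?_
    simp_rw [enorm_mul]
    refine hH.trans ?_
    rw [← hhnorm]
    refine le_trans (le_of_eq ?_) (mul_le_mul_right hT2 _)
    rw [eLpNorm_eq_lintegral_rpow_enorm_toReal hp0' ofReal_ne_top,
      eLpNorm_eq_lintegral_rpow_enorm_toReal hq0' ofReal_ne_top, toReal_ofReal hp0.le,
      toReal_ofReal hq0.le]
  by_cases ha0 : a = 0
  · rw [ha0]; exact zero_le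
  · have e : a ^ p = a * a ^ (p - 1) := by
      conv_lhs => rw [show p = 1 + (p - 1) by ring, ENNReal.rpow_add _ _ ha0 hatop, rpow_one]
    rw [e] at main
    have h1 : a ^ (p - 1) ≠ 0 := by positivity
    have h2 : a ^ (p - 1) ≠ ⊤ := by simp_all
    refine (ENNReal.mul_le_mul_iff_left h1 h2).1 (main.trans (le_of_eq ?_))
    ring

include hpq in
/-- **M. Riesz' theorem**: the Cauchy transform is bounded from `L_p` to `L_p` of horizontal lines. -/
lemma riesz :
    ∃ C : ℝ≥0, ∀ v : ℝ → ℂ, MemLp v 𝔭 → ∀ t : ℝ, t ≠ 0 →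
      MemLp (fun x => cauchyT v (cpt x t)) 𝔭 ∧
      eLpNorm (fun x => cauchyT v (cpt x t)) 𝔭
        ≤ C * eLpNorm v 𝔭 := by
  rcases le_or_gt p 2 with h | h
  · obtain ⟨C, hC⟩ := exists_rieszBound_of_le_two hpq h
    exact ⟨C, fun v hv t ht => hC.memLp hpq hv ht⟩
  · obtain ⟨C, hC⟩ := exists_rieszBound_of_two_lt hpq h
    exact ⟨C, fun v hv t ht => hC.memLp hpq hv ht⟩

/-- Lipschitz functions with compact support. -/
structure IsLipCpt (R M L : ℝ) (v : ℝ → ℂ) : Prop extends IsBddCpt R M v where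
  hR : 0 ≤ R
  hM : 0 ≤ M
  hL : 0 ≤ L
  lip : ∀ a b, ‖v a - v b‖ ≤ L * |a - b|

lemma IsLipCpt.continuous (h : IsLipCpt R M L v) : Continuous v :=
  (LipschitzWith.of_dist_le_mul (K := ⟨L, h.hL⟩) fun a b => by
    rw [dist_eq_norm, dist_eq]; exact h.lip a b).continuous

lemma exists_isLipCpt (hc : HasCompactSupport v) (hv : ContDiff ℝ 1 v) :
    ∃ R M L, IsLipCpt R M L v := by
  obtain ⟨L, hL⟩ := hv.lipschitzWith_of_hasCompactSupport hc one_ne_zero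
  obtain ⟨M, hM⟩ := hc.exists_bound_of_continuous hv.continuous
  obtain ⟨R, hR⟩ := hc.isCompact.isBounded.subset_closedBall 0
  refine ⟨max R 0, M, L, ⟨⟨hv.continuous.aestronglyMeasurable, hM, fun x hx => ?_⟩, le_max_right _ _,
    (norm_nonneg _).trans (hM 0), L.2, fun a b => ?_⟩⟩
  · by_contra h0
    have := hR (subset_tsupport v (Function.mem_support.2 h0))
    rw [mem_closedBall, dist_zero_right, norm_eq_abs] at this
    grind
  · have := hL.dist_le_mul a b
    rwa [dist_eq_norm, dist_eq] at this

/-- Odd bounded kernels dominated by `1 / |s|`. -/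
structure IsOddKernel (κ : ℝ → ℝ) : Prop where
  meas : Measurable κ
  odd : ∀ s, κ (-s) = -κ s
  le : ∀ s, |κ s| ≤ |s|⁻¹
  bdd : ∃ B, ∀ s, |κ s| ≤ B

lemma IsOddKernel.integrable (hκ : IsOddKernel κ) (hv : Integrable v)
    (x : ℝ) : Integrable (fun y => (κ (y - x) : ℂ) * v y) := by
  obtain ⟨B, hB⟩ := hκ.bdd
  refine hv.bdd_mul (c := B) ?_ (ae_of_all _ fun y => ?_)
  · have := hκ.meas
    apply Measurable.aestronglyMeasurable; fun_prop
  · rw [norm_real]; exact hB _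

lemma IsOddKernel.integral_eq (hκ : IsOddKernel κ) (hv : Integrable v)
    (x : ℝ) : ∫ y, (κ (y - x) : ℂ) * v y = ∫ s in Ioi (0 : ℝ), (κ s : ℂ) * (v (x + s) - v (x - s)) := by
  have hi : Integrable (fun s => (κ s : ℂ) * v (x + s)) := by
    have := (hκ.integrable hv x).comp_add_left x
    simpa using this
  have e1 : ∫ y, (κ (y - x) : ℂ) * v y = ∫ s, (κ s : ℂ) * v (x + s) := by
    rw [← integral_add_left_eq_self _ x]; simp
  have hi2 : Integrable (fun s => (κ (-s) : ℂ) * v (x + -s)) := hi.comp_neg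
  rw [e1, ← integral_Iic_add_Ioi hi.integrableOn hi.integrableOn (b := (0 : ℝ))]
  have e2 := integral_comp_neg_Ioi (0 : ℝ) (fun s => (κ s : ℂ) * v (x + s))
  rw [neg_zero] at e2
  rw [← e2, ← integral_add hi2.integrableOn hi.integrableOn]
  refine integral_congr_ae (ae_of_all _ fun s => ?_)
  simp only [hκ.odd]
  push_cast
  ring_nf

/-- The Hilbert transform (times `π`) of a Lipschitz function with compact support. -/
def hilbertLip (v : ℝ → ℂ) (x : ℝ) : ℂ := ∫ s in Ioi 0, ((s⁻¹ : ℝ) : ℂ) * (v (x + s) - v (x - s))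

lemma IsLipCpt.norm_diff_le (h : IsLipCpt R M L v) (hk : |k| ≤ |s|⁻¹)
    (x : ℝ) (hs : 0 < s) :
    ‖(k : ℂ) * (v (x + s) - v (x - s))‖ ≤ (Ioc 0 (|x| + R)).indicator (fun _ => 2 * L) s := by
  by_cases hsR : s ≤ |x| + R
  · rw [indicator_of_mem (show s ∈ Ioc 0 (|x| + R) from ⟨hs, hsR⟩), norm_mul, norm_real, norm_eq_abs]
    have h1 := h.lip (x + s) (x - s)
    rw [show x + s - (x - s) = 2 * s by ring, abs_of_pos (by linarith : 0 < 2 * s)] at h1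
    rw [abs_of_pos hs] at hk
    calc |k| * ‖v (x + s) - v (x - s)‖ ≤ s⁻¹ * (L * (2 * s)) := by gcongr
      _ = 2 * L := by field_simp
  · have h1 : v (x + s) = 0 := h.supp _ (by grind)
    have h2 : v (x - s) = 0 := h.supp _ (by grind)
    simp_all

lemma integrable_indicator_Ioc (b c : ℝ) :
    Integrable ((Ioc 0 b).indicator (fun _ => c)) (volume : Measure ℝ) :=
  (integrableOn_const (by simp)).integrable_indicator measurableSet_Ioc

lemma IsLipCpt.tendsto_odd {ι : Type*} {l : Filter ι} [l.IsCountablyGenerated]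
    (h : IsLipCpt R M L v) {κ : ι → ℝ → ℝ} (hκ : ∀ᶠ n in l, IsOddKernel (κ n))
    (hlim : ∀ s, 0 < s → Tendsto (fun n => κ n s) l (𝓝 s⁻¹)) {x : ι → ℝ} (hx : Tendsto x l (𝓝 x₀)) :
    Tendsto (fun n => ∫ y, (κ n (y - x n) : ℂ) * v y) l (𝓝 (hilbertLip v x₀)) := by
  have h1 : (fun n => ∫ y, (κ n (y - x n) : ℂ) * v y) =ᶠ[l]
      fun n => ∫ s in Ioi 0, (κ n s : ℂ) * (v (x n + s) - v (x n - s)) := by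
    filter_upwards [hκ] with n hn using hn.integral_eq h.integrable _
  refine Tendsto.congr' h1.symm ?_
  refine tendsto_integral_filter_of_dominated_convergence
    ((Ioc 0 (|x₀| + 1 + R)).indicator (fun _ => 2 * L)) ?_ ?_ ?_ ?_
  · filter_upwards [hκ] with n hn
    have := h.continuous
    have := hn.meas
    fun_prop
  · filter_upwards [hκ, hx.abs.eventually (ge_mem_nhds (show |x₀| < |x₀| + 1 by linarith))] with n hn hxn
    refine (ae_restrict_mem measurableSet_Ioi).mono fun s hs => ?_
    refine (h.norm_diff_le (hn.le s) (x n) hs).trans ?_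
    refine indicator_le_indicator_of_subset (by grind) (fun _ => ?_) s
    have := h.hL; positivity
  · exact (integrable_indicator_Ioc _ _).integrableOn
  · refine (ae_restrict_mem measurableSet_Ioi).mono fun s hs => ?_
    have hc := h.continuous
    refine ((Complex.continuous_ofReal.tendsto _).comp (hlim s hs)).mul (Tendsto.sub ?_ ?_)
    · exact (hc.tendsto _).comp (hx.add_const s)
    · exact (hc.tendsto _).comp (hx.sub_const s)

lemma IsLipCpt.exists_odd_bound (h : IsLipCpt R M L v) :
    ∃ K : ℝ, 0 ≤ K ∧ ∀ κ, IsOddKernel κ → ∀ x, ‖∫ y, (κ (y - x) : ℂ) * v y‖ ≤ K * (1 + |x|)⁻¹ := by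
  have hR := h.hR
  have hL := h.hL
  have hN : 0 ≤ ∫ y, ‖v y‖ := by positivity
  refine ⟨4 * (∫ y, ‖v y‖) + 8 * L * (3 + 2 * R) * (R + 1), by positivity, fun κ hκ x => ?_⟩
  rw [← div_eq_mul_inv, le_div_iff₀ (by positivity)]
  rcases le_total |x| (2 * R + 1) with hx | hx
  · have h1 : ‖∫ y, (κ (y - x) : ℂ) * v y‖ ≤ 2 * L * (|x| + R) := by
      rw [hκ.integral_eq h.integrable]
      refine (norm_integral_le_of_norm_le (g := (Ioc 0 (|x| + R)).indicator (fun _ => 2 * L)) ?_ ?_).trans (le_of_eq ?_)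
      · exact (integrable_indicator_Ioc _ _).integrableOn
      · exact (ae_restrict_mem measurableSet_Ioi).mono fun s hs => h.norm_diff_le (hκ.le s) x hs
      · have h0 : 0 ≤ |x| + R := by positivity
        simp [h0]
        ring
    have h2 : 2 * L * (|x| + R) * (1 + |x|) ≤ 8 * L * (3 + 2 * R) * (R + 1) := by
      have : |x| + R ≤ 4 * (R + 1) := by linarith
      have h3 : 1 + |x| ≤ 3 + 2 * R := by linarith
      calc 2 * L * (|x| + R) * (1 + |x|) ≤ 2 * L * (4 * (R + 1)) * (3 + 2 * R) := by
            gcongr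
        _ = _ := by ring
    calc _ ≤ 2 * L * (|x| + R) * (1 + |x|) := by gcongr
      _ ≤ _ := h2
      _ ≤ _ := by
        linarith
  · have h1 : ‖∫ y, (κ (y - x) : ℂ) * v y‖ ≤ (∫ y, ‖v y‖) * (4 / (1 + |x|)) := by
      rw [← integral_mul_const]
      refine norm_integral_le_of_norm_le (h.integrable.norm.mul_const _) (.of_forall fun y => ?_)
      rw [norm_mul, mul_comm, norm_real, norm_eq_abs]
      by_cases hy : v y = 0
      · simp [hy]
      have hyR : |y| ≤ R := by by_contra! hc; exact hy (h.supp y hc)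
      gcongr
      have h3 : |x| - |y| ≤ |y - x| := by grind
      have h4 : (1 + |x|) / 4 ≤ |y - x| := by linarith
      calc _ ≤ |y - x|⁻¹ := hκ.le _
        _ ≤ ((1 + |x|) / 4)⁻¹ := by gcongr
        _ = _ := by rw [inv_div]
    calc _ ≤ (∫ y, ‖v y‖) * (4 / (1 + |x|)) * (1 + |x|) := by gcongr
      _ = 4 * (∫ y, ‖v y‖) := by field_simp
      _ ≤ _ := by bound

/-- The kernel of the conjugate Poisson integral (times `π`). -/
def conjKer (t s : ℝ) : ℝ := s / (s ^ 2 + t ^ 2)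

/-- The truncated kernel of the Hilbert transform (times `π`). -/
def truncKer (ε s : ℝ) : ℝ := if ε < |s| then s⁻¹ else 0

lemma isOddKernel_conjKer (ht : t ≠ 0) : IsOddKernel (conjKer t) := by
  refine ⟨by unfold conjKer; fun_prop, fun s => by unfold conjKer; ring, fun s => ?_, |t|⁻¹, fun s => ?_⟩
  · rcases eq_or_ne s 0 with rfl | hs
    · simp [conjKer]
    have := abs_pos.2 hs
    rw [conjKer, abs_div, abs_of_pos (by positivity : 0 < s ^ 2 + t ^ 2), div_le_iff₀ (by positivity),
      ← div_eq_inv_mul, le_div_iff₀ this, ← sq, sq_abs]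
    nlinarith
  · have := abs_pos.2 ht
    rw [conjKer, abs_div, abs_of_pos (by positivity : 0 < s ^ 2 + t ^ 2), div_le_iff₀ (by positivity),
      ← div_eq_inv_mul, le_div_iff₀ this, ← sq_abs s, ← sq_abs t]
    nlinarith

lemma isOddKernel_truncKer (hε : 0 < ε) : IsOddKernel (truncKer ε) := by
  refine ⟨?_, fun s => ?_, fun s => ?_, ε⁻¹, fun s => ?_⟩
  · exact Measurable.ite (by measurability) measurable_inv measurable_const
  · unfold truncKer; grind
  · unfold truncKer; aesop
  · unfold truncKer; split_ifs with h
    · rw [abs_inv]; gcongr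
    · simp [hε.le]

lemma tendsto_conjKer (hs : 0 < s) : Tendsto (fun t => conjKer t s) (𝓝 0) (𝓝 s⁻¹) := by
  have : ContinuousAt (fun t => conjKer t s) 0 := by
    refine ContinuousAt.div (by fun_prop) (by fun_prop) (by positivity)
  have h := this.tendsto
  have e : conjKer 0 s = s⁻¹ := by unfold conjKer; field_simp; ring
  rwa [e] at h

lemma tendsto_truncKer (hs : 0 < s) : Tendsto (fun ε => truncKer ε s) (𝓝 0) (𝓝 s⁻¹) := by
  refine tendsto_const_nhds.congr' ?_
  filter_upwards [gt_mem_nhds (show 0 < |s| by positivity)] with ε hε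
  simp [truncKer, hε]

lemma abs_truncKer_sub_conjKer_le (hε : 0 < ε) (s : ℝ) :
    |truncKer ε s - conjKer ε s| ≤ ε / (s ^ 2 + ε ^ 2) := by
  have h0 : 0 < s ^ 2 + ε ^ 2 := by positivity
  unfold truncKer conjKer
  split_ifs with h
  · have hs : 0 < |s| := hε.trans h
    have e : s⁻¹ - s / (s ^ 2 + ε ^ 2) = ε ^ 2 / (s * (s ^ 2 + ε ^ 2)) := by field_simp; ring
    rw [e, abs_div, abs_mul, abs_of_pos h0, abs_of_pos (by positivity : 0 < ε ^ 2),
      div_le_div_iff₀ (by positivity) h0]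
    nlinarith [mul_pos hε h0, mul_lt_mul_of_pos_right h (mul_pos hε h0)]
  · push Not at h
    rw [zero_sub, abs_neg, abs_div, abs_of_pos h0]
    gcongr

/-- The conjugate Poisson integral (times `π`). -/
def conjP (t : ℝ) (v : ℝ → ℂ) (x : ℝ) : ℂ := ∫ y, (conjKer t (y - x) : ℂ) * v y

/-- The truncated Hilbert transform (times `π`). -/
def truncH (ε : ℝ) (v : ℝ → ℂ) (x : ℝ) : ℂ := ∫ y, (truncKer ε (y - x) : ℂ) * v y

/-- The Poisson integral (times `π`). -/
def poisP (t : ℝ) (v : ℝ → ℂ) (x : ℝ) : ℂ := ∫ y, ((t / ((y - x) ^ 2 + t ^ 2) : ℝ) : ℂ) * v y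

lemma div_ofReal_sub_cpt (y x t : ℝ) (ht : t ≠ 0) :
    1 / ((y : ℂ) - cpt x t) = (conjKer t (y - x) : ℂ) + I * ((t / ((y - x) ^ 2 + t ^ 2) : ℝ) : ℂ) := by
  have h0 : ((((y - x) ^ 2 + t ^ 2 : ℝ)) : ℂ) ≠ 0 := by exact_mod_cast (by positivity : (y - x) ^ 2 + t ^ 2 ≠ 0)
  have h1 : (y : ℂ) - cpt x t ≠ 0 := ofReal_sub_ne_zero y (by simpa)
  rw [conjKer, ofReal_div, ofReal_div, ← mul_div_assoc, ← add_div, div_eq_div_iff h1 h0, cpt]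
  push_cast
  linear_combination ((t : ℂ) ^ 2) * I_sq

lemma conjP_eq (hv : AEStronglyMeasurable v)
    (hvi : PInt v) (ht : t ≠ 0) (x : ℝ) :
    conjP t v x = (cauchyT v (cpt x t) + cauchyT v (cpt x (-t))) / 2 := by
  rw [cauchyT, cauchyT, ← integral_add (integrable_cauchyT hv hvi (by simpa)) (integrable_cauchyT hv hvi (by simpa)),
    ← integral_div, conjP]
  refine integral_congr_ae (ae_of_all _ fun y => ?_)
  have h1 := div_ofReal_sub_cpt y x t ht
  have h2 := div_ofReal_sub_cpt y x (-t) (by simpa)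
  have h3 : conjKer (-t) (y - x) = conjKer t (y - x) := by simp [conjKer]
  simp only [div_eq_mul_one_div (v y), h1, h2, h3]
  push_cast
  ring

lemma poisP_eq (hv : AEStronglyMeasurable v)
    (hvi : PInt v) (ht : t ≠ 0) (x : ℝ) :
    poisP t v x = (cauchyT v (cpt x t) - cauchyT v (cpt x (-t))) / (2 * I) := by
  rw [cauchyT, cauchyT, ← integral_sub (integrable_cauchyT hv hvi (by simpa)) (integrable_cauchyT hv hvi (by simpa)),
    ← integral_div, poisP]
  refine integral_congr_ae (ae_of_all _ fun y => ?_)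
  have h1 := div_ofReal_sub_cpt y x t ht
  have h2 := div_ofReal_sub_cpt y x (-t) (by simpa)
  have h3 : conjKer (-t) (y - x) = conjKer t (y - x) := by simp [conjKer]
  simp only [div_eq_mul_one_div (v y), h1, h2, h3]
  push_cast
  field_simp
  ring

lemma cauchyT_cpt (hv : AEStronglyMeasurable v)
    (hvi : PInt v) (ht : t ≠ 0) (x : ℝ) :
    cauchyT v (cpt x t) = conjP t v x + I * poisP t v x := by
  rw [conjP_eq hv hvi ht, poisP_eq hv hvi ht]
  field_simp
  ring

lemma poisP_neg (t : ℝ) (v : ℝ → ℂ) (x : ℝ) : poisP (-t) v x = -poisP t v x := by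
  rw [poisP, poisP, ← integral_neg]
  refine integral_congr_ae (.of_forall fun y => ?_)
  push_cast
  ring

lemma poisP_eq_scaled (ht : 0 < t) (v : ℝ → ℂ) (x : ℝ) :
    poisP t v x = ∫ s, (((1 + s ^ 2)⁻¹ : ℝ) : ℂ) * v (x + t * s) := by
  have h1 := Measure.integral_comp_div (fun s => (((1 + s ^ 2)⁻¹ : ℝ) : ℂ) * v (x + t * s)) t
  have h2 := integral_sub_right_eq_self (μ := volume) (fun y => (((1 + (y / t) ^ 2)⁻¹ : ℝ) : ℂ) * v (x + t * (y / t))) x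
  rw [h1] at h2
  rw [abs_of_pos ht] at h2
  have h3 : (t : ℂ) ≠ 0 := by aesop
  have h4 : ∫ s, (((1 + s ^ 2)⁻¹ : ℝ) : ℂ) * v (x + t * s) =
      (t : ℂ)⁻¹ * (∫ y, (((1 + ((y - x) / t) ^ 2)⁻¹ : ℝ) : ℂ) * v (x + t * ((y - x) / t))) := by simp_all
  rw [h4, poisP, ← integral_const_mul]
  refine integral_congr_ae (.of_forall fun y => ?_)
  have e : x + t * ((y - x) / t) = y := by field_simp; ring
  have e2 : t / ((y - x) ^ 2 + t ^ 2) = t⁻¹ * (1 + ((y - x) / t) ^ 2)⁻¹ := by field_simp; ring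
  simp only [e]
  rw [e2]
  push_cast
  ring

lemma IsLipCpt.tendsto_poisP {ι : Type*} {l : Filter ι} [l.IsCountablyGenerated]
    (h : IsLipCpt R M L v) {t x : ι → ℝ} (ht : Tendsto t l (𝓝[>] 0)) (hx : Tendsto x l (𝓝 x₀)) :
    Tendsto (fun n => poisP (t n) v (x n)) l (𝓝 (π * v x₀)) := by
  have ht0 : ∀ᶠ n in l, 0 < t n := ht.eventually self_mem_nhdsWithin
  have ht' : Tendsto t l (𝓝 0) := ht.mono_right nhdsWithin_le_nhds
  have h1 : (fun n => poisP (t n) v (x n)) =ᶠ[l]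
      fun n => ∫ s, (((1 + s ^ 2)⁻¹ : ℝ) : ℂ) * v (x n + t n * s) := by
    filter_upwards [ht0] with n hn using poisP_eq_scaled hn v _
  have e : (π * v x₀ : ℂ) = ∫ s, (((1 + s ^ 2)⁻¹ : ℝ) : ℂ) * v x₀ := by
    rw [integral_mul_const, ← integral_univ_inv_one_add_sq]
    congr 1
    exact integral_ofReal.symm
  rw [e]
  refine Tendsto.congr' h1.symm ?_
  have hc := h.continuous
  refine tendsto_integral_filter_of_dominated_convergence (fun s => (1 + s ^ 2)⁻¹ * M) ?_ ?_
    (integrable_inv_one_add_sq.mul_const M) ?_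
  · refine .of_forall fun n => ?_
    fun_prop
  · refine .of_forall fun n => .of_forall fun s => ?_
    rw [norm_mul, norm_real, norm_of_nonneg (by positivity)]
    gcongr
    exact h.bdd _
  · refine .of_forall fun s => Tendsto.mul tendsto_const_nhds ?_
    refine (hc.tendsto _).comp ?_
    simpa using hx.add (ht'.mul_const s)

lemma IsLipCpt.exists_poisP_bound (h : IsLipCpt R M L v) :
    ∃ K : ℝ, 0 ≤ K ∧ ∀ t, 0 < t → t ≤ 1 → ∀ x, ‖poisP t v x‖ ≤ K * (1 + |x|)⁻¹ := by
  have hR := h.hR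
  have hM := h.hM
  have hN : 0 ≤ ∫ y, ‖v y‖ := by positivity
  refine ⟨π * M * (3 + 2 * R) + 4 * (∫ y, ‖v y‖), by positivity, fun t ht ht1 x => ?_⟩
  rw [← div_eq_mul_inv, le_div_iff₀ (by positivity)]
  rcases le_total |x| (2 * R + 1) with hx | hx
  · have h1 : ‖poisP t v x‖ ≤ π * M := by
      rw [poisP_eq_scaled ht, ← integral_univ_inv_one_add_sq, ← integral_mul_const]
      refine norm_integral_le_of_norm_le (integrable_inv_one_add_sq.mul_const M) (.of_forall fun s => ?_)
      rw [norm_mul, norm_real, norm_of_nonneg (by positivity)]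
      gcongr
      exact h.bdd _
    have h3 : 1 + |x| ≤ 3 + 2 * R := by linarith
    calc _ ≤ π * M * (3 + 2 * R) := by gcongr
      _ ≤ _ := by linarith
  · have h1 : ‖poisP t v x‖ ≤ (∫ y, ‖v y‖) * (4 / (1 + |x|)) := by
      rw [← integral_mul_const]
      refine norm_integral_le_of_norm_le (h.integrable.norm.mul_const _) (.of_forall fun y => ?_)
      rw [norm_mul, mul_comm, norm_real, norm_eq_abs]
      by_cases hy : v y = 0
      · simp [hy]
      have hyR : |y| ≤ R := by by_contra! hc; exact hy (h.supp y hc)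
      gcongr
      have h3 : |x| - |y| ≤ |y - x| := by grind
      rw [abs_of_nonneg (by positivity), div_le_div_iff₀ (by positivity) (by positivity), ← sq_abs (y - x)]
      nlinarith
    calc _ ≤ (∫ y, ‖v y‖) * (4 / (1 + |x|)) * (1 + |x|) := by gcongr
      _ = 4 * (∫ y, ‖v y‖) := by field_simp
      _ ≤ _ := by bound

/-- Boundary behaviour of the Cauchy transform of a smooth function. -/
lemma IsLipCpt.tendsto_cauchyT (h : IsLipCpt R M L v) (x₀ : ℝ) :
    Tendsto (cauchyT v) (𝓝[{z | 0 < z.im}] (x₀ : ℂ)) (𝓝 (hilbertLip v x₀ + I * (π * v x₀))) := by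
  have hre : Tendsto re (𝓝[{z | 0 < z.im}] (x₀ : ℂ)) (𝓝 x₀) :=
    (Complex.continuous_re.tendsto' (x₀ : ℂ) x₀ (by simp)).mono_left nhdsWithin_le_nhds
  have him : Tendsto im (𝓝[{z | 0 < z.im}] (x₀ : ℂ)) (𝓝 0) :=
    (Complex.continuous_im.tendsto' (x₀ : ℂ) 0 (by simp)).mono_left nhdsWithin_le_nhds
  have hpos : ∀ᶠ z in 𝓝[{z | 0 < z.im}] (x₀ : ℂ), 0 < z.im := self_mem_nhdsWithin
  have him' : Tendsto im (𝓝[{z | 0 < z.im}] (x₀ : ℂ)) (𝓝[>] 0) :=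
    tendsto_nhdsWithin_iff.2 ⟨him, hpos⟩
  have h1 := h.tendsto_odd (by filter_upwards [hpos] with z hz using isOddKernel_conjKer hz.ne')
    (fun s hs => (tendsto_conjKer hs).comp him) hre
  have h2 := h.tendsto_poisP him' hre
  refine (h1.add (h2.const_mul I)).congr' ?_
  filter_upwards [hpos] with z hz
  have e : z = cpt z.re z.im := by apply Complex.ext <;> simp
  conv_rhs => rw [e, cauchyT_cpt h.meas (Integrable.div_one_add_abs h.integrable) hz.ne']
  rfl

include hpq in
lemma exists_isLipCpt_eLpNorm_sub_le
    (hv : MemLp v 𝔭) {ε : ℝ≥0∞} (hε : ε ≠ 0) :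
    ∃ g R M L, IsLipCpt R M L g ∧ eLpNorm (v - g) 𝔭 ≤ ε := by
  obtain ⟨δ, hδ0, hδ⟩ : ∃ δ, 0 < δ ∧ ofReal δ ≤ ε := by
    rcases eq_or_ne ε ⊤ with rfl | h
    · exact ⟨1, one_pos, le_top⟩
    · exact ⟨ε.toReal, toReal_pos hε h, by simp_all⟩
  obtain ⟨g, h1, h2, h3⟩ := hv.exist_eLpNorm_sub_le ofReal_ne_top (one_le_ofReal hpq) hδ0
  obtain ⟨R, M, L, h⟩ := exists_isLipCpt h1 (h2.of_le (by simp))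
  grind

lemma aestronglyMeasurable_integral_kernel {κ : ℝ → ℂ} (hκ : Measurable κ)
    (hv : AEStronglyMeasurable v) :
    AEStronglyMeasurable (fun x => ∫ y, κ (y - x) * v y) := by
  have h1 : AEStronglyMeasurable (fun z => κ (z.2 - z.1) * v z.2) (volume.prod volume) :=
    AEStronglyMeasurable.mul (hκ.comp (by fun_prop)).aestronglyMeasurable hv.comp_snd
  exact h1.integral_prod_right'

lemma IsOddKernel.integrable' (hκ : IsOddKernel κ)
    (hv : AEStronglyMeasurable v) (hvi : PInt v) (x : ℝ) :
    Integrable (fun y => (κ (y - x) : ℂ) * v y) := by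
  obtain ⟨B, hB⟩ := hκ.bdd
  refine (hvi.const_mul ((B + 1) * (1 + |x|))).mono' ?_ (.of_forall fun y => ?_)
  · have := hκ.meas
    exact (Measurable.aestronglyMeasurable (by fun_prop)).mul hv
  rw [norm_mul, norm_real, norm_eq_abs, ← mul_div_assoc, le_div_iff₀ (by positivity)]
  have h1 : |κ (y - x)| * (1 + |y - x|) ≤ B + 1 := by
    have h2 : |κ (y - x)| * |y - x| ≤ 1 := by
      calc _ ≤ |y - x|⁻¹ * |y - x| := by gcongr; exact hκ.le _
        _ ≤ 1 := inv_mul_le_one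
    grind
  have h3 : 1 + |y| ≤ (1 + |x|) * (1 + |y - x|) := by
    have : |y| ≤ |y - x| + |x| := by grind
    nlinarith [abs_nonneg x, abs_nonneg (y - x)]
  calc |κ (y - x)| * ‖v y‖ * (1 + |y|) ≤ |κ (y - x)| * ‖v y‖ * ((1 + |x|) * (1 + |y - x|)) := by gcongr
    _ = |κ (y - x)| * (1 + |y - x|) * ((1 + |x|) * ‖v y‖) := by ring
    _ ≤ (B + 1) * ((1 + |x|) * ‖v y‖) := by gcongr
    _ = _ := by ring

lemma IsOddKernel.integral_sub (hκ : IsOddKernel κ) (hpq : p.HolderConjugate q)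
    (hv : MemLp v 𝔭) (hw : MemLp w 𝔭) (x : ℝ) :
    ∫ y, (κ (y - x) : ℂ) * (v - w) y = (∫ y, (κ (y - x) : ℂ) * v y) - ∫ y, (κ (y - x) : ℂ) * w y := by
  rw [← MeasureTheory.integral_sub (hκ.integrable' hv.1 (MemLp.integrable_div_one_add_abs hpq hv) x)
    (hκ.integrable' hw.1 (MemLp.integrable_div_one_add_abs hpq hw) x)]
  simp [mul_sub]

lemma lintegral_decay_ne_top (hp : 1 < p) (K : ℝ) :
    ∫⁻ x : ℝ, ofReal (K * (1 + |x|)⁻¹) ^ p ≠ ⊤ := by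
  have h := (memLp_inv_one_add_abs hp).const_mul K
  have hp0 : 0 < p := by linarith
  have h2 := lintegral_rpow_enorm_lt_top_of_eLpNorm_lt_top (by simpa using hp0) ofReal_ne_top h.2
  rw [toReal_ofReal hp0.le] at h2
  refine ne_top_of_le_ne_top h2.ne (lintegral_mono fun x => rpow_le_rpow ?_ hp0.le)
  rw [← ofReal_norm]
  exact ofReal_le_ofReal (Real.le_norm_self _)

lemma IsLipCpt.norm_hilbertLip_le (h : IsLipCpt R M L v) {K : ℝ}
    (hK : ∀ κ, IsOddKernel κ → ∀ x, ‖∫ y, (κ (y - x) : ℂ) * v y‖ ≤ K * (1 + |x|)⁻¹) (x : ℝ) :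
    ‖hilbertLip v x‖ ≤ K * (1 + |x|)⁻¹ := by
  have := h.tendsto_odd (l := 𝓝[>] (0 : ℝ))
    (by filter_upwards [self_mem_nhdsWithin] with t ht using isOddKernel_conjKer (ne_of_gt ht))
    (fun s hs => (tendsto_conjKer hs).mono_left nhdsWithin_le_nhds) (tendsto_const_nhds (x := x))
  refine le_of_tendsto this.norm ?_
  filter_upwards [self_mem_nhdsWithin] with t ht using hK _ (isOddKernel_conjKer (ne_of_gt ht)) x

lemma IsLipCpt.aestronglyMeasurable_hilbertLip (h : IsLipCpt R M L v) :
    AEStronglyMeasurable (hilbertLip v) := by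
  refine aestronglyMeasurable_of_tendsto_ae (𝓝[>] 0) (f := fun t x => ∫ y, (conjKer t (y - x) : ℂ) * v y) (fun t => ?_)
    (.of_forall fun x => h.tendsto_odd
    (by filter_upwards [self_mem_nhdsWithin] with t ht using isOddKernel_conjKer (ne_of_gt ht))
    (fun s hs => (tendsto_conjKer hs).mono_left nhdsWithin_le_nhds) (by simp))
  exact aestronglyMeasurable_integral_kernel (κ := fun s => (conjKer t s : ℂ)) (by unfold conjKer; fun_prop) h.meas

lemma IsLipCpt.memLp_hilbertLip (h : IsLipCpt R M L v) (hp : 1 < p) :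
    MemLp (hilbertLip v) 𝔭 := by
  obtain ⟨K, hK0, hK⟩ := h.exists_odd_bound
  refine ((memLp_inv_one_add_abs hp).const_mul K).mono h.aestronglyMeasurable_hilbertLip
    (.of_forall fun x => ?_)
  exact (h.norm_hilbertLip_le hK x).trans (Real.le_norm_self _)

lemma IsLipCpt.tendsto_eLpNorm_odd (h : IsLipCpt R M L v) (hp : 1 < p)
    {κ : ℝ → ℝ → ℝ} (hκ : ∀ t, 0 < t → IsOddKernel (κ t))
    (hlim : ∀ s, 0 < s → Tendsto (fun t => κ t s) (𝓝 0) (𝓝 s⁻¹)) :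
    Tendsto (fun t => eLpNorm ((fun x => ∫ y, (κ t (y - x) : ℂ) * v y) - hilbertLip v) 𝔭)
      (𝓝[>] 0) (𝓝 0) := by
  obtain ⟨K, hK0, hK⟩ := h.exists_odd_bound
  have hpos : ∀ᶠ t : ℝ in 𝓝[>] 0, 0 < t := self_mem_nhdsWithin
  refine tendsto_eLpNorm_of_dominated (by linarith) (g := fun x => ofReal (2 * K * (1 + |x|)⁻¹)) ?_
    (lintegral_decay_ne_top hp (2 * K)) ?_ ?_
  · filter_upwards [hpos] with t ht
    have := (hκ t ht).meas
    exact (aestronglyMeasurable_integral_kernel (κ := fun s => (κ t s : ℂ)) (by fun_prop) h.meas).sub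
      h.aestronglyMeasurable_hilbertLip
  · filter_upwards [hpos] with t ht
    refine .of_forall fun x => ?_
    rw [← ofReal_norm]
    refine ofReal_le_ofReal ((norm_sub_le _ _).trans ?_)
    have h1 := hK _ (hκ t ht) x
    have h2 := h.norm_hilbertLip_le hK x
    linarith
  · refine ae_of_all _ fun x => ?_
    have := h.tendsto_odd (l := 𝓝[>] (0 : ℝ)) (κ := κ)
      (by filter_upwards [hpos] with t ht using hκ t ht)
      (fun s hs => (hlim s hs).mono_left nhdsWithin_le_nhds) (tendsto_const_nhds (x := x))
    simpa using this.sub_const (hilbertLip v x)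

include hpq in
lemma exists_conjP_bound : ∃ C : ℝ≥0, ∀ v : ℝ → ℂ,
    MemLp v 𝔭 → ∀ t : ℝ, t ≠ 0 → MemLp (conjP t v) 𝔭 ∧
      eLpNorm (conjP t v) 𝔭 ≤ C * eLpNorm v 𝔭 := by
  obtain ⟨C, hC⟩ := riesz hpq
  refine ⟨C, fun v hv t ht => ?_⟩
  have e : conjP t v = (2 : ℂ)⁻¹ • ((fun x => cauchyT v (cpt x t)) + (fun x => cauchyT v (cpt x (-t)))) := by
    ext x
    rw [conjP_eq hv.1 (MemLp.integrable_div_one_add_abs hpq hv) ht]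
    simp [div_eq_inv_mul]
  obtain ⟨a1, a2⟩ := hC v hv t ht
  obtain ⟨b1, b2⟩ := hC v hv (-t) (by simpa)
  rw [e]
  refine ⟨(a1.add b1).const_smul _, ?_⟩
  rw [eLpNorm_const_smul]
  calc _ ≤ ‖(2 : ℂ)⁻¹‖ₑ * (C * eLpNorm v 𝔭 + C * eLpNorm v 𝔭) := by
        gcongr
        exact (eLpNorm_add_le a1.1 b1.1 (one_le_ofReal hpq)).trans (add_le_add a2 b2)
    _ = (‖(2 : ℂ)⁻¹‖ₑ * 2) * (C * eLpNorm v 𝔭) := by ring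
    _ = _ := by
        have : ‖(2 : ℂ)⁻¹‖ₑ = 2⁻¹ := by
          rw [enorm_inv (by norm_num), ← ofReal_norm]; simp
        rw [this, ENNReal.inv_mul_cancel (by simp) (by simp), one_mul]

include hpq in
lemma tendsto_truncH_sub_conjP
    (hv : MemLp v 𝔭) :
    Tendsto (fun ε => eLpNorm (truncH ε v - conjP ε v) 𝔭) (𝓝[>] 0) (𝓝 0) := by
  have hpos : ∀ᶠ t : ℝ in 𝓝[>] 0, 0 < t := self_mem_nhdsWithin
  refine tendsto_zero_of_dense (T := fun ε v => truncH ε v - conjP ε v) (C := Real.pi.toNNReal)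
    (one_le_ofReal hpq) ?_ ?_ ?_ hv
  · filter_upwards [hpos] with t ht v w hv hw
    refine ae_of_all _ fun x => ?_
    simp only [Pi.sub_apply, truncH, conjP]
    have h1 := (isOddKernel_truncKer ht).integral_sub hpq hv hw x
    have h2 := (isOddKernel_conjKer ht.ne').integral_sub hpq hv hw x
    simp only [Pi.sub_apply] at h1 h2
    grind
  · filter_upwards [hpos] with t ht v hv
    have hm : AEStronglyMeasurable (truncH t v - conjP t v) :=
      (aestronglyMeasurable_integral_kernel (κ := fun s => (truncKer t s : ℂ))
        (by have := (isOddKernel_truncKer ht).meas; fun_prop) hv.1).sub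
      (aestronglyMeasurable_integral_kernel (κ := fun s => (conjKer t s : ℂ))
        (by have := (isOddKernel_conjKer ht.ne').meas; fun_prop) hv.1)
    have hb : eLpNorm (truncH t v - conjP t v) 𝔭 ≤
        ofReal π * eLpNorm v 𝔭 := by
      refine eLpNorm_le_of_le_poisson hpq ht.ne' hv.1 (ae_of_all _ fun x => ?_)
      have hvi := MemLp.integrable_div_one_add_abs hpq hv
      rw [Pi.sub_apply, truncH, conjP, ← MeasureTheory.integral_sub ((isOddKernel_truncKer ht).integrable' hv.1 hvi x)
        ((isOddKernel_conjKer ht.ne').integrable' hv.1 hvi x)]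
      refine (enorm_integral_le_lintegral_enorm _).trans (lintegral_mono fun y => ?_)
      rw [← sub_mul, enorm_mul, ← ofReal_sub]
      gcongr
      rw [← ofReal_norm, norm_real, norm_eq_abs, abs_of_pos ht]
      exact ofReal_le_ofReal (abs_truncKer_sub_conjKer_le ht _)
    exact ⟨⟨hm, hb.trans_lt (mul_lt_top ofReal_lt_top hv.2)⟩, hb⟩
  · intro v hv ε hε
    obtain ⟨g, R, M, L, hg, hvg⟩ := exists_isLipCpt_eLpNorm_sub_le hpq hv hε
    refine ⟨g, hg.memLp _, hvg, ?_⟩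
    have h1 := hg.tendsto_eLpNorm_odd hpq.lt (fun t => isOddKernel_truncKer) (fun s => tendsto_truncKer)
    have h2 := hg.tendsto_eLpNorm_odd hpq.lt (fun t ht => isOddKernel_conjKer ht.ne') (fun s => tendsto_conjKer)
    have h3 := h1.add h2
    rw [add_zero] at h3
    refine tendsto_zero_of_le h3 ?_
    filter_upwards [hpos] with t ht
    have e : truncH t g - conjP t g = (truncH t g - hilbertLip g) - (conjP t g - hilbertLip g) := by abel
    rw [e]
    refine eLpNorm_sub_le ?_ ?_ (one_le_ofReal hpq)
    · exact (aestronglyMeasurable_integral_kernel (κ := fun s => (truncKer t s : ℂ))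
        (by have := (isOddKernel_truncKer ht).meas; fun_prop) hg.meas).sub hg.aestronglyMeasurable_hilbertLip
    · exact (aestronglyMeasurable_integral_kernel (κ := fun s => (conjKer t s : ℂ))
        (by have := (isOddKernel_conjKer ht.ne').meas; fun_prop) hg.meas).sub hg.aestronglyMeasurable_hilbertLip

include hpq in
/-- Existence of the Hilbert transform in `L_p`. -/
lemma exists_tendsto_conjP
    (hv : MemLp v 𝔭) :
    ∃ H, MemLp H 𝔭 ∧
      Tendsto (fun t => eLpNorm (conjP t v - H) 𝔭) (𝓝[>] 0) (𝓝 0) := by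
  have hpos : ∀ᶠ t : ℝ in 𝓝[>] 0, 0 < t := self_mem_nhdsWithin
  obtain ⟨C, hC⟩ := exists_conjP_bound hpq
  refine exists_tendsto_of_dense (C := C) (one_le_ofReal hpq) ?_ ?_ ?_ hv
  · filter_upwards [hpos] with t ht v w hv hw
    exact ae_of_all _ fun x => (isOddKernel_conjKer ht.ne').integral_sub hpq hv hw x
  · filter_upwards [hpos] with t ht v hv using hC v hv t ht.ne'
  · intro v hv ε hε
    obtain ⟨g, R, M, L, hg, hvg⟩ := exists_isLipCpt_eLpNorm_sub_le hpq hv hε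
    exact ⟨g, hg.memLp _, hvg, hilbertLip g, hg.memLp_hilbertLip hpq.lt,
      hg.tendsto_eLpNorm_odd hpq.lt (fun t ht => isOddKernel_conjKer ht.ne') (fun s => tendsto_conjKer)⟩

lemma integrable_poisP (hv : AEStronglyMeasurable v)
    (hvi : PInt v) (ht : t ≠ 0) (x : ℝ) :
    Integrable (fun y => ((t / ((y - x) ^ 2 + t ^ 2) : ℝ) : ℂ) * v y) := by
  have h := ((integrable_cauchyT hv hvi (w := cpt x t) (by simpa)).sub
    (integrable_cauchyT hv hvi (w := cpt x (-t)) (by simpa))).div_const (2 * I)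
  refine h.congr (ae_of_all _ fun y => ?_)
  have h1 := div_ofReal_sub_cpt y x t ht
  have h2 := div_ofReal_sub_cpt y x (-t) (by simpa)
  have h3 : conjKer (-t) (y - x) = conjKer t (y - x) := by simp [conjKer]
  simp only [Pi.sub_apply, div_eq_mul_one_div (v y), h1, h2, h3]
  push_cast
  field_simp
  ring

include hpq in
/-- The Poisson integrals converge in `L_p`. -/
lemma tendsto_poisP
    (hv : MemLp v 𝔭) :
    Tendsto (fun t => eLpNorm (poisP t v - (π : ℂ) • v) 𝔭) (𝓝[>] 0) (𝓝 0) := by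
  have hpos : ∀ᶠ t : ℝ in 𝓝[>] 0, 0 < t := self_mem_nhdsWithin
  have hmeas : ∀ (t : ℝ) {w : ℝ → ℂ}, AEStronglyMeasurable w → AEStronglyMeasurable (poisP t w) := fun t w hw =>
    aestronglyMeasurable_integral_kernel (κ := fun s => ((t / (s ^ 2 + t ^ 2) : ℝ) : ℂ)) (by fun_prop) hw
  refine tendsto_zero_of_dense (T := fun t v => poisP t v - (π : ℂ) • v) (C := 2 * Real.pi.toNNReal)
    (one_le_ofReal hpq) ?_ ?_ ?_ hv
  · filter_upwards [hpos] with t ht v w hv hw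
    refine ae_of_all _ fun x => ?_
    have : poisP t (v - w) x = poisP t v x - poisP t w x := by
      rw [poisP, poisP, poisP, ← MeasureTheory.integral_sub
        (integrable_poisP hv.1 (MemLp.integrable_div_one_add_abs hpq hv) ht.ne' x)
        (integrable_poisP hw.1 (MemLp.integrable_div_one_add_abs hpq hw) ht.ne' x)]
      simp [mul_sub]
    simp only [Pi.sub_apply, Pi.smul_apply, this, smul_eq_mul]
    ring
  · filter_upwards [hpos] with t ht v hv
    have hb : eLpNorm (poisP t v) 𝔭 ≤
        ofReal π * eLpNorm v 𝔭 := by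
      refine eLpNorm_le_of_le_poisson hpq ht.ne' hv.1 (ae_of_all _ fun x => ?_)
      refine (enorm_integral_le_lintegral_enorm _).trans (lintegral_mono fun y => ?_)
      rw [enorm_mul]
      rw [← ofReal_norm, norm_real, norm_eq_abs, abs_of_nonneg (by positivity), abs_of_pos ht]
    have h1 : MemLp (poisP t v) 𝔭 :=
      ⟨hmeas t hv.1, hb.trans_lt (mul_lt_top ofReal_lt_top hv.2)⟩
    refine ⟨h1.sub (hv.const_smul _), (eLpNorm_sub_le h1.1 (hv.const_smul _).1 (one_le_ofReal hpq)).trans ?_⟩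
    rw [eLpNorm_const_smul]
    refine (add_le_add_left hb _).trans (le_of_eq ?_)
    rw [← ofReal_norm, norm_real, norm_of_nonneg Real.pi_pos.le]
    push_cast
    rw [ofReal]
    ring
  · intro v hv ε hε
    obtain ⟨g, R, M, L, hg, hvg⟩ := exists_isLipCpt_eLpNorm_sub_le hpq hv hε
    refine ⟨g, hg.memLp _, hvg, ?_⟩
    obtain ⟨K, hK0, hK⟩ := hg.exists_poisP_bound
    have hK' : ∀ x, ‖(π : ℂ) * g x‖ ≤ K * (1 + |x|)⁻¹ := fun x => by
      refine le_of_tendsto (hg.tendsto_poisP (l := 𝓝[>] (0 : ℝ)) tendsto_id (tendsto_const_nhds (x := x))).norm ?_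
      filter_upwards [hpos, nhdsWithin_le_nhds (ge_mem_nhds one_pos)] with t ht ht1 using hK t ht ht1 x
    refine tendsto_eLpNorm_of_dominated hpq.pos (g := fun x => ofReal (2 * K * (1 + |x|)⁻¹)) ?_
      (lintegral_decay_ne_top hpq.lt (2 * K)) ?_ ?_
    · exact Eventually.of_forall fun t => (hmeas t hg.meas).sub (hg.meas.const_smul _)
    · filter_upwards [hpos, nhdsWithin_le_nhds (ge_mem_nhds one_pos)] with t ht ht1
      refine .of_forall fun x => ?_
      rw [← ofReal_norm]
      refine ofReal_le_ofReal ((norm_sub_le _ _).trans ?_)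
      have h1 := hK t ht ht1 x
      have h2 := hK' x
      simp only [Pi.smul_apply, smul_eq_mul]
      linarith
    · refine ae_of_all _ fun x => ?_
      have := hg.tendsto_poisP (l := 𝓝[>] (0 : ℝ)) tendsto_id (tendsto_const_nhds (x := x))
      simpa using this.sub_const ((π : ℂ) * g x)

include hpq in
/-- Boundary values of Cauchy transforms in `L_p`. -/
lemma tendsto_cauchyT_sub
    (hv : MemLp v 𝔭) (hH : MemLp H 𝔭)
    (h : Tendsto (fun t => eLpNorm (conjP t v - H) 𝔭) (𝓝[>] 0) (𝓝 0))
    (hσ : σ = 1 ∨ σ = -1) :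
    Tendsto (fun t => eLpNorm (fun x => cauchyT v (cpt x (σ * t)) - (H x + σ * I * π * v x))
      𝔭) (𝓝[>] 0) (𝓝 0) := by
  have hpos : ∀ᶠ t : ℝ in 𝓝[>] 0, 0 < t := self_mem_nhdsWithin
  have h2 := tendsto_poisP hpq hv
  have h3 := h.add h2
  rw [add_zero] at h3
  refine tendsto_zero_of_le h3 ?_
  filter_upwards [hpos] with t ht
  have hvi := MemLp.integrable_div_one_add_abs hpq hv
  have e : (fun x => cauchyT v (cpt x (σ * t)) - (H x + σ * I * π * v x)) =
      (conjP t v - H) + ((σ : ℂ) * I) • (poisP t v - (π : ℂ) • v) := by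
    ext x
    simp only [Pi.add_apply, Pi.sub_apply, Pi.smul_apply, smul_eq_mul]
    rcases hσ with rfl | rfl
    · rw [one_mul, cauchyT_cpt hv.1 hvi ht.ne']; push_cast; ring
    · have hc : conjP (-t) v x = conjP t v x := by simp [conjP, conjKer]
      rw [neg_one_mul, cauchyT_cpt hv.1 hvi (neg_ne_zero.2 ht.ne'), poisP_neg, hc]; push_cast; ring
  have hn : ‖(σ : ℂ) * I‖ₑ = 1 := by
    rw [← ofReal_norm]; bound
  obtain ⟨C, hC⟩ := exists_conjP_bound hpq
  rw [e]
  refine (eLpNorm_add_le ((hC v hv t ht.ne').1.1.sub hH.1) (AEStronglyMeasurable.const_smul (AEStronglyMeasurable.sub ?_ (hv.1.const_smul _)) _) (one_le_ofReal hpq)).trans ?_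
  · exact aestronglyMeasurable_integral_kernel (κ := fun s => ((t / (s ^ 2 + t ^ 2) : ℝ) : ℂ)) (by fun_prop) hv.1
  · rw [eLpNorm_const_smul, hn, one_mul]

/-- Lebesgue measure on the half line `y > 0`. -/
abbrev halfVol : Measure ℝ := volume.restrict (Ioi 0)

lemma ae_halfVol_pos : ∀ᵐ y ∂halfVol, 0 < y := ae_restrict_mem measurableSet_Ioi

lemma integrable_rpow_mul_one_add_rpow (ha : -1 < a) (hab : a + b < -1) :
    Integrable (fun y : ℝ => y ^ a * (1 + y) ^ b) halfVol := by
  have hm : ∀ s, AEStronglyMeasurable (fun y : ℝ => y ^ a * (1 + y) ^ b) (volume.restrict s) := fun s => by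
    fun_prop
  have key : ∀ y : ℝ, 0 < y → ∀ m : ℝ, 0 < m → m ≤ 1 + y → 1 + y ≤ 2 * m →
      (1 + y) ^ b ≤ 2 ^ |b| * m ^ b := by
    intro y hy m hm h1 h2
    rcases le_total 0 b with hb | hb
    · linarith
    · calc (1 + y) ^ b ≤ m ^ b := rpow_le_rpow_of_nonpos hm h1 hb
        _ ≤ _ := le_mul_of_one_le_left (by positivity) (Real.one_le_rpow (by norm_num) (abs_nonneg b))
  have e : Ioi (0 : ℝ) = Ioc 0 1 ∪ Ioi 1 := by simp
  rw [halfVol, e]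
  refine IntegrableOn.union ?_ ?_
  · have h1 : IntegrableOn (fun y : ℝ => 2 ^ |b| * y ^ a) (Ioc 0 1) := by
      have := (intervalIntegrable_rpow' (a := 0) (b := 1) ha).const_mul (2 ^ |b|)
      rwa [intervalIntegrable_iff_integrableOn_Ioc_of_le zero_le_one] at this
    refine h1.mono' (hm _) ((ae_restrict_mem measurableSet_Ioc).mono fun y hy => ?_)
    have hy0 := hy.1
    have hy1 := hy.2
    rw [norm_of_nonneg (by positivity), mul_comm]
    gcongr
    simpa using key y hy0 1 one_pos (by linarith) (by linarith)
  · have h1 : IntegrableOn (fun y : ℝ => 2 ^ |b| * y ^ (a + b)) (Ioi 1) :=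
      (integrableOn_Ioi_rpow_of_lt hab one_pos).const_mul _
    refine h1.mono' (hm _) ((ae_restrict_mem measurableSet_Ioi).mono fun y hy => ?_)
    have hy1 : 1 < y := hy
    have hy0 : 0 < y := by linarith
    rw [norm_of_nonneg (by positivity), rpow_add hy0]
    calc y ^ a * (1 + y) ^ b ≤ y ^ a * (2 ^ |b| * y ^ b) := by bound
      _ = _ := by ring

/-- The integrals in Schur's test for homogeneous kernels. -/
lemma lintegral_homogeneous (ha : -1 < a) (hab : a + b < -1) :
    ∃ c : ℝ≥0, ∀ x : ℝ, 0 < x →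
      ∫⁻ y, ofReal (y ^ a * (x + y) ^ b) ∂halfVol = c * ofReal (x ^ (a + b + 1)) := by
  have hi := integrable_rpow_mul_one_add_rpow ha hab
  refine ⟨(∫ y, y ^ a * (1 + y) ^ b ∂halfVol).toNNReal, fun x hx => ?_⟩
  have hpt : ∀ s, 0 < s → (x * s) ^ a * (x + x * s) ^ b = x ^ (a + b) * (s ^ a * (1 + s) ^ b) := by
    intro s hs
    rw [show x + x * s = x * (1 + s) by ring, mul_rpow hx.le hs.le, mul_rpow hx.le (by linarith),
      rpow_add hx]
    ring
  have hi2 : IntegrableOn (fun y => y ^ a * (x + y) ^ b) (Ioi 0) := by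
    rw [← mul_zero x, ← integrableOn_Ioi_comp_mul_left_iff _ _ hx]
    refine (hi.const_mul (x ^ (a + b))).congr (ae_halfVol_pos.mono fun s hs => ?_)
    simp_all
  have hnn : ∀ᵐ y ∂halfVol, 0 ≤ y ^ a * (x + y) ^ b := ae_halfVol_pos.mono fun y hy => by positivity
  rw [← ofReal_integral_eq_lintegral_ofReal hi2 hnn]
  have h1 := integral_comp_mul_left_Ioi (fun y => y ^ a * (x + y) ^ b) 0 hx
  have h2 : ∫ s in Ioi 0, (x * s) ^ a * (x + x * s) ^ b = x ^ (a + b) * ∫ y, y ^ a * (1 + y) ^ b ∂halfVol := by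
    rw [← integral_const_mul]
    exact setIntegral_congr_fun measurableSet_Ioi fun s hs => hpt s hs
  rw [h2, smul_eq_mul] at h1
  have h3 : ∫ y, y ^ a * (x + y) ^ b ∂halfVol = (∫ y, y ^ a * (1 + y) ^ b ∂halfVol) * x ^ (a + b + 1) := by
    rw [rpow_add hx, Real.rpow_one]
    grind
  rw [h3, ofReal_mul]
  · rfl
  · exact integral_nonneg_of_ae (ae_halfVol_pos.mono fun y hy => by positivity)

/-- The homogeneous kernel `y^{-a} x^{-b} (x + y)^{a + b - 1}`. -/
def homKer (a b x y : ℝ) : ℝ := y ^ (-a) * x ^ (-b) * (x + y) ^ (a + b - 1)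

lemma measurable_homKer (a b : ℝ) : Measurable (fun z : ℝ × ℝ => homKer a b z.1 z.2) := by
  unfold homKer; fun_prop

include hpq in
lemma exists_schur_homKer
    (ha' : a < 1 / q) (hb' : b < 1 / p) :
    ∃ C : ℝ≥0, (∀ f : ℝ → ℂ, AEStronglyMeasurable f halfVol → ∀ g : ℝ → ℂ,
      (∀ᵐ x ∂halfVol, ‖g x‖ₑ ≤ ∫⁻ y, ofReal (homKer a b x y) * ‖f y‖ₑ ∂halfVol) →
      eLpNorm g 𝔭 halfVol ≤ C * eLpNorm f 𝔭 halfVol) ∧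
      (∀ f : ℝ → ℂ, AEStronglyMeasurable f halfVol →
        ∫⁻ x, (∫⁻ y, ofReal (homKer a b x y) * ‖f y‖ₑ ∂halfVol) ^ p ∂halfVol ≤
          C * ∫⁻ y, ‖f y‖ₑ ^ p ∂halfVol) := by
  have hp := hpq.pos
  have hq := hpq.symm.pos
  have hsum : 1 / p + 1 / q = 1 := by rw [one_div, one_div]; exact hpq.inv_add_inv_eq_one
  obtain ⟨A, hA⟩ := lintegral_homogeneous (a := -a - 1 / p) (b := a + b - 1) (by linarith) (by linarith)
  obtain ⟨B, hB⟩ := lintegral_homogeneous (a := -b - 1 / q) (b := a + b - 1) (by linarith) (by linarith)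
  set w : ℝ → ℝ≥0∞ := fun y => ofReal (y ^ (-(1 / (p * q)))) with hw
  have hN : Measurable (Function.uncurry fun x y => ofReal (homKer a b x y)) :=
    (measurable_homKer a b).ennreal_ofReal
  have hwm : Measurable w := by fun_prop
  have hw0 : ∀ᵐ y ∂halfVol, w y ≠ 0 ∧ w y ≠ ⊤ := ae_halfVol_pos.mono fun y hy => by
    have : 0 < y ^ (-(1 / (p * q))) := by positivity
    simpa [hw] using this
  have hwq : ∀ y, 0 < y → w y ^ q = ofReal (y ^ (-(1 / p))) := fun y hy => by
    rw [ofReal_rpow_of_nonneg (by positivity) hq.le, ← Real.rpow_mul hy.le]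
    grind
  have hwp : ∀ y, 0 < y → w y ^ p = ofReal (y ^ (-(1 / q))) := fun y hy => by
    rw [ofReal_rpow_of_nonneg (by positivity) hp.le, ← Real.rpow_mul hy.le]
    grind
  have h1 : ∀ᵐ x ∂halfVol, ∫⁻ y, ofReal (homKer a b x y) * w y ^ q ∂halfVol ≤ A * w x ^ q := by
    refine ae_halfVol_pos.mono fun x hx => ?_
    have e : ∫⁻ y, ofReal (homKer a b x y) * w y ^ q ∂halfVol =
        ofReal (x ^ (-b)) * ∫⁻ y, ofReal (y ^ (-a - 1 / p) * (x + y) ^ (a + b - 1)) ∂halfVol := by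
      rw [← lintegral_const_mul' _ _ ofReal_ne_top]
      refine lintegral_congr_ae (ae_halfVol_pos.mono fun y hy => ?_)
      simp only []
      rw [hwq y hy, ← ofReal_mul (by unfold homKer; positivity), ← ofReal_mul (by positivity), homKer]
      rw [sub_eq_add_neg (-a), rpow_add hy]
      ring
    rw [e, hA x hx, mul_left_comm, ← ofReal_mul (by positivity), ← rpow_add hx]
    grind
  have h2 : ∀ᵐ y ∂halfVol, ∫⁻ x, ofReal (homKer a b x y) * w x ^ p ∂halfVol ≤ B * w y ^ p := by
    refine ae_halfVol_pos.mono fun y hy => ?_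
    have e : ∫⁻ x, ofReal (homKer a b x y) * w x ^ p ∂halfVol =
        ofReal (y ^ (-a)) * ∫⁻ x, ofReal (x ^ (-b - 1 / q) * (y + x) ^ (a + b - 1)) ∂halfVol := by
      rw [← lintegral_const_mul' _ _ ofReal_ne_top]
      refine lintegral_congr_ae (ae_halfVol_pos.mono fun x hx => ?_)
      simp only []
      rw [hwp x hx, ← ofReal_mul (by unfold homKer; positivity), ← ofReal_mul (by positivity), homKer]
      rw [sub_eq_add_neg (-b), rpow_add hx, add_comm y x]
      ring
    rw [e, hB y hy, mul_left_comm, ← ofReal_mul (by positivity), ← rpow_add hy]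
    grind
  have hA1 : A ^ (1 / q) = ((A ^ (1 / q) : ℝ≥0) : ℝ≥0∞) := (coe_rpow_of_nonneg _ (by positivity)).symm
  have hB1 : B ^ (1 / p) = ((B ^ (1 / p) : ℝ≥0) : ℝ≥0∞) := (coe_rpow_of_nonneg _ (by positivity)).symm
  have hA2 : A ^ (p / q) = ((A ^ (p / q) : ℝ≥0) : ℝ≥0∞) := (coe_rpow_of_nonneg _ (by positivity)).symm
  refine ⟨A ^ (1 / q) * B ^ (1 / p) + A ^ (p / q) * B, fun f hf g hg => ?_, fun f hf => ?_⟩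
  · refine (eLpNorm_schur hpq hN hwm hwm hw0 h1 h2 hf hg).trans ?_
    rw [hA1, hB1]
    bound
  · refine (lintegral_schur hpq hN hwm hwm hw0 h1 h2 hf.enorm).trans ?_
    rw [hA2]
    bound

/-- The holomorphic kernel `(2/π) z^{β+1} y^{-β} / (y² - z²)`. -/
def mKer (β : ℝ) (z : ℂ) (y : ℝ) : ℂ :=
  (2 / π : ℂ) * z ^ ((β : ℂ) + 1) * (y ⁻^ β / ((y : ℂ) ^ 2 - z ^ 2))

/-- The integral operator on the half line with kernel `mKer`. -/
def mop (β : ℝ) (v : ℝ → ℂ) (z : ℂ) : ℂ := ∫ y, mKer β z y * v y ∂halfVol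

include hpq hβ in
lemma memLp_weight :
    MemLp (fun y : ℝ => y ^ (-β) / (1 + y ^ 2)) (ofReal q) halfVol := by
  have hq := hpq.symm.pos
  have hm : AEStronglyMeasurable (fun y : ℝ => y ^ (-β) / (1 + y ^ 2)) halfVol := by
    apply Measurable.aestronglyMeasurable; fun_prop
  rw [← integrable_norm_rpow_iff hm (by simpa using hq) ofReal_ne_top, toReal_ofReal hq.le]
  have h1 : β * q < 1 := by rw [← lt_div_iff₀ hq]; exact hβ.2
  have h2 : 1 < (β + 2) * q := by rw [← div_lt_iff₀ hq]; linarith [hβ.1]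
  refine ((integrable_rpow_mul_one_add_rpow (a := -β * q) (b := -2 * q) (by linarith) (by linarith)).const_mul (2 ^ q)).mono'
    (by apply Measurable.aestronglyMeasurable; fun_prop) (ae_halfVol_pos.mono fun y hy => ?_)
  rw [norm_of_nonneg (by positivity), norm_of_nonneg (by positivity), Real.rpow_mul hy.le,
    Real.rpow_mul (by linarith), ← mul_rpow (by positivity) (by positivity), ← mul_rpow (by positivity) (by positivity)]
  rw [rpow_neg (by linarith : 0 ≤ 1 + y) 2, div_eq_mul_inv, mul_left_comm]
  gcongr
  rw [← div_eq_mul_inv, inv_eq_one_div, div_le_div_iff₀ (by positivity) (by positivity)]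
  norm_num
  nlinarith [sq_nonneg (y - 1)]

include hpq hβ in
lemma integrable_weight
    (hv : MemLp v 𝔭 halfVol) :
    Integrable (fun y : ℝ => ‖y ⁻^ β * v y‖ / (1 + ‖(y : ℂ) ^ 2‖)) halfVol := by
  have hw := memLp_weight hpq hβ
  have := hpq.ennrealOfReal
  refine (hv.norm.integrable_mul hw).congr (ae_halfVol_pos.mono fun y hy => ?_)
  simp only [Pi.mul_apply, norm_mul, norm_pow, norm_real]
  rw [norm_of_nonneg (by positivity : 0 ≤ y ^ (-β)), norm_of_nonneg hy.le]
  ring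

lemma sq_notMem_of_im_ne_zero (hz : z.im ≠ 0) : z ^ 2 ∉ {s : ℂ | s.im = 0 ∧ 0 ≤ s.re} := by
  have e1 : (z ^ 2).im = 2 * z.re * z.im := by rw [sq, mul_im]; ring
  have e2 : (z ^ 2).re = z.re ^ 2 - z.im ^ 2 := by rw [sq, mul_re]; ring
  simp_all

lemma isClosed_nonneg_reals : IsClosed {s : ℂ | s.im = 0 ∧ 0 ≤ s.re} :=
  (isClosed_eq continuous_im continuous_const).inter (isClosed_le continuous_const Complex.continuous_re)

lemma ae_sq_mem : ∀ᵐ y : ℝ ∂halfVol, ((y : ℂ) ^ 2) ∈ {s : ℂ | s.im = 0 ∧ 0 ≤ s.re} := by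
  refine .of_forall fun y => ?_
  rw [← ofReal_pow]
  exact ⟨ofReal_im _, by rw [ofReal_re]; positivity⟩

lemma sq_sub_sq_ne_zero (y : ℝ) (hz : z.im ≠ 0) : (y : ℂ) ^ 2 - z ^ 2 ≠ 0 := by
  rw [sq_sub_sq]
  refine mul_ne_zero ?_ (ofReal_sub_ne_zero y hz)
  have := ofReal_sub_ne_zero y (w := -z) (by simpa)
  simp_all

section Mop

lemma aestronglyMeasurable_weight (hv : AEStronglyMeasurable v halfVol) (β : ℝ) :
    AEStronglyMeasurable (fun y : ℝ => y ⁻^ β * v y) halfVol :=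
  by fun_prop

include hpq hβ

lemma integrable_weight_div (hv : MemLp v 𝔭 halfVol)
    (hζ : ζ ∉ {s : ℂ | s.im = 0 ∧ 0 ≤ s.re}) :
    Integrable (fun y : ℝ => y ⁻^ β * v y / ((y : ℂ) ^ 2 - ζ)) halfVol := by
  obtain ⟨ε, hε, hb⟩ := Metric.isOpen_iff.1 isClosed_nonneg_reals.isOpen_compl ζ hζ
  refine integrable_cauchy (by fun_prop) ae_sq_mem (aestronglyMeasurable_weight hv.1 β)
    (integrable_weight hpq hβ hv) hε fun s hs => ?_
  by_contra! hlt
  exact hb (by rwa [mem_ball, dist_eq_norm]) hs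

lemma integrable_mKer_mul (hv : MemLp v 𝔭 halfVol) (hz : z.im ≠ 0) :
    Integrable (fun y => mKer β z y * v y) halfVol := by
  refine ((integrable_weight_div hpq hβ hv (sq_notMem_of_im_ne_zero hz)).const_mul
    ((2 / π : ℂ) * z ^ ((β : ℂ) + 1))).congr (ae_of_all _ fun y => ?_)
  simp only [mKer]; ring

omit hpq hβ in
lemma mop_eq (β : ℝ) (v : ℝ → ℂ) (z : ℂ) :
    mop β v z = (2 / π : ℂ) * z ^ ((β : ℂ) + 1) * ∫ y, y ⁻^ β * v y / ((y : ℂ) ^ 2 - z ^ 2) ∂halfVol := by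
  rw [mop, ← integral_const_mul]
  refine integral_congr_ae (ae_of_all _ fun y => ?_)
  simp only [mKer]; ring

omit hpq hβ in
lemma mem_slitPlane_of_im (hz : z.im ≠ 0) : z ∈ slitPlane := Or.inr hz

lemma differentiableAt_mop (hv : MemLp v 𝔭 halfVol) (hz : z.im ≠ 0) :
    DifferentiableAt ℂ (mop β v) z := by
  have h1 := (hasDerivAt_cauchy isClosed_nonneg_reals (by fun_prop) ae_sq_mem (aestronglyMeasurable_weight hv.1 β)
    (integrable_weight hpq hβ hv) (sq_notMem_of_im_ne_zero hz)).differentiableAt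
  have h2 : DifferentiableAt ℂ (fun z => z ^ 2) z := by fun_prop
  have h3 := DifferentiableAt.comp z h1 h2
  have h4 : DifferentiableAt ℂ (fun z => (2 / π : ℂ) * z ^ ((β : ℂ) + 1)) z :=
    (differentiableAt_id.cpow_const (mem_slitPlane_of_im hz)).const_mul _
  have h5 := h4.mul h3
  refine h5.congr_of_eventuallyEq (.of_forall fun z => ?_)
  rw [mop_eq]; rfl

lemma continuous_mop_line (hv : MemLp v 𝔭 halfVol) (ht : t ≠ 0) :
    Continuous (fun x : ℝ => mop β v (cpt x t)) := by
  rw [continuous_iff_continuousAt]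
  intro x
  exact ContinuousAt.comp (f := fun x : ℝ => cpt x t)
    (differentiableAt_mop hpq hβ hv (z := cpt x t) (by simpa)).continuousAt (by unfold cpt; fun_prop)

lemma mop_add (hv : MemLp v 𝔭 halfVol) (hw : MemLp w 𝔭 halfVol)
    (hz : z.im ≠ 0) : mop β (v + w) z = mop β v z + mop β w z := by
  rw [mop, mop, mop, ← integral_add (integrable_mKer_mul hpq hβ hv hz) (integrable_mKer_mul hpq hβ hw hz)]
  simp [mul_add]

lemma mop_sub (hv : MemLp v 𝔭 halfVol) (hw : MemLp w 𝔭 halfVol)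
    (hz : z.im ≠ 0) : mop β (v - w) z = mop β v z - mop β w z := by
  rw [mop, mop, mop, ← integral_sub (integrable_mKer_mul hpq hβ hv hz) (integrable_mKer_mul hpq hβ hw hz)]
  simp [mul_sub]

omit hpq hβ in
lemma mop_smul (c : ℂ) (v : ℝ → ℂ) (z : ℂ) : mop β (c • v) z = c * mop β v z := by
  rw [mop, mop, ← integral_const_mul]
  simp [mul_left_comm]

omit hpq hβ in
lemma mop_congr_ae (h : v =ᵐ[halfVol] w) (z : ℂ) : mop β v z = mop β w z :=
  integral_congr_ae (by filter_upwards [h] with y hy; rw [hy])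

omit hpq hβ in
lemma conj_mKer (z : ℂ) (hz : z.im ≠ 0) (y : ℝ) : star (mKer β z y) = mKer β (star z) y := by
  have h1 : z.arg ≠ π := (Complex.mem_slitPlane_iff_arg.1 (mem_slitPlane_of_im hz)).1
  have h2 := Complex.cpow_conj z ((β : ℂ) + 1) h1
  have h3 : (starRingEnd ℂ) ((β : ℂ) + 1) = (β : ℂ) + 1 := by simp
  simp only [mKer, star_mul', star_div₀, star_sub, star_pow]
  simp_all

omit hpq hβ in
lemma conj_mop (v : ℝ → ℂ) (hz : z.im ≠ 0) :
    star (mop β v z) = mop β (fun y => star (v y)) (star z) := by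
  have : star (mop β v z) = ∫ y, star (mKer β z y * v y) ∂halfVol := integral_conj.symm
  rw [this, mop]
  refine integral_congr_ae (.of_forall fun y => ?_)
  simp only [star_mul']
  rw [conj_mKer z hz]

end Mop

lemma ofReal_mul_cpow (hr : 0 < r) {w : ℂ} (hw : w ≠ 0) (c : ℂ) :
    ((r : ℂ) * w) ^ c = (r : ℂ) ^ c * w ^ c := by
  have hr' : (r : ℂ) ≠ 0 := by exact_mod_cast hr.ne'
  rw [cpow_def_of_ne_zero (mul_ne_zero hr' hw), cpow_def_of_ne_zero hr',
    cpow_def_of_ne_zero hw, Complex.log_ofReal_mul hr hw, ← exp_add, Complex.ofReal_log hr.le]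
  ring

lemma rpow_le_two_rpow_abs {m : ℝ} (h1 : 1 / 2 ≤ m) (h2 : m ≤ 2) : m ^ c ≤ 2 ^ |c| := by
  rcases le_total 0 c with h | h
  · rw [abs_of_nonneg h]; gcongr
  · rw [abs_of_nonpos h]
    calc m ^ c ≤ (1 / 2 : ℝ) ^ c := rpow_le_rpow_of_nonpos (by simp) h1 h
      _ = _ := by rw [one_div, inv_rpow (by simp), rpow_neg (by simp)]

lemma norm_cpow_sub_one_le (β : ℝ) : ∃ C : ℝ, 0 ≤ C ∧ ∀ η : ℂ,
    ‖η ^ (β : ℂ) - 1‖ * (1 + ‖η‖) ≤ C * ‖η - 1‖ * (1 + ‖η‖ ^ β) := by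
  refine ⟨5 + |β| * 2 ^ |β - 1| * (5 / 2), by positivity, fun η => ?_⟩
  rcases le_or_gt (1 / 2) ‖η - 1‖ with h | h
  · have h1 : ‖η‖ ≤ ‖η - 1‖ + 1 := by simpa using norm_add_le (η - 1) 1
    have h2 : ‖η ^ (β : ℂ) - 1‖ ≤ 1 + ‖η‖ ^ β := by
      refine (norm_sub_le _ _).trans ?_
      rw [norm_cpow_real, norm_one, add_comm]
    have h3 : 0 ≤ |β| * 2 ^ |β - 1| * (5 / 2) := by positivity
    calc _ ≤ (1 + ‖η‖ ^ β) * (5 * ‖η - 1‖) := by gcongr; linarith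
      _ = 5 * ‖η - 1‖ * (1 + ‖η‖ ^ β) := by ring
      _ ≤ _ := by gcongr; linarith
  · have hball : ∀ z ∈ ball (1 : ℂ) (1 / 2), 1 / 2 ≤ ‖z‖ ∧ ‖z‖ ≤ 2 ∧ 0 < z.re := by
      intro z hz
      rw [mem_ball, dist_eq_norm] at hz
      have h1 : ‖(1 : ℂ)‖ - ‖z‖ ≤ ‖z - 1‖ := by rw [norm_sub_rev]; exact norm_sub_norm_le _ _
      have h2 : ‖z‖ ≤ ‖z - 1‖ + 1 := by simpa using norm_add_le (z - 1) 1
      rw [norm_one] at h1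
      have h3 := (abs_le.1 (abs_re_le_norm (z - 1))).1
      simp at h3
      grind
    have hη : η ∈ ball 1 (1 / 2) := by rwa [mem_ball, dist_eq_norm]
    have hmv := (convex_ball 1 (1 / 2)).norm_image_sub_le_of_norm_hasDerivWithin_le
      (f' := fun z => (β : ℂ) * z ^ ((β : ℂ) - 1)) (C := |β| * 2 ^ |β - 1|)
      (fun z hz => by
        have := (hasDerivAt_id z).cpow_const (c := (β : ℂ)) (Or.inl (hball z hz).2.2)
        simpa using this.hasDerivWithinAt)
      (fun z hz => by
        obtain ⟨b1, b2, b3⟩ := hball z hz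
        rw [norm_mul, norm_real, norm_eq_abs, ← ofReal_one, ← ofReal_sub,
          norm_cpow_real]
        gcongr
        exact rpow_le_two_rpow_abs b1 b2)
      (Metric.mem_ball_self (by simp)) hη
    rw [Complex.one_cpow] at hmv
    have h3 : ‖η‖ ≤ 3 / 2 := by
      have : ‖η‖ ≤ ‖η - 1‖ + 1 := by simpa using norm_add_le (η - 1) 1
      linarith
    calc _ ≤ (|β| * 2 ^ |β - 1| * ‖η - 1‖) * (5 / 2) := by gcongr; linarith
      _ = (|β| * 2 ^ |β - 1| * (5 / 2)) * ‖η - 1‖ * 1 := by ring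
      _ ≤ _ := by bound

/-- Radial majorant for the difference of two kernels. -/
def radKer (β r y : ℝ) : ℝ := r * (1 + (r / y) ^ β) / (r + y) ^ 2

lemma cpow_add_one' (hz : z ≠ 0) (β : ℝ) : z ^ ((β : ℂ) + 1) = z ^ (β : ℂ) * z := by
  rw [cpow_add _ _ hz, cpow_one]

lemma mKer_sub_eq (β : ℝ) (hz : z ≠ 0) (hy : 0 < y) :
    mKer β z y - mKer 0 z y =
      (2 / π : ℂ) * (((z / y) ^ (β : ℂ) - 1) * (z / ((y : ℂ) ^ 2 - z ^ 2))) := by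
  have hy' : (y : ℂ) ≠ 0 := by exact_mod_cast hy.ne'
  have e : z ^ (β : ℂ) * y ⁻^ β = (z / y) ^ (β : ℂ) := by
    have h1 := ofReal_mul_cpow hy (div_ne_zero hz hy') (β : ℂ)
    rw [mul_div_cancel₀ _ hy'] at h1
    rw [h1, ofReal_cpow hy.le, mul_right_comm]
    push_cast
    rw [Complex.cpow_neg, mul_inv_cancel₀, one_mul]
    simp_all
  rw [mKer, mKer, cpow_add_one' hz, cpow_add_one' hz, ← e]
  simp
  ring

lemma norm_mKer_sub_le (β : ℝ) : ∃ C : ℝ, 0 ≤ C ∧ ∀ z : ℂ, 0 ≤ z.re → z.im ≠ 0 → ∀ y : ℝ, 0 < y →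
    ‖mKer β z y - mKer 0 z y‖ ≤ C * radKer β ‖z‖ y := by
  obtain ⟨C, hC0, hC⟩ := norm_cpow_sub_one_le β
  have hpi := pi_pos
  refine ⟨4 * C / π, by positivity, fun z hre him y hy => ?_⟩
  have hz : z ≠ 0 := by bound
  have hy' : (y : ℂ) ≠ 0 := by exact_mod_cast hy.ne'
  rw [mKer_sub_eq β hz hy]
  set η := z / y with hη
  have hzη : z = y * η := by grind
  have hr : ‖η‖ = ‖z‖ / y := by rw [hη, norm_div, norm_real, norm_of_nonneg hy.le]
  have hηre : 0 ≤ η.re := by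
    rw [hη, Complex.div_ofReal_re]; positivity
  have hηim : η.im ≠ 0 := by
    rw [hη, Complex.div_ofReal_im]; positivity
  have h1 : 1 + ‖η‖ ≤ 2 * ‖1 + η‖ := by
    have a1 : 1 ≤ ‖1 + η‖ := by
      refine le_trans ?_ (re_le_norm _)
      simpa using hηre
    have a2 : ‖η‖ ≤ ‖1 + η‖ := by
      rw [← sq_le_sq₀ (norm_nonneg _) (norm_nonneg _), ← normSq_eq_norm_sq, ← normSq_eq_norm_sq,
        normSq_apply, normSq_apply]
      simp; nlinarith
    linarith
  have h2 : 0 < ‖η - 1‖ := norm_pos_iff.2 fun h => by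
    rw [sub_eq_zero] at h; rw [h] at hηim; simp at hηim
  have e1 : (y : ℂ) ^ 2 - z ^ 2 = -(y ^ 2 * ((η - 1) * (1 + η))) := by rw [hzη]; ring
  have h3 := hC η
  set D := ‖η ^ (β : ℂ) - 1‖
  have h4 : D / ‖η - 1‖ ≤ C * (1 + ‖η‖ ^ β) / (1 + ‖η‖) := by
    rw [div_le_div_iff₀ h2 (by positivity)]; linarith
  calc _ = 2 / π * (D * (‖z‖ / (y ^ 2 * (‖η - 1‖ * ‖1 + η‖)))) := by
        rw [norm_mul, norm_mul, norm_div, norm_div, e1, norm_neg, norm_mul, norm_mul, norm_pow,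
          norm_real, norm_real, norm_of_nonneg hy.le, norm_of_nonneg hpi.le]
        norm_num
        exact Or.inl rfl
    _ = 2 / π * (D / ‖η - 1‖ * (‖z‖ / (y ^ 2 * ‖1 + η‖))) := by field_simp
    _ ≤ 2 / π * (C * (1 + ‖η‖ ^ β) / (1 + ‖η‖) * (‖z‖ / (y ^ 2 * ((1 + ‖η‖) / 2)))) := by
        gcongr
        linarith
    _ = _ := by
        rw [radKer, hr]
        field_simp
        ring

lemma radKer_le_homKer (h1 : -2 < β) (h2 : β < 1) (hx : 0 < x) (hxr : x ≤ r) (hy : 0 < y) :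
    radKer β r y ≤ 2 * homKer (max β 0) (max (-β - 1) 0) x y := by
  have hr : 0 < r := by linarith
  have hxy : 0 < x + y := by linarith
  have hry : 0 < r + y := by linarith
  set a := max β 0
  set b := max (-β - 1) 0
  have ha : 0 ≤ a := le_max_right _ _
  have hb : 0 ≤ b := le_max_right _ _
  have hb1 : r / (r + y) ^ 2 ≤ homKer a b x y := by
    calc r / (r + y) ^ 2 ≤ 1 / (r + y) := by
          rw [div_le_div_iff₀ (by positivity) hry]; nlinarith
      _ ≤ 1 / (x + y) := by gcongr
      _ = (x + y) ^ (-a) * (x + y) ^ (-b) * (x + y) ^ (a + b - 1) := by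
          rw [← rpow_add hxy, ← rpow_add hxy, one_div, ← rpow_neg_one]; ring
      _ ≤ _ := by
          unfold homKer
          gcongr ?_ * ?_ * _
          · exact rpow_le_rpow_of_nonpos hy (by linarith) (by linarith)
          · exact rpow_le_rpow_of_nonpos hx (by linarith) (by linarith)
  have hb2 : r * (r / y) ^ β / (r + y) ^ 2 ≤ homKer a b x y := by
    have e : r * (r / y) ^ β / (r + y) ^ 2 = r ^ (β + 1) * y ^ (-β) * (r + y) ^ (-2 : ℝ) := by
      rw [div_rpow hr.le hy.le, rpow_neg hy.le, rpow_neg hry.le, rpow_add hr, Real.rpow_one]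
      norm_num
      field_simp
    rw [e]
    rcases le_total 0 β with h | h
    · have ea : a = β := max_eq_left h
      have eb : b = 0 := by grind
      rw [ea, eb, homKer, neg_zero, rpow_zero, mul_one, add_zero]
      calc r ^ (β + 1) * y ^ (-β) * (r + y) ^ (-2 : ℝ) ≤ (r + y) ^ (β + 1) * y ^ (-β) * (r + y) ^ (-2 : ℝ) := by
            gcongr; linarith
        _ = y ^ (-β) * (r + y) ^ (β - 1) := by
            rw [mul_comm ((r + y) ^ (β + 1)), mul_assoc, ← rpow_add hry]; ring
        _ ≤ _ := by
            exact mul_le_mul_of_nonneg_left (rpow_le_rpow_of_nonpos hxy (by linarith) (by linarith)) (by positivity)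
    · have ea : a = 0 := max_eq_right h
      rcases le_total (-1) β with h' | h'
      · have eb : b = 0 := by grind
        rw [ea, eb, homKer, neg_zero, rpow_zero, rpow_zero, mul_one, one_mul, add_zero, zero_sub]
        calc r ^ (β + 1) * y ^ (-β) * (r + y) ^ (-2 : ℝ) ≤ (r + y) ^ (β + 1) * (r + y) ^ (-β) * (r + y) ^ (-2 : ℝ) := by
              gcongr ?_ * ?_ * _
              · exact Real.rpow_le_rpow hr.le (by linarith) (by linarith)
              bound
          _ = (r + y) ^ (-1 : ℝ) := by
              rw [← rpow_add hry, ← rpow_add hry]; ring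
          _ ≤ _ := rpow_le_rpow_of_nonpos hxy (by linarith) (by linarith)
      · have eb : b = -β - 1 := by grind
        rw [ea, eb, homKer, neg_zero, rpow_zero, one_mul, zero_add]
        calc r ^ (β + 1) * y ^ (-β) * (r + y) ^ (-2 : ℝ) ≤ x ^ (β + 1) * (r + y) ^ (-β) * (r + y) ^ (-2 : ℝ) := by
              gcongr ?_ * ?_ * _
              · exact rpow_le_rpow_of_nonpos hx hxr (by linarith)
              bound
          _ = x ^ (β + 1) * (r + y) ^ (-β - 2) := by
              rw [mul_assoc, ← rpow_add hry]; congr 2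
          _ ≤ x ^ (β + 1) * (x + y) ^ (-β - 2) := by
              exact mul_le_mul_of_nonneg_left (rpow_le_rpow_of_nonpos hxy (by linarith) (by linarith)) (by positivity)
          _ = _ := by congr 2 <;> ring
  have e : radKer β r y = r / (r + y) ^ 2 + r * (r / y) ^ β / (r + y) ^ 2 := by
    unfold radKer; ring
  linarith

section Limits

/-- The limit on the real axis of the difference of two kernels. -/
def diffKer (β x y : ℝ) : ℂ := (2 / π : ℂ) * ((((x / y : ℝ) : ℂ) ^ (β : ℂ) - 1) * ((x : ℂ) / ((y : ℂ) ^ 2 - (x : ℂ) ^ 2)))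

lemma tendsto_mKer_sub (β : ℝ) (σ : ℝ) (hx : 0 < x) (hy : 0 < y) (hxy : y ≠ x) :
    Tendsto (fun t : ℝ => mKer β (cpt x (σ * t)) y - mKer 0 (cpt x (σ * t)) y) (𝓝[>] 0) (𝓝 (diffKer β x y)) := by
  have h1 : Tendsto (fun t => cpt x (σ * t)) (𝓝[>] 0) (𝓝 (x : ℂ)) := by
    have : Continuous (fun t => cpt x (σ * t)) := by unfold cpt; fun_prop
    exact (this.tendsto' 0 (x : ℂ) (by simp [cpt])).mono_left nhdsWithin_le_nhds
  have h2 : ContinuousAt (fun z => (2 / π : ℂ) * (((z / y) ^ (β : ℂ) - 1) * (z / ((y : ℂ) ^ 2 - z ^ 2)))) (x : ℂ) := by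
    refine continuousAt_const.mul (ContinuousAt.mul (ContinuousAt.sub ?_ continuousAt_const) ?_)
    · refine ContinuousAt.cpow (by fun_prop) continuousAt_const (Or.inl ?_)
      simp_all
    · refine ContinuousAt.div (by fun_prop) (by fun_prop) ?_
      norm_cast
      rw [sub_eq_zero]
      intro h
      exact hxy ((sq_eq_sq₀ hy.le hx.le).1 h)
  have h3 := h2.tendsto.comp h1
  have e : diffKer β x y = (2 / π : ℂ) * ((((x : ℂ) / y) ^ (β : ℂ) - 1) * ((x : ℂ) / ((y : ℂ) ^ 2 - (x : ℂ) ^ 2))) := by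
    unfold diffKer; push_cast; rfl
  rw [e]
  refine h3.congr' ?_
  filter_upwards [self_mem_nhdsWithin] with t ht
  have : cpt x (σ * t) ≠ 0 := by
    intro h
    have := congrArg re h
    simp at this
    linarith
  exact (mKer_sub_eq β this hy).symm

include hpq in
include hβ in
lemma bounds_of_mem :
    -2 < β ∧ β < 1 ∧ max β 0 < 1 / q ∧ max (-β - 1) 0 < 1 / p := by
  have hp := hpq.pos
  have hq := hpq.symm.pos
  have hsum : 1 / p + 1 / q = 1 := by rw [one_div, one_div]; exact hpq.inv_add_inv_eq_one
  have hp' : 0 < 1 / p := by positivity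
  have hq' : 0 < 1 / q := by positivity
  grind

include hpq hβ

/-- The difference of the operators with kernels `mKer β` and `mKer 0` is dominated by a fixed
positive operator that is bounded on `L_p`. -/
lemma exists_mKer_majorant : ∃ K : ℝ, 0 ≤ K ∧ ∃ C : ℝ≥0,
    (∀ x, 0 < x → ∀ t, t ≠ 0 → ∀ y, 0 < y → ‖mKer β (cpt x t) y - mKer 0 (cpt x t) y‖ ≤
      K * homKer (max β 0) (max (-β - 1) 0) x y) ∧
    ∀ f : ℝ → ℂ, AEStronglyMeasurable f halfVol →
      ∫⁻ x, (∫⁻ y, ofReal (K * homKer (max β 0) (max (-β - 1) 0) x y) * ‖f y‖ₑ ∂halfVol) ^ p ∂halfVol ≤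
          C * ∫⁻ y, ‖f y‖ₑ ^ p ∂halfVol := by
  obtain ⟨b1, b2, b3, b4⟩ := bounds_of_mem hpq hβ
  obtain ⟨K, hK0, hK⟩ := norm_mKer_sub_le β
  obtain ⟨C, -, hC⟩ := exists_schur_homKer hpq b3 b4
  have hp := hpq.pos
  refine ⟨K * 2, by positivity, ((K * 2) ^ p).toNNReal * C, fun x hx t ht y hy => ?_, fun f hf => ?_⟩
  · refine (hK _ (by simpa using hx.le) (by simpa) y hy).trans ?_
    rw [mul_assoc]
    gcongr
    refine radKer_le_homKer b1 b2 hx ?_ hy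
    have := re_le_norm (cpt x t)
    simpa using this
  · have e : ∀ x, ∫⁻ y, ofReal (K * 2 * homKer (max β 0) (max (-β - 1) 0) x y) * ‖f y‖ₑ ∂halfVol =
        ofReal (K * 2) * ∫⁻ y, ofReal (homKer (max β 0) (max (-β - 1) 0) x y) * ‖f y‖ₑ ∂halfVol := by
      intro x
      rw [← lintegral_const_mul' _ _ ofReal_ne_top]
      refine lintegral_congr fun y => ?_
      rw [ofReal_mul (by positivity), mul_assoc]
    simp_rw [e, mul_rpow_of_nonneg _ _ hp.le]
    rw [lintegral_const_mul' _ _ (by finiteness)]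
    push_cast
    rw [mul_assoc]
    refine mul_le_mul' (le_of_eq ?_) (hC f hf)
    rw [ofReal_rpow_of_nonneg (by positivity) hp.le]
    rfl

omit hβ in
lemma zero_mem_range : (0 : ℝ) ∈ Ioo (1 / q - 2) (1 / q) := by
  have hq := hpq.symm.lt
  have h1 : 1 / q < 1 := by bound
  exact ⟨by linarith, by positivity⟩

omit hβ in
lemma neg_one_mem_range : (-1 : ℝ) ∈ Ioo (1 / q - 2) (1 / q) := by
  have hq := hpq.symm.lt
  have h1 : 1 / q < 1 := by bound
  have : 0 < 1 / q := by positivity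
  grind

lemma aestronglyMeasurable_mop_line (hv : MemLp v 𝔭 halfVol) (ht : t ≠ 0) :
    AEStronglyMeasurable (fun x : ℝ => mop β v (cpt x t)) halfVol :=
  (continuous_mop_line hpq hβ hv ht).aestronglyMeasurable

/-- The operators `mop β - mop 0` are uniformly bounded and converge in `L_p`. -/
lemma exists_mop_sub : ∃ C : ℝ≥0, ∀ v : ℝ → ℂ, MemLp v 𝔭 halfVol →
    (∀ t, t ≠ 0 → eLpNorm (fun x => mop β v (cpt x t) - mop 0 v (cpt x t)) 𝔭 halfVol ≤
        C * eLpNorm v 𝔭 halfVol) ∧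
    ∃ S, MemLp S 𝔭 halfVol ∧ ∀ σ : ℝ, σ ≠ 0 →
      Tendsto (fun t => eLpNorm (fun x => mop β v (cpt x (σ * t)) - mop 0 v (cpt x (σ * t)) - S x)
        𝔭 halfVol) (𝓝[>] 0) (𝓝 0) := by
  obtain ⟨K, hK0, C, hK, hC⟩ := exists_mKer_majorant hpq hβ
  have h0 := zero_mem_range hpq
  have hp := hpq.pos
  have hp0 : ofReal p ≠ 0 := by simpa using hp
  refine ⟨C ^ (1 / p), fun v hv => ?_⟩
  set Q : ℝ → ℝ≥0∞ := fun x => ∫⁻ y, ofReal (K * homKer (max β 0) (max (-β - 1) 0) x y) * ‖v y‖ₑ ∂halfVol with hQ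
  have hQp : ∫⁻ x, Q x ^ p ∂halfVol ≤ C * ∫⁻ y, ‖v y‖ₑ ^ p ∂halfVol := hC v hv.1
  have hvfin : ∫⁻ y, ‖v y‖ₑ ^ p ∂halfVol ≠ ⊤ := by
    have := lintegral_rpow_enorm_lt_top_of_eLpNorm_lt_top hp0 ofReal_ne_top hv.2
    rw [toReal_ofReal hp.le] at this
    exact this.ne
  have hQfin : ∫⁻ x, Q x ^ p ∂halfVol ≠ ⊤ := ne_top_of_le_ne_top (mul_ne_top coe_ne_top hvfin) hQp
  have hQm : AEMeasurable Q halfVol := by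
    have : AEMeasurable (fun z : ℝ × ℝ => ofReal (K * homKer (max β 0) (max (-β - 1) 0) z.1 z.2) * ‖v z.2‖ₑ)
        (halfVol.prod halfVol) := by
      refine AEMeasurable.mul ?_ hv.1.enorm.comp_snd
      have := measurable_homKer (max β 0) (max (-β - 1) 0)
      fun_prop
    exact this.lintegral_prod_right'
  have hQae : ∀ᵐ x ∂halfVol, Q x < ⊤ := by
    have := ae_lt_top' (hQm.pow_const p) hQfin
    filter_upwards [this] with x hx
    by_contra h
    rw [not_lt, top_le_iff] at h
    rw [h, ENNReal.top_rpow_of_pos hp] at hx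
    grind
  have hdiff : ∀ x t, t ≠ 0 → mop β v (cpt x t) - mop 0 v (cpt x t) =
      ∫ y, (mKer β (cpt x t) y - mKer 0 (cpt x t) y) * v y ∂halfVol := by
    intro x t ht
    rw [mop, mop, ← integral_sub (integrable_mKer_mul hpq hβ hv (by simpa)) (integrable_mKer_mul hpq h0 hv (by simpa))]
    simp [sub_mul]
  have hle : ∀ x, 0 < x → ∀ t, t ≠ 0 → ‖mop β v (cpt x t) - mop 0 v (cpt x t)‖ₑ ≤ Q x := by
    intro x hx t ht
    rw [hdiff x t ht]
    refine (enorm_integral_le_lintegral_enorm _).trans (lintegral_mono_ae (ae_halfVol_pos.mono fun y hy => ?_))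
    rw [enorm_mul]
    rw [← ofReal_norm]
    bound
  have hlim : ∀ᵐ x ∂halfVol, ∀ σ : ℝ, σ ≠ 0 → Tendsto (fun t => mop β v (cpt x (σ * t)) - mop 0 v (cpt x (σ * t)))
      (𝓝[>] 0) (𝓝 (∫ y, diffKer β x y * v y ∂halfVol)) := by
    filter_upwards [hQae, ae_halfVol_pos] with x hQx hx σ hσ
    have e : (fun t => mop β v (cpt x (σ * t)) - mop 0 v (cpt x (σ * t))) =ᶠ[𝓝[>] 0]
        fun t => ∫ y, (mKer β (cpt x (σ * t)) y - mKer 0 (cpt x (σ * t)) y) * v y ∂halfVol := by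
      filter_upwards [self_mem_nhdsWithin] with t ht
      grind
    refine Tendsto.congr' e.symm ?_
    refine tendsto_integral_filter_of_dominated_convergence
      (fun y => K * homKer (max β 0) (max (-β - 1) 0) x y * ‖v y‖) ?_ ?_ ?_ ?_
    · filter_upwards [self_mem_nhdsWithin] with t ht
      have ht' : σ * t ≠ 0 := by grind
      have := (integrable_mKer_mul hpq hβ hv (z := cpt x (σ * t)) (by simpa using ht')).sub
        (integrable_mKer_mul hpq h0 hv (z := cpt x (σ * t)) (by simpa using ht'))
      refine this.1.congr (ae_of_all _ fun y => ?_)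
      simp [sub_mul]
    · filter_upwards [self_mem_nhdsWithin] with t ht
      have ht' : σ * t ≠ 0 := by grind
      refine ae_halfVol_pos.mono fun y hy => ?_
      rw [norm_mul]
      bound
    · refine ⟨?_, ?_⟩
      · refine AEStronglyMeasurable.mul ?_ hv.1.norm
        have := measurable_homKer (max β 0) (max (-β - 1) 0)
        fun_prop
      · refine lt_of_le_of_lt (lintegral_mono_ae (ae_halfVol_pos.mono fun y hy => ?_)) hQx
        have hk : 0 ≤ K * homKer (max β 0) (max (-β - 1) 0) x y := by
          unfold homKer; positivity
        rw [enorm_mul, enorm_norm, Real.enorm_eq_ofReal hk]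
    · have hne : ∀ᵐ y ∂halfVol, y ≠ x := by
        refine ae_restrict_of_ae ?_
        simp [ae_iff]
      filter_upwards [ae_halfVol_pos, hne] with y hy hyx
      exact (tendsto_mKer_sub β σ hx hy hyx).mul_const _
  have hmeas : ∀ t, t ≠ 0 → AEStronglyMeasurable (fun x => mop β v (cpt x t) - mop 0 v (cpt x t)) halfVol := fun t ht =>
    (aestronglyMeasurable_mop_line hpq hβ hv ht).sub (aestronglyMeasurable_mop_line hpq h0 hv ht)
  set S : ℝ → ℂ := fun x => ∫ y, diffKer β x y * v y ∂halfVol with hS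
  have hSm : AEStronglyMeasurable S halfVol := by
    have hseq : Tendsto (fun n : ℕ => ((n : ℝ) + 1)⁻¹) atTop (𝓝[>] 0) := by
      refine tendsto_nhdsWithin_iff.2 ⟨?_, Eventually.of_forall fun n => by simp only [mem_Ioi]; positivity⟩
      simpa using tendsto_one_div_add_atTop_nhds_zero_nat (𝕜 := ℝ)
    refine aestronglyMeasurable_of_tendsto_ae atTop (f := fun (n : ℕ) x => mop β v (cpt x (1 * ((n : ℝ) + 1)⁻¹)) - mop 0 v (cpt x (1 * ((n : ℝ) + 1)⁻¹)))
      (fun n => hmeas _ (by positivity)) ?_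
    filter_upwards [hlim] with x hx
    exact (hx 1 one_ne_zero).comp hseq
  have hSle : ∀ᵐ x ∂halfVol, ‖S x‖ₑ ≤ Q x := by
    filter_upwards [hlim, ae_halfVol_pos] with x hx hx0
    refine le_of_tendsto (hx 1 one_ne_zero).enorm ?_
    filter_upwards [self_mem_nhdsWithin] with t ht
    grind
  have hnorm : ∀ {g : ℝ → ℂ}, (∀ᵐ x ∂halfVol, ‖g x‖ₑ ≤ Q x) →
      eLpNorm g 𝔭 halfVol ≤ (C ^ (1 / p) : ℝ≥0) * eLpNorm v 𝔭 halfVol := by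
    intro g hg
    rw [eLpNorm_eq_lintegral_rpow_enorm_toReal hp0 ofReal_ne_top,
      eLpNorm_eq_lintegral_rpow_enorm_toReal hp0 ofReal_ne_top, toReal_ofReal hp.le,
      coe_rpow_of_nonneg _ (by positivity), ← mul_rpow_of_nonneg _ _ (by positivity)]
    refine rpow_le_rpow (le_trans (lintegral_mono_ae ?_) hQp) (by positivity)
    filter_upwards [hg] with x hx using rpow_le_rpow hx hp.le
  refine ⟨fun t ht => hnorm (ae_halfVol_pos.mono fun x hx => hle x hx t ht), S,
    ⟨hSm, (hnorm hSle).trans_lt (mul_lt_top coe_lt_top hv.2)⟩, fun σ hσ => ?_⟩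
  refine tendsto_eLpNorm_of_dominated hp (g := fun x => 2 * Q x) ?_ ?_ ?_ ?_
  · filter_upwards [self_mem_nhdsWithin] with t ht
    exact (hmeas _ (by grind)).sub hSm
  · simp_rw [mul_rpow_of_nonneg _ _ hp.le]
    rw [lintegral_const_mul' _ _ (by finiteness)]
    exact mul_ne_top (by finiteness) hQfin
  · filter_upwards [self_mem_nhdsWithin] with t ht
    filter_upwards [hSle, ae_halfVol_pos] with x hx hx0
    refine (enorm_sub_le).trans ?_
    rw [two_mul]
    exact add_le_add (by grind) hx
  · filter_upwards [hlim] with x hx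
    have h9 := (hx σ hσ).sub_const (S x)
    rw [show (∫ y, diffKer β x y * v y ∂halfVol) - S x = 0 from sub_self _] at h9
    exact h9

end Limits

lemma ae_eq_of_tendsto_eLpNorm {X ι : Type*} [MeasurableSpace X] {μ : Measure X} {l : Filter ι} [l.NeBot]
    (hP : 1 ≤ P) {f : ι → X → ℂ} {a b : X → ℂ}
    (hf : ∀ᶠ i in l, AEStronglyMeasurable (f i) μ) (ha : AEStronglyMeasurable a μ) (hb : AEStronglyMeasurable b μ)
    (h1 : Tendsto (fun i => eLpNorm (fun x => f i x - a x) P μ) l (𝓝 0))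
    (h2 : Tendsto (fun i => eLpNorm (fun x => f i x - b x) P μ) l (𝓝 0)) : a =ᵐ[μ] b := by
  have h3 : Tendsto (fun _ : ι => eLpNorm (a - b) P μ) l (𝓝 0) := by
    have h4 := h2.add h1
    rw [add_zero] at h4
    refine tendsto_zero_of_le h4 ?_
    filter_upwards [hf] with i hi
    have : a - b = (fun x => f i x - b x) - (fun x => f i x - a x) := by
      ext x; simp
    rw [this]
    exact eLpNorm_sub_le (hi.sub hb) (hi.sub ha) hP
  have h5 : eLpNorm (a - b) P μ = 0 := by simp_all
  rw [eLpNorm_eq_zero_iff (ha.sub hb) (by positivity)] at h5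
  filter_upwards [h5] with x hx
  simpa [sub_eq_zero] using hx

lemma eLpNorm_comp_neg {E : Type*} [NormedAddCommGroup E] {f : ℝ → E} (hf : AEStronglyMeasurable f) (P : ℝ≥0∞) :
    eLpNorm (fun x => f (-x)) P = eLpNorm f P :=
  eLpNorm_comp_measurePreserving hf (measurePreserving_neg volume)

lemma memLp_indicator_halfVol (hv : MemLp v P halfVol) :
    MemLp ((Ioi (0 : ℝ)).indicator v) P := (memLp_indicator_iff_restrict measurableSet_Ioi).2 hv

lemma eLpNorm_indicator_halfVol (v : ℝ → ℂ) (P : ℝ≥0∞) :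
    eLpNorm ((Ioi (0 : ℝ)).indicator v) P = eLpNorm v P halfVol :=
  eLpNorm_indicator_eq_eLpNorm_restrict measurableSet_Ioi

lemma integral_indicator_mul (v k : ℝ → ℂ) :
    ∫ y, k y * (Ioi (0 : ℝ)).indicator v y = ∫ y, k y * v y ∂halfVol := by
  rw [halfVol, ← integral_indicator measurableSet_Ioi]
  congr 1; ext y
  by_cases hy : y ∈ Ioi 0 <;> simp [hy]

lemma cauchyT_indicator (v : ℝ → ℂ) (z : ℂ) :
    cauchyT ((Ioi (0 : ℝ)).indicator v) z = ∫ y : ℝ, v y / ((y : ℂ) - z) ∂halfVol := by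
  have := integral_indicator_mul v fun y => ((y : ℂ) - z)⁻¹
  simp only [cauchyT, div_eq_inv_mul]
  exact this

section Bdry

include hpq in
lemma integrable_half_cauchy (hv : MemLp v 𝔭 halfVol) (hz : z.im ≠ 0) :
    Integrable (fun y : ℝ => v y / ((y : ℂ) - z)) halfVol := by
  have h := memLp_indicator_halfVol hv
  have h2 := (integrable_cauchyT h.1 (MemLp.integrable_div_one_add_abs hpq h) hz).integrableOn (s := Ioi 0)
  refine h2.congr (ae_halfVol_pos.mono fun y hy => ?_)
  simp_all

include hpq in
lemma mop_zero_eq (hv : MemLp v 𝔭 halfVol) (hz : z.im ≠ 0) :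
    mop 0 v z = (1 / π : ℂ) * (cauchyT ((Ioi (0 : ℝ)).indicator v) z - cauchyT ((Ioi (0 : ℝ)).indicator v) (-z)) := by
  have hz' : (-z).im ≠ 0 := by simpa
  rw [cauchyT_indicator, cauchyT_indicator, ← integral_sub (integrable_half_cauchy hpq hv hz) (integrable_half_cauchy hpq hv hz'),
    ← integral_const_mul, mop]
  refine integral_congr_ae (.of_forall fun y => ?_)
  have h3 := sq_sub_sq_ne_zero y hz
  simp only [mKer, ofReal_zero, zero_add, cpow_one, neg_zero, rpow_zero, ofReal_one]
  grind

include hpq in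
lemma mop_neg_one_eq (hv : MemLp v 𝔭 halfVol) (hz : z.im ≠ 0) :
    mop (-1) v z = (1 / π : ℂ) * (cauchyT ((Ioi (0 : ℝ)).indicator v) z + cauchyT ((Ioi (0 : ℝ)).indicator v) (-z)) := by
  have hz' : (-z).im ≠ 0 := by simpa
  rw [cauchyT_indicator, cauchyT_indicator, ← integral_add (integrable_half_cauchy hpq hv hz) (integrable_half_cauchy hpq hv hz'),
    ← integral_const_mul, mop]
  refine integral_congr_ae (.of_forall fun y => ?_)
  have h3 := sq_sub_sq_ne_zero y hz
  simp only [mKer, ofReal_neg, ofReal_one, neg_add_cancel, cpow_zero, neg_neg, Real.rpow_one]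
  grind

lemma neg_cpt (x t : ℝ) : -cpt x t = cpt (-x) (-t) := by
  apply Complex.ext <;> simp

include hpq in
include hβ in
lemma exists_mop_bound : ∃ C : ℝ≥0, ∀ v : ℝ → ℂ,
    MemLp v 𝔭 halfVol → ∀ t : ℝ, t ≠ 0 →
    MemLp (fun x => mop β v (cpt x t)) 𝔭 halfVol ∧
    eLpNorm (fun x => mop β v (cpt x t)) 𝔭 halfVol ≤ C * eLpNorm v 𝔭 halfVol := by
  obtain ⟨A, hA⟩ := riesz hpq
  obtain ⟨B, hB⟩ := exists_mop_sub hpq hβ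
  have h0 := zero_mem_range hpq
  suffices h : ∀ v : ℝ → ℂ, MemLp v 𝔭 halfVol → ∀ t, t ≠ 0 →
      eLpNorm (fun x => mop β v (cpt x t)) 𝔭 halfVol ≤
        ((B + 2 * A : ℝ≥0) : ℝ≥0∞) * eLpNorm v 𝔭 halfVol from
    ⟨B + 2 * A, fun v hv t ht => ⟨⟨aestronglyMeasurable_mop_line hpq hβ hv ht,
      (h v hv t ht).trans_lt (mul_lt_top coe_lt_top hv.2)⟩, h v hv t ht⟩⟩
  intro v hv t ht
  set w := (Ioi 0).indicator v with hw
  have hwm := memLp_indicator_halfVol hv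
  have hwn := eLpNorm_indicator_halfVol v 𝔭
  obtain ⟨a1, a2⟩ := hA w hwm t ht
  obtain ⟨a3, a4⟩ := hA w hwm (-t) (by simpa)
  have a5 : eLpNorm (fun x => cauchyT w (cpt (-x) (-t))) 𝔭 ≤ A * eLpNorm v 𝔭 halfVol := by
    rw [eLpNorm_comp_neg (f := fun x => cauchyT w (cpt x (-t))) a3.1, ← hwn]; exact a4
  have a6 : AEStronglyMeasurable (fun x => cauchyT w (cpt (-x) (-t))) :=
    a3.1.comp_measurePreserving (measurePreserving_neg volume)
  have e : (fun x => mop β v (cpt x t)) = (fun x => mop β v (cpt x t) - mop 0 v (cpt x t)) +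
      ((1 / π : ℂ) • ((fun x => cauchyT w (cpt x t)) - (fun x => cauchyT w (cpt (-x) (-t))))) := by
    ext x
    simp
    rw [mop_zero_eq hpq hv (by simpa), neg_cpt]
    ring
  have hpi : ‖(1 / π : ℂ)‖ₑ ≤ 1 := by
    rw [← ofReal_norm, ENNReal.ofReal_le_one]
    simp only [norm_div, norm_one, norm_real, norm_eq_abs, abs_of_pos pi_pos]
    rw [div_le_one pi_pos]; linarith [Real.pi_gt_three]
  rw [e]
  refine (eLpNorm_add_le ((aestronglyMeasurable_mop_line hpq hβ hv ht).sub (aestronglyMeasurable_mop_line hpq h0 hv ht))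
    ((a1.1.sub a6).restrict.const_smul _) (one_le_ofReal hpq)).trans ?_
  push_cast
  rw [add_mul]
  refine add_le_add ((hB v hv).1 t ht) ?_
  rw [eLpNorm_const_smul]
  refine (mul_le_of_le_one_left zero_le hpi).trans ((eLpNorm_restrict_le _ _ _ _).trans ?_)
  refine (eLpNorm_sub_le a1.1 a6 (one_le_ofReal hpq)).trans ?_
  rw [two_mul, add_mul]
  rw [hwn] at a2
  gcongr

/-- `S ± i v` are the `L_p` boundary values on `(0, ∞)` of the holomorphic function `mop β v`, from above and
from below. -/
structure IsBdry (p β : ℝ) (v S : ℝ → ℂ) : Prop where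
  left : MemLp v (ofReal p) halfVol
  right : MemLp S (ofReal p) halfVol
  lim : ∀ σ : ℝ, σ = 1 ∨ σ = -1 → Tendsto (fun t =>
    eLpNorm (fun x => mop β v (cpt x (σ * t)) - (S x + σ * I * v x)) (ofReal p) halfVol) (𝓝[>] 0) (𝓝 0)

include hpq

include hβ in
lemma isBdry_of_tendsto
    (hv : MemLp v 𝔭 halfVol) (hT : MemLp T 𝔭 halfVol)
    (hTl : ∀ σ : ℝ, σ ≠ 0 → Tendsto (fun t => eLpNorm (fun x => mop β v (cpt x (σ * t)) - mop 0 v (cpt x (σ * t)) - T x)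
        𝔭 halfVol) (𝓝[>] 0) (𝓝 0)) (hH : MemLp H 𝔭)
    (hHl : Tendsto (fun t => eLpNorm (conjP t ((Ioi (0 : ℝ)).indicator v) - H) 𝔭) (𝓝[>] 0) (𝓝 0)) :
    IsBdry p β v fun x => T x + (1 / π : ℂ) * (H x - H (-x)) := by
  have h0 := zero_mem_range hpq
  set w := (Ioi 0).indicator v with hw
  have hwm := memLp_indicator_halfVol hv
  have hH' : MemLp (fun x => H (-x)) 𝔭 :=
    hH.comp_measurePreserving (measurePreserving_neg volume)
  refine ⟨hv, hT.add (((hH.sub hH').restrict _).const_mul _), fun σ hσ => ?_⟩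
  have hσ0 : σ ≠ 0 := by grind
  have hσ' : -σ = 1 ∨ -σ = -1 := by grind
  have l1 := hTl σ hσ0
  have l2 := tendsto_cauchyT_sub hpq hwm hH hHl hσ
  have l3 := tendsto_cauchyT_sub hpq hwm hH hHl hσ'
  have l4 := (l1.add (ENNReal.Tendsto.const_mul (l2.add l3) (a := ‖(1 / π : ℂ)‖ₑ) (Or.inr enorm_ne_top)))
  simp only [add_zero, mul_zero] at l4
  refine tendsto_zero_of_le l4 ?_
  filter_upwards [self_mem_nhdsWithin] with t ht
  have ht' : σ * t ≠ 0 := by grind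
  set f1 : ℝ → ℂ := fun x => cauchyT w (cpt x (σ * t)) - (H x + σ * I * π * w x) with hf1
  set f2 : ℝ → ℂ := fun x => cauchyT w (cpt x (-σ * t)) - (H x + (-σ : ℝ) * I * π * w x) with hf2
  have m0 : ∀ s : ℝ, s ≠ 0 → AEStronglyMeasurable (fun x => cauchyT w (cpt x s)) := fun s hs =>
    (continuous_cauchyT_line hwm.1 (MemLp.integrable_div_one_add_abs hpq hwm) hs).aestronglyMeasurable
  have m1 : AEStronglyMeasurable f1 := (m0 _ ht').sub (hH.1.add (hwm.1.const_mul _))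
  have m2 : AEStronglyMeasurable f2 := (m0 _ (by simpa using ht')).sub (hH.1.add (hwm.1.const_mul _))
  have m3 : AEStronglyMeasurable (fun x => f2 (-x)) :=
    m2.comp_measurePreserving (measurePreserving_neg volume)
  rw [← eLpNorm_comp_neg m2]
  have e : (fun x => mop β v (cpt x (σ * t)) - (T x + (1 / π : ℂ) * (H x - H (-x)) + σ * I * v x)) =ᵐ[halfVol]
      (fun x => mop β v (cpt x (σ * t)) - mop 0 v (cpt x (σ * t)) - T x) +
      ((1 / π : ℂ) • (f1 - fun x => f2 (-x))) := by
    filter_upwards [ae_halfVol_pos] with x hx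
    have e1 : w x = v x := indicator_of_mem (by grind) v
    have e2 : w (-x) = 0 := indicator_of_notMem (by grind) v
    simp only [Pi.add_apply, Pi.smul_apply, Pi.sub_apply, smul_eq_mul, hf1, hf2]
    rw [mop_zero_eq hpq hv (z := cpt x (σ * t)) (by simpa using ht'), neg_cpt, e1, e2, neg_mul σ t, ← hw]
    field_simp
    ring
  rw [eLpNorm_congr_ae e]
  refine (eLpNorm_add_le (((aestronglyMeasurable_mop_line hpq hβ hv ht').sub (aestronglyMeasurable_mop_line hpq h0 hv ht')).sub hT.1)
    ((m1.sub m3).restrict.const_smul _) (one_le_ofReal hpq)).trans ?_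
  refine add_le_add le_rfl ?_
  rw [eLpNorm_const_smul]
  gcongr
  exact (eLpNorm_restrict_le _ _ _ _).trans (eLpNorm_sub_le m1 m3 (one_le_ofReal hpq))

include hβ in
lemma exists_isBdry
    (hv : MemLp v 𝔭 halfVol) : ∃ S, IsBdry p β v S := by
  obtain ⟨B, hB⟩ := exists_mop_sub hpq hβ
  obtain ⟨-, T, hT, hTl⟩ := hB v hv
  obtain ⟨H, hH, hHl⟩ := exists_tendsto_conjP hpq (memLp_indicator_halfVol hv)
  exact ⟨_, isBdry_of_tendsto hpq hβ hv hT hTl hH hHl⟩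

lemma isBdry_zero (hv : MemLp v 𝔭 halfVol) (hH : MemLp H 𝔭)
    (hHl : Tendsto (fun t => eLpNorm (conjP t ((Ioi (0 : ℝ)).indicator v) - H) 𝔭) (𝓝[>] 0) (𝓝 0)) :
    IsBdry p 0 v fun x => (1 / π : ℂ) * (H x - H (-x)) := by
  simpa using isBdry_of_tendsto hpq (zero_mem_range hpq) hv MemLp.zero' (by simp) hH hHl

include hβ

lemma IsBdry.ae_eq (h : IsBdry p β v S) (h' : IsBdry p β v S') : S =ᵐ[halfVol] S' := by
  have := ae_eq_of_tendsto_eLpNorm (one_le_ofReal hpq) ?_ (h.right.1.add (h.left.1.const_mul _)) (h'.right.1.add (h.left.1.const_mul _))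
    (h.lim 1 (Or.inl rfl)) (h'.lim 1 (Or.inl rfl))
  · filter_upwards [this] with x hx
    simpa using hx
  · filter_upwards [self_mem_nhdsWithin] with t ht
    exact aestronglyMeasurable_mop_line hpq hβ h.left (by grind)

omit hpq hβ in
lemma IsBdry.congr {v' : ℝ → ℂ} (h : IsBdry p β v S) (hv : v =ᵐ[halfVol] v') (hS : S =ᵐ[halfVol] S') :
    IsBdry p β v' S' := by
  refine ⟨h.left.ae_eq hv, h.right.ae_eq hS, fun σ hσ => (h.lim σ hσ).congr fun t => eLpNorm_congr_ae ?_⟩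
  filter_upwards [hv, hS] with x h1 h2
  rw [h1, h2, mop_congr_ae hv]

lemma IsBdry.add (h : IsBdry p β v S) (h' : IsBdry p β w T) : IsBdry p β (v + w) (S + T) := by
  refine ⟨h.left.add h'.left, h.right.add h'.right, fun σ hσ => ?_⟩
  have hσ0 : σ ≠ 0 := by grind
  have l := (h.lim σ hσ).add (h'.lim σ hσ)
  rw [add_zero] at l
  refine tendsto_zero_of_le l ?_
  filter_upwards [self_mem_nhdsWithin] with t ht
  have ht' : σ * t ≠ 0 := by grind
  refine le_trans (le_of_eq ?_) (eLpNorm_add_le ((aestronglyMeasurable_mop_line hpq hβ h.left ht').sub (h.right.1.add (h.left.1.const_mul _)))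
    ((aestronglyMeasurable_mop_line hpq hβ h'.left ht').sub (h'.right.1.add (h'.left.1.const_mul _))) (one_le_ofReal hpq))
  congr 1
  ext x
  simp
  rw [mop_add hpq hβ h.left h'.left (by simpa using ht')]
  ring

omit hpq hβ in
lemma IsBdry.const_smul (h : IsBdry p β v S) (c : ℂ) : IsBdry p β (c • v) (c • S) := by
  refine ⟨h.left.const_smul c, h.right.const_smul c, fun σ hσ => ?_⟩
  have l := ENNReal.Tendsto.const_mul (h.lim σ hσ) (a := ‖c‖ₑ) (Or.inr enorm_ne_top)
  rw [mul_zero] at l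
  refine l.congr fun t => ?_
  rw [← eLpNorm_const_smul]
  congr 1
  ext x
  simp only [Pi.smul_apply, smul_eq_mul, mop_smul]
  ring

lemma IsBdry.sub (h : IsBdry p β v S) (h' : IsBdry p β w T) : IsBdry p β (v - w) (S - T) := by
  have := h.add hpq hβ (h'.const_smul (-1))
  simpa [sub_eq_add_neg] using this

omit hpq hβ in
lemma IsBdry.conj (h : IsBdry p β v S) :
    IsBdry p β (fun x => star (v x)) (fun x => star (S x)) := by
  refine ⟨h.left.star, h.right.star, fun σ hσ => ?_⟩
  have hσ' : -σ = 1 ∨ -σ = -1 := by grind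
  refine (h.lim (-σ) hσ').congr' ?_
  filter_upwards [self_mem_nhdsWithin] with t ht
  have ht' : σ * t ≠ 0 := by grind
  refine eLpNorm_congr_norm_ae (ae_of_all _ fun x => ?_)
  rw [← norm_star]
  have := conj_mop (β := β) v (z := cpt x (-σ * t)) (by simpa using ht')
  rw [star_sub, this, ← cpt_neg, star_add, star_mul', star_mul']
  simp

/-- The boundary operator is bounded. -/
lemma exists_isBdry_bound : ∃ C : ℝ≥0, ∀ v S : ℝ → ℂ, IsBdry p β v S →
    eLpNorm S 𝔭 halfVol ≤ C * eLpNorm v 𝔭 halfVol := by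
  obtain ⟨C, hC⟩ := exists_mop_bound hpq hβ
  refine ⟨C + 1, fun v S h => ?_⟩
  have l := (tendsto_const_nhds (x := ((C + 1 : ℝ≥0) : ℝ≥0∞) * eLpNorm v 𝔭 halfVol)).add (h.lim 1 (Or.inl rfl))
  rw [add_zero] at l
  refine ge_of_tendsto l ?_
  filter_upwards [self_mem_nhdsWithin] with t ht
  have ht' : 1 * t ≠ 0 := by grind
  have m1 := aestronglyMeasurable_mop_line hpq hβ h.left ht'
  have m2 : AEStronglyMeasurable (fun x => mop β v (cpt x (1 * t)) - (S x + 1 * I * v x)) halfVol :=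
    m1.sub (h.right.1.add (h.left.1.const_mul _))
  have e : S = (fun x => mop β v (cpt x (1 * t))) - ((I • v) +
      (fun x => mop β v (cpt x (1 * t)) - (S x + 1 * I * v x))) := by
    ext x
    simp
    ring
  calc eLpNorm S 𝔭 halfVol
      ≤ eLpNorm (fun x => mop β v (cpt x (1 * t))) 𝔭 halfVol + eLpNorm ((I • v) +
      (fun x => mop β v (cpt x (1 * t)) - (S x + 1 * I * v x))) 𝔭 halfVol := by
        conv_lhs => rw [e]
        exact eLpNorm_sub_le m1 ((h.left.1.const_smul _).add m2) (one_le_ofReal hpq)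
    _ ≤ C * eLpNorm v 𝔭 halfVol + (eLpNorm v 𝔭 halfVol +
      eLpNorm (fun x => mop β v (cpt x (1 * t)) - (S x + 1 * I * v x)) 𝔭 halfVol) := by
        refine add_le_add (hC v h.left _ ht').2 ((eLpNorm_add_le (h.left.1.const_smul _) m2 (one_le_ofReal hpq)).trans ?_)
        rw [eLpNorm_const_smul, ← ofReal_norm I, norm_I, ENNReal.ofReal_one, one_mul]
    _ = _ := by
        push_cast
        grind

end Bdry

lemma image_div_one_add : (fun s : ℝ => s / (1 + s)) '' Ioi 0 = Ioo 0 1 := by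
  ext x
  simp
  constructor
  · bound
  · rintro ⟨h0, h1⟩
    refine ⟨x / (1 - x), by positivity, ?_⟩
    grind

lemma integral_rpow_div_add_one (hγ : γ ∈ Ioo (-1 : ℝ) 0) :
    ∫ s : ℝ, ((s ^ γ : ℝ) : ℂ) / ((s : ℂ) + 1) ∂halfVol = -(π / sin (π * γ)) := by
  obtain ⟨h1, h2⟩ := hγ
  have hre1 : 0 < ((γ : ℂ) + 1).re := by simp; linarith
  have hre2 : 0 < (1 - ((γ : ℂ) + 1)).re := by simp; linarith
  have e1 := Complex.Gamma_mul_Gamma_eq_betaIntegral hre1 hre2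
  rw [Complex.Gamma_mul_Gamma_one_sub, add_sub_cancel, Complex.Gamma_one, one_mul] at e1
  have e2 : sin (π * ((γ : ℂ) + 1)) = -sin (π * γ) := by
    rw [mul_add, mul_one, Complex.sin_add_pi]
  rw [e2, div_neg] at e1
  rw [e1, Complex.betaIntegral, integral_of_le zero_le_one, ← integral_Ioc_eq_integral_Ioo.symm,
    ← image_div_one_add]
  rw [integral_image_eq_integral_abs_deriv_smul (f' := fun s => 1 / (1 + s) ^ 2) measurableSet_Ioi]
  · refine setIntegral_congr_fun measurableSet_Ioi fun s hs => ?_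
    have hs0 : 0 < s := hs
    have hs1 : 0 < 1 + s := by linarith
    have a1 : ((s / (1 + s) : ℝ) : ℂ) ^ ((γ : ℂ) + 1 - 1) = (((s / (1 + s)) ^ γ : ℝ) : ℂ) := by
      rw [add_sub_cancel_right, ofReal_cpow (by positivity)]
    have a2 : (1 - ((s / (1 + s) : ℝ) : ℂ)) ^ (1 - ((γ : ℂ) + 1) - 1) = (((1 + s) ^ (γ + 1) : ℝ) : ℂ) := by
      have : (1 - ((s / (1 + s) : ℝ) : ℂ)) = (((1 + s)⁻¹ : ℝ) : ℂ) := by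
        rw [← ofReal_one, ← ofReal_sub]; grind
      rw [this, show (1 - ((γ : ℂ) + 1) - 1) = ((-(γ + 1) : ℝ) : ℂ) by push_cast; ring, ← ofReal_cpow (by positivity),
        inv_rpow hs1.le, rpow_neg hs1.le, inv_inv]
    simp only [real_smul]
    rw [a1, a2, ← Complex.ofReal_mul, ← Complex.ofReal_mul, ← ofReal_one, ← Complex.ofReal_add, ← ofReal_div]
    rw [div_rpow hs0.le hs1.le, rpow_add hs1, Real.rpow_one, abs_of_nonneg (by positivity)]
    field_simp
    ring
  · intro s hs
    have hs1 : (1 + s) ≠ 0 := by grind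
    have := ((hasDerivAt_id s).div ((hasDerivAt_id s).const_add 1) hs1)
    refine (this.congr_deriv ?_).hasDerivWithinAt
    simp
  · intro s hs r hr h
    grind

lemma integrable_rpow_div_one_add (hγ : γ ∈ Ioo (-1 : ℝ) 0) :
    Integrable (fun s : ℝ => ‖((s ^ γ : ℝ) : ℂ)‖ / (1 + ‖(s : ℂ)‖)) halfVol := by
  refine (integrable_rpow_mul_one_add_rpow (a := γ) (b := -1) hγ.1 (by linarith [hγ.2])).congr
    (ae_halfVol_pos.mono fun s hs => ?_)
  simp only [norm_real]
  rw [norm_of_nonneg (by positivity), norm_of_nonneg hs.le, rpow_neg_one, div_eq_mul_inv]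

lemma ae_ofReal_mem : ∀ᵐ y : ℝ ∂halfVol, (y : ℂ) ∈ {s : ℂ | s.im = 0 ∧ 0 ≤ s.re} :=
  ae_halfVol_pos.mono fun y hy => ⟨ofReal_im _, by positivity⟩

lemma neg_notMem_of_slitPlane (hZ : Z ∈ slitPlane) : -Z ∉ {s : ℂ | s.im = 0 ∧ 0 ≤ s.re} := by
  rintro ⟨h1, h2⟩
  simp at h1 h2
  rcases hZ with h | h
  · linarith
  · exact h h1

lemma integrable_stieltjes (hγ : γ ∈ Ioo (-1 : ℝ) 0) (hZ : Z ∈ slitPlane) :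
    Integrable (fun s : ℝ => ((s ^ γ : ℝ) : ℂ) / ((s : ℂ) + Z)) halfVol := by
  obtain ⟨ε, hε, hb⟩ := Metric.isOpen_iff.1 isClosed_nonneg_reals.isOpen_compl _ (neg_notMem_of_slitPlane hZ)
  refine (integrable_cauchy (ζ := -Z) (by fun_prop) ae_ofReal_mem
    (v := fun s : ℝ => ((s ^ γ : ℝ) : ℂ)) (by fun_prop)
    (integrable_rpow_div_one_add hγ) hε fun s hs => ?_).congr (by simp)
  by_contra! hlt
  exact hb (by rwa [mem_ball, dist_eq_norm]) hs

/-- The Stieltjes transform of a power. -/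
lemma integral_stieltjes (hγ : γ ∈ Ioo (-1 : ℝ) 0) (hZ : Z ∈ slitPlane) :
    ∫ s : ℝ, ((s ^ γ : ℝ) : ℂ) / ((s : ℂ) + Z) ∂halfVol = -(π / sin (π * γ)) * Z ^ (γ : ℂ) := by
  set f : ℂ → ℂ := fun Z => ∫ s : ℝ, ((s ^ γ : ℝ) : ℂ) / ((s : ℂ) + Z) ∂halfVol with hf
  have hd : DifferentiableOn ℂ f slitPlane := fun Z hZ => by
    have h1 := (hasDerivAt_cauchy isClosed_nonneg_reals (φ := fun y : ℝ => (y : ℂ)) (by fun_prop) ae_ofReal_mem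
      (v := fun s : ℝ => ((s ^ γ : ℝ) : ℂ)) (by fun_prop)
      (integrable_rpow_div_one_add hγ) (neg_notMem_of_slitPlane hZ)).differentiableAt
    have h2 := DifferentiableAt.comp Z h1 (differentiableAt_id.neg)
    refine (h2.congr_of_eventuallyEq (Eventually.of_forall fun z => ?_)).differentiableWithinAt
    simp [hf]
  have hg : DifferentiableOn ℂ (fun Z => -(π / sin (π * γ)) * Z ^ (γ : ℂ)) slitPlane :=
    fun Z hZ => ((differentiableAt_id.cpow_const hZ).const_mul _).differentiableWithinAt
  have hr : ∀ r : ℝ, 0 < r → f r = -(π / sin (π * γ)) * (r : ℂ) ^ (γ : ℂ) := by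
    intro r hr
    have h1 := integral_comp_mul_left_Ioi (fun s => ((s ^ γ : ℝ) : ℂ) / ((s : ℂ) + r)) 0 hr
    have h2 : ∫ s in Ioi 0, (((r * s) ^ γ : ℝ) : ℂ) / (((r * s : ℝ) : ℂ) + r) =
        (((r ^ γ / r : ℝ)) : ℂ) * ∫ s, ((s ^ γ : ℝ) : ℂ) / ((s : ℂ) + 1) ∂halfVol := by
      rw [← integral_const_mul]
      refine setIntegral_congr_fun measurableSet_Ioi fun s hs => ?_
      have hs0 : 0 < s := hs
      rw [mul_rpow hr.le hs0.le]
      have e2 : ((r * s : ℝ) : ℂ) + r ≠ 0 := by exact_mod_cast (by positivity : r * s + r ≠ 0)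
      push_cast at e2 ⊢
      field_simp
    rw [h2, integral_rpow_div_add_one hγ, real_smul] at h1
    have e3 : (r : ℂ) ≠ 0 := by exact_mod_cast hr.ne'
    have h3 : f r = r * ((((r ^ γ / r : ℝ)) : ℂ) * -(π / sin (π * γ))) := by simp_all
    rw [h3, ← ofReal_cpow hr.le]
    push_cast
    field_simp
  have hpre : IsPreconnected slitPlane := (Complex.starConvex_one_slitPlane.isPathConnected (by simp)).isConnected.isPreconnected
  refine (hd.analyticOnNhd Complex.isOpen_slitPlane).eqOn_of_preconnected_of_frequently_eq
    (hg.analyticOnNhd Complex.isOpen_slitPlane) hpre (z₀ := 1) (by simp) ?_ hZ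
  have hseq : Tendsto (fun n : ℕ => ((1 + ((n : ℝ) + 1)⁻¹ : ℝ) : ℂ)) atTop (𝓝[≠] 1) := by
    refine tendsto_nhdsWithin_iff.2 ⟨?_, Eventually.of_forall fun n => ?_⟩
    · have : Tendsto (fun n : ℕ => (1 + ((n : ℝ) + 1)⁻¹ : ℝ)) atTop (𝓝 1) := by
        simpa using (tendsto_one_div_add_atTop_nhds_zero_nat (𝕜 := ℝ)).const_add 1
      exact (Complex.continuous_ofReal.tendsto' 1 1 (by simp)).comp this
    · simp only [mem_compl_iff, mem_singleton_iff]
      norm_cast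
      grind
  exact hseq.frequently (Frequently.of_forall fun n => hr _ (by positivity))

lemma integral_stieltjes_sub (hγ : γ ∈ Ioo (-1 : ℝ) 1) (hγ0 : γ ≠ 0) {W : ℂ} (hZ : Z ∈ slitPlane)
    (hW : W ∈ slitPlane) :
    ∫ s : ℝ, ((s ^ γ : ℝ) : ℂ) * (1 / ((s : ℂ) + Z) - 1 / ((s : ℂ) + W)) ∂halfVol =
      -(π / sin (π * γ)) * (Z ^ (γ : ℂ) - W ^ (γ : ℂ)) := by
  rcases lt_or_gt_of_ne hγ0 with h | h
  · have hγ' : γ ∈ Ioo (-1 : ℝ) 0 := ⟨hγ.1, h⟩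
    rw [mul_sub, ← integral_stieltjes hγ' hZ, ← integral_stieltjes hγ' hW,
      ← integral_sub (integrable_stieltjes hγ' hZ) (integrable_stieltjes hγ' hW)]
    grind
  · have hγ' : γ - 1 ∈ Ioo (-1 : ℝ) 0 := by simp_all
    have hZ0 := Complex.slitPlane_ne_zero hZ
    have hW0 := Complex.slitPlane_ne_zero hW
    have e : ∫ s, ((s ^ γ : ℝ) : ℂ) * (1 / ((s : ℂ) + Z) - 1 / ((s : ℂ) + W)) ∂halfVol =
        ∫ s, (W * (((s ^ (γ - 1) : ℝ) : ℂ) / ((s : ℂ) + W)) - Z * (((s ^ (γ - 1) : ℝ) : ℂ) / ((s : ℂ) + Z))) ∂halfVol := by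
      refine integral_congr_ae (ae_halfVol_pos.mono fun s hs => ?_)
      have hsZ : ∀ {Z : ℂ}, Z ∈ slitPlane → (s : ℂ) + Z ≠ 0 := fun {Z} hZ h => by
        refine neg_notMem_of_slitPlane hZ ?_
        rw [← eq_neg_of_add_eq_zero_left h]
        exact ⟨ofReal_im _, by simpa using hs.le⟩
      have h3 : ((s ^ γ : ℝ) : ℂ) = ((s ^ (γ - 1) : ℝ) : ℂ) * s := by
        rw [← Complex.ofReal_mul, ← Real.rpow_add_one hs.ne', sub_add_cancel]
      grind
    rw [e, integral_sub ((integrable_stieltjes hγ' hW).const_mul W) ((integrable_stieltjes hγ' hZ).const_mul Z),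
      integral_const_mul, integral_const_mul, integral_stieltjes hγ' hZ, integral_stieltjes hγ' hW]
    have h1 : ∀ {Z : ℂ}, Z ≠ 0 → Z ^ (γ : ℂ) = Z * Z ^ ((γ - 1 : ℝ) : ℂ) := fun {Z} hZ => by
      push_cast
      rw [Complex.cpow_sub _ _ hZ, cpow_one, mul_div_cancel₀ _ hZ]
    have h2 : sin (π * ((γ - 1 : ℝ) : ℂ)) = -sin (π * γ) := by
      push_cast
      rw [mul_sub, mul_one, Complex.sin_sub_pi]
    grind

lemma neg_sq_cpow (hz : 0 < z.im) (γ : ℝ) :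
    (-z ^ 2) ^ (γ : ℂ) = exp (-(I * π * γ)) * z ^ (2 * γ : ℂ) := by
  have hz0 : z ≠ 0 := fun h => by simp_all
  have h1 : 0 < z.arg := by
    refine lt_of_le_of_ne (Complex.arg_nonneg_iff.2 hz.le) fun h => ?_
    rw [eq_comm, Complex.arg_eq_zero_iff] at h
    exact hz.ne' h.2
  have h2 : z.arg < π := Complex.arg_lt_pi_iff.2 (Or.inr hz.ne')
  have h3 : log (-z ^ 2) = 2 * log z - π * I := by
    have : -z ^ 2 = exp (2 * log z - π * I) := by
      rw [Complex.exp_sub, exp_pi_mul_I, ← Nat.cast_ofNat (R := ℂ) (n := 2), Complex.exp_nat_mul, exp_log hz0]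
      rw [div_neg, div_one]
    rw [this, log_exp]
    · simp [log_im]; linarith
    · simp [log_im]; linarith
  rw [cpow_def_of_ne_zero (by simp_all), cpow_def_of_ne_zero hz0, h3, ← exp_add]
  ring

lemma neg_cpow_of_im_neg (hY : Y.im < 0) (γ : ℝ) :
    (-Y) ^ (γ : ℂ) = exp (I * π * γ) * Y ^ (γ : ℂ) := by
  have hY0 : Y ≠ 0 := fun h => by simp_all
  have h1 : Y.arg < 0 := Complex.arg_neg_iff.2 hY
  have h2 : -π < Y.arg := Complex.neg_pi_lt_arg Y
  have h3 : log (-Y) = log Y + π * I := by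
    have : -Y = exp (log Y + π * I) := by
      rw [exp_add, exp_pi_mul_I, exp_log hY0]
      simp
    rw [this, log_exp]
    · simp [log_im]; linarith
    · simp [log_im]; linarith
  rw [cpow_def_of_ne_zero (neg_ne_zero.2 hY0), cpow_def_of_ne_zero hY0, h3, ← exp_add]
  ring

lemma neg_sq_mem_slitPlane (hz : z.im ≠ 0) : -z ^ 2 ∈ slitPlane := by
  by_contra h
  refine sq_notMem_of_im_ne_zero hz ?_
  rw [Complex.mem_slitPlane_iff, not_or, not_lt, not_not] at h
  simp_all

lemma sin_pi_mul_ne_zero (hγ : γ ∈ Ioo (-1 : ℝ) 1) (hγ0 : γ ≠ 0) : sin (π * γ) ≠ 0 := by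
  norm_cast
  intro h
  rw [Real.sin_eq_zero_iff] at h
  obtain ⟨n, hn⟩ := h
  rw [mul_comm] at hn
  have hn' := mul_left_cancel₀ pi_ne_zero hn
  rw [← hn'] at hγ hγ0
  obtain ⟨h5, h6⟩ := hγ
  have h5' : (-1 : ℤ) < n := by exact_mod_cast h5
  have h6' : n < (1 : ℤ) := by exact_mod_cast h6
  have : n = 0 := by omega
  simp_all

lemma integral_rpow_div_mul (hγ : γ ∈ Ioo (-1 : ℝ) 1) (hγ0 : γ ≠ 0) (hz : 0 < z.im) (hY : Y.im < 0)
    (hYz : Y - z ^ 2 ≠ 0) :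
    ∫ w : ℝ, ((w ^ (2 * γ + 1) : ℝ) : ℂ) / (((w : ℂ) ^ 2 - z ^ 2) * (Y - (w : ℂ) ^ 2)) ∂halfVol =
      -(π / (2 * sin (π * γ))) * ((exp (-(I * π * γ)) * z ^ (2 * γ : ℂ) -
        exp (I * π * γ) * Y ^ (γ : ℂ)) / (Y - z ^ 2)) := by
  have hY' : -Y ∈ slitPlane := Or.inr (by simpa using hY.ne)
  have h1 := integral_stieltjes_sub hγ hγ0 (neg_sq_mem_slitPlane hz.ne') hY'
  rw [neg_sq_cpow hz, neg_cpow_of_im_neg hY] at h1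
  have h2 := integral_comp_rpow_Ioi_of_pos
    (g := fun s => ((s ^ γ : ℝ) : ℂ) * (1 / ((s : ℂ) + -z ^ 2) - 1 / ((s : ℂ) + -Y))) two_pos
  have h3 : ∫ w, ((w ^ (2 * γ + 1) : ℝ) : ℂ) / (((w : ℂ) ^ 2 - z ^ 2) * (Y - (w : ℂ) ^ 2)) ∂halfVol =
      (1 / (2 * (Y - z ^ 2))) * ∫ s, ((s ^ γ : ℝ) : ℂ) * (1 / ((s : ℂ) + -z ^ 2) - 1 / ((s : ℂ) + -Y)) ∂halfVol := by
    rw [halfVol, ← h2, ← integral_const_mul]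
    refine setIntegral_congr_fun measurableSet_Ioi fun w hw => ?_
    have hw0 : 0 < w := hw
    have e1 : (w : ℂ) ^ 2 - z ^ 2 ≠ 0 := sq_sub_sq_ne_zero w hz.ne'
    have e2 : Y - (w : ℂ) ^ 2 ≠ 0 := fun h => by
      have := congrArg im h
      rw [← ofReal_pow, sub_im, ofReal_im, sub_zero] at this
      exact hY.ne this
    have e3 : w ^ (2 * γ + 1) = w ^ (2 - 1 : ℝ) * (w ^ (2 : ℝ)) ^ γ := by
      rw [← Real.rpow_mul hw0.le, ← rpow_add hw0]; ring
    simp only [real_smul]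
    rw [e3, rpow_two]
    push_cast
    grind
  grind

/-- `C¹` functions whose support is a compact subset of `(0, ∞)`. -/
structure IsBump (a b : ℝ) (v : ℝ → ℂ) : Prop where
  smooth : ContDiff ℝ 1 v
  pos : 0 < a
  left : ∀ y, y < a → v y = 0
  right : ∀ y, b < y → v y = 0

include hpq in
lemma exists_isBump_eLpNorm_sub_le
    (hv : MemLp v 𝔭 halfVol) {ε : ℝ≥0∞} (hε : ε ≠ 0) :
    ∃ g a b, IsBump a b g ∧ eLpNorm (v - g) 𝔭 halfVol ≤ ε := by
  have hp := hpq.pos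
  obtain ⟨δ, hδ0, hδ⟩ : ∃ δ : ℝ, 0 < δ ∧ ofReal δ ≤ ε / 2 := by
    rcases eq_or_ne (ε / 2) ⊤ with h | h
    · exact ⟨1, one_pos, h ▸ le_top⟩
    · exact ⟨(ε / 2).toReal, toReal_pos (ENNReal.half_pos hε).ne' h, by rw [ofReal_toReal h]⟩
  have h1 : Tendsto (fun c : ℝ => eLpNorm (v - (Ioi c).indicator v) 𝔭 halfVol) (𝓝[>] 0) (𝓝 0) := by
    refine tendsto_eLpNorm_of_dominated hp (g := fun x => ‖v x‖ₑ) ?_ ?_ ?_ ?_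
    · exact Eventually.of_forall fun c => hv.1.sub (hv.1.indicator measurableSet_Ioi)
    · have := lintegral_rpow_enorm_lt_top_of_eLpNorm_lt_top (by simpa using hp) ofReal_ne_top hv.2
      rw [toReal_ofReal hp.le] at this
      exact this.ne
    · refine Eventually.of_forall fun c => ae_of_all _ fun x => ?_
      by_cases hx : x ∈ Ioi c <;> simp [hx]
    · filter_upwards [ae_halfVol_pos] with x hx
      refine tendsto_const_nhds.congr' ?_
      filter_upwards [nhdsWithin_le_nhds (Iio_mem_nhds hx)] with c hc
      simp_all
  obtain ⟨c, hc1, hc0⟩ := ((h1.eventually (ge_mem_nhds (ENNReal.half_pos hε))).and self_mem_nhdsWithin).exists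
  have hc : 0 < c := hc0
  have hv1 : MemLp ((Ioi c).indicator v) 𝔭 :=
    (memLp_indicator_iff_restrict measurableSet_Ioi).2 (hv.mono_measure (restrict_mono (Ioi_subset_Ioi hc.le) le_rfl))
  obtain ⟨g, g1, g2, g3⟩ := hv1.exist_eLpNorm_sub_le ofReal_ne_top (one_le_ofReal hpq) hδ0
  obtain ⟨b, hb⟩ := g1.isCompact.isBounded.subset_closedBall 0
  set χ : ℝ → ℝ := fun y => smoothTransition ((y - c / 2) / (c / 2)) with hχ
  have hχs : ContDiff ℝ 1 χ := by fun_prop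
  refine ⟨fun y => χ y • g y, c / 2, b, ⟨hχs.smul (g2.of_le (by simp)), by positivity, fun y hy => ?_, fun y hy => ?_⟩, ?_⟩
  · have : χ y = 0 := Real.smoothTransition.zero_of_nonpos (div_nonpos_of_nonpos_of_nonneg (by linarith) (by positivity))
    simp [this]
  · have : g y = 0 := by
      by_contra h0
      have := hb (subset_tsupport g (Function.mem_support.2 h0))
      rw [mem_closedBall, dist_zero_right, norm_eq_abs] at this
      grind
    simp [this]
  · have h2 : eLpNorm ((Ioi c).indicator v - fun y => χ y • g y) 𝔭 halfVol ≤ ε / 2 := by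
      refine (eLpNorm_mono fun y => ?_).trans (((eLpNorm_restrict_le _ _ _ _).trans g3).trans hδ)
      by_cases hy : y ∈ Ioi c
      · have : χ y = 1 := by
          refine Real.smoothTransition.one_of_one_le ?_
          rw [le_div_iff₀ (by positivity)]
          grind
        simp [this]
      · simp only [Pi.sub_apply, indicator_of_notMem hy, zero_sub, norm_neg, norm_smul]
        refine mul_le_of_le_one_left (norm_nonneg _) ?_
        rw [norm_of_nonneg (Real.smoothTransition.nonneg _)]
        exact Real.smoothTransition.le_one _
    have e : v - (fun y => χ y • g y) = (v - (Ioi c).indicator v) + ((Ioi c).indicator v - fun y => χ y • g y) := by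
      simp
    rw [e, ← ENNReal.add_halves ε]
    exact (eLpNorm_add_le (hv.1.sub (hv.1.indicator measurableSet_Ioi))
      ((hv.1.indicator measurableSet_Ioi).sub ((hχs.continuous.smul g2.continuous).aestronglyMeasurable))
      (one_le_ofReal hpq)).trans (add_le_add hc1 h2)

include hpq hβ in
lemma exists_mop_apply_bound
    (hz : z.im ≠ 0) : ∃ C : ℝ≥0, ∀ v : ℝ → ℂ, MemLp v 𝔭 halfVol →
      ‖mop β v z‖ₑ ≤ C * eLpNorm v 𝔭 halfVol := by
  obtain ⟨ε, hε, hb⟩ := Metric.isOpen_iff.1 isClosed_nonneg_reals.isOpen_compl _ (sq_notMem_of_im_ne_zero hz)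
  have hw := memLp_weight hpq hβ
  have hh := hpq.ennrealOfReal
  set D := (1 + ‖z ^ 2‖) / ε + 1 with hD
  set E := ‖(2 / π : ℂ) * z ^ ((β : ℂ) + 1)‖ * D with hE
  have hE0 : 0 ≤ E := by positivity
  refine ⟨E.toNNReal * (eLpNorm (fun y : ℝ => y ^ (-β) / (1 + y ^ 2)) (ofReal q) halfVol).toNNReal, fun v hv => ?_⟩
  have hk : ∀ y : ℝ, 0 < y → ‖mKer β z y‖ ≤ E * (y ^ (-β) / (1 + y ^ 2)) := fun y hy => by
    rw [mKer, norm_mul, hE, mul_assoc]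
    gcongr
    rw [norm_div, norm_real, norm_of_nonneg (by positivity), ← mul_div_assoc]
    have h0 : 0 < ‖(y : ℂ) ^ 2 - z ^ 2‖ := norm_pos_iff.2 (sq_sub_sq_ne_zero y hz)
    have h1 := one_add_norm_le_mul_norm_sub hε (fun s hs => by
      by_contra! hlt
      exact hb (by rwa [mem_ball, dist_eq_norm]) hs) (s := (y : ℂ) ^ 2)
      (by rw [← ofReal_pow]; exact ⟨ofReal_im _, by rw [ofReal_re]; positivity⟩)
    rw [norm_pow, norm_real, norm_eq_abs, sq_abs] at h1
    rw [div_le_div_iff₀ h0 (by positivity)]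
    calc y ^ (-β) * (1 + y ^ 2) ≤ y ^ (-β) * (D * ‖(y : ℂ) ^ 2 - z ^ 2‖) := by gcongr
      _ = _ := by ring
  calc ‖mop β v z‖ₑ ≤ ∫⁻ y, ‖mKer β z y * v y‖ₑ ∂halfVol := enorm_integral_le_lintegral_enorm _
    _ ≤ ∫⁻ y, ofReal E * (‖y ^ (-β) / (1 + y ^ 2)‖ₑ * ‖v y‖ₑ) ∂halfVol := by
        refine lintegral_mono_ae (ae_halfVol_pos.mono fun y hy => ?_)
        rw [enorm_mul, ← mul_assoc]
        rw [Real.enorm_eq_ofReal (by positivity), ← ofReal_mul hE0, ← ofReal_norm]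
        bound
    _ = ofReal E * eLpNorm ((fun y : ℝ => y ^ (-β) / (1 + y ^ 2)) • v) 1 halfVol := by
        rw [lintegral_const_mul' _ _ ofReal_ne_top, eLpNorm_one_eq_lintegral_enorm]
        simp only [Pi.smul_apply', enorm_smul]
    _ ≤ ofReal E * (eLpNorm (fun y : ℝ => y ^ (-β) / (1 + y ^ 2)) (ofReal q) halfVol *
        eLpNorm v 𝔭 halfVol) := by
        gcongr
        exact eLpNorm_smul_le_mul_eLpNorm hv.1 hw.1
    _ = _ := by
        push_cast
        rw [coe_toNNReal hw.2.ne, mul_assoc]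
        rfl

/-- The density in the variable `τ = y²`. -/
def sqrtLift (β : ℝ) (v : ℝ → ℂ) (τ : ℝ) : ℂ := ((τ ^ (-(β + 1) / 2) / 2 : ℝ) : ℂ) * v (Real.sqrt τ)

section Bump

variable {a b : ℝ} {v : ℝ → ℂ} (hv : IsBump a b v)

include hv

lemma IsBump.sqrtLift_eq_zero (β : ℝ) {τ : ℝ} (h : τ < a ^ 2) : sqrtLift β v τ = 0 := by
  have ha := hv.pos
  rw [sqrtLift, hv.left, mul_zero]
  rwa [Real.sqrt_lt' ha]

lemma IsBump.exists_isLipCpt_sqrtLift (β : ℝ) : ∃ R M L, IsLipCpt R M L (sqrtLift β v) := by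
  have ha := hv.pos
  refine exists_isLipCpt ?_ ?_
  · refine HasCompactSupport.intro (K := Icc 0 (max b 0 ^ 2)) isCompact_Icc fun τ hτ => ?_
    rcases lt_or_ge τ 0 with h | h
    · exact hv.sqrtLift_eq_zero β (by nlinarith)
    · rw [sqrtLift, hv.right, mul_zero]
      have h1 : max b 0 ^ 2 < τ := by simp_all
      exact lt_of_le_of_lt (le_max_left b 0) (Real.lt_sqrt_of_sq_lt h1)
  · rw [contDiff_iff_contDiffAt]
    intro τ
    rcases lt_or_ge τ (a ^ 2) with h | h
    · refine contDiffAt_const (c := (0 : ℂ)) |>.congr_of_eventuallyEq ?_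
      filter_upwards [Iio_mem_nhds h] with s hs using hv.sqrtLift_eq_zero β hs
    · have hτ : τ ≠ 0 := (lt_of_lt_of_le (by positivity) h).ne'
      refine ContDiffAt.mul ?_ ?_
      · exact Complex.ofRealCLM.contDiff.contDiffAt.comp τ ((Real.contDiffAt_rpow_const_of_ne hτ).div_const 2)
      · exact hv.smooth.contDiffAt.comp τ (Real.contDiffAt_sqrt hτ)

lemma IsBump.cauchyT_sqrtLift (β : ℝ) (ζ : ℂ) :
    cauchyT (sqrtLift β v) ζ = ∫ y : ℝ, y ⁻^ β * v y / ((y : ℂ) ^ 2 - ζ) ∂halfVol := by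
  have ha := hv.pos
  rw [cauchyT, ← setIntegral_eq_integral_of_forall_compl_eq_zero,
    ← integral_comp_rpow_Ioi_of_pos (g := fun τ => sqrtLift β v τ / ((τ : ℂ) - ζ)) two_pos]
  · refine setIntegral_congr_fun measurableSet_Ioi fun y hy => ?_
    have hy0 : 0 < y := hy
    have h1 : y ^ (-β) = y ^ (2 - 1 : ℝ) * (y ^ (2 : ℝ)) ^ (-(β + 1) / 2) := by
      rw [← Real.rpow_mul hy0.le, ← rpow_add hy0]; ring
    simp only [real_smul, sqrtLift]
    rw [h1]
    simp only [rpow_two]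
    rw [Real.sqrt_sq hy0.le]
    push_cast
    ring
  · intro τ hτ
    rw [hv.sqrtLift_eq_zero β, zero_div]
    have : τ ≤ 0 := not_lt.1 hτ
    nlinarith

lemma IsBump.mop_eq (β : ℝ) (z : ℂ) :
    mop β v z = (2 / π : ℂ) * z ^ ((β : ℂ) + 1) * cauchyT (sqrtLift β v) (z ^ 2) := by
  rw [HarmonicMeasure.mop_eq, hv.cauchyT_sqrtLift]

lemma IsBump.memLp (P : ℝ≥0∞) : MemLp v P halfVol := by
  refine (hv.smooth.continuous.memLp_of_hasCompactSupport ?_).restrict _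
  refine HasCompactSupport.intro (K := Icc a b) isCompact_Icc fun y hy => ?_
  rcases lt_or_ge y a with h | h
  · exact hv.left y h
  · refine hv.right y ?_
    simp_all

/-- The boundary values of `mop β v`, pointwise. -/
lemma IsBump.bdry_eq (hpq : p.HolderConjugate q) (hβ : β ∈ Ioo (1 / q - 2) (1 / q))
    (h : IsBdry p β v S) :
    ∀ᵐ w ∂halfVol, S w + I * v w = (2 / π : ℂ) * ((w ^ (β + 1) : ℝ) : ℂ) *
      (hilbertLip (sqrtLift β v) (w ^ 2) + I * (π * sqrtLift β v (w ^ 2))) := by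
  obtain ⟨R, M, L, hG⟩ := hv.exists_isLipCpt_sqrtLift β
  have hseq : Tendsto (fun n : ℕ => ((n : ℝ) + 1)⁻¹) atTop (𝓝[>] 0) := by
    refine tendsto_nhdsWithin_iff.2 ⟨?_, Eventually.of_forall fun n => by simp only [mem_Ioi]; positivity⟩
    simpa using tendsto_one_div_add_atTop_nhds_zero_nat (𝕜 := ℝ)
  have h1 := (h.lim 1 (Or.inl rfl)).comp hseq
  have h2 : TendstoInMeasure halfVol (fun (n : ℕ) x => mop β v (cpt x (1 * ((n : ℝ) + 1)⁻¹))) atTop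
      (fun x => S x + (1 : ℝ) * I * v x) :=
    tendstoInMeasure_of_tendsto_eLpNorm (p := ofReal p) (by simpa using hpq.pos)
      (fun n => aestronglyMeasurable_mop_line hpq hβ h.left (by positivity))
      (h.right.1.add (h.left.1.const_mul _)) h1
  obtain ⟨ns, hns, hlim⟩ := h2.exists_seq_tendsto_ae
  filter_upwards [hlim, ae_halfVol_pos] with w hw hw0
  rw [show S w + I * v w = S w + 1 * I * v w by simp]
  refine tendsto_nhds_unique hw ?_
  have e : (fun i => mop β v (cpt w (1 * ((ns i : ℝ) + 1)⁻¹))) = fun i => (2 / π : ℂ) *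
      (cpt w (1 * ((ns i : ℝ) + 1)⁻¹)) ^ ((β : ℂ) + 1) * cauchyT (sqrtLift β v) ((cpt w (1 * ((ns i : ℝ) + 1)⁻¹)) ^ 2) := by
    ext i; exact hv.mop_eq β _
  rw [e]
  have hc : Tendsto (fun i => cpt w (1 * ((ns i : ℝ) + 1)⁻¹)) atTop (𝓝 (w : ℂ)) := by
    have h3 : Continuous fun t : ℝ => cpt w (1 * t) := by unfold cpt; fun_prop
    exact (h3.tendsto' 0 (w : ℂ) (by simp [cpt])).comp
      ((hseq.mono_right nhdsWithin_le_nhds).comp hns.tendsto_atTop)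
  refine Tendsto.mul (Tendsto.const_mul _ ?_) ?_
  · have h4 : ContinuousAt (fun z => z ^ ((β : ℂ) + 1)) (w : ℂ) :=
      (continuousAt_id.cpow continuousAt_const (by simp_all))
    have h5 : (w : ℂ) ^ ((β : ℂ) + 1) = ((w ^ (β + 1) : ℝ) : ℂ) := by
      rw [ofReal_cpow hw0.le]; push_cast; rfl
    rw [← h5]
    exact h4.tendsto.comp hc
  · refine (hG.tendsto_cauchyT (w ^ 2)).comp (tendsto_nhdsWithin_iff.2 ⟨?_, .of_forall fun i => ?_⟩)
    · push_cast
      exact hc.pow 2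
    · have : (cpt w (1 * ((ns i : ℝ) + 1)⁻¹) ^ 2).im = 2 * w * ((ns i : ℝ) + 1)⁻¹ := by
        rw [sq, mul_im]; simp; ring
      simp only [mem_ofPred_eq, this]
      positivity

end Bump

lemma exists_inv_sq_sub_bound (hζ : ζ ∉ {s : ℂ | s.im = 0 ∧ 0 ≤ s.re}) :
    ∃ D : ℝ, 0 ≤ D ∧ ∀ w : ℝ, ‖((w : ℂ) ^ 2 - ζ)⁻¹‖ ≤ D * (1 + w ^ 2)⁻¹ := by
  obtain ⟨ε, hε, hb⟩ := Metric.isOpen_iff.1 isClosed_nonneg_reals.isOpen_compl _ hζ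
  refine ⟨(1 + ‖ζ‖) / ε + 1, by positivity, fun w => ?_⟩
  have hmem : (w : ℂ) ^ 2 ∈ {s : ℂ | s.im = 0 ∧ 0 ≤ s.re} := by
    rw [← ofReal_pow]; exact ⟨ofReal_im _, by rw [ofReal_re]; positivity⟩
  have h1 := one_add_norm_le_mul_norm_sub hε (fun s hs => by
    by_contra! hlt
    exact hb (by rwa [mem_ball, dist_eq_norm]) hs) hmem
  have h0 : 0 < ‖(w : ℂ) ^ 2 - ζ‖ := norm_pos_iff.2 (by grind)
  rw [norm_pow, norm_real, norm_eq_abs, sq_abs] at h1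
  rw [norm_inv, ← div_eq_mul_inv, inv_eq_one_div, div_le_div_iff₀ h0 (by positivity), one_mul]
  exact h1

lemma im_ofReal_sq (y : ℝ) : ((y : ℂ) ^ 2).im = 0 := by rw [← ofReal_pow, ofReal_im]

lemma inv_sq_sub_bound (hδ : 0 < δ) (hδ1 : δ ≤ 1) (hy : 0 < y) (hyb : y ≤ b) (w : ℝ) :
    ‖((y : ℂ) ^ 2 - δ * I - (w : ℂ) ^ 2)⁻¹‖ ≤ ((1 + (b ^ 2 + 1)) / δ + 1) * (1 + w ^ 2)⁻¹ := by
  set Y : ℂ := (y : ℂ) ^ 2 - δ * I with hY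
  have hYim : Y.im = -δ := by rw [hY, sub_im, im_ofReal_sq]; simp
  have hYn : ‖Y‖ ≤ b ^ 2 + 1 := by
    refine (norm_sub_le _ _).trans ?_
    rw [norm_pow, norm_real, norm_mul, norm_real, norm_I, norm_of_nonneg hy.le, norm_of_nonneg hδ.le]
    nlinarith
  have hmem : (w : ℂ) ^ 2 ∈ {s : ℂ | s.im = 0 ∧ 0 ≤ s.re} := by
    rw [← ofReal_pow]; exact ⟨ofReal_im _, by rw [ofReal_re]; positivity⟩
  have h2 : ∀ s ∈ {s : ℂ | s.im = 0 ∧ 0 ≤ s.re}, δ ≤ ‖s - Y‖ := fun s hs => by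
    have := abs_im_le_norm (s - Y)
    rw [sub_im, hYim, hs.1, zero_sub, neg_neg, abs_of_pos hδ] at this
    exact this
  have h1 := one_add_norm_le_mul_norm_sub hδ h2 hmem
  have h0 : 0 < ‖(w : ℂ) ^ 2 - Y‖ := hδ.trans_le (h2 _ hmem)
  rw [norm_pow, norm_real, norm_eq_abs, sq_abs] at h1
  rw [norm_inv, norm_sub_rev, ← div_eq_mul_inv, inv_eq_one_div, div_le_div_iff₀ h0 (by positivity), one_mul]
  refine h1.trans ?_
  gcongr

lemma integrable_rpow_mul_inv_sq (h1 : -1 < s) (h2 : s < 3) :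
    Integrable (fun w : ℝ => w ^ s * ((1 + w ^ 2)⁻¹ * (1 + w ^ 2)⁻¹)) halfVol := by
  refine ((integrable_rpow_mul_one_add_rpow (a := s) (b := -4) h1 (by linarith)).const_mul 4).mono'
    (by fun_prop) (ae_halfVol_pos.mono fun w hw => ?_)
  rw [norm_of_nonneg (by positivity), mul_left_comm 4]
  refine mul_le_mul_of_nonneg_left ?_ (rpow_nonneg hw.le s)
  rw [rpow_neg (by linarith : (0 : ℝ) ≤ 1 + w), show (4 : ℝ) = (4 : ℕ) by norm_num, Real.rpow_natCast, ← mul_inv,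
    inv_eq_one_div, ← div_eq_mul_inv, div_le_div_iff₀ (by positivity) (by positivity), one_mul]
  have h3 : (1 + w) ^ 2 ≤ 2 * (1 + w ^ 2) := by nlinarith [sq_nonneg (w - 1)]
  calc (1 + w) ^ 4 = (1 + w) ^ 2 * (1 + w) ^ 2 := by ring
    _ ≤ (2 * (1 + w ^ 2)) * (2 * (1 + w ^ 2)) := by gcongr
    _ = _ := by ring

section

variable {a b : ℝ} {v : ℝ → ℂ} (hv : IsBump a b v) {α β : ℝ} (hαβ : (β - α) / 2 ∈ Ioo (-1 : ℝ) 1)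
  (hne : (β - α) / 2 ≠ 0) {z : ℂ} (hz : 0 < z.im) (hz' : 0 < z.re)

/-- The regularized double integral. -/
def regKer (α β δ : ℝ) (z : ℂ) (w y : ℝ) : ℂ :=
  (((w ^ (2 * ((β - α) / 2) + 1) : ℝ) : ℂ) / (((w : ℂ) ^ 2 - z ^ 2) * ((y : ℂ) ^ 2 - δ * I - (w : ℂ) ^ 2)))

include hv in
lemma IsBump.integrable_weight (β : ℝ) : Integrable (fun y : ℝ => y ⁻^ β * v y) halfVol := by
  have h1 : IntegrableOn (fun y => y ⁻^ β * v y) (Icc a b) := by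
    refine ContinuousOn.integrableOn_compact isCompact_Icc (ContinuousOn.mul ?_ hv.smooth.continuous.continuousOn)
    refine Complex.continuous_ofReal.comp_continuousOn (continuousOn_id.rpow_const fun y hy => Or.inl ?_)
    exact (lt_of_lt_of_le hv.pos hy.1).ne'
  have h2 : (fun y => y ⁻^ β * v y) = (Icc a b).indicator fun y => y ⁻^ β * v y := by
    ext y
    by_cases hy : y ∈ Icc a b
    · simp_all
    · rw [indicator_of_notMem hy]
      rcases lt_or_ge y a with h | h
      · rw [hv.left y h, mul_zero]
      · rw [hv.right y (by simp_all), mul_zero]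
  rw [h2]
  exact ((integrable_indicator_iff measurableSet_Icc).2 h1).restrict

include hv hαβ hz in
lemma IsBump.integrable_regKer (hδ : 0 < δ) (hδ1 : δ ≤ 1) :
    Integrable (fun x : ℝ × ℝ => regKer α β δ z x.1 x.2 * (((x.2 ^ (-β) : ℝ) : ℂ) * v x.2)) (halfVol.prod halfVol) := by
  obtain ⟨D, hD0, hD⟩ := exists_inv_sq_sub_bound (sq_notMem_of_im_ne_zero hz.ne')
  have hg := (hv.integrable_weight β).norm
  have hm : Measurable v := hv.smooth.continuous.measurable
  refine (((integrable_rpow_mul_inv_sq (s := 2 * ((β - α) / 2) + 1) (by grind) (by grind)).const_mul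
    (D * ((1 + (b ^ 2 + 1)) / δ + 1))).mul_prod hg).mono' ?_ ?_
  · unfold regKer
    fun_prop
  · have h1 : ∀ᵐ x ∂(halfVol.prod halfVol), 0 < x.1 ∧ 0 < x.2 := by
      rw [prod_restrict]
      exact (ae_restrict_mem (measurableSet_Ioi.prod measurableSet_Ioi)).mono fun x hx => hx
    filter_upwards [h1] with x hx
    obtain ⟨hx1, hx2⟩ := hx
    rw [norm_mul]
    by_cases hb : x.2 ≤ b
    · refine mul_le_mul_of_nonneg_right ?_ (norm_nonneg _)
      rw [regKer, div_eq_mul_inv, mul_inv, norm_mul, norm_mul, norm_real, norm_of_nonneg (by positivity)]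
      calc _ ≤ x.1 ^ (2 * ((β - α) / 2) + 1) * ((D * (1 + x.1 ^ 2)⁻¹) * (((1 + (b ^ 2 + 1)) / δ + 1) * (1 + x.1 ^ 2)⁻¹)) := by
            gcongr
            · exact hD x.1
            · exact inv_sq_sub_bound hδ hδ1 hx2 hb x.1
        _ = _ := by ring
    · rw [hv.right x.2 (not_le.1 hb)]
      simp

include hv hαβ hne hz hz' in
/-- The regularized double integral, in closed form. -/
lemma IsBump.integral_regKer (hδ : 0 < δ) (hδ1 : δ ≤ 1) :
    ∫ w : ℝ, w ⁻^ α / ((w : ℂ) ^ 2 - z ^ 2) * (((w ^ (β + 1) : ℝ) : ℂ) *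
      cauchyT (sqrtLift β v) ((w : ℂ) ^ 2 + δ * I)) ∂halfVol =
    ∫ y : ℝ, -(π / (2 * sin (π * ((β - α) / 2 : ℝ)))) *
      ((exp (-(I * π * ((β - α) / 2 : ℝ))) * z ^ (2 * ((β - α) / 2 : ℝ) : ℂ) -
        exp (I * π * ((β - α) / 2 : ℝ)) * ((y : ℂ) ^ 2 - δ * I) ^ (((β - α) / 2 : ℝ) : ℂ)) /
          ((y : ℂ) ^ 2 - δ * I - z ^ 2)) * (y ⁻^ β * v y) ∂halfVol := by
  have h1 := integral_integral_swap (f := fun w y => regKer α β δ z w y * (y ⁻^ β * v y))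
    (hv.integrable_regKer hαβ hz hδ hδ1)
  have e1 : ∀ w, 0 < w → ∫ y, regKer α β δ z w y * (y ⁻^ β * v y) ∂halfVol =
      w ⁻^ α / ((w : ℂ) ^ 2 - z ^ 2) * (((w ^ (β + 1) : ℝ) : ℂ) *
      cauchyT (sqrtLift β v) ((w : ℂ) ^ 2 + δ * I)) := fun w hw => by
    rw [hv.cauchyT_sqrtLift, ← integral_const_mul, ← integral_const_mul]
    refine integral_congr_ae (.of_forall fun y => ?_)
    have h2 : w ^ (2 * ((β - α) / 2) + 1) = w ^ (-α) * w ^ (β + 1) := by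
      rw [← rpow_add hw]; ring
    simp only [regKer]
    rw [h2, sub_sub, add_comm (δ * I)]
    push_cast
    grind
  have e2 : ∀ y, ∫ w, regKer α β δ z w y * (y ⁻^ β * v y) ∂halfVol =
      -(π / (2 * sin (π * ((β - α) / 2 : ℝ)))) *
      ((exp (-(I * π * ((β - α) / 2 : ℝ))) * z ^ (2 * ((β - α) / 2 : ℝ) : ℂ) -
        exp (I * π * ((β - α) / 2 : ℝ)) * ((y : ℂ) ^ 2 - δ * I) ^ (((β - α) / 2 : ℝ) : ℂ)) /
          ((y : ℂ) ^ 2 - δ * I - z ^ 2)) * (y ⁻^ β * v y) := fun y => by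
    have hY : ((y : ℂ) ^ 2 - δ * I).im < 0 := by
      rw [sub_im, im_ofReal_sq]; simpa using hδ
    rw [integral_mul_const]
    unfold regKer
    rw [integral_rpow_div_mul hαβ hne hz hY]
    intro h
    have h2 := congrArg im h
    rw [sub_im, sq z, mul_im] at h2
    simp only [Complex.zero_im] at h2
    nlinarith
  rw [← integral_congr_ae (.of_forall e2), ← h1]
  exact integral_congr_ae (ae_halfVol_pos.mono fun w hw => (e1 w hw).symm)

end

section

variable {a b : ℝ} {v : ℝ → ℂ} (hv : IsBump a b v) {α β : ℝ} (hαβ : (β - α) / 2 ∈ Ioo (-1 : ℝ) 1)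
  (hne : (β - α) / 2 ≠ 0) {z : ℂ} (hz : 0 < z.im) (hz' : 0 < z.re)

include hv hαβ hz in
lemma IsBump.tendsto_regKer_left :
    Tendsto (fun δ : ℝ => ∫ w : ℝ, w ⁻^ α / ((w : ℂ) ^ 2 - z ^ 2) * (((w ^ (β + 1) : ℝ) : ℂ) *
      cauchyT (sqrtLift β v) ((w : ℂ) ^ 2 + δ * I)) ∂halfVol) (𝓝[>] 0)
    (𝓝 (∫ w : ℝ, w ⁻^ α / ((w : ℂ) ^ 2 - z ^ 2) * (((w ^ (β + 1) : ℝ) : ℂ) *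
      (hilbertLip (sqrtLift β v) (w ^ 2) + I * (π * sqrtLift β v (w ^ 2)))) ∂halfVol)) := by
  obtain ⟨R, M, L, hG⟩ := hv.exists_isLipCpt_sqrtLift β
  obtain ⟨K, hK0, hK⟩ := hG.exists_odd_bound
  obtain ⟨K', hK0', hK'⟩ := hG.exists_poisP_bound
  obtain ⟨D, hD0, hD⟩ := exists_inv_sq_sub_bound (sq_notMem_of_im_ne_zero hz.ne')
  have hGi := hG.toIsBddCpt.integrable
  have hGd := Integrable.div_one_add_abs hGi
  have hsm : ∀ᶠ δ : ℝ in 𝓝[>] 0, 0 < δ ∧ δ ≤ 1 :=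
    eventually_mem_nhdsWithin.and (nhdsWithin_le_nhds (Iic_mem_nhds one_pos))
  have hcpt : ∀ w δ : ℝ, (w : ℂ) ^ 2 + δ * I = cpt (w ^ 2) δ := fun w δ => by simp [cpt]
  refine tendsto_integral_filter_of_dominated_convergence
    (fun w => (D * (K + K')) * (w ^ (2 * ((β - α) / 2) + 1) * ((1 + w ^ 2)⁻¹ * (1 + w ^ 2)⁻¹))) ?_ ?_
    ((integrable_rpow_mul_inv_sq (by grind) (by grind)).const_mul _) ?_
  · filter_upwards [hsm] with δ hδ
    refine (Measurable.aestronglyMeasurable (by fun_prop)).mul ((Measurable.aestronglyMeasurable (by fun_prop)).mul ?_)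
    simp_rw [hcpt]
    exact ((continuous_cauchyT_line hGi.1 hGd hδ.1.ne').comp (continuous_pow 2)).aestronglyMeasurable
  · filter_upwards [hsm] with δ hδ
    refine ae_halfVol_pos.mono fun w hw => ?_
    have h1 : ‖cauchyT (sqrtLift β v) (cpt (w ^ 2) δ)‖ ≤ (K + K') * (1 + w ^ 2)⁻¹ := by
      rw [cauchyT_cpt hGi.1 hGd hδ.1.ne']
      refine (norm_add_le _ _).trans ?_
      rw [norm_mul, norm_I, one_mul, add_mul]
      have h2 := hK _ (isOddKernel_conjKer hδ.1.ne') (w ^ 2)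
      have h3 := hK' δ hδ.1 hδ.2 (w ^ 2)
      rw [abs_of_nonneg (sq_nonneg w)] at h2 h3
      exact add_le_add h2 h3
    have h4 : w ^ (2 * ((β - α) / 2) + 1) = w ^ (-α) * w ^ (β + 1) := by
      rw [← rpow_add hw]; ring
    rw [hcpt, norm_mul, norm_mul, div_eq_mul_inv, norm_mul, norm_real, norm_real,
      norm_of_nonneg (by positivity), norm_of_nonneg (by positivity), h4]
    calc _ ≤ w ^ (-α) * (D * (1 + w ^ 2)⁻¹) * (w ^ (β + 1) * ((K + K') * (1 + w ^ 2)⁻¹)) := by bound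
      _ = _ := by ring
  · refine ae_of_all _ fun w => Tendsto.const_mul _ (Tendsto.const_mul _ ?_)
    refine (hG.tendsto_cauchyT (w ^ 2)).comp (tendsto_nhdsWithin_iff.2 ⟨?_, ?_⟩)
    · have : Continuous fun δ : ℝ => (w : ℂ) ^ 2 + δ * I := by fun_prop
      exact (this.tendsto' 0 _ (by simp)).mono_left nhdsWithin_le_nhds
    simp_all

include hv hz hz' in
lemma IsBump.tendsto_regKer_right (γ : ℝ) (c A E : ℂ) :
    Tendsto (fun δ : ℝ => ∫ y : ℝ, c * ((A - E * ((y : ℂ) ^ 2 - δ * I) ^ (γ : ℂ)) /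
          ((y : ℂ) ^ 2 - δ * I - z ^ 2)) * (y ⁻^ β * v y) ∂halfVol) (𝓝[>] 0)
    (𝓝 (∫ y : ℝ, c * ((A - E * ((y ^ (2 * γ) : ℝ) : ℂ)) / ((y : ℂ) ^ 2 - z ^ 2)) * (y ⁻^ β * v y) ∂halfVol)) := by
  have ha := hv.pos
  have hm : Measurable v := hv.smooth.continuous.measurable
  have hsm : ∀ᶠ δ : ℝ in 𝓝[>] 0, 0 < δ ∧ δ ≤ 1 :=
    eventually_mem_nhdsWithin.and (nhdsWithin_le_nhds (Iic_mem_nhds one_pos))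
  have hm0 : 0 < 2 * z.re * z.im := by positivity
  have hden : ∀ y δ : ℝ, 0 ≤ δ → 2 * z.re * z.im ≤ ‖(y : ℂ) ^ 2 - δ * I - z ^ 2‖ := fun y δ hδ => by
    have h1 := abs_im_le_norm ((y : ℂ) ^ 2 - δ * I - z ^ 2)
    have h2 : ((y : ℂ) ^ 2 - δ * I - z ^ 2).im = -(δ + 2 * z.re * z.im) := by
      rw [sub_im, sub_im, im_ofReal_sq, sq, mul_im]; simp; ring
    grind
  refine tendsto_integral_filter_of_dominated_convergence
    (fun y => ‖c‖ * ((‖A‖ + ‖E‖ * ((a ^ 2) ^ γ + (b ^ 2 + 1) ^ γ)) / (2 * z.re * z.im)) * ‖y ⁻^ β * v y‖) ?_ ?_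
    ((hv.integrable_weight β).norm.const_mul _) ?_
  · filter_upwards [hsm] with δ hδ
    fun_prop
  · filter_upwards [hsm] with δ hδ
    refine ae_halfVol_pos.mono fun y hy => ?_
    rw [norm_mul]
    by_cases hab : a ≤ y ∧ y ≤ b
    · rw [norm_mul, norm_div]
      have h1 : ‖((y : ℂ) ^ 2 - δ * I) ^ (γ : ℂ)‖ ≤ (a ^ 2) ^ γ + (b ^ 2 + 1) ^ γ := by
        rw [norm_cpow_real]
        have l1 : a ^ 2 ≤ ‖(y : ℂ) ^ 2 - δ * I‖ := by
          have := re_le_norm ((y : ℂ) ^ 2 - δ * I)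
          rw [← ofReal_pow] at this ⊢
          simp only [sub_re, ofReal_re, mul_re, I_re, ofReal_im, I_im] at this
          nlinarith
        have l2 : ‖(y : ℂ) ^ 2 - δ * I‖ ≤ b ^ 2 + 1 := by
          refine (norm_sub_le _ _).trans ?_
          rw [norm_pow, norm_real, norm_mul, norm_real, norm_I, norm_of_nonneg hy.le, norm_of_nonneg hδ.1.le]
          nlinarith
        rcases le_total 0 γ with hγ | hγ
        · exact (Real.rpow_le_rpow (norm_nonneg _) l2 hγ).trans (le_add_of_nonneg_left (by positivity))
        · exact (rpow_le_rpow_of_nonpos (by positivity) l1 hγ).trans (le_add_of_nonneg_right (by positivity))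
      have h2 : ‖A - E * ((y : ℂ) ^ 2 - δ * I) ^ (γ : ℂ)‖ ≤ ‖A‖ + ‖E‖ * ((a ^ 2) ^ γ + (b ^ 2 + 1) ^ γ) := by
        refine (norm_sub_le _ _).trans ?_
        rw [norm_mul]
        gcongr
      bound
    · have : v y = 0 := by
        rcases lt_or_ge y a with h | h
        · exact hv.left y h
        · exact hv.right y (by simp_all)
      simp [this]
  · refine ae_halfVol_pos.mono fun y hy => Tendsto.mul_const _ (Tendsto.const_mul _ ?_)
    have h0 : Tendsto (fun δ : ℝ => (y : ℂ) ^ 2 - δ * I) (𝓝[>] 0) (𝓝 ((y : ℂ) ^ 2)) := by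
      have : Continuous fun δ : ℝ => (y : ℂ) ^ 2 - δ * I := by fun_prop
      exact (this.tendsto' 0 _ (by simp)).mono_left nhdsWithin_le_nhds
    have h1 : ((y : ℂ) ^ 2) ^ (γ : ℂ) = ((y ^ (2 * γ) : ℝ) : ℂ) := by
      rw [← ofReal_pow, ← ofReal_cpow (by positivity), Real.rpow_mul hy.le, rpow_two]
    have h2 : ContinuousAt (fun Y => Y ^ (γ : ℂ)) ((y : ℂ) ^ 2) := by
      refine continuousAt_id.cpow continuousAt_const (Or.inl ?_)
      simp
      rw [← ofReal_pow, ofReal_re]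
      positivity
    rw [← h1]
    refine ((tendsto_const_nhds.sub ((h2.tendsto.comp h0).const_mul E))).div (h0.sub_const _) ?_
    have := hden y 0 le_rfl
    rw [ofReal_zero, zero_mul, sub_zero] at this
    exact norm_pos_iff.1 (hm0.trans_le this)

include hv hαβ hne hz hz' in
lemma IsBump.mop_bdry (hpq : p.HolderConjugate q) (hα : α ∈ Ioo (1 / q - 2) (1 / q))
    (hβ : β ∈ Ioo (1 / q - 2) (1 / q)) (h : IsBdry p β v S) :
    sin (π * ((β - α) / 2 : ℝ)) * (mop α S z + I * mop α v z) =
      exp (I * π * ((β - α) / 2 : ℝ)) * mop α v z -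
      exp (-(I * π * ((β - α) / 2 : ℝ))) * mop β v z := by
  have hsin := sin_pi_mul_ne_zero hαβ hne
  have hz0 : z ≠ 0 := fun h => by simp_all
  have l1 := hv.tendsto_regKer_left (α := α) hαβ hz
  have l2 := hv.tendsto_regKer_right (β := β) hz hz' ((β - α) / 2) (-(π / (2 * sin (π * ((β - α) / 2 : ℝ)))))
    (exp (-(I * π * ((β - α) / 2 : ℝ))) * z ^ (2 * ((β - α) / 2 : ℝ) : ℂ))
    (exp (I * π * ((β - α) / 2 : ℝ)))
  have hsm : ∀ᶠ δ : ℝ in 𝓝[>] 0, 0 < δ ∧ δ ≤ 1 :=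
    eventually_mem_nhdsWithin.and (nhdsWithin_le_nhds (Iic_mem_nhds one_pos))
  have key := tendsto_nhds_unique l1 (l2.congr' (hsm.mono fun δ hδ => (hv.integral_regKer hαβ hne hz hz' hδ.1 hδ.2).symm))
  have e1 : mop α S z + I * mop α v z = (2 / π : ℂ) * z ^ ((α : ℂ) + 1) * ((2 / π : ℂ) *
      ∫ w, w ⁻^ α / ((w : ℂ) ^ 2 - z ^ 2) * (((w ^ (β + 1) : ℝ) : ℂ) *
      (hilbertLip (sqrtLift β v) (w ^ 2) + I * (π * sqrtLift β v (w ^ 2)))) ∂halfVol) := by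
    rw [← mop_smul, ← mop_add hpq hα h.right (h.left.const_smul I) hz.ne', HarmonicMeasure.mop_eq, ← integral_const_mul (2 / π : ℂ)]
    congr 1
    refine integral_congr_ae ?_
    filter_upwards [hv.bdry_eq hpq hβ h] with w hw
    simp
    rw [hw]
    ring
  have e2 : ∫ y, -(π / (2 * sin (π * ((β - α) / 2 : ℝ)))) *
      ((exp (-(I * π * ((β - α) / 2 : ℝ))) * z ^ (2 * ((β - α) / 2 : ℝ) : ℂ) -
        exp (I * π * ((β - α) / 2 : ℝ)) * ((y ^ (2 * ((β - α) / 2)) : ℝ) : ℂ)) / ((y : ℂ) ^ 2 - z ^ 2)) *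
        (y ⁻^ β * v y) ∂halfVol =
      -(π / (2 * sin (π * ((β - α) / 2 : ℝ)))) *
      (exp (-(I * π * ((β - α) / 2 : ℝ))) * z ^ (2 * ((β - α) / 2 : ℝ) : ℂ) *
        (∫ y, y ⁻^ β * v y / ((y : ℂ) ^ 2 - z ^ 2) ∂halfVol) -
        exp (I * π * ((β - α) / 2 : ℝ)) *
        ∫ y, y ⁻^ α * v y / ((y : ℂ) ^ 2 - z ^ 2) ∂halfVol) := by
    have i1 := integrable_weight_div hpq hβ h.left (sq_notMem_of_im_ne_zero hz.ne')
    have i2 := integrable_weight_div hpq hα h.left (sq_notMem_of_im_ne_zero hz.ne')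
    rw [← integral_const_mul, ← integral_const_mul, ← integral_sub (i1.const_mul _) (i2.const_mul _), ← integral_const_mul]
    refine integral_congr_ae (ae_halfVol_pos.mono fun y hy => ?_)
    have h3 : y ^ (-α) = y ^ (2 * ((β - α) / 2)) * y ^ (-β) := by
      rw [← rpow_add hy]; ring
    simp
    rw [h3]
    push_cast
    ring
  have e3 : z ^ ((β : ℂ) + 1) = z ^ ((α : ℂ) + 1) * z ^ (2 * ((β - α) / 2 : ℝ) : ℂ) := by
    rw [← cpow_add _ _ hz0]; push_cast; ring
  rw [e1, key, e2, HarmonicMeasure.mop_eq α v, HarmonicMeasure.mop_eq β v, e3]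
  grind

end

include hpq hα hβ in
lemma mop_bdry_of_re_pos
 (h : IsBdry p β v S) (hz : 0 < z.im) (hz' : 0 < z.re) :
    sin (π * ((β - α) / 2 : ℝ)) * mop α S z =
      Complex.cos (π * ((β - α) / 2 : ℝ)) * mop α v z -
      exp (-(I * π * ((β - α) / 2 : ℝ))) * mop β v z := by
  have hγ : (β - α) / 2 ∈ Ioo (-1 : ℝ) 1 := by grind
  rcases eq_or_ne ((β - α) / 2) 0 with h0 | h0
  · have : β = α := by linarith
    rw [h0, this]; simp
  set γ := (β - α) / 2 with hγd
  have hbump : ∀ {g T : ℝ → ℂ} {a b : ℝ}, IsBump a b g → IsBdry p β g T → sin (π * γ) * mop α T z =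
      Complex.cos (π * γ) * mop α g z - exp (-(I * π * γ)) * mop β g z := by
    intro g T a b hg hT
    have h1 := hg.mop_bdry hγ h0 hz hz' hpq hα hβ hT
    have h2 : exp (I * π * γ) = Complex.cos (π * γ) + sin (π * γ) * I := by
      rw [← exp_mul_I]; ring
    grind
  obtain ⟨A, hA⟩ := exists_mop_apply_bound hpq hα hz.ne'
  obtain ⟨B, hB⟩ := exists_mop_apply_bound hpq hβ hz.ne'
  obtain ⟨C, hC⟩ := exists_isBdry_bound hpq hβ
  set s := sin (π * γ)
  set c := Complex.cos (π * γ)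
  set e := exp (-(I * π * γ))
  have hle : ∀ n : ℕ, ‖s * mop α S z - (c * mop α v z - e * mop β v z)‖ₑ ≤
      (‖s‖ₑ * (A * C) + (‖c‖ₑ * A + ‖e‖ₑ * B)) * (n : ℝ≥0∞)⁻¹ := by
    intro n
    obtain ⟨g, a, b, hg, hgv⟩ := exists_isBump_eLpNorm_sub_le hpq h.left (ε := (n : ℝ≥0∞)⁻¹) (by simp)
    obtain ⟨T, hT⟩ := exists_isBdry hpq hβ (hg.memLp 𝔭)
    have hd := h.sub hpq hβ hT
    have e1 : s * mop α S z - (c * mop α v z - e * mop β v z) =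
        s * mop α (S - T) z - (c * mop α (v - g) z - e * mop β (v - g) z) := by
      rw [mop_sub hpq hα h.right hT.right hz.ne', mop_sub hpq hα h.left hT.left hz.ne', mop_sub hpq hβ h.left hT.left hz.ne']
      grind
    rw [e1]
    calc _ ≤ ‖s‖ₑ * ‖mop α (S - T) z‖ₑ + (‖c‖ₑ * ‖mop α (v - g) z‖ₑ + ‖e‖ₑ * ‖mop β (v - g) z‖ₑ) := by
          refine enorm_sub_le.trans (add_le_add (enorm_mul _ _).le (enorm_sub_le.trans ?_))
          simp
      _ ≤ ‖s‖ₑ * (A * (C * (n : ℝ≥0∞)⁻¹)) + (‖c‖ₑ * (A * (n : ℝ≥0∞)⁻¹) + ‖e‖ₑ * (B * (n : ℝ≥0∞)⁻¹)) := by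
          gcongr
          · exact (hA _ hd.right).trans (by gcongr; exact (hC _ _ hd).trans (by gcongr))
          · exact (hA _ hd.left).trans (by gcongr)
          · exact (hB _ hd.left).trans (by gcongr)
      _ = _ := by ring
  have h3 := ge_of_tendsto' (ENNReal.Tendsto.const_mul ENNReal.tendsto_inv_nat_nhds_zero
    (a := ‖s‖ₑ * (A * C) + (‖c‖ₑ * A + ‖e‖ₑ * B)) (Or.inr (by finiteness))) hle
  rw [mul_zero, nonpos_iff_eq_zero, enorm_eq_zero, sub_eq_zero] at h3
  exact h3

include hpq hα hβ in
/-- The operators `mop` compose with their boundary values like the holomorphic functions they represent. -/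
lemma mop_bdry
 (h : IsBdry p β v S) (hz : 0 < z.im) (hz' : 0 ≤ z.re) :
    sin (π * ((β - α) / 2 : ℝ)) * mop α S z =
      Complex.cos (π * ((β - α) / 2 : ℝ)) * mop α v z -
      exp (-(I * π * ((β - α) / 2 : ℝ))) * mop β v z := by
  have hzc : z = cpt z.re z.im := by apply Complex.ext <;> simp
  rw [hzc]
  have hcl : IsClosed {x : ℝ | sin (π * ((β - α) / 2 : ℝ)) * mop α S (cpt x z.im) =
      Complex.cos (π * ((β - α) / 2 : ℝ)) * mop α v (cpt x z.im) -
      exp (-(I * π * ((β - α) / 2 : ℝ))) * mop β v (cpt x z.im)} := by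
    have c1 := continuous_mop_line hpq hα h.right hz.ne'
    have c2 := continuous_mop_line hpq hα h.left hz.ne'
    have c3 := continuous_mop_line hpq hβ h.left hz.ne'
    exact isClosed_eq (by fun_prop) (by fun_prop)
  have hsub : closure (Ioi (0 : ℝ)) ⊆ _ := closure_minimal (fun x hx => mop_bdry_of_re_pos hpq hα hβ h (z := cpt x z.im)
    (by simpa) (by simpa using hx)) hcl
  rw [closure_Ioi] at hsub
  exact hsub hz'

section HalfLine

lemma one_add_mul_I_ne_zero (k : ℝ) : 1 + (k : ℂ) * I ≠ 0 := fun h => by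
  have := congrArg re h; simp at this

lemma one_sub_mul_I_ne_zero (k : ℝ) : 1 - (k : ℂ) * I ≠ 0 := fun h => by
  have := congrArg re h; simp at this

lemma exp_eq_cos_mul (hc : cos a ≠ 0) (hk : tan a = k) :
    exp (a * I) = cos a * (1 + k * I) ∧ Real.sin a = k * cos a := by
  have hs : Real.sin a = k * cos a := by
    rw [← hk, Real.tan_eq_sin_div_cos, div_mul_cancel₀ _ hc]
  refine ⟨?_, hs⟩
  rw [exp_mul_I, ← ofReal_cos, ← ofReal_sin, hs]
  push_cast
  ring

/-- The relation of `mop α` and `mop 0`, for boundary values of `mop 0`. -/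
def transferSign (z : ℂ) : ℂ := if 0 < z.im then I else -I

include hpq

include hα in
lemma mop_of_bdry_zero (hc : cos (π * α / 2) ≠ 0)
    (hk : tan (π * α / 2) = k) (h : IsBdry p 0 ψ S) (hz : z.im ≠ 0) (hz' : 0 ≤ z.re) :
    mop α (ψ + (k : ℂ) • S) z = (1 + k * transferSign z) * mop 0 ψ z := by
  have h0 := zero_mem_range hpq
  obtain ⟨he, hs⟩ := exp_eq_cos_mul hc hk
  have hcC : (cos (π * α / 2) : ℂ) ≠ 0 := by exact_mod_cast hc
  have up : ∀ {ψ S : ℝ → ℂ}, IsBdry p 0 ψ S → ∀ {z : ℂ}, 0 < z.im → 0 ≤ z.re →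
      mop α (ψ + (k : ℂ) • S) z = (1 + k * I) * mop 0 ψ z := by
    intro ψ S h z hz hz'
    have h1 := mop_bdry hpq hα h0 h hz hz'
    rw [show ((0 - α) / 2 : ℝ) = -(α / 2) by ring] at h1
    have e1 : (π : ℂ) * ((-(α / 2) : ℝ) : ℂ) = -((π * α / 2 : ℝ) : ℂ) := by push_cast; ring
    have e2 : -(I * π * ((-(α / 2) : ℝ) : ℂ)) = ((π * α / 2 : ℝ) : ℂ) * I := by push_cast; ring
    rw [e1, e2, Complex.sin_neg, Complex.cos_neg, he, ← ofReal_sin, ← ofReal_cos, hs] at h1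
    rw [mop_add hpq hα h.left (h.right.const_smul _) hz.ne', mop_smul]
    apply mul_left_cancel₀ hcC
    push_cast at h1 ⊢
    grind
  rcases lt_or_gt_of_ne hz with hz0 | hz0
  · have h1 := up h.conj (z := star z) (by simpa using hz0) (by simpa using hz')
    have h2 := congrArg star h1
    rw [transferSign, if_neg (not_lt.2 hz0.le)]
    have hz1 : (star z).im ≠ 0 := by simpa using hz
    rw [conj_mop _ hz1, star_mul', conj_mop _ hz1, star_star] at h2
    refine Eq.trans ?_ (h2.trans ?_)
    · congr 1
      ext y
      simp
    · simp
  · rw [transferSign, if_pos hz0]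
    simp_all

lemma mop_neg_one_of_bdry_zero (h : IsBdry p 0 ψ S) (hz : z.im ≠ 0) (hz' : 0 ≤ z.re) :
    mop (-1) S z = transferSign z * mop 0 ψ z := by
  have h0 := zero_mem_range hpq
  have h1 := neg_one_mem_range hpq
  have up : ∀ {ψ S : ℝ → ℂ}, IsBdry p 0 ψ S → ∀ {z : ℂ}, 0 < z.im → 0 ≤ z.re →
      mop (-1) S z = I * mop 0 ψ z := by
    intro ψ S h z hz hz'
    have h2 := mop_bdry hpq h1 h0 h hz hz'
    have e1 : (π : ℂ) * (((0 - -1) / 2 : ℝ) : ℂ) = π / 2 := by push_cast; ring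
    have e2 : -(I * π * (((0 - -1) / 2 : ℝ) : ℂ)) = -(π / 2 * I) := by push_cast; ring
    rw [e1, e2, Complex.sin_pi_div_two, Complex.cos_pi_div_two, Complex.exp_neg, Complex.exp_pi_div_two_mul_I, inv_I] at h2
    linear_combination h2
  rcases lt_or_gt_of_ne hz with hz0 | hz0
  · have h1 := up h.conj (z := star z) (by simpa using hz0) (by simpa using hz')
    have h2 := congrArg star h1
    rw [transferSign, if_neg (not_lt.2 hz0.le)]
    have hz1 : (star z).im ≠ 0 := by simpa using hz
    rw [conj_mop _ hz1, star_mul', conj_mop _ hz1, star_star] at h2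
    simp_all
  · rw [transferSign, if_pos hz0]
    grind

include hα in
lemma mop_zero_of_bdry (hc : cos (π * α / 2) ≠ 0)
    (hk : tan (π * α / 2) = k) (h : IsBdry p α u S) (hz : z.im ≠ 0) (hz' : 0 ≤ z.re) :
    mop 0 (u - (k : ℂ) • S) z = (1 - k * transferSign z) * mop α u z := by
  have h0 := zero_mem_range hpq
  obtain ⟨he, hs⟩ := exp_eq_cos_mul (a := -(π * α / 2)) (k := -k) (by simpa using hc) (by simpa using hk)
  rw [Real.cos_neg] at he hs
  rw [Real.sin_neg] at hs
  have hcC : (cos (π * α / 2) : ℂ) ≠ 0 := by exact_mod_cast hc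
  have up : ∀ {u S : ℝ → ℂ}, IsBdry p α u S → ∀ {z : ℂ}, 0 < z.im → 0 ≤ z.re →
      mop 0 (u - (k : ℂ) • S) z = (1 - k * I) * mop α u z := by
    intro ψ S h z hz hz'
    have h1 := mop_bdry hpq h0 hα h hz hz'
    have e1 : (π : ℂ) * (((α - 0) / 2 : ℝ) : ℂ) = ((π * α / 2 : ℝ) : ℂ) := by push_cast; ring
    have e2 : -(I * π * (((α - 0) / 2 : ℝ) : ℂ)) = ((-(π * α / 2) : ℝ) : ℂ) * I := by push_cast; ring
    have hs' : Real.sin (π * α / 2) = k * cos (π * α / 2) := by linarith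
    rw [e1, e2, he, ← ofReal_sin, ← ofReal_cos, hs'] at h1
    rw [mop_sub hpq h0 h.left (h.right.const_smul _) hz.ne', mop_smul]
    apply mul_left_cancel₀ hcC
    push_cast at h1 ⊢
    grind
  rcases lt_or_gt_of_ne hz with hz0 | hz0
  · have h1 := up h.conj (z := star z) (by simpa using hz0) (by simpa using hz')
    have h2 := congrArg star h1
    rw [transferSign, if_neg (not_lt.2 hz0.le)]
    have hz1 : (star z).im ≠ 0 := by simpa using hz
    rw [conj_mop _ hz1, star_mul', conj_mop _ hz1, star_star] at h2
    refine Eq.trans ?_ (h2.trans ?_)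
    · congr 1
      ext y
      simp
    · simp
  · rw [transferSign, if_pos hz0]
    grind

omit hpq in
lemma transferSign_cpt (hσ : σ = 1 ∨ σ = -1) (ht : 0 < t) :
    transferSign (cpt x (σ * t)) = σ * I := by
  rcases hσ with rfl | rfl
  · simp [transferSign, ht]
  · simp [transferSign, ht.le]

include hα in
/-- The boundary equation on the half line has at most one solution. -/
lemma ae_eq_zero_of_bdry (hc : cos (π * α / 2) ≠ 0)
    (hk : tan (π * α / 2) = k) (h : IsBdry p 0 ψ S)
    (h0 : ψ + (k : ℂ) • S =ᵐ[halfVol] 0) : ψ =ᵐ[halfVol] 0 := by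
  have hm : ∀ x t : ℝ, 0 < x → t ≠ 0 → mop 0 ψ (cpt x t) = 0 := by
    intro x t hx ht
    have h1 := mop_of_bdry_zero hpq hα hc hk h (z := cpt x t) (by simpa) (by simpa using hx.le)
    rw [mop_congr_ae h0] at h1
    have h2 : mop α (0 : ℝ → ℂ) (cpt x t) = 0 := by simp [mop]
    rw [h2, zero_eq_mul] at h1
    refine h1.resolve_left ?_
    unfold transferSign
    split_ifs
    · exact one_add_mul_I_ne_zero k
    · rw [mul_neg, ← sub_eq_add_neg]; exact one_sub_mul_I_ne_zero k
  have hb : ∀ σ : ℝ, σ = 1 ∨ σ = -1 → (fun x => S x + σ * I * ψ x) =ᵐ[halfVol] 0 := by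
    intro σ hσ
    have hσ0 : σ ≠ 0 := by grind
    have h3 := h.lim σ hσ
    have h4 : (fun t : ℝ => eLpNorm (fun x => mop 0 ψ (cpt x (σ * t)) - (S x + σ * I * ψ x)) 𝔭 halfVol)
        =ᶠ[𝓝[>] 0] fun _ => eLpNorm (fun x => S x + σ * I * ψ x) 𝔭 halfVol := by
      filter_upwards [self_mem_nhdsWithin] with t ht
      refine eLpNorm_congr_norm_ae (ae_halfVol_pos.mono fun x hx => ?_)
      rw [hm x _ hx (mul_ne_zero hσ0 (ne_of_gt ht)), zero_sub, norm_neg]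
    have h5 := tendsto_nhds_unique (tendsto_const_nhds.congr' h4.symm) h3
    have hm : AEStronglyMeasurable (fun x => S x + σ * I * ψ x) halfVol := h.right.1.add (h.left.1.const_mul _)
    exact (eLpNorm_eq_zero_iff hm (by simpa using hpq.pos)).1 h5
  filter_upwards [hb 1 (Or.inl rfl), hb (-1) (Or.inr rfl)] with x h1 h2
  push_cast at h1 h2
  have : I * ψ x = 0 := by grind
  simpa using this

include hα in
/-- The boundary equation on the half line has a solution. -/
lemma exists_bdry_solution (hc : cos (π * α / 2) ≠ 0)
    (hk : tan (π * α / 2) = k) (hu : MemLp u 𝔭 halfVol) :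
    ∃ ψ S, IsBdry p 0 ψ S ∧ u = (1 / 2 : ℂ) • (ψ + (k : ℂ) • S) := by
  obtain ⟨T, hT⟩ := exists_isBdry hpq hα hu
  have hk0 : (1 + (k : ℂ) ^ 2) ≠ 0 := by
    have : (1 + k ^ 2 : ℝ) ≠ 0 := by positivity
    exact_mod_cast this
  have hψ : MemLp (u - (k : ℂ) • T) 𝔭 halfVol := hu.sub (hT.right.const_smul _)
  refine ⟨(2 / (1 + (k : ℂ) ^ 2)) • (u - (k : ℂ) • T), (2 / (1 + (k : ℂ) ^ 2)) • (T + (k : ℂ) • u), ?_, ?_⟩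
  · refine IsBdry.const_smul ⟨hψ, hT.right.add (hu.const_smul _), fun σ hσ => ?_⟩ _
    have hσ0 : σ ≠ 0 := by grind
    have hσ2 : (σ : ℂ) ^ 2 = 1 := by bound
    have l := ENNReal.Tendsto.const_mul (hT.lim σ hσ) (a := ‖(1 - k * (σ * I) : ℂ)‖ₑ) (Or.inr enorm_ne_top)
    rw [mul_zero] at l
    refine l.congr' ?_
    filter_upwards [self_mem_nhdsWithin] with t ht
    rw [← eLpNorm_const_smul]
    refine eLpNorm_congr_ae (ae_halfVol_pos.mono fun x hx => ?_)
    have e := mop_zero_of_bdry hpq hα hc hk hT (z := cpt x (σ * t)) (by simpa using ⟨hσ0, ne_of_gt ht⟩) (by simpa using hx.le)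
    rw [transferSign_cpt hσ ht] at e
    simp only [Pi.smul_apply, Pi.sub_apply, Pi.add_apply, smul_eq_mul]
    rw [e]
    linear_combination (k * u x) * (I ^ 2 * hσ2 + I_sq)
  · ext x
    simp
    grind

end HalfLine

section Divergence

variable {W : ℝ × ℝ → ℂ} (hW : ContDiff ℝ 1 W) (hc : HasCompactSupport W)

include hW hc

lemma integrable_fderiv_apply (v : ℝ × ℝ) : Integrable (fun z => fderiv ℝ W z v) :=
  ((hW.continuous_fderiv one_ne_zero).clm_apply continuous_const).integrable_of_hasCompactSupport (hc.fderiv_apply ℝ v)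

omit hc in
lemma deriv_slice_fst (t x : ℝ) : deriv (fun t => W (t, x)) t = fderiv ℝ W (t, x) (1, 0) := by
  have h1 : HasFDerivAt W (fderiv ℝ W (t, x)) (t, x) := (hW.differentiable one_ne_zero (t, x)).hasFDerivAt
  have h2 : HasDerivAt (fun t => (t, x)) (1, 0) t := (hasDerivAt_id t).prodMk (hasDerivAt_const t x)
  exact (h1.comp_hasDerivAt t h2).deriv

omit hc in
lemma deriv_slice_snd (t x : ℝ) : deriv (fun x => W (t, x)) x = fderiv ℝ W (t, x) (0, 1) := by
  have h1 : HasFDerivAt W (fderiv ℝ W (t, x)) (t, x) := (hW.differentiable one_ne_zero (t, x)).hasFDerivAt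
  have h2 : HasDerivAt (fun x => (t, x)) (0, 1) x := (hasDerivAt_const x t).prodMk (hasDerivAt_id x)
  exact (h1.comp_hasDerivAt x h2).deriv

omit hW in
lemma hasCompactSupport_slice_fst (x : ℝ) : HasCompactSupport fun t => W (t, x) := by
  obtain ⟨R, hR⟩ := hc.isCompact.isBounded.subset_closedBall 0
  refine HasCompactSupport.intro (isCompact_closedBall 0 R) fun t ht => ?_
  by_contra h
  have := hR (subset_tsupport W (Function.mem_support.2 h))
  exact ht (by simp_all)

omit hW in
lemma hasCompactSupport_slice_snd (t : ℝ) : HasCompactSupport fun x => W (t, x) := by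
  obtain ⟨R, hR⟩ := hc.isCompact.isBounded.subset_closedBall 0
  refine HasCompactSupport.intro (isCompact_closedBall 0 R) fun x hx => ?_
  by_contra h
  have := hR (subset_tsupport W (Function.mem_support.2 h))
  exact hx (by simp_all)

omit hW hc in
lemma restrict_snd (s : Set ℝ) :
    (volume : Measure (ℝ × ℝ)).restrict {z | z.2 ∈ s} = volume.prod (volume.restrict s) := by
  have : {z : ℝ × ℝ | z.2 ∈ s} = univ ×ˢ s := by ext z; simp
  rw [this, volume_eq_prod, ← prod_restrict, restrict_univ]

lemma setIntegral_fderiv_fst (s : Set ℝ) : ∫ z in {z : ℝ × ℝ | z.2 ∈ s}, fderiv ℝ W z (1, 0) = 0 := by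
  have hi := (integrable_fderiv_apply hW hc (1, 0)).integrableOn (s := {z : ℝ × ℝ | z.2 ∈ s})
  rw [IntegrableOn, restrict_snd] at hi
  rw [restrict_snd, integral_prod_symm _ hi]
  refine integral_eq_zero_of_ae (ae_of_all _ fun x => ?_)
  have hs : ContDiff ℝ 1 fun t => W (t, x) := hW.comp (by fun_prop)
  have h1 := HasCompactSupport.integral_Ioi_deriv_eq hs (hasCompactSupport_slice_fst hc x) 0
  have h2 := HasCompactSupport.integral_Iic_deriv_eq hs (hasCompactSupport_slice_fst hc x) 0
  have h3 : Integrable (deriv fun t => W (t, x)) :=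
    (hs.continuous_deriv le_rfl).integrable_of_hasCompactSupport (hasCompactSupport_slice_fst hc x).deriv
  have h4 := integral_Iic_add_Ioi (b := 0) h3.integrableOn h3.integrableOn
  rw [h1, h2, add_neg_cancel] at h4
  simp
  rw [h4]
  exact integral_congr_ae (.of_forall fun t => (deriv_slice_fst hW t x).symm)

lemma setIntegral_fderiv_snd_Ioi :
    ∫ z in {z : ℝ × ℝ | z.2 ∈ Ioi 0}, fderiv ℝ W z (0, 1) = -∫ t, W (t, 0) := by
  have hi := (integrable_fderiv_apply hW hc (0, 1)).integrableOn (s := {z : ℝ × ℝ | z.2 ∈ Ioi 0})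
  rw [IntegrableOn, restrict_snd] at hi
  rw [restrict_snd, integral_prod _ hi, ← integral_neg]
  refine integral_congr_ae (.of_forall fun t => ?_)
  have hs : ContDiff ℝ 1 fun x => W (t, x) := hW.comp (by fun_prop)
  simp
  rw [← HasCompactSupport.integral_Ioi_deriv_eq hs (hasCompactSupport_slice_snd hc t) 0]
  exact integral_congr_ae (.of_forall fun x => (deriv_slice_snd hW t x).symm)

lemma setIntegral_fderiv_snd_Iic :
    ∫ z in {z : ℝ × ℝ | z.2 ∈ Iic 0}, fderiv ℝ W z (0, 1) = ∫ t, W (t, 0) := by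
  have hi := (integrable_fderiv_apply hW hc (0, 1)).integrableOn (s := {z : ℝ × ℝ | z.2 ∈ Iic 0})
  rw [IntegrableOn, restrict_snd] at hi
  rw [restrict_snd, integral_prod _ hi]
  refine integral_congr_ae (.of_forall fun t => ?_)
  have hs : ContDiff ℝ 1 fun x => W (t, x) := hW.comp (by fun_prop)
  simp
  rw [← HasCompactSupport.integral_Iic_deriv_eq hs (hasCompactSupport_slice_snd hc t) 0]
  exact integral_congr_ae (.of_forall fun x => (deriv_slice_snd hW t x).symm)

end Divergence

lemma measurableSet_snd_pos : MeasurableSet {z : ℝ × ℝ | z.2 ∈ Ioi 0} := measurable_snd measurableSet_Ioi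

section Glue

variable {Ω : Set (ℝ × ℝ)} (hΩ : IsOpen Ω) {φ : ℝ × ℝ → ℂ} (hφ : IsTest Ω φ)

include hφ in
lemma IsTest.eq_zero {z : ℝ × ℝ} (hz : z ∉ Ω) : φ z = 0 ∧ grad φ z = 0 := by
  have h1 : z ∉ tsupport φ := fun h => hz (hφ.2.2 h)
  have h2 : fderiv ℝ φ z = 0 := by
    by_contra h
    exact h1 (support_fderiv_subset ℝ (by simp_all))
  refine ⟨image_eq_zero_of_notMem_tsupport h1, ?_⟩
  ext i
  fin_cases i <;> simp [grad, h2]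

include hΩ hφ in
lemma IsTest.contDiff_mul_of_le {n : WithTop ℕ∞} (hn : n ≤ (⊤ : ℕ∞)) {v : ℝ × ℝ → ℂ} (hv : ContDiffOn ℝ n v Ω) : ContDiff ℝ n (fun z => v z * φ z) := by
  rw [contDiff_iff_contDiffAt]
  intro z
  by_cases hz : z ∈ Ω
  · exact (hv.contDiffAt (hΩ.mem_nhds hz)).mul (hφ.1.of_le hn).contDiffAt
  · have h1 : z ∉ tsupport φ := fun h => hz (hφ.2.2 h)
    refine (contDiffAt_const (c := (0 : ℂ))).congr_of_eventuallyEq ?_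
    filter_upwards [notMem_tsupport_iff_eventuallyEq.1 h1] with w hw
    rw [hw]; simp

include hΩ hφ in
lemma IsTest.contDiff_mul {v : ℝ × ℝ → ℂ} (hv : ContDiffOn ℝ 1 v Ω) : ContDiff ℝ 1 (fun z => v z * φ z) :=
  hφ.contDiff_mul_of_le hΩ (by simp) hv

include hΩ hφ in
lemma IsTest.fderiv_mul {v : ℝ × ℝ → ℂ} (hv : ContDiffOn ℝ 1 v Ω) {z : ℝ × ℝ} (hz : z ∈ Ω) (e : ℝ × ℝ) :
    fderiv ℝ (fun z => v z * φ z) z e = fderiv ℝ v z e * φ z + v z * fderiv ℝ φ z e := by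
  have h1 := (hv.contDiffAt (hΩ.mem_nhds hz)).differentiableAt one_ne_zero
  have h2 := (hφ.1.differentiable (by simp) z)
  rw [fderiv_fun_mul h1 h2]
  simp
  ring

/-- A piecewise smooth vector field whose normal components match on the line `x = 0`. -/
lemma integral_glue (hΩ : IsOpen Ω) (hφ : IsTest Ω φ) {a b a' b' d d' : ℝ × ℝ → ℂ} (ha : ContDiffOn ℝ 1 a Ω)
    (hb : ContDiffOn ℝ 1 b Ω) (ha' : ContDiffOn ℝ 1 a' Ω) (hb' : ContDiffOn ℝ 1 b' Ω)
    (hd : ∀ z ∈ Ω, fderiv ℝ a z (1, 0) + fderiv ℝ b z (0, 1) = d z)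
    (hd' : ∀ z ∈ Ω, fderiv ℝ a' z (1, 0) + fderiv ℝ b' z (0, 1) = d' z)
    (hm : ∀ t, (t, 0) ∈ Ω → b (t, 0) = b' (t, 0)) :
    ∫ z in Ω, (if 0 < z.2 then a z * grad φ z 0 + b z * grad φ z 1 + d z * φ z
      else a' z * grad φ z 0 + b' z * grad φ z 1 + d' z * φ z) = 0 := by
  have key : ∀ {a b d : ℝ × ℝ → ℂ}, ContDiffOn ℝ 1 a Ω → ContDiffOn ℝ 1 b Ω →
      (∀ z ∈ Ω, fderiv ℝ a z (1, 0) + fderiv ℝ b z (0, 1) = d z) → ∀ z,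
      a z * grad φ z 0 + b z * grad φ z 1 + d z * φ z =
        fderiv ℝ (fun z => a z * φ z) z (1, 0) + fderiv ℝ (fun z => b z * φ z) z (0, 1) := by
    intro a b d ha hb hd z
    by_cases hz : z ∈ Ω
    · rw [hφ.fderiv_mul hΩ ha hz, hφ.fderiv_mul hΩ hb hz, ← hd z hz]
      simp only [grad, cons_val_zero, cons_val_one]
      ring
    · obtain ⟨h1, h2⟩ := hφ.eq_zero hz
      have h3 : z ∉ tsupport φ := fun h => hz (hφ.2.2 h)
      have h4 : ∀ a : ℝ × ℝ → ℂ, fderiv ℝ (fun z => a z * φ z) z = 0 := fun a => by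
        have : (fun z => a z * φ z) =ᶠ[𝓝 z] fun _ => 0 := by
          filter_upwards [notMem_tsupport_iff_eventuallyEq.1 h3] with w hw
          rw [hw]; simp
        rw [this.fderiv_eq]; simp
      simp_all
  have hcs : ∀ a : ℝ × ℝ → ℂ, HasCompactSupport fun z => a z * φ z := fun a => hφ.2.1.mul_left
  have e : ∀ z, (if 0 < z.2 then a z * grad φ z 0 + b z * grad φ z 1 + d z * φ z
      else a' z * grad φ z 0 + b' z * grad φ z 1 + d' z * φ z) =
      {z : ℝ × ℝ | z.2 ∈ Ioi 0}.piecewise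
        (fun z => fderiv ℝ (fun z => a z * φ z) z (1, 0) + fderiv ℝ (fun z => b z * φ z) z (0, 1))
        (fun z => fderiv ℝ (fun z => a' z * φ z) z (1, 0) + fderiv ℝ (fun z => b' z * φ z) z (0, 1)) z := by
    intro z
    by_cases hz : 0 < z.2
    · rw [if_pos hz, piecewise_eq_of_mem _ _ _ (by grind), key ha hb hd]
    · rw [if_neg hz, piecewise_eq_of_notMem _ _ _ (by grind), key ha' hb' hd']
  have h0 : ∀ z ∉ Ω, (if 0 < z.2 then a z * grad φ z 0 + b z * grad φ z 1 + d z * φ z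
      else a' z * grad φ z 0 + b' z * grad φ z 1 + d' z * φ z) = 0 := fun z hz => by
    obtain ⟨h1, h2⟩ := hφ.eq_zero hz
    rw [h1, h2]; simp
  rw [setIntegral_eq_integral_of_forall_compl_eq_zero h0]
  simp_rw [e]
  have i1 := fun a (ha : ContDiffOn ℝ 1 a Ω) e => integrable_fderiv_apply (hφ.contDiff_mul hΩ ha) (hcs a) e
  have hcompl : {z : ℝ × ℝ | z.2 ∈ Ioi 0}ᶜ = {z : ℝ × ℝ | z.2 ∈ Iic 0} := by ext z; simp
  have i2 : ∀ {a b : ℝ × ℝ → ℂ}, ContDiffOn ℝ 1 a Ω → ContDiffOn ℝ 1 b Ω → Integrable (fun z =>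
      fderiv ℝ (fun z => a z * φ z) z (1, 0) + fderiv ℝ (fun z => b z * φ z) z (0, 1)) := by fun_prop
  rw [integral_piecewise measurableSet_snd_pos (i2 ha hb).integrableOn (i2 ha' hb').integrableOn, hcompl,
    integral_add (i1 a ha _).integrableOn (i1 b hb _).integrableOn,
    integral_add (i1 a' ha' _).integrableOn (i1 b' hb' _).integrableOn,
    setIntegral_fderiv_fst (hφ.contDiff_mul hΩ ha) (hcs a), setIntegral_fderiv_fst (hφ.contDiff_mul hΩ ha') (hcs a'),
    setIntegral_fderiv_snd_Ioi (hφ.contDiff_mul hΩ hb) (hcs b), setIntegral_fderiv_snd_Iic (hφ.contDiff_mul hΩ hb') (hcs b')]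
  have : ∀ t, b (t, 0) * φ (t, 0) = b' (t, 0) * φ (t, 0) := fun t => by
    by_cases ht : ((t, 0) : ℝ × ℝ) ∈ Ω
    · rw [hm t ht]
    · rw [(hφ.eq_zero ht).1]; simp
  simp_rw [this]
  ring

/-- The function that equals `f` for `x > 0` and `g` for `x ≤ 0`. -/
def glue {E : Type*} (f g : ℝ × ℝ → E) (z : ℝ × ℝ) : E := if 0 < z.2 then f z else g z

lemma glue_eq {E : Type*} (f g : ℝ × ℝ → E) : glue f g = {z : ℝ × ℝ | z.2 ∈ Ioi 0}.piecewise f g := by bound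

lemma locallyIntegrableOn_glue {E : Type*} [NormedAddCommGroup E] (hΩ : IsOpen Ω) {f g : ℝ × ℝ → E} (hf : ContinuousOn f Ω)
    (hg : ContinuousOn g Ω) : LocallyIntegrableOn (glue f g) Ω := by
  rw [locallyIntegrableOn_iff hΩ.isLocallyClosed]
  intro K hK hKc
  rw [glue_eq]
  exact Integrable.piecewise measurableSet_snd_pos ((hf.mono hK).integrableOn_compact hKc).integrableOn
    ((hg.mono hK).integrableOn_compact hKc).integrableOn

lemma memLp_glue {f g : ℝ × ℝ → Fin 2 → ℂ} (hf : ContinuousOn f Ω)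
    (hg : ContinuousOn g Ω) (hKc : IsCompact K) (hK : K ⊆ Ω) (P : ℝ≥0∞) :
    MemLp (glue f g) P (volume.restrict K) := by
  have key : ∀ {f : ℝ × ℝ → Fin 2 → ℂ}, ContinuousOn f Ω → MemLp f P (volume.restrict K) := by
    intro f hf
    obtain ⟨C, hC⟩ := hKc.exists_bound_of_continuousOn (hf.mono hK)
    have : IsFiniteMeasure (volume.restrict K : Measure (ℝ × ℝ)) := ⟨by simpa using hKc.measure_lt_top⟩
    exact MemLp.of_bound ((hf.mono hK).aestronglyMeasurable hKc.measurableSet) C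
      ((ae_restrict_mem hKc.measurableSet).mono fun z hz => hC z hz)
  rw [glue_eq]
  exact MemLp.piecewise measurableSet_snd_pos ((key hf).restrict _) ((key hg).restrict _)

lemma ae_snd_ne_zero : ∀ᵐ z : ℝ × ℝ, z.2 ≠ 0 := by
  exact Measure.quasiMeasurePreserving_snd.ae (p := fun x : ℝ => x ≠ 0) (by simp [ae_iff])

end Glue

/-- Functions that are holomorphic off the real axis. -/
def HolOff (p : ℂ → ℂ) : Prop := ∀ ζ, ζ.im ≠ 0 → DifferentiableAt ℂ p ζ

lemma isOpen_im_ne_zero : IsOpen {ζ : ℂ | ζ.im ≠ 0} := isOpen_ne_fun continuous_im continuous_const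

lemma HolOff.differentiableOn {p : ℂ → ℂ} (hp : HolOff p) : DifferentiableOn ℂ p {ζ | ζ.im ≠ 0} :=
  fun ζ hζ => (hp ζ hζ).differentiableWithinAt

lemma HolOff.deriv {p : ℂ → ℂ} (hp : HolOff p) : HolOff (deriv p) := fun _ hζ =>
  (hp.differentiableOn.deriv isOpen_im_ne_zero).differentiableAt (isOpen_im_ne_zero.mem_nhds hζ)

lemma HolOff.add {p : ℂ → ℂ} (hp : HolOff p) (hm : HolOff m) : HolOff (p + m) := fun ζ hζ => (hp ζ hζ).add (hm ζ hζ)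

lemma HolOff.const_mul {p : ℂ → ℂ} (hp : HolOff p) (c : ℂ) : HolOff (fun ζ => c * p ζ) := fun ζ hζ => (hp ζ hζ).const_mul c

lemma HolOff.comp_neg {p : ℂ → ℂ} (hp : HolOff p) : HolOff (fun ζ => p (-ζ)) := fun ζ hζ =>
  DifferentiableAt.comp ζ (hp (-ζ) (by simpa)) differentiable_neg.differentiableAt

/-- The first component of the field generated by `p` and `m`. -/
def hf0 (p m : ℂ → ℂ) (z : ℝ × ℝ) : ℂ := p (cpt z.2 z.1) + m (cpt z.2 (-z.1))

/-- The second component of the field generated by `p` and `m`: a harmonic conjugate. -/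
def hf1 (p m : ℂ → ℂ) (z : ℝ × ℝ) : ℂ := -I * p (cpt z.2 z.1) + I * m (cpt z.2 (-z.1))

lemma hasFDerivAt_comp_cpt {p : ℂ → ℂ} (hp : HolOff p) (σ : ℝ) {z : ℝ × ℝ} (hz : σ * z.1 ≠ 0) :
    ∃ L : ℝ × ℝ →L[ℝ] ℂ, HasFDerivAt (fun z : ℝ × ℝ => p (cpt z.2 (σ * z.1))) L z ∧
      L (1, 0) = deriv p (cpt z.2 (σ * z.1)) * (σ * I) ∧ L (0, 1) = deriv p (cpt z.2 (σ * z.1)) := by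
  have h1 := (hp (cpt z.2 (σ * z.1)) (by simpa using hz)).hasDerivAt.complexToReal_fderiv
  have h2 : HasFDerivAt (fun z : ℝ × ℝ => cpt z.2 (σ * z.1))
      (Complex.ofRealCLM.comp (ContinuousLinearMap.snd ℝ ℝ ℝ) +
        (σ * I : ℂ) • Complex.ofRealCLM.comp (ContinuousLinearMap.fst ℝ ℝ ℝ)) z := by
    have h3 := (Complex.ofRealCLM.comp (ContinuousLinearMap.snd ℝ ℝ ℝ) +
        (σ * I : ℂ) • Complex.ofRealCLM.comp (ContinuousLinearMap.fst ℝ ℝ ℝ)).hasFDerivAt (x := z)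
    refine h3.congr_of_eventuallyEq (Eventually.of_forall fun z => ?_)
    simp [cpt]
    ring
  refine ⟨_, h1.comp z h2, ?_, ?_⟩ <;> simp

lemma holOff_comp_cpt_fderiv {p : ℂ → ℂ} (hp : HolOff p) (σ : ℝ) {z : ℝ × ℝ} (hz : σ * z.1 ≠ 0) :
    DifferentiableAt ℝ (fun z : ℝ × ℝ => p (cpt z.2 (σ * z.1))) z ∧
    fderiv ℝ (fun z : ℝ × ℝ => p (cpt z.2 (σ * z.1))) z (1, 0) = deriv p (cpt z.2 (σ * z.1)) * (σ * I) ∧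
    fderiv ℝ (fun z : ℝ × ℝ => p (cpt z.2 (σ * z.1))) z (0, 1) = deriv p (cpt z.2 (σ * z.1)) := by
  obtain ⟨L, h1, h2, h3⟩ := hasFDerivAt_comp_cpt hp σ hz
  rw [h1.fderiv]
  exact ⟨h1.differentiableAt, h2, h3⟩

lemma HolOff.contDiffOn_comp {n : WithTop ℕ∞} {p : ℂ → ℂ} (hp : HolOff p) (hσ : σ ≠ 0) (hΩ : ∀ z ∈ Ω, z.1 ≠ 0) :
    ContDiffOn ℝ n (fun z : ℝ × ℝ => p (cpt z.2 (σ * z.1))) Ω := by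
  have h1 : ContDiffOn ℂ n p {ζ : ℂ | ζ.im ≠ 0} := hp.differentiableOn.contDiffOn isOpen_im_ne_zero
  have h2 : ContDiffOn ℝ n p {ζ : ℂ | ζ.im ≠ 0} := h1.restrict_scalars ℝ
  have h3 : ContDiff ℝ n (fun z : ℝ × ℝ => cpt z.2 (σ * z.1)) := by
    exact (Complex.ofRealCLM.contDiff.comp contDiff_snd).add
      ((Complex.ofRealCLM.contDiff.comp (contDiff_const.mul contDiff_fst)).mul contDiff_const)
  exact h2.comp h3.contDiffOn fun z hz => by simpa using ⟨hσ, hΩ z hz⟩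

section Pair

variable {p m : ℂ → ℂ} (hp : HolOff p) (hm : HolOff m)

include hp hm

lemma contDiffOn_hf0_of {n : WithTop ℕ∞} (hΩ : ∀ z ∈ Ω, z.1 ≠ 0) : ContDiffOn ℝ n (hf0 p m) Ω := by
  have h1 := hp.contDiffOn_comp (n := n) one_ne_zero hΩ
  have h2 := hm.contDiffOn_comp (n := n) (neg_ne_zero.2 one_ne_zero) hΩ
  simp at h1 h2
  exact h1.add h2

lemma contDiffOn_hf0 (hΩ : ∀ z ∈ Ω, z.1 ≠ 0) : ContDiffOn ℝ 1 (hf0 p m) Ω := contDiffOn_hf0_of hp hm hΩ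

lemma contDiffOn_hf1 (hΩ : ∀ z ∈ Ω, z.1 ≠ 0) : ContDiffOn ℝ 1 (hf1 p m) Ω := by
  have h1 := hp.contDiffOn_comp (n := 1) one_ne_zero hΩ
  have h2 := hm.contDiffOn_comp (n := 1) (neg_ne_zero.2 one_ne_zero) hΩ
  simp at h1 h2
  exact (contDiffOn_const.mul h1).add (contDiffOn_const.mul h2)

lemma fderiv_hf0 {z : ℝ × ℝ} (hz : z.1 ≠ 0) : DifferentiableAt ℝ (hf0 p m) z ∧
    fderiv ℝ (hf0 p m) z (1, 0) = -hf1 (deriv p) (deriv m) z ∧ fderiv ℝ (hf0 p m) z (0, 1) = hf0 (deriv p) (deriv m) z := by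
  obtain ⟨a1, a2, a3⟩ := holOff_comp_cpt_fderiv hp 1 (by simpa)
  obtain ⟨b1, b2, b3⟩ := holOff_comp_cpt_fderiv hm (-1) (by simpa)
  simp at a1 a2 a3 b1 b2 b3
  have e : hf0 p m = (fun z => p (cpt z.2 z.1)) + fun z => m (cpt z.2 (-z.1)) := rfl
  rw [e, fderiv_add a1 b1]
  refine ⟨a1.add b1, ?_, ?_⟩
  · rw [add_apply, a2, b2, hf1]; ring
  · rw [add_apply, a3, b3, hf0]

lemma fderiv_hf1 {z : ℝ × ℝ} (hz : z.1 ≠ 0) : DifferentiableAt ℝ (hf1 p m) z ∧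
    fderiv ℝ (hf1 p m) z (1, 0) = hf0 (deriv p) (deriv m) z ∧ fderiv ℝ (hf1 p m) z (0, 1) = hf1 (deriv p) (deriv m) z := by
  obtain ⟨a1, a2, a3⟩ := fderiv_hf0 (hp.const_mul (-I)) (hm.const_mul I) hz
  refine ⟨a1, a2.trans ?_, a3.trans ?_⟩
  · rw [hf1, hf0, deriv_const_mul_field, deriv_const_mul_field]
    linear_combination (-deriv p (cpt z.2 z.1) - deriv m (cpt z.2 (-z.1))) * I_sq
  · rw [hf0, hf1, deriv_const_mul_field, deriv_const_mul_field]

end Pair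

/-- Two pairs of holomorphic functions, for `x > 0` and `x ≤ 0`, whose fields have matching tangential
components and conormal components on the line `x = 0`. -/
structure IsPair (k : ℝ) (p m q n : ℂ → ℂ) : Prop where
  hp : HolOff p
  hm : HolOff m
  hq : HolOff q
  hn : HolOff n
  tang : ∀ t : ℝ, t ≠ 0 → hf0 p m (t, 0) = hf0 q n (t, 0)
  conorm : ∀ t : ℝ, t ≠ 0 → hf1 p m (t, 0) - k * hf0 p m (t, 0) = hf1 q n (t, 0) + k * hf0 q n (t, 0)

/-- The field generated by a pair. -/
def pairField (p m q n : ℂ → ℂ) : ℝ × ℝ → Fin 2 → ℂ := glue (fun z => ![hf0 p m z, hf1 p m z]) (fun z => ![hf0 q n z, hf1 q n z])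

/-- The gradient of the first component of the field generated by a pair. -/
def pairGrad (p m q n : ℂ → ℂ) : ℝ × ℝ → Fin 2 → ℂ := glue
  (fun z => ![-hf1 (deriv p) (deriv m) z, hf0 (deriv p) (deriv m) z]) (fun z => ![-hf1 (deriv q) (deriv n) z, hf0 (deriv q) (deriv n) z])

lemma coeff_mulVec (k x : ℝ) (a b : ℂ) : coeff k x *ᵥ ![a, b] = ![a + k * sign x * b, -(k * sign x) * a + b] := by
  ext i
  fin_cases i <;> simp [coeff, Matrix.mulVec, dotProduct, Fin.sum_univ_two]

lemma continuousOn_vec {a b : ℝ × ℝ → ℂ} (ha : ContinuousOn a Ω) (hb : ContinuousOn b Ω) :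
    ContinuousOn (fun z => ![a z, b z]) Ω := by fun_prop

lemma isOpen_halfPlane : IsOpen halfPlane := isOpen_lt continuous_const continuous_fst

lemma measurableSet_halfPlane : MeasurableSet halfPlane := isOpen_halfPlane.measurableSet

namespace IsPair

variable {k : ℝ} {p m q n : ℂ → ℂ} (h : IsPair k p m q n) {Ω : Set (ℝ × ℝ)} (hΩo : IsOpen Ω) (hΩ : ∀ z ∈ Ω, z.1 ≠ 0)

include h hΩo hΩ

lemma isFirstOrderSolution : IsFirstOrderSolution k Ω (pairField p m q n) := by
  have c0 := contDiffOn_hf0 h.hp h.hm hΩ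
  have c1 := contDiffOn_hf1 h.hp h.hm hΩ
  have d0 := contDiffOn_hf0 h.hq h.hn hΩ
  have d1 := contDiffOn_hf1 h.hq h.hn hΩ
  have ck : ContDiffOn ℝ 1 (fun _ : ℝ × ℝ => (k : ℂ)) Ω := contDiffOn_const
  refine ⟨locallyIntegrableOn_glue hΩo (continuousOn_vec c0.continuousOn c1.continuousOn) (continuousOn_vec d0.continuousOn d1.continuousOn),
    fun φ hφ => ⟨?_, ?_⟩⟩
  · have := integral_glue (d := 0) (d' := 0) hΩo hφ (c0.add (ck.mul c1)) (c1.sub (ck.mul c0)) (d0.sub (ck.mul d1)) (d1.add (ck.mul d0))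
      (fun z hz => ?_) (fun z hz => ?_) (fun t ht => h.conorm t (hΩ _ ht))
    · refine Eq.trans (setIntegral_congr_ae hΩo.measurableSet ?_) this
      filter_upwards [ae_snd_ne_zero] with z hz _
      rcases lt_or_gt_of_ne hz with hz | hz
      · rw [pairField, glue, if_neg (not_lt.2 hz.le), if_neg (not_lt.2 hz.le), coeff_mulVec, sign_of_neg hz]
        simp only [dotProduct, Fin.sum_univ_two, cons_val_zero, cons_val_one, Pi.zero_apply]
        push_cast
        ring
      · rw [pairField, glue, if_pos hz, if_pos hz, coeff_mulVec, sign_of_pos hz]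
        simp only [dotProduct, Fin.sum_univ_two, cons_val_zero, cons_val_one, Pi.zero_apply]
        push_cast
        ring
    · obtain ⟨a1, a2, a3⟩ := fderiv_hf0 h.hp h.hm (hΩ z hz)
      obtain ⟨b1, b2, b3⟩ := fderiv_hf1 h.hp h.hm (hΩ z hz)
      rw [fderiv_fun_add a1 (b1.const_mul _), fderiv_fun_sub b1 (a1.const_mul _), fderiv_const_mul b1, fderiv_const_mul a1]
      simp_all
    · obtain ⟨a1, a2, a3⟩ := fderiv_hf0 h.hq h.hn (hΩ z hz)
      obtain ⟨b1, b2, b3⟩ := fderiv_hf1 h.hq h.hn (hΩ z hz)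
      rw [fderiv_fun_sub a1 (b1.const_mul _), fderiv_fun_add b1 (a1.const_mul _), fderiv_const_mul b1, fderiv_const_mul a1]
      simp_all
  · have := integral_glue (d := 0) (d' := 0) hΩo hφ c1 c0.neg d1 d0.neg
      (fun z hz => ?_) (fun z hz => ?_) (fun t ht => by rw [h.tang t (hΩ _ ht)])
    · refine Eq.trans (setIntegral_congr_fun hΩo.measurableSet fun z _ => ?_) this
      by_cases hz : 0 < z.2
      · simp only [pairField, glue, if_pos hz, cons_val_zero, cons_val_one, Pi.zero_apply]
        ring
      · simp only [pairField, glue, if_neg hz, cons_val_zero, cons_val_one, Pi.zero_apply]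
        ring
    · rw [fderiv_fun_neg, (fderiv_hf1 h.hp h.hm (hΩ z hz)).2.1]
      simp [(fderiv_hf0 h.hp h.hm (hΩ z hz)).2.2]
    · rw [fderiv_fun_neg, (fderiv_hf1 h.hq h.hn (hΩ z hz)).2.1]
      simp [(fderiv_hf0 h.hq h.hn (hΩ z hz)).2.2]

omit hΩo hΩ

lemma hasWeakGrad : HasWeakGrad (fun z => pairField p m q n z 0) (pairGrad p m q n) := by
  have hΩ : ∀ z ∈ halfPlane, z.1 ≠ 0 := fun z hz => ne_of_gt hz
  have c0 := contDiffOn_hf0 h.hp h.hm hΩ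
  have d0 := contDiffOn_hf0 h.hq h.hn hΩ
  have c0' := contDiffOn_hf0 h.hp.deriv h.hm.deriv hΩ
  have d0' := contDiffOn_hf0 h.hq.deriv h.hn.deriv hΩ
  have c1' := contDiffOn_hf1 h.hp.deriv h.hm.deriv hΩ
  have d1' := contDiffOn_hf1 h.hq.deriv h.hn.deriv hΩ
  have eU : (fun z => pairField p m q n z 0) = glue (hf0 p m) (hf0 q n) := by
    ext z
    by_cases hz : 0 < z.2 <;> simp [pairField, glue, hz]
  have l0 : LocallyIntegrableOn (glue (hf0 p m) (hf0 q n)) halfPlane :=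
    locallyIntegrableOn_glue isOpen_halfPlane c0.continuousOn d0.continuousOn
  have l1 : LocallyIntegrableOn (pairGrad p m q n) halfPlane := locallyIntegrableOn_glue isOpen_halfPlane
    (continuousOn_vec c1'.continuousOn.neg c0'.continuousOn) (continuousOn_vec d1'.continuousOn.neg d0'.continuousOn)
  rw [eU]
  refine ⟨l0, l1, fun φ hφ i => ?_⟩
  have hcg : Continuous fun z => grad φ z i := by
    have := hφ.1.continuous_fderiv (by simp)
    fin_cases i
    · exact this.clm_apply continuous_const
    · exact this.clm_apply continuous_const
  have hsub : ∀ z, z ∉ tsupport φ → grad φ z i = 0 := fun z hz => by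
    have h2 : fderiv ℝ φ z = 0 := by
      by_contra h
      exact hz (support_fderiv_subset ℝ (by simp_all))
    fin_cases i <;> simp [grad, h2]
  have int : ∀ {f g : ℝ × ℝ → ℂ}, LocallyIntegrableOn f halfPlane → Continuous g → (∀ z, z ∉ tsupport φ → g z = 0) →
      IntegrableOn (fun z => f z * g z) halfPlane := by
    intro f g hf hg h0
    have h1 : IntegrableOn (fun z => f z * g z) (tsupport φ) :=
      ((hf.integrableOn_compact_subset hφ.2.2 hφ.2.1).mul_continuousOn hg.continuousOn hφ.2.1)
    have h2 : Integrable (fun z => f z * g z) := by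
      rw [← integrable_indicator_iff hφ.2.1.isClosed.measurableSet] at h1
      refine h1.congr (ae_of_all _ fun z => ?_)
      by_cases hz : z ∈ tsupport φ
      · rw [indicator_of_mem hz]
      · simp [h0 z hz]
    exact h2.integrableOn
  have l1i : LocallyIntegrableOn (fun z => pairGrad p m q n z i) halfPlane := by
    have : (fun z => pairGrad p m q n z i) = glue (fun z => (![-hf1 (deriv p) (deriv m) z, hf0 (deriv p) (deriv m) z] : Fin 2 → ℂ) i)
        (fun z => (![-hf1 (deriv q) (deriv n) z, hf0 (deriv q) (deriv n) z] : Fin 2 → ℂ) i) := by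
      ext z
      by_cases hz : 0 < z.2 <;> simp [pairGrad, glue, hz]
    rw [this]
    exact locallyIntegrableOn_glue isOpen_halfPlane (continuousOn_pi.1 (continuousOn_vec c1'.continuousOn.neg c0'.continuousOn) i)
      (continuousOn_pi.1 (continuousOn_vec d1'.continuousOn.neg d0'.continuousOn) i)
  have i1 := int l0 hcg hsub
  have i2 := int l1i hφ.1.continuous fun z hz => image_eq_zero_of_notMem_tsupport hz
  rw [eq_neg_iff_add_eq_zero, ← integral_add i1 i2]
  have z0 : ContDiffOn ℝ 1 (fun _ : ℝ × ℝ => (0 : ℂ)) halfPlane := contDiffOn_const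
  fin_cases i
  · refine Eq.trans (setIntegral_congr_fun measurableSet_halfPlane fun z _ => ?_)
      (integral_glue (d := fun z => -hf1 (deriv p) (deriv m) z) (d' := fun z => -hf1 (deriv q) (deriv n) z) isOpen_halfPlane hφ c0 z0 d0 z0 (fun z hz => by
      simp [(fderiv_hf0 h.hp h.hm (hΩ z hz)).2.1]) (fun z hz => by
      simp [(fderiv_hf0 h.hq h.hn (hΩ z hz)).2.1]) (fun t ht => rfl))
    by_cases hz : 0 < z.2 <;> simp [pairGrad, glue, hz]
  · refine Eq.trans (setIntegral_congr_fun measurableSet_halfPlane fun z _ => ?_)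
      (integral_glue (d := hf0 (deriv p) (deriv m)) (d' := hf0 (deriv q) (deriv n)) isOpen_halfPlane hφ z0 c0 z0 d0 (fun z hz => by
      simp [(fderiv_hf0 h.hp h.hm (hΩ z hz)).2.2]) (fun z hz => by
      simp [(fderiv_hf0 h.hq h.hn (hΩ z hz)).2.2]) (fun t ht => h.tang t (hΩ _ ht)))
    by_cases hz : 0 < z.2 <;> simp [pairGrad, glue, hz]

lemma conorm_deriv (ht : t ≠ 0) :
    hf0 (deriv p) (deriv m) (t, 0) + k * hf1 (deriv p) (deriv m) (t, 0) =
      hf0 (deriv q) (deriv n) (t, 0) - k * hf1 (deriv q) (deriv n) (t, 0) := by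
  have key : ∀ {p m : ℂ → ℂ}, HolOff p → HolOff m → ∀ c : ℂ, HasDerivAt (fun t => hf1 p m (t, 0) + c * hf0 p m (t, 0))
      (hf0 (deriv p) (deriv m) (t, 0) - c * hf1 (deriv p) (deriv m) (t, 0)) t := by
    intro p m hp hm c
    obtain ⟨a1, a2, -⟩ := fderiv_hf0 hp hm (z := (t, 0)) ht
    obtain ⟨b1, b2, -⟩ := fderiv_hf1 hp hm (z := (t, 0)) ht
    have h2 : HasDerivAt (fun t : ℝ => (t, (0 : ℝ))) (1, 0) t := (hasDerivAt_id t).prodMk (hasDerivAt_const t 0)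
    have a4 := a1.hasFDerivAt.comp_hasDerivAt t h2
    have b4 := b1.hasFDerivAt.comp_hasDerivAt t h2
    rw [a2] at a4
    rw [b2] at b4
    refine (b4.add (a4.const_mul c)).congr_deriv ?_
    ring
  have h1 := key h.hp h.hm (-k)
  have h2 := key h.hq h.hn k
  have h3 : (fun t => hf1 p m (t, 0) + -k * hf0 p m (t, 0)) =ᶠ[𝓝 t] fun t => hf1 q n (t, 0) + k * hf0 q n (t, 0) := by
    filter_upwards [isOpen_ne.mem_nhds ht] with s hs
    rw [← h.conorm s hs]; ring
  have h4 := (h1.congr_of_eventuallyEq h3.symm).unique h2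
  simp_all

lemma pairGrad_spec : HasWeakGrad (fun z => pairField p m q n z 0) (pairGrad p m q n) ∧
    (∀ K : Set (ℝ × ℝ), IsCompact K → K ⊆ halfPlane → MemLp (pairGrad p m q n) 2 (volume.restrict K)) ∧
    ∀ φ, IsTest halfPlane φ → ∫ z in halfPlane, (coeff k z.2 *ᵥ pairGrad p m q n z) ⬝ᵥ grad φ z = 0 := by
  have hΩ : ∀ z ∈ halfPlane, z.1 ≠ 0 := fun z hz => ne_of_gt hz
  have c0' := contDiffOn_hf0 h.hp.deriv h.hm.deriv hΩ
  have d0' := contDiffOn_hf0 h.hq.deriv h.hn.deriv hΩ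
  have c1' := contDiffOn_hf1 h.hp.deriv h.hm.deriv hΩ
  have d1' := contDiffOn_hf1 h.hq.deriv h.hn.deriv hΩ
  have ck : ContDiffOn ℝ 1 (fun _ : ℝ × ℝ => (k : ℂ)) halfPlane := contDiffOn_const
  refine ⟨h.hasWeakGrad, fun K hKc hK => memLp_glue (continuousOn_vec c1'.continuousOn.neg c0'.continuousOn)
    (continuousOn_vec d1'.continuousOn.neg d0'.continuousOn) hKc hK 2, fun φ hφ => ?_⟩
  have := integral_glue (d := 0) (d' := 0) isOpen_halfPlane hφ (c1'.neg.add (ck.mul c0')) (c0'.add (ck.mul c1'))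
    (d1'.neg.sub (ck.mul d0')) (d0'.sub (ck.mul d1'))
      (fun z hz => ?_) (fun z hz => ?_) (fun t ht => h.conorm_deriv (hΩ _ ht))
  · refine Eq.trans (setIntegral_congr_ae measurableSet_halfPlane ?_) this
    filter_upwards [ae_snd_ne_zero] with z hz _
    rcases lt_or_gt_of_ne hz with hz | hz
    · rw [pairGrad, glue, if_neg (not_lt.2 hz.le), if_neg (not_lt.2 hz.le), coeff_mulVec, sign_of_neg hz]
      simp only [dotProduct, Fin.sum_univ_two, cons_val_zero, cons_val_one, Pi.zero_apply]
      push_cast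
      ring
    · rw [pairGrad, glue, if_pos hz, if_pos hz, coeff_mulVec, sign_of_pos hz]
      simp only [dotProduct, Fin.sum_univ_two, cons_val_zero, cons_val_one, Pi.zero_apply]
      push_cast
      ring
  · obtain ⟨a1, a2, a3⟩ := fderiv_hf0 h.hp.deriv h.hm.deriv (hΩ z hz)
    obtain ⟨b1, b2, b3⟩ := fderiv_hf1 h.hp.deriv h.hm.deriv (hΩ z hz)
    rw [fderiv_fun_add b1.fun_neg (a1.const_mul _), fderiv_fun_neg, fderiv_fun_add a1 (b1.const_mul _), fderiv_const_mul b1, fderiv_const_mul a1]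
    simp [a2, a3, b2, b3]
    ring
  · obtain ⟨a1, a2, a3⟩ := fderiv_hf0 h.hq.deriv h.hn.deriv (hΩ z hz)
    obtain ⟨b1, b2, b3⟩ := fderiv_hf1 h.hq.deriv h.hn.deriv (hΩ z hz)
    rw [fderiv_fun_sub b1.fun_neg (a1.const_mul _), fderiv_fun_neg, fderiv_fun_sub a1 (b1.const_mul _), fderiv_const_mul b1, fderiv_const_mul a1]
    simp_all

lemma isWeakSolution : IsWeakSolution k (fun z => pairField p m q n z 0) := ⟨_, h.pairGrad_spec⟩

end IsPair

/-- The function on the line that is `a` on the right half and the reflection of `b` on the left half. -/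
def fold {E : Type*} (a b : ℝ → E) (x : ℝ) : E := if 0 < x then a x else b (-x)

lemma fold_pos {E : Type*} (a b : ℝ → E) (hx : 0 < x) : fold a b x = a x := if_pos hx

lemma fold_neg {E : Type*} (a b : ℝ → E) (hx : 0 < x) : fold a b (-x) = b x := by
  rw [fold, if_neg (by simpa using hx.le), neg_neg]

lemma ae_ne_zero : ∀ᵐ x : ℝ, x ≠ 0 := compl_mem_ae_iff.2 (measure_singleton 0)

section Halves

variable {E : Type*} [NormedAddCommGroup E]

omit [NormedAddCommGroup E] in
lemma ae_eq_fold {a b f : ℝ → E} (ha : f =ᵐ[halfVol] a) (hb : (fun x => f (-x)) =ᵐ[halfVol] b) : f =ᵐ[volume] fold a b := by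
  have h1 := (ae_restrict_iff' measurableSet_Ioi).1 ha
  have h2 := (measurePreserving_neg (volume : Measure ℝ)).quasiMeasurePreserving.ae ((ae_restrict_iff' measurableSet_Ioi).1 hb)
  filter_upwards [h1, h2, ae_ne_zero] with x hx hx' h0
  rcases lt_or_gt_of_ne h0 with h | h
  · rw [fold, if_neg (not_lt.2 h.le), ← hx' (neg_pos.2 h), neg_neg]
  · rw [fold, if_pos h, hx h]

lemma fold_ae_eq (a b : ℝ → E) :
    fold a b =ᵐ[volume] (Ioi (0 : ℝ)).indicator a + fun x => (Ioi (0 : ℝ)).indicator b (-x) := by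
  filter_upwards [ae_ne_zero] with x hx
  rcases lt_or_gt_of_ne hx with h | h
  · simp [fold, h, not_lt.2 h.le]
  · simp [fold, h, not_lt.2 h.le]

lemma memLp_fold {a b : ℝ → E} (ha : MemLp a P halfVol) (hb : MemLp b P halfVol) : MemLp (fold a b) P volume := by
  have h1 := (memLp_indicator_iff_restrict measurableSet_Ioi).2 ha
  have h2 := ((memLp_indicator_iff_restrict measurableSet_Ioi).2 hb).comp_measurePreserving (measurePreserving_neg volume)
  exact (h1.add h2).ae_eq (fold_ae_eq a b).symm

lemma memLp_of_halves {f : ℝ → E} (h1 : MemLp f P halfVol) (h2 : MemLp (fun x => f (-x)) P halfVol) : MemLp f P :=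
  (memLp_fold h1 h2).ae_eq (ae_eq_fold .rfl .rfl).symm

lemma MemLp.comp_neg {f : ℝ → E} (h : MemLp f P) : MemLp (fun x => f (-x)) P :=
  h.comp_measurePreserving (measurePreserving_neg volume)

lemma eLpNorm_le_halves {f : ℝ → E} (hf : AEStronglyMeasurable f) (hP : 1 ≤ P) :
    eLpNorm f P ≤ eLpNorm f P halfVol + eLpNorm (fun x => f (-x)) P halfVol := by
  have hg : AEStronglyMeasurable (fun x => f (-x)) := hf.comp_measurePreserving (measurePreserving_neg volume)
  have h1 := hf.indicator (measurableSet_Ioi (a := (0 : ℝ)))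
  have h2 := hg.indicator (measurableSet_Ioi (a := (0 : ℝ)))
  rw [eLpNorm_congr_ae ((ae_eq_fold (f := f) .rfl .rfl).trans (fold_ae_eq _ _)), ← eLpNorm_indicator_eq_eLpNorm_restrict measurableSet_Ioi,
    ← eLpNorm_indicator_eq_eLpNorm_restrict measurableSet_Ioi, ← eLpNorm_comp_neg h2]
  exact eLpNorm_add_le h1 (h2.comp_measurePreserving (measurePreserving_neg volume)) hP

lemma tendsto_of_halves {ι : Type*} {l : Filter ι} {f : ι → ℝ → E} (hP : 1 ≤ P) (hf : ∀ᶠ i in l, AEStronglyMeasurable (f i))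
    (h1 : Tendsto (fun i => eLpNorm (f i) P halfVol) l (𝓝 0)) (h2 : Tendsto (fun i => eLpNorm (fun x => f i (-x)) P halfVol) l (𝓝 0)) :
    Tendsto (fun i => eLpNorm (f i) P) l (𝓝 0) := by
  have h3 := h1.add h2
  rw [add_zero] at h3
  exact tendsto_zero_of_le h3
    (hf.mono fun i hi => eLpNorm_le_halves hi hP)

lemma integrable_of_halves {f : ℝ → E} (h1 : Integrable f halfVol) (h2 : Integrable (fun x => f (-x)) halfVol) : Integrable f :=
  memLp_one_iff_integrable.1 (memLp_of_halves (memLp_one_iff_integrable.2 h1) (memLp_one_iff_integrable.2 h2))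

lemma integral_halves [NormedSpace ℝ E] {f : ℝ → E} (h1 : Integrable f halfVol) (h2 : Integrable (fun x => f (-x)) halfVol) :
    ∫ x, f x = ∫ x, (f x + f (-x)) ∂halfVol := by
  have h := integrable_of_halves h1 h2
  rw [integral_add h1 h2, integral_comp_neg_Ioi, neg_zero, add_comm, integral_Iic_add_Ioi h.integrableOn h.integrableOn]

end Halves

lemma measurable_sign : Measurable sign :=
  Measurable.ite measurableSet_Iio measurable_const (Measurable.ite measurableSet_Ioi measurable_const measurable_const)

lemma measurable_doubleLayerKernel (ε : ℝ) : Measurable fun z : ℝ × ℝ => doubleLayerKernel ε z.2 z.1 := by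
  refine measurable_const.mul (Measurable.sub (Measurable.ite (measurableSet_lt measurable_const (by fun_prop))
    ((measurable_sign.comp measurable_snd).div (by fun_prop)) measurable_const) (by fun_prop))

lemma doubleLayerKernel_pos (ε : ℝ) (hx : 0 < x) (hy : 0 < y) :
    doubleLayerKernel ε y x = (1 / π) * (truncKer ε (y - x) - (x + y)⁻¹) ∧
    doubleLayerKernel ε (-y) x = (1 / π) * (truncKer ε (y - -x) - (x + y)⁻¹) := by
  constructor
  · rw [doubleLayerKernel, truncKer, sign_of_pos hy, abs_of_pos hx, abs_of_pos hy, add_comm y x, one_div (x + y), one_div (y - x)]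
  · have e : -y - x = -(x + y) := by ring
    rw [doubleLayerKernel, truncKer, sign_of_neg (neg_lt_zero.2 hy), abs_neg, abs_of_pos hx, abs_of_pos hy, add_comm y x, e, abs_neg,
      neg_div_neg_eq, sub_neg_eq_add, add_comm y x]
    simp

lemma integral_doubleLayerKernel_neg (ε x : ℝ) (ψ : ℝ → ℂ) :
    ∫ y, (doubleLayerKernel ε y (-x) : ℂ) * ψ y = ∫ y, (doubleLayerKernel ε y x : ℂ) * ψ (-y) := by
  rw [← integral_neg_eq_self]
  refine integral_congr_ae (ae_of_all _ fun y => ?_)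
  have e : doubleLayerKernel ε (-y) (-x) = doubleLayerKernel ε y x := by
    have : -y - -x = -(y - x) := by ring
    rw [doubleLayerKernel, doubleLayerKernel, this, abs_neg, abs_neg, abs_neg, Real.sign_neg, neg_div_neg_eq]
  simp only [e]

lemma aestronglyMeasurable_doubleLayer (ε : ℝ) (hψ : AEStronglyMeasurable ψ) :
    AEStronglyMeasurable (fun x => ∫ y, (doubleLayerKernel ε y x : ℂ) * ψ y) volume := by
  have h := ((Complex.measurable_ofReal.comp (measurable_doubleLayerKernel ε)).aestronglyMeasurable
   ).mul (hψ.comp_snd (μ := volume))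
  exact h.integral_prod_right'

section HalfLine

include hpq

lemma integrable_inv_add_mul (hψ : MemLp ψ 𝔭) (hx : 0 < x) :
    Integrable (fun y => (((x + y)⁻¹ : ℝ) : ℂ) * ψ y) halfVol := by
  refine Integrable.mono' ((MemLp.integrable_div_one_add_abs hpq hψ).restrict.const_mul (1 + x⁻¹))
    ((by fun_prop : Measurable fun y => (((x + y)⁻¹ : ℝ) : ℂ)).aestronglyMeasurable.mul hψ.1.restrict) (ae_halfVol_pos.mono fun y hy => ?_)
  rw [norm_mul, norm_real, norm_of_nonneg (by positivity), abs_of_pos hy, mul_div_assoc', mul_comm (1 + x⁻¹), mul_div_assoc,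
    mul_comm]
  refine mul_le_mul_of_nonneg_left ?_ (norm_nonneg _)
  rw [inv_eq_one_div, div_le_div_iff₀ (by positivity) (by positivity)]
  have : (1 + x⁻¹) * (x + y) = x + y + 1 + y / x := by field_simp; ring
  have := div_pos hy hx
  linarith

lemma doubleLayer_eq (hψ : MemLp ψ 𝔭) (hε : 0 < ε) (hx : 0 < x) :
    ∫ y, (doubleLayerKernel ε y x : ℂ) * ψ y = (1 / π : ℂ) * (truncH ε ((Ioi (0 : ℝ)).indicator ψ) x -
      truncH ε ((Ioi (0 : ℝ)).indicator ψ) (-x) + ∫ y, ((truncKer ε (y - -x) - (x + y)⁻¹ : ℝ) : ℂ) * (ψ y + ψ (-y)) ∂halfVol) := by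
  have hψ' := MemLp.comp_neg hψ
  have i1 : ∀ {φ : ℝ → ℂ}, MemLp φ 𝔭 → ∀ s, Integrable (fun y => (truncKer ε (y - s) : ℂ) * φ y) halfVol :=
    fun h s => ((isOddKernel_truncKer hε).integrable' h.1 (MemLp.integrable_div_one_add_abs hpq h) s).restrict
  have i2 := integrable_inv_add_mul hpq hψ hx
  have i2' := integrable_inv_add_mul hpq hψ' hx
  have e1 : (fun y => (doubleLayerKernel ε y x : ℂ) * ψ y) =ᵐ[halfVol]
      fun y => (1 / π : ℂ) * ((truncKer ε (y - x) : ℂ) * ψ y - (((x + y)⁻¹ : ℝ) : ℂ) * ψ y) := by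
    filter_upwards [ae_halfVol_pos] with y hy
    rw [(doubleLayerKernel_pos ε hx hy).1]; push_cast; ring
  have e2 : (fun y => (doubleLayerKernel ε (-y) x : ℂ) * ψ (-y)) =ᵐ[halfVol]
      fun y => (1 / π : ℂ) * ((truncKer ε (y - -x) : ℂ) * ψ (-y) - (((x + y)⁻¹ : ℝ) : ℂ) * ψ (-y)) := by
    filter_upwards [ae_halfVol_pos] with y hy
    rw [(doubleLayerKernel_pos ε hx hy).2]; push_cast; ring
  have j1 := (((i1 hψ x).sub i2).const_mul (1 / π : ℂ)).congr e1.symm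
  have j2 := (((i1 hψ' (-x)).sub i2').const_mul (1 / π : ℂ)).congr e2.symm
  rw [integral_halves j1 j2, truncH, truncH, integral_indicator_mul, integral_indicator_mul, ← integral_sub (i1 hψ x) (i1 hψ (-x)),
    ← integral_add (f := fun y => (truncKer ε (y - x) : ℂ) * ψ y - (truncKer ε (y - -x) : ℂ) * ψ y) (by fun_prop), ← integral_const_mul]
  · refine integral_congr_ae ?_
    filter_upwards [e1, e2] with y h1 h2
    rw [h1, h2]; push_cast; ring
  · refine (((i1 hψ (-x)).add (i1 hψ' (-x))).sub (i2.add i2')).congr (.of_forall fun y => ?_)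
    simp
    ring

lemma tendsto_doubleLayer (hψ : MemLp ψ 𝔭) (h : IsBdry p 0 ψ S) :
    Tendsto (fun ε => eLpNorm (fun x => (∫ y, (doubleLayerKernel ε y x : ℂ) * ψ y) - S x) 𝔭 halfVol) (𝓝[>] 0) (𝓝 0) := by
  set g := (Ioi (0 : ℝ)).indicator ψ with hg
  have hgm : MemLp g 𝔭 := hψ.indicator measurableSet_Ioi
  obtain ⟨H, hH, hHl⟩ := exists_tendsto_conjP hpq hgm
  have hS := h.ae_eq hpq (zero_mem_range hpq) (isBdry_zero hpq (hψ.restrict _) hH hHl)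
  have hφ : MemLp (fun y => ψ y + ψ (-y)) 𝔭 halfVol := (hψ.add (MemLp.comp_neg hψ)).restrict _
  have mT : ∀ ε, 0 < ε → AEStronglyMeasurable (truncH ε g) := fun ε hε =>
    aestronglyMeasurable_integral_kernel (Complex.measurable_ofReal.comp (isOddKernel_truncKer hε).meas) hgm.1
  have mC : ∀ ε, 0 < ε → AEStronglyMeasurable (conjP ε g) := fun ε hε =>
    aestronglyMeasurable_integral_kernel (Complex.measurable_ofReal.comp (isOddKernel_conjKer hε.ne').meas) hgm.1
  have P1 := one_le_ofReal hpq
  have l1 : Tendsto (fun ε => eLpNorm (truncH ε g - H) 𝔭) (𝓝[>] 0) (𝓝 0) := by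
    have := (tendsto_truncH_sub_conjP hpq hgm).add hHl
    rw [add_zero] at this
    refine tendsto_zero_of_le this ?_
    filter_upwards [self_mem_nhdsWithin] with ε hε
    rw [← sub_add_sub_cancel (truncH ε g) (conjP ε g) H]
    exact eLpNorm_add_le ((mT ε hε).sub (mC ε hε)) ((mC ε hε).sub hH.1) P1
  set E : ℝ → ℝ → ℂ := fun ε x => ∫ y, ((truncKer ε (y - -x) - (x + y)⁻¹ : ℝ) : ℂ) * (ψ y + ψ (-y)) ∂halfVol with hE
  have hneg : ∀ {f : ℝ → ℂ}, AEStronglyMeasurable f → AEStronglyMeasurable (fun x => f (-x)) := fun h =>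
    h.comp_measurePreserving (measurePreserving_neg volume)
  have mE : ∀ ε, 0 < ε → AEStronglyMeasurable (E ε) halfVol := fun ε hε => by
    refine AEStronglyMeasurable.congr ((((aestronglyMeasurable_doubleLayer ε hψ.1).const_mul (π : ℂ)).sub (mT ε hε)).add (hneg (mT ε hε))).restrict
      (ae_halfVol_pos.mono fun x hx => ?_)
    simp only [Pi.add_apply, Pi.sub_apply]
    rw [doubleLayer_eq hpq hψ hε hx]
    field_simp
    simp only [hE, hg]
    ring_nf
  obtain ⟨C, -, hC⟩ := exists_schur_homKer hpq (a := 0) (b := 0) (by have := hpq.symm.pos; positivity) (by have := hpq.pos; positivity)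
  have l2 : Tendsto (fun ε => eLpNorm (E ε) 𝔭 halfVol) (𝓝[>] 0) (𝓝 0) := by
    refine tendsto_eLpNorm_of_dominated hpq.pos (g := fun x => ∫⁻ y, ofReal (homKer 0 0 x y) * ‖ψ y + ψ (-y)‖ₑ ∂halfVol) ?_
      (ne_top_of_le_ne_top (mul_ne_top coe_ne_top ?_) (hC _ hφ.1)) ?_ ?_
    · filter_upwards [self_mem_nhdsWithin] with ε hε using mE ε hε
    · have := lintegral_rpow_enorm_lt_top_of_eLpNorm_lt_top (by positivity) ofReal_ne_top hφ.2
      rw [toReal_ofReal hpq.pos.le] at this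
      exact this.ne
    · filter_upwards [self_mem_nhdsWithin] with ε hε
      filter_upwards [ae_halfVol_pos] with x hx
      refine (enorm_integral_le_lintegral_enorm _).trans (lintegral_mono_ae (ae_halfVol_pos.mono fun y hy => ?_))
      rw [enorm_mul]
      gcongr
      rw [← ofReal_norm, norm_real]
      have e : homKer 0 0 x y = (x + y)⁻¹ := by simp [homKer, rpow_neg_one]
      have h0 : 0 < (x + y)⁻¹ := by positivity
      rw [e, truncKer, sub_neg_eq_add, add_comm y x]
      split_ifs
      · simpa using h0.le
      · rw [zero_sub, norm_neg, norm_of_nonneg h0.le]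
    · filter_upwards [ae_halfVol_pos] with x hx
      refine Tendsto.congr' (f₁ := fun _ => 0) ?_ tendsto_const_nhds
      filter_upwards [mem_nhdsWithin_of_mem_nhds (Iio_mem_nhds hx)] with ε hε
      symm
      refine (integral_congr_ae (ae_halfVol_pos.mono fun y hy => ?_)).trans (integral_zero _ _)
      have : ε < |y - -x| := by grind
      rw [truncKer, if_pos this]
      simp [add_comm y x]
  have l3 := (ENNReal.Tendsto.const_mul ((l1.add l1).add l2) (a := ‖(1 / π : ℂ)‖ₑ) (Or.inr enorm_ne_top))
  simp only [add_zero, mul_zero] at l3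
  refine tendsto_zero_of_le l3 ?_
  filter_upwards [self_mem_nhdsWithin] with ε hε
  have m1 := (mT ε hε).sub hH.1
  have e : (fun x => (∫ y, (doubleLayerKernel ε y x : ℂ) * ψ y) - S x) =ᵐ[halfVol]
      (1 / π : ℂ) • (((truncH ε g - H) - fun x => (truncH ε g - H) (-x)) + E ε) := by
    filter_upwards [hS, ae_halfVol_pos] with x h1 hx
    rw [h1, doubleLayer_eq hpq hψ hε hx]
    simp only [Pi.smul_apply, Pi.add_apply, Pi.sub_apply, smul_eq_mul, hE, ← hg]
    ring
  rw [eLpNorm_congr_ae e, eLpNorm_const_smul]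
  gcongr
  refine (eLpNorm_add_le (m1.sub (hneg m1)).restrict (mE ε hε) P1).trans ?_
  gcongr
  refine (eLpNorm_mono_measure _ restrict_le_self).trans ((eLpNorm_sub_le m1 (hneg m1) P1).trans_eq ?_)
  rw [eLpNorm_comp_neg m1]

/-- The boundary equation decouples into one equation on each of the two half lines. -/
lemma boundaryEquation_iff (hu : MemLp u 𝔭) (hψ : MemLp ψ 𝔭)
    (hS : IsBdry p 0 ψ S) (hT : IsBdry p 0 (fun x => ψ (-x)) T) :
    BoundaryEquation k 𝔭 u ψ ↔ u =ᵐ[halfVol] (1 / 2 : ℂ) • (ψ + (k : ℂ) • S) ∧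
      (fun x => u (-x)) =ᵐ[halfVol] (1 / 2 : ℂ) • ((fun x => ψ (-x)) + (k : ℂ) • T) := by
  have P1 := one_le_ofReal hpq
  set B : ℝ → ℝ → ℂ := fun ε x => (1 / 2 : ℂ) * (ψ x + (k : ℂ) * ∫ y, (doubleLayerKernel ε y x : ℂ) * ψ y) with hB
  have mB : ∀ ε, AEStronglyMeasurable (B ε) := fun ε =>
    (hψ.1.add ((aestronglyMeasurable_doubleLayer ε hψ.1).const_mul _)).const_mul _
  have mB' : ∀ ε, AEStronglyMeasurable (fun x => B ε (-x)) := fun ε =>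
    (mB ε).comp_measurePreserving (measurePreserving_neg volume)
  have key : ∀ {ψ S : ℝ → ℂ}, MemLp ψ 𝔭 → IsBdry p 0 ψ S → Tendsto (fun ε => eLpNorm (fun x =>
      (1 / 2 : ℂ) * (ψ x + (k : ℂ) * ∫ y, (doubleLayerKernel ε y x : ℂ) * ψ y) - ((1 / 2 : ℂ) • (ψ + (k : ℂ) • S)) x)
      𝔭 halfVol) (𝓝[>] 0) (𝓝 0) := by
    intro ψ S hψ hS
    have l := ENNReal.Tendsto.const_mul (tendsto_doubleLayer hpq hψ hS) (a := ‖(1 / 2 * k : ℂ)‖ₑ) (Or.inr enorm_ne_top)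
    rw [mul_zero] at l
    refine l.congr fun ε => ?_
    rw [← eLpNorm_const_smul]
    congr 1
    ext x
    simp
    ring
  have k1 := key hψ hS
  have k2 := key (MemLp.comp_neg hψ) hT
  simp only [← integral_doubleLayerKernel_neg] at k2
  have m1 : AEStronglyMeasurable ((1 / 2 : ℂ) • (ψ + (k : ℂ) • S)) halfVol := ((hS.left.1.add (hS.right.1.const_smul _)).const_smul _)
  have m2 : AEStronglyMeasurable ((1 / 2 : ℂ) • ((fun x => ψ (-x)) + (k : ℂ) • T)) halfVol :=
    ((hT.left.1.add (hT.right.1.const_smul _)).const_smul _)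
  constructor
  · intro h
    refine ⟨ae_eq_of_tendsto_eLpNorm P1 (Eventually.of_forall fun ε => (mB ε).restrict) hu.1.restrict m1 ?_ k1,
      ae_eq_of_tendsto_eLpNorm P1 (Eventually.of_forall fun ε => (mB' ε).restrict) (MemLp.comp_neg hu).1.restrict m2 ?_ k2⟩
    · exact tendsto_of_tendsto_of_tendsto_of_le_of_le tendsto_const_nhds h (fun _ => zero_le)
        fun ε => eLpNorm_mono_measure _ restrict_le_self
    · refine tendsto_of_tendsto_of_tendsto_of_le_of_le tendsto_const_nhds h (fun _ => zero_le) fun ε => ?_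
      refine (eLpNorm_mono_measure _ restrict_le_self).trans ?_
      exact (eLpNorm_comp_neg (f := fun x => B ε x - u x) ((mB ε).sub hu.1) _).le
  · rintro ⟨h1, h2⟩
    refine tendsto_of_halves P1 (Eventually.of_forall fun ε => (mB ε).sub hu.1) ?_ ?_
    · refine k1.congr fun ε => eLpNorm_congr_ae ?_
      filter_upwards [h1] with x hx
      rw [hx]
    · refine k2.congr fun ε => eLpNorm_congr_ae ?_
      filter_upwards [h2] with x hx
      rw [hx]

include hα in
/-- Solvability of the boundary equation. -/
lemma exists_boundary_solution (hc : cos (π * α / 2) ≠ 0)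
    (hk : tan (π * α / 2) = k) (hu : MemLp u 𝔭) :
    ∃ ψ S T, MemLp ψ 𝔭 ∧ IsBdry p 0 ψ S ∧ IsBdry p 0 (fun x => ψ (-x)) T ∧
      u =ᵐ[halfVol] (1 / 2 : ℂ) • (ψ + (k : ℂ) • S) ∧ (fun x => u (-x)) =ᵐ[halfVol] (1 / 2 : ℂ) • ((fun x => ψ (-x)) + (k : ℂ) • T) := by
  obtain ⟨a, S, hS, h1⟩ := exists_bdry_solution hpq hα hc hk (hu.restrict (Ioi 0))
  obtain ⟨b, T, hT, h2⟩ := exists_bdry_solution hpq hα hc hk ((MemLp.comp_neg hu).restrict (Ioi 0))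
  have e1 : a =ᵐ[halfVol] fold a b := ae_halfVol_pos.mono fun x hx => (fold_pos a b hx).symm
  have e2 : b =ᵐ[halfVol] fun x => fold a b (-x) := ae_halfVol_pos.mono fun x hx => (fold_neg a b hx).symm
  refine ⟨fold a b, S, T, memLp_fold hS.left hT.left, hS.congr e1 .rfl, hT.congr e2 .rfl, ?_, ?_⟩
  · filter_upwards [e1] with x hx
    rw [h1]; simp [hx]
  · filter_upwards [e2] with x hx
    rw [show u (-x) = _ from congrFun h2 x]; simp [hx]

include hα in
lemma boundaryEquation_unique (hc : cos (π * α / 2) ≠ 0)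
    (hk : tan (π * α / 2) = k) {ψ' : ℝ → ℂ} (hu : MemLp u 𝔭)
    (hψ : MemLp ψ 𝔭) (hψ' : MemLp ψ' 𝔭)
    (h : BoundaryEquation k 𝔭 u ψ) (h' : BoundaryEquation k 𝔭 u ψ') : ψ' =ᵐ[volume] ψ := by
  have h0 := zero_mem_range hpq
  have key : ∀ {u ψ ψ' S S' : ℝ → ℂ}, IsBdry p 0 ψ S → IsBdry p 0 ψ' S' → u =ᵐ[halfVol] (1 / 2 : ℂ) • (ψ + (k : ℂ) • S) →
      u =ᵐ[halfVol] (1 / 2 : ℂ) • (ψ' + (k : ℂ) • S') → ψ' =ᵐ[halfVol] ψ := by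
    intro u ψ ψ' S S' hS hS' h1 h2
    have := ae_eq_zero_of_bdry hpq hα hc hk (hS'.sub hpq h0 hS) (by
      filter_upwards [h1, h2] with x e1 e2
      have e := e1.symm.trans e2
      simp at e ⊢
      grind)
    filter_upwards [this] with x hx
    simpa [sub_eq_zero] using hx
  obtain ⟨S, hS⟩ := exists_isBdry hpq h0 (hψ.restrict (Ioi 0))
  obtain ⟨T, hT⟩ := exists_isBdry hpq h0 ((MemLp.comp_neg hψ).restrict (Ioi 0))
  obtain ⟨S', hS'⟩ := exists_isBdry hpq h0 (hψ'.restrict (Ioi 0))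
  obtain ⟨T', hT'⟩ := exists_isBdry hpq h0 ((MemLp.comp_neg hψ').restrict (Ioi 0))
  obtain ⟨a1, a2⟩ := (boundaryEquation_iff hpq hu hψ hS hT).1 h
  obtain ⟨b1, b2⟩ := (boundaryEquation_iff hpq hu hψ' hS' hT').1 h'
  exact (ae_eq_fold (key hS hS' a1 b1) (key hT hT' a2 b2)).trans (ae_eq_fold .rfl .rfl).symm

end HalfLine

/-- The operator whose kernel is the imaginary part of `mKer`. -/
def imM (β : ℝ) (v : ℝ → ℂ) (x t : ℝ) : ℂ := (mop β v (cpt x t) - mop β v (cpt x (-t))) / (2 * I)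

/-- The operator whose kernel is the real part of `mKer`. -/
def reM (β : ℝ) (v : ℝ → ℂ) (x t : ℝ) : ℂ := (mop β v (cpt x t) + mop β v (cpt x (-t))) / 2

lemma integral_congr_of_integrable {X : Type*} [MeasurableSpace X] {μ : Measure X} {f g : X → ℂ} {c : ℂ} (hf : Integrable f μ)
    (hc : ∫ x, f x ∂μ = c) (h : f =ᵐ[μ] g) : Integrable g μ ∧ ∫ x, g x ∂μ = c :=
  ⟨hf.congr h, by rw [← integral_congr_ae h, hc]⟩

section Kernel

include hpq hα

lemma integral_im_mKer (hv : MemLp v 𝔭 halfVol) (x : ℝ) (ht : t ≠ 0) :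
    Integrable (fun y => ((mKer α (cpt x t) y).im : ℂ) * v y) halfVol ∧ ∫ y, ((mKer α (cpt x t) y).im : ℂ) * v y ∂halfVol = imM α v x t := by
  have h1 := integrable_mKer_mul hpq hα hv (z := cpt x t) (by simpa)
  have h2 := integrable_mKer_mul hpq hα hv (z := cpt x (-t)) (by simpa)
  have e : (fun y => ((mKer α (cpt x t) y).im : ℂ) * v y) =
      fun y => (2 * I)⁻¹ * (mKer α (cpt x t) y * v y - mKer α (cpt x (-t)) y * v y) := by
    ext y
    rw [cpt_neg, ← conj_mKer _ (by simpa), Complex.im_eq_sub_conj]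
    simp only [star_def]
    ring
  rw [e, integral_const_mul, integral_sub h1 h2, imM, mop, mop, div_eq_inv_mul]
  exact ⟨(h1.sub h2).const_mul _, rfl⟩

lemma integral_re_mKer (hv : MemLp v 𝔭 halfVol) (x : ℝ) (ht : t ≠ 0) :
    Integrable (fun y => ((mKer α (cpt x t) y).re : ℂ) * v y) halfVol ∧ ∫ y, ((mKer α (cpt x t) y).re : ℂ) * v y ∂halfVol = reM α v x t := by
  have h1 := integrable_mKer_mul hpq hα hv (z := cpt x t) (by simpa)
  have h2 := integrable_mKer_mul hpq hα hv (z := cpt x (-t)) (by simpa)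
  have e : (fun y => ((mKer α (cpt x t) y).re : ℂ) * v y) =
      fun y => 2⁻¹ * (mKer α (cpt x t) y * v y + mKer α (cpt x (-t)) y * v y) := by
    ext y
    rw [cpt_neg, ← conj_mKer _ (by simpa), Complex.re_eq_add_conj]
    simp
    ring
  rw [e, integral_const_mul, integral_add h1 h2, reM, mop, mop, div_eq_inv_mul]
  exact ⟨(h1.add h2).const_mul _, rfl⟩

/-- Integrals against a real kernel that is composed of the half line kernels. -/
lemma integral_of_kernel (hu : MemLp u 𝔭) (x : ℝ) (ht : t ≠ 0) {K : ℝ → ℝ}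
    (h1 : ∀ y, 0 < y → K y = a * (mKer (-1) (cpt x t) y).im + a * (mKer α (cpt x t) y).im + c * (mKer 0 (cpt x t) y).re)
    (h2 : ∀ y, 0 < y → K (-y) = -a * (mKer (-1) (cpt x t) y).im + a * (mKer α (cpt x t) y).im) :
    Integrable (fun y => (K y : ℂ) * u y) ∧ ∫ y, (K y : ℂ) * u y =
      a * (imM (-1) u x t - imM (-1) (fun y => u (-y)) x t) + a * (imM α u x t + imM α (fun y => u (-y)) x t) + c * reM 0 u x t := by
  have hv := hu.restrict (Ioi 0)
  have hw := (MemLp.comp_neg hu).restrict (Ioi 0)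
  obtain ⟨i1, e1⟩ := integral_im_mKer hpq (neg_one_mem_range hpq) hv x ht
  obtain ⟨i2, e2⟩ := integral_im_mKer hpq hα hv x ht
  obtain ⟨i3, e3⟩ := integral_re_mKer hpq (zero_mem_range hpq) hv x ht
  obtain ⟨i1', e1'⟩ := integral_im_mKer hpq (neg_one_mem_range hpq) hw x ht
  obtain ⟨i2', e2'⟩ := integral_im_mKer hpq hα hw x ht
  have j1 := ((i1.const_mul (a : ℂ)).add (i2.const_mul (a : ℂ))).add (i3.const_mul (c : ℂ))
  have j2 := (i1'.const_mul (-a : ℂ)).add (i2'.const_mul (a : ℂ))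
  have J1 := integral_add' ((i1.const_mul (a : ℂ)).add (i2.const_mul (a : ℂ))) (i3.const_mul (c : ℂ))
  have J2 := integral_add' (i1'.const_mul (-a : ℂ)) (i2'.const_mul (a : ℂ))
  rw [integral_add' (i1.const_mul _) (i2.const_mul _)] at J1
  simp only [integral_const_mul, e1, e2, e3, e1', e2'] at J1 J2
  obtain ⟨k1, K1⟩ := integral_congr_of_integrable (g := fun y => (K y : ℂ) * u y) j1 J1 (ae_halfVol_pos.mono fun y hy => by
    simp only [h1 y hy, Pi.add_apply]; push_cast; ring)
  obtain ⟨k2, K2⟩ := integral_congr_of_integrable (g := fun y => (K (-y) : ℂ) * u (-y)) j2 J2 (ae_halfVol_pos.mono fun y hy => by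
    simp only [h2 y hy, Pi.add_apply]; push_cast; ring)
  refine ⟨integrable_of_halves k1 k2, ?_⟩
  rw [integral_halves k1 k2, integral_add k1 k2, K1, K2]
  ring

end Kernel

lemma normSq_sq_sub (x t y : ℝ) : normSq ((y : ℂ) ^ 2 - cpt x t ^ 2) = (t ^ 2 + (x - y) ^ 2) * (t ^ 2 + (x + y) ^ 2) := by
  have : (y : ℂ) ^ 2 - cpt x t ^ 2 = (y - cpt x t) * (y + cpt x t) := by ring
  rw [this, Complex.normSq_mul]
  simp [normSq_apply, cpt]
  ring

lemma mKer_im_eq (β x t y : ℝ) : (mKer β (cpt x t) y).im = (2 / π) *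
    ((y ^ (-β) * (cpt x t ^ ((β : ℂ) + 1) * ((y : ℂ) ^ 2 - star (cpt x t) ^ 2)).im) / ((t ^ 2 + (x - y) ^ 2) * (t ^ 2 + (x + y) ^ 2))) := by
  have e : mKer β (cpt x t) y = ((2 / π * y ^ (-β) / normSq ((y : ℂ) ^ 2 - cpt x t ^ 2) : ℝ) : ℂ) *
      (cpt x t ^ ((β : ℂ) + 1) * ((y : ℂ) ^ 2 - star (cpt x t) ^ 2)) := by
    rw [mKer, div_eq_mul_inv _ ((y : ℂ) ^ 2 - cpt x t ^ 2), Complex.inv_def]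
    simp
    ring
  rw [e, im_ofReal_mul, normSq_sq_sub]
  ring

lemma jumpPoissonKernel_pos (α t : ℝ) (hx : 0 ≤ x) (hy : 0 < y) :
    jumpPoissonKernel α t x y = (1 / 2) * (mKer (-1) (cpt x t) y).im + (1 / 2) * (mKer α (cpt x t) y).im ∧
    jumpPoissonKernel α t x (-y) = -(1 / 2) * (mKer (-1) (cpt x t) y).im + (1 / 2) * (mKer α (cpt x t) y).im := by
  have e0 : ((|x| : ℝ) : ℂ) + I * (t : ℂ) = cpt x t := by rw [abs_of_nonneg hx, cpt, mul_comm]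
  have e1 : ((|x| : ℝ) : ℂ) - I * (t : ℂ) = star (cpt x t) := by
    rw [abs_of_nonneg hx, ← cpt_neg, cpt]; push_cast; ring
  have e2 : (y ^ (-(-1 : ℝ)) * (cpt x t ^ (((-1 : ℝ) : ℂ) + 1) * ((y : ℂ) ^ 2 - star (cpt x t) ^ 2)).im) = 2 * x * t * y := by
    have : ((y : ℂ) ^ 2 - star (cpt x t) ^ 2) = ((y ^ 2 - x ^ 2 + t ^ 2 : ℝ) : ℂ) + ((2 * x * t : ℝ) : ℂ) * I := by
      rw [← cpt_neg, cpt]; push_cast; linear_combination (-(t : ℂ) ^ 2) * I_sq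
    have h0 : (((-1 : ℝ) : ℂ) + 1) = 0 := by push_cast; ring
    rw [this, h0, cpow_zero, one_mul, neg_neg, Real.rpow_one, add_im, ofReal_im, im_ofReal_mul, I_im]
    ring
  rw [mKer_im_eq, mKer_im_eq, e2]
  constructor
  · rw [jumpPoissonKernel, e0, e1, abs_of_pos hy]; ring
  · rw [jumpPoissonKernel, e0, e1, abs_neg, abs_of_pos hy]; push_cast; ring

lemma jumpPoissonKernel_neg (α t x y : ℝ) : jumpPoissonKernel α t (-x) (-y) = jumpPoissonKernel α t x y := by
  unfold jumpPoissonKernel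
  rw [abs_neg, abs_neg, ofReal_neg, neg_sq]
  ring

lemma dirichletCauchyKernel_neg (k t x y : ℝ) : dirichletCauchyKernel k t (-x) (-y) = dirichletCauchyKernel k t x y := by
  unfold dirichletCauchyKernel
  rw [abs_neg, abs_neg, Real.sign_neg]
  ring

lemma mKer_zero_neg_one (x : ℝ) (ht : t ≠ 0) :
    mKer (-1) (cpt x t) y + mKer 0 (cpt x t) y = ((2 / π : ℝ) : ℂ) * (y - cpt x t)⁻¹ ∧
    mKer 0 (cpt x t) y - mKer (-1) (cpt x t) y = ((2 / π : ℝ) : ℂ) * -(y + cpt x t)⁻¹ := by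
  have h1 := ofReal_sub_ne_zero y (w := cpt x t) (by simpa)
  have h2 : (y : ℂ) + cpt x t ≠ 0 := by have := ofReal_sub_ne_zero y (w := -cpt x t) (by simpa); simp_all
  have e : (y : ℂ) ^ 2 - cpt x t ^ 2 = (y - cpt x t) * (y + cpt x t) := by ring
  constructor <;> (rw [mKer, mKer, e]; simp; grind)

lemma dirichletCauchyKernel_pos (k : ℝ) (ht : t ≠ 0) (hx : 0 ≤ x) (hy : 0 < y) :
    dirichletCauchyKernel k t x y = (1 / 4) * (mKer (-1) (cpt x t) y).im + (1 / 4) * (mKer 0 (cpt x t) y).im + (k / 2) * (mKer 0 (cpt x t) y).re ∧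
    dirichletCauchyKernel k t x (-y) = -(1 / 4) * (mKer (-1) (cpt x t) y).im + (1 / 4) * (mKer 0 (cpt x t) y).im := by
  obtain ⟨e1, e2⟩ := mKer_zero_neg_one x (y := y) ht
  have n1 : normSq (y - cpt x t) = t ^ 2 + (x - y) ^ 2 := by simp [normSq_apply]; ring
  have n2 : normSq (y + cpt x t) = t ^ 2 + (x + y) ^ 2 := by simp [normSq_apply]; ring
  have a1 := congrArg im e1
  have a2 := congrArg im e2
  have a3 := congrArg re e1
  have a4 := congrArg re e2
  simp only [add_im, sub_im, add_re, sub_re, im_ofReal_mul, Complex.re_ofReal_mul, neg_im, neg_re,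
    inv_im, inv_re, n1, n2, cpt_re, cpt_im, ofReal_re, ofReal_im, zero_add, zero_sub, neg_neg] at a1 a2 a3 a4
  rw [dirichletCauchyKernel, dirichletCauchyKernel, sign_of_pos hy, sign_of_neg (neg_lt_zero.2 hy), abs_neg, abs_of_pos hy, abs_of_nonneg hx,
    sub_neg_eq_add]
  constructor
  · linear_combination (-1 / 4) * a1 + (-k / 4) * (a3 + a4)
  · linear_combination (-1 / 4) * a2

lemma integral_kernel_neg {K : ℝ → ℝ → ℝ} (hK : ∀ x y, K (-x) (-y) = K x y) (u : ℝ → ℂ) (x : ℝ) :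
    (Integrable (fun y => (K x y : ℂ) * u (-y)) → Integrable (fun y => (K (-x) y : ℂ) * u y)) ∧
    ∫ y, (K (-x) y : ℂ) * u y = ∫ y, (K x y : ℂ) * u (-y) := by
  have e : (fun y => (K x y : ℂ) * u (-y)) = fun y => (K (-x) (-y) : ℂ) * u (-y) := by ext y; rw [hK]
  refine ⟨fun h => ?_, ?_⟩
  · rw [e] at h
    simpa using h.comp_neg
  · rw [e, integral_neg_eq_self (fun y => (K (-x) y : ℂ) * u y)]

section Poisson

lemma poissonIntegral_neg (α : ℝ) (u : ℝ → ℂ) (t x : ℝ) : poissonIntegral α u (t, -x) = poissonIntegral α (fun y => u (-y)) (t, x) :=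
  (integral_kernel_neg (jumpPoissonKernel_neg α t) u x).2

include hpq hα

lemma poissonIntegral_eq (hu : MemLp u 𝔭) (ht : t ≠ 0) (hx : 0 ≤ x) :
    Integrable (fun y => (jumpPoissonKernel α t x y : ℂ) * u y) ∧ poissonIntegral α u (t, x) =
      (1 / 2 : ℂ) * (imM (-1) u x t - imM (-1) (fun y => u (-y)) x t) + (1 / 2) * (imM α u x t + imM α (fun y => u (-y)) x t) := by
  have h := integral_of_kernel hpq hα hu x ht (c := 0)
    (fun y hy => by rw [(jumpPoissonKernel_pos α t hx hy).1]; ring) (fun y hy => (jumpPoissonKernel_pos α t hx hy).2)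
  refine ⟨h.1, h.2.trans ?_⟩
  push_cast
  ring

lemma integrable_jumpPoissonKernel (hu : MemLp u 𝔭) (ht : t ≠ 0) (x : ℝ) :
    Integrable (fun y => (jumpPoissonKernel α t x y : ℂ) * u y) := by
  rcases le_total 0 x with hx | hx
  · exact (poissonIntegral_eq hpq hα hu ht hx).1
  · have := (integral_kernel_neg (jumpPoissonKernel_neg α t) u (-x)).1 (poissonIntegral_eq hpq hα (MemLp.comp_neg hu) ht (neg_nonneg.2 hx)).1
    simp_all

omit hα in
lemma integral_dirichletCauchyKernel (k : ℝ) (hu : MemLp u 𝔭) (ht : t ≠ 0) (hx : 0 ≤ x) :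
    Integrable (fun y => (dirichletCauchyKernel k t x y : ℂ) * u y) ∧ ∫ y, (dirichletCauchyKernel k t x y : ℂ) * u y =
      (1 / 4 : ℂ) * (imM (-1) u x t - imM (-1) (fun y => u (-y)) x t) + (1 / 4) * (imM 0 u x t + imM 0 (fun y => u (-y)) x t)
        + (k / 2) * reM 0 u x t := by
  have h := integral_of_kernel hpq (zero_mem_range hpq) hu x ht
    (fun y hy => (dirichletCauchyKernel_pos k ht hx hy).1) (fun y hy => (dirichletCauchyKernel_pos k ht hx hy).2)
  simp_all

/-- The Poisson integral is given by the boundary equation method. -/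
lemma poissonIntegral_eq_integral (hc : cos (π * α / 2) ≠ 0)
    (hk : tan (π * α / 2) = k) (hu : MemLp u 𝔭) (hψ : MemLp ψ 𝔭)
    (hS : IsBdry p 0 ψ S) (hT : IsBdry p 0 (fun x => ψ (-x)) T) (h1 : u =ᵐ[halfVol] (1 / 2 : ℂ) • (ψ + (k : ℂ) • S))
    (h2 : (fun x => u (-x)) =ᵐ[halfVol] (1 / 2 : ℂ) • ((fun x => ψ (-x)) + (k : ℂ) • T)) (ht : 0 < t) (x : ℝ) :
    Integrable (fun y => (dirichletCauchyKernel k t x y : ℂ) * ψ y) ∧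
      poissonIntegral α u (t, x) = ∫ y, (dirichletCauchyKernel k t x y : ℂ) * ψ y := by
  have key : ∀ {u ψ S T : ℝ → ℂ}, MemLp u 𝔭 → MemLp ψ 𝔭 →
      IsBdry p 0 ψ S → IsBdry p 0 (fun x => ψ (-x)) T → u =ᵐ[halfVol] (1 / 2 : ℂ) • (ψ + (k : ℂ) • S) →
      (fun x => u (-x)) =ᵐ[halfVol] (1 / 2 : ℂ) • ((fun x => ψ (-x)) + (k : ℂ) • T) → ∀ {x : ℝ}, 0 ≤ x →
      Integrable (fun y => (dirichletCauchyKernel k t x y : ℂ) * ψ y) ∧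
      poissonIntegral α u (t, x) = ∫ y, (dirichletCauchyKernel k t x y : ℂ) * ψ y := by
    intro u ψ S T hu hψ hS hT h1 h2 x hx
    have ht1 : (cpt x t).im ≠ 0 := by simpa using ht.ne'
    have ht2 : (cpt x (-t)).im ≠ 0 := by simp_all
    have s1 : transferSign (cpt x t) = I := by simpa using transferSign_cpt (Or.inl rfl) ht
    have s2 : transferSign (cpt x (-t)) = -I := by simpa using transferSign_cpt (Or.inr rfl) ht
    have A : ∀ {v ψ S : ℝ → ℂ}, IsBdry p 0 ψ S → v =ᵐ[halfVol] (1 / 2 : ℂ) • (ψ + (k : ℂ) • S) →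
        imM α v x t = (1 / 2) * imM 0 ψ x t + (k / 2) * reM 0 ψ x t ∧
        imM (-1) v x t = (1 / 2) * imM (-1) ψ x t + (k / 2) * reM 0 ψ x t := by
      intro v ψ S h e
      have n1 := neg_one_mem_range hpq
      constructor
      · rw [imM, mop_congr_ae e, mop_congr_ae e, mop_smul, mop_smul, mop_of_bdry_zero hpq hα hc hk h ht1 (by simpa),
          mop_of_bdry_zero hpq hα hc hk h ht2 (by simpa), s1, s2, imM, reM]
        field_simp
        ring
      · rw [imM, mop_congr_ae e, mop_congr_ae e, mop_smul, mop_smul, mop_add hpq n1 h.left (h.right.const_smul _) ht1,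
          mop_add hpq n1 h.left (h.right.const_smul _) ht2, mop_smul, mop_smul, mop_neg_one_of_bdry_zero hpq h ht1 (by simpa),
          mop_neg_one_of_bdry_zero hpq h ht2 (by simpa), s1, s2, imM, reM]
        field_simp
        ring
    obtain ⟨d1, d2⟩ := integral_dirichletCauchyKernel hpq k hψ ht.ne' hx
    refine ⟨d1, ?_⟩
    rw [d2, (poissonIntegral_eq hpq hα hu ht.ne' hx).2, (A hS h1).1, (A hS h1).2, (A hT h2).1, (A hT h2).2]
    ring
  rcases le_total 0 x with hx | hx
  · grind
  · obtain ⟨a1, a2⟩ := key (MemLp.comp_neg hu) (MemLp.comp_neg hψ) hT (by simpa using hS) h2 (by simpa using h1) (neg_nonneg.2 hx)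
    obtain ⟨b1, b2⟩ := integral_kernel_neg (dirichletCauchyKernel_neg k t) ψ (-x)
    have c := poissonIntegral_neg α u t (-x)
    grind

lemma exists_imM_bound : ∃ C : ℝ≥0, ∀ v : ℝ → ℂ, MemLp v 𝔭 halfVol → ∀ t : ℝ, t ≠ 0 →
    MemLp (fun x => imM α v x t) 𝔭 halfVol ∧
    eLpNorm (fun x => imM α v x t) 𝔭 halfVol ≤ C * eLpNorm v 𝔭 halfVol := by
  obtain ⟨C, hC⟩ := exists_mop_bound hpq hα
  refine ⟨C, fun v hv t ht => ?_⟩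
  obtain ⟨a1, a2⟩ := hC v hv t ht
  obtain ⟨b1, b2⟩ := hC v hv (-t) (neg_ne_zero.2 ht)
  have e : (fun x => imM α v x t) = (2 * I)⁻¹ • ((fun x => mop α v (cpt x t)) - fun x => mop α v (cpt x (-t))) := by
    ext x; simp [imM, div_eq_inv_mul]
  rw [e]
  refine ⟨(a1.sub b1).const_smul _, ?_⟩
  rw [eLpNorm_const_smul]
  have h2 : ‖((2 * I)⁻¹ : ℂ)‖ₑ = 2⁻¹ := by
    rw [← ofReal_norm]
    simp
  rw [h2]
  calc _ ≤ 2⁻¹ * (C * eLpNorm v 𝔭 halfVol + C * eLpNorm v 𝔭 halfVol) := by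
        gcongr; exact (eLpNorm_sub_le a1.1 b1.1 (one_le_ofReal hpq)).trans (add_le_add a2 b2)
    _ = _ := by rw [← two_mul, ← mul_assoc, ENNReal.inv_mul_cancel two_ne_zero ENNReal.ofNat_ne_top, one_mul]

lemma tendsto_imM (hv : MemLp v 𝔭 halfVol) :
    Tendsto (fun t => eLpNorm (fun x => imM α v x t - v x) 𝔭 halfVol) (𝓝[>] 0) (𝓝 0) := by
  obtain ⟨S, hS⟩ := exists_isBdry hpq hα hv
  have l := ENNReal.Tendsto.const_mul ((hS.lim 1 (Or.inl rfl)).add (hS.lim (-1) (Or.inr rfl))) (a := ‖((2 * I)⁻¹ : ℂ)‖ₑ) (Or.inr enorm_ne_top)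
  simp only [add_zero, mul_zero] at l
  refine tendsto_zero_of_le l ?_
  filter_upwards [self_mem_nhdsWithin] with t ht
  have m : ∀ σ : ℝ, σ ≠ 0 → AEStronglyMeasurable (fun x => mop α v (cpt x (σ * t)) - (S x + σ * I * v x)) halfVol := fun σ hσ =>
    (aestronglyMeasurable_mop_line hpq hα hv (by grind)).sub (hS.right.1.add (hv.1.const_mul _))
  have e : (fun x => imM α v x t - v x) = (2 * I)⁻¹ • ((fun x => mop α v (cpt x ((1 : ℝ) * t)) - (S x + (1 : ℝ) * I * v x)) -
      fun x => mop α v (cpt x ((-1 : ℝ) * t)) - (S x + (-1 : ℝ) * I * v x)) := by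
    ext x
    simp only [Pi.smul_apply, Pi.sub_apply, smul_eq_mul, imM, one_mul, neg_one_mul]
    push_cast
    field_simp
    ring
  rw [e, eLpNorm_const_smul]
  gcongr
  exact eLpNorm_sub_le (m 1 one_ne_zero) (m (-1) (by norm_num)) (one_le_ofReal hpq)

lemma exists_poissonIntegral_bound : ∃ C : ℝ≥0, ∀ u : ℝ → ℂ, MemLp u 𝔭 → ∀ t : ℝ, 0 < t →
    MemLp (fun x => poissonIntegral α u (t, x)) 𝔭 ∧
    eLpNorm (fun x => poissonIntegral α u (t, x)) 𝔭 ≤ C * eLpNorm u 𝔭 := by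
  obtain ⟨C, hC⟩ := exists_imM_bound hpq hα
  obtain ⟨D, hD⟩ := exists_imM_bound hpq (neg_one_mem_range hpq)
  have P1 := one_le_ofReal hpq
  have key : ∀ u : ℝ → ℂ, MemLp u 𝔭 → ∀ t : ℝ, 0 < t →
      MemLp (fun x => poissonIntegral α u (t, x)) 𝔭 halfVol ∧
      eLpNorm (fun x => poissonIntegral α u (t, x)) 𝔭 halfVol ≤ (2 * D + 2 * C) * eLpNorm u 𝔭 := by
    intro u hu t ht
    have hv := hu.restrict (Ioi 0)
    have hw := (MemLp.comp_neg hu).restrict (Ioi 0)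
    have n1 : eLpNorm u 𝔭 halfVol ≤ eLpNorm u 𝔭 := eLpNorm_mono_measure _ restrict_le_self
    have n2 : eLpNorm (fun x => u (-x)) 𝔭 halfVol ≤ eLpNorm u 𝔭 :=
      (eLpNorm_mono_measure _ restrict_le_self).trans_eq (eLpNorm_comp_neg hu.1 _)
    obtain ⟨a1, a2⟩ := hC _ hv t ht.ne'
    obtain ⟨b1, b2⟩ := hC _ hw t ht.ne'
    obtain ⟨c1, c2⟩ := hD _ hv t ht.ne'
    obtain ⟨d1, d2⟩ := hD _ hw t ht.ne'
    have e : (fun x => poissonIntegral α u (t, x)) =ᵐ[halfVol] (1 / 2 : ℂ) • (((fun x => imM (-1) u x t) - fun x => imM (-1) (fun y => u (-y)) x t) +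
        ((fun x => imM α u x t) + fun x => imM α (fun y => u (-y)) x t)) := ae_halfVol_pos.mono fun x hx => by
      simp only [(poissonIntegral_eq hpq hα hu ht.ne' hx.le).2, Pi.smul_apply, Pi.add_apply, Pi.sub_apply, smul_eq_mul]
      ring
    refine ⟨(((c1.sub d1).add (a1.add b1)).const_smul _).ae_eq e.symm, ?_⟩
    rw [eLpNorm_congr_ae e, eLpNorm_const_smul]
    have h1 : ‖(1 / 2 : ℂ)‖ₑ ≤ 1 := by rw [← ofReal_norm]; norm_num
    refine (mul_le_mul' h1 ((eLpNorm_add_le (c1.sub d1).1 (a1.add b1).1 P1).trans (add_le_add (eLpNorm_sub_le c1.1 d1.1 P1) (eLpNorm_add_le a1.1 b1.1 P1)))).trans ?_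
    rw [one_mul, add_mul, mul_assoc, mul_assoc, two_mul, two_mul]
    gcongr
    · exact c2.trans (by gcongr)
    · exact d2.trans (by gcongr)
    · exact a2.trans (by gcongr)
    · exact b2.trans (by gcongr)
  refine ⟨(2 * D + 2 * C) + (2 * D + 2 * C), fun u hu t ht => ?_⟩
  obtain ⟨a1, a2⟩ := key u hu t ht
  obtain ⟨b1, b2⟩ := key _ (MemLp.comp_neg hu) t ht
  simp only [← poissonIntegral_neg] at b1 b2
  rw [eLpNorm_comp_neg hu.1] at b2
  have m := memLp_of_halves a1 b1
  refine ⟨m, (eLpNorm_le_halves m.1 P1).trans ((add_le_add a2 b2).trans_eq ?_)⟩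
  push_cast
  ring

lemma tendsto_poissonIntegral (hu : MemLp u 𝔭) :
    Tendsto (fun t : ℝ => eLpNorm (fun x => poissonIntegral α u (t, x) - u x) 𝔭) (𝓝[>] 0) (𝓝 0) := by
  have P1 := one_le_ofReal hpq
  obtain ⟨C, hC⟩ := exists_poissonIntegral_bound hpq hα
  have key : ∀ u : ℝ → ℂ, MemLp u 𝔭 →
      Tendsto (fun t => eLpNorm (fun x => poissonIntegral α u (t, x) - u x) 𝔭 halfVol) (𝓝[>] 0) (𝓝 0) := by
    intro u hu
    have hv := hu.restrict (Ioi 0)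
    have hw := (MemLp.comp_neg hu).restrict (Ioi 0)
    obtain ⟨Ca, hCa⟩ := exists_imM_bound hpq hα
    obtain ⟨Cb, hCb⟩ := exists_imM_bound hpq (neg_one_mem_range hpq)
    have n1 := neg_one_mem_range hpq
    have l := ENNReal.Tendsto.const_mul (((tendsto_imM hpq n1 hv).add (tendsto_imM hpq n1 hw)).add ((tendsto_imM hpq hα hv).add (tendsto_imM hpq hα hw)))
      (a := ‖(1 / 2 : ℂ)‖ₑ) (Or.inr enorm_ne_top)
    simp only [add_zero, mul_zero] at l
    refine tendsto_zero_of_le l ?_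
    filter_upwards [self_mem_nhdsWithin] with t ht
    have ht' : t ≠ 0 := ne_of_gt ht
    have m1 := ((hCb _ hv t ht').1.sub hv).1
    have m2 := ((hCb _ hw t ht').1.sub hw).1
    have m3 := ((hCa _ hv t ht').1.sub hv).1
    have m4 := ((hCa _ hw t ht').1.sub hw).1
    have e : (fun x => poissonIntegral α u (t, x) - u x) =ᵐ[halfVol] (1 / 2 : ℂ) • (((fun x => imM (-1) u x t - u x) -
        fun x => imM (-1) (fun y => u (-y)) x t - u (-x)) + ((fun x => imM α u x t - u x) + fun x => imM α (fun y => u (-y)) x t - u (-x))) :=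
      ae_halfVol_pos.mono fun x hx => by
        simp only [(poissonIntegral_eq hpq hα hu ht' hx.le).2, Pi.smul_apply, Pi.add_apply, Pi.sub_apply, smul_eq_mul]
        ring
    rw [eLpNorm_congr_ae e, eLpNorm_const_smul]
    gcongr
    exact (eLpNorm_add_le (m1.sub m2) (m3.add m4) P1).trans (add_le_add (eLpNorm_sub_le m1 m2 P1) (eLpNorm_add_le m3 m4 P1))
  refine tendsto_of_halves P1 ?_ (key u hu) ?_
  · filter_upwards [self_mem_nhdsWithin] with t ht using ((hC u hu t ht).1.sub hu).1
  · simpa [poissonIntegral_neg] using key _ (MemLp.comp_neg hu)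

end Poisson

/-- A family of functions on the line that is bounded in `L_p` and converges in `L_p` to `W` as `t → 0`. -/
structure IsSlice {E : Type*} [NormedAddCommGroup E] (P : ℝ≥0∞) (w : ℝ → ℝ → E) (W : ℝ → E) : Prop where
  memLp : ∀ t, 0 < t → MemLp (w t) P
  bounded : ∃ C : ℝ≥0, ∀ t, 0 < t → eLpNorm (w t) P ≤ C
  trace_memLp : MemLp W P
  trace : Tendsto (fun t => eLpNorm (w t - W) P) (𝓝[>] 0) (𝓝 0)

namespace IsSlice

variable {P : ℝ≥0∞} {w v : ℝ → ℝ → ℂ} {W V : ℝ → ℂ}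

lemma add (hP : 1 ≤ P) (h : IsSlice P w W) (h' : IsSlice P v V) : IsSlice P (fun t x => w t x + v t x) (fun x => W x + V x) := by
  obtain ⟨C, hC⟩ := h.bounded
  obtain ⟨D, hD⟩ := h'.bounded
  refine ⟨fun t ht => (h.memLp t ht).add (h'.memLp t ht), ⟨C + D, fun t ht => ?_⟩, h.trace_memLp.add h'.trace_memLp, ?_⟩
  · exact (eLpNorm_add_le (h.memLp t ht).1 (h'.memLp t ht).1 hP).trans (add_le_add (hC t ht) (hD t ht))
  · have l := h.trace.add h'.trace
    rw [add_zero] at l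
    refine tendsto_zero_of_le l ?_
    filter_upwards [self_mem_nhdsWithin] with t ht
    have e : (fun x => w t x + v t x) - (fun x => W x + V x) = (w t - W) + (v t - V) := by
      ext x; simp; ring
    rw [e]
    exact eLpNorm_add_le ((h.memLp t ht).sub h.trace_memLp).1 ((h'.memLp t ht).sub h'.trace_memLp).1 hP

lemma const_mul (h : IsSlice P w W) (c : ℂ) : IsSlice P (fun t x => c * w t x) (fun x => c * W x) := by
  obtain ⟨C, hC⟩ := h.bounded
  refine ⟨fun t ht => (h.memLp t ht).const_mul c, ⟨‖c‖₊ * C, fun t ht => ?_⟩, h.trace_memLp.const_mul c, ?_⟩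
  · exact (eLpNorm_const_smul c (w t) P volume).trans_le (mul_le_mul' le_rfl (hC t ht))
  · have l := ENNReal.Tendsto.const_mul h.trace (a := ‖c‖ₑ) (Or.inr enorm_ne_top)
    rw [mul_zero] at l
    refine l.congr fun t => ?_
    rw [← eLpNorm_const_smul]
    congr 1
    ext x
    simp [mul_sub]

lemma comp_neg (h : IsSlice P w W) : IsSlice P (fun t x => w t (-x)) (fun x => W (-x)) := by
  obtain ⟨C, hC⟩ := h.bounded
  refine ⟨fun t ht => MemLp.comp_neg (h.memLp t ht), ⟨C, fun t ht => ?_⟩, MemLp.comp_neg h.trace_memLp, ?_⟩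
  · rw [eLpNorm_comp_neg (h.memLp t ht).1]; exact hC t ht
  · refine h.trace.congr' ?_
    filter_upwards [self_mem_nhdsWithin] with t ht
    exact (eLpNorm_comp_neg ((h.memLp t ht).sub h.trace_memLp).1 P).symm

lemma indicator (h : IsSlice P w W) {s : Set ℝ} (hs : MeasurableSet s) : IsSlice P (fun t => s.indicator (w t)) (s.indicator W) := by
  obtain ⟨C, hC⟩ := h.bounded
  refine ⟨fun t ht => (h.memLp t ht).indicator hs, ⟨C, fun t ht => (eLpNorm_indicator_le _).trans (hC t ht)⟩, h.trace_memLp.indicator hs,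
    tendsto_of_tendsto_of_tendsto_of_le_of_le tendsto_const_nhds h.trace (fun _ => zero_le) fun t => ?_⟩
  rw [← indicator_sub']
  exact eLpNorm_indicator_le _

lemma ite (hP : 1 ≤ P) (h : IsSlice P w W) (h' : IsSlice P v V) :
    IsSlice P (fun t x => if 0 < x then w t x else v t x) (fun x => if 0 < x then W x else V x) := by
  have := (h.indicator (measurableSet_Ioi (a := (0 : ℝ)))).add hP (h'.indicator (measurableSet_Ioi (a := (0 : ℝ))).compl)
  have e : ∀ (f g : ℝ → ℂ) x, (Ioi 0).indicator f x + (Ioi 0)ᶜ.indicator g x = if 0 < x then f x else g x := by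
    intro f g x
    by_cases hx : 0 < x <;> simp_all
  grind

lemma pi (hP : 1 ≤ P) {w : ℝ → ℝ → Fin 2 → ℂ} {W : ℝ → Fin 2 → ℂ}
    (h : ∀ i, IsSlice P (fun t x => w t x i) (fun x => W x i)) : IsSlice P w W := by
  have key : ∀ {f : ℝ → Fin 2 → ℂ}, (∀ i, AEStronglyMeasurable (fun x => f x i)) →
      eLpNorm f P ≤ eLpNorm (fun x => f x 0) P + eLpNorm (fun x => f x 1) P := by
    intro f hf
    rw [← eLpNorm_norm (fun x => f x 0), ← eLpNorm_norm (fun x => f x 1)]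
    refine (eLpNorm_mono_real fun x => ?_).trans (eLpNorm_add_le (hf 0).norm (hf 1).norm hP)
    refine (pi_norm_le_iff_of_nonneg (add_nonneg (norm_nonneg _) (norm_nonneg _))).2 fun i => ?_
    fin_cases i <;> simp
  have meas : ∀ {f : ℝ → Fin 2 → ℂ}, (∀ i, AEStronglyMeasurable (fun x => f x i)) → AEStronglyMeasurable f :=
    fun hf => (aemeasurable_pi_iff.2 fun i => (hf i).aemeasurable).aestronglyMeasurable
  have mem : ∀ {f : ℝ → Fin 2 → ℂ}, (∀ i, MemLp (fun x => f x i) P) → MemLp f P := fun hf =>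
    ⟨meas fun i => (hf i).1, (key fun i => (hf i).1).trans_lt (ENNReal.add_lt_top.2 ⟨(hf 0).2, (hf 1).2⟩)⟩
  obtain ⟨C, hC⟩ := (h 0).bounded
  obtain ⟨D, hD⟩ := (h 1).bounded
  refine ⟨fun t ht => mem fun i => (h i).memLp t ht, ⟨C + D, fun t ht => ?_⟩, mem fun i => (h i).trace_memLp, ?_⟩
  · exact (key fun i => ((h i).memLp t ht).1).trans (add_le_add (hC t ht) (hD t ht))
  · have l := (h 0).trace.add (h 1).trace
    rw [add_zero] at l
    refine tendsto_zero_of_le l ?_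
    filter_upwards [self_mem_nhdsWithin] with t ht
    exact key fun i => (((h i).memLp t ht).sub (h i).trace_memLp).1

end IsSlice

/-- The function `f`, holomorphic off the real line, has the `L_p` boundary values `B 1` from above and `B (-1)` from below. -/
def HasTraces (P : ℝ≥0∞) (f : ℂ → ℂ) (B : ℝ → ℝ → ℂ) : Prop :=
  ∀ σ, σ = 1 ∨ σ = -1 → IsSlice P (fun t x => f (cpt x (σ * t))) (B σ)

/-- The holomorphic functions that generate the field `C_k [ψ, k sgn(x) ψ]`. -/
def dirP (k : ℝ) (c : ℂ) (f g h : ℂ → ℂ) (ζ : ℂ) : ℂ :=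
  (1 / (2 * π) : ℂ) * (c * (f ζ + -1 * g (-ζ)) + (k / 2) * (h ζ + -1 * h (-ζ)))

lemma HolOff.dirP {f g h : ℂ → ℂ} (hf : HolOff f) (hg : HolOff g) (hh : HolOff h) (k : ℝ) (c : ℂ) : HolOff (dirP k c f g h) :=
  HolOff.const_mul (((hf.add (hg.comp_neg.const_mul _)).const_mul c).add ((hh.add (hh.comp_neg.const_mul _)).const_mul _)) _

lemma HasTraces.dirP (hP : 1 ≤ P) {f g h : ℂ → ℂ} {F G H : ℝ → ℝ → ℂ} (hf : HasTraces P f F) (hg : HasTraces P g G)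
    (hh : HasTraces P h H) (k : ℝ) (c : ℂ) : HasTraces P (dirP k c f g h) fun σ x =>
      (1 / (2 * π) : ℂ) * (c * (F σ x + -1 * G (-σ) (-x)) + (k / 2) * (H σ x + -1 * H (-σ) (-x))) := by
  intro σ hσ
  have hσ' : -σ = 1 ∨ -σ = -1 := by grind
  have n : ∀ {g : ℂ → ℂ} {G : ℝ → ℝ → ℂ}, HasTraces P g G → IsSlice P (fun t x => g (-cpt x (σ * t))) (fun x => G (-σ) (-x)) := fun h => by
    simpa [neg_cpt, neg_mul] using (h _ hσ').comp_neg
  exact (((hf σ hσ).add hP ((n hg).const_mul _)).const_mul _ |>.add hP (((hh σ hσ).add hP ((n hh).const_mul _)).const_mul _)).const_mul _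

lemma HasTraces.pairField (hP : 1 ≤ P) {p q : ℂ → ℂ} {Bp Bm Bq Bn : ℝ → ℝ → ℂ} (hp : HasTraces P p Bp) (hm : HasTraces P m Bm)
    (hq : HasTraces P q Bq) (hn : HasTraces P n Bn) (hσ : σ = 1 ∨ σ = -1) :
    IsSlice P (fun t x => pairField p m q n (σ * t, x)) fun x => if 0 < x then ![Bp σ x + Bm (-σ) x, -I * Bp σ x + I * Bm (-σ) x]
      else ![Bq σ x + Bn (-σ) x, -I * Bq σ x + I * Bn (-σ) x] := by
  have hσ' : -σ = 1 ∨ -σ = -1 := by grind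
  have a0 := ((hp σ hσ).add hP (hm _ hσ')).ite hP ((hq σ hσ).add hP (hn _ hσ'))
  have a1 := (((hp σ hσ).const_mul (-I)).add hP ((hm _ hσ').const_mul I)).ite hP
    (((hq σ hσ).const_mul (-I)).add hP ((hn _ hσ').const_mul I))
  refine IsSlice.pi hP fun i => ?_
  fin_cases i
  · convert a0 using 3 with t x x
    · by_cases hx : 0 < x <;> simp [HarmonicMeasure.pairField, glue, hx, hf0]
    bound
  · convert a1 using 3 with t x x
    · by_cases hx : 0 < x <;> simp [HarmonicMeasure.pairField, glue, hx, hf1]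
    bound

lemma isPair_dirP {f g : ℂ → ℂ} (hf : HolOff f) (hg : HolOff g) (k : ℝ) :
    IsPair k (dirP k (2 * I)⁻¹ f g f) (dirP k (-(2 * I)⁻¹) f g f) (dirP k (2 * I)⁻¹ f g (fun ζ => -1 * g ζ))
      (dirP k (-(2 * I)⁻¹) f g (fun ζ => -1 * g ζ)) := by
  have hI : (2 * I)⁻¹ = -I / 2 := by rw [mul_inv, inv_I]; ring
  have e : ∀ t, cpt 0 (-t) = -cpt 0 t := fun t => by rw [neg_cpt, neg_zero]
  refine ⟨hf.dirP hg hf k _, hf.dirP hg hf k _, hf.dirP hg (hg.const_mul _) k _, hf.dirP hg (hg.const_mul _) k _, fun t _ => ?_, fun t _ => ?_⟩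
  · simp only [hf0, dirP, e, neg_neg]
    ring
  · simp only [hf0, hf1, dirP, e, neg_neg, hI]
    ring

lemma IsFirstOrderSolution.neg {F : ℝ × ℝ → Fin 2 → ℂ} (h : IsFirstOrderSolution k Ω F) :
    IsFirstOrderSolution k Ω (-F) := by
  refine ⟨h.1.neg, fun φ hφ => ?_⟩
  obtain ⟨h1, h2⟩ := h.2 φ hφ
  constructor
  · simp only [Pi.neg_apply, Matrix.mulVec_neg, neg_dotProduct, integral_neg, h1, neg_zero]
  · have e : ∀ z, (-F) z 1 * grad φ z 0 - (-F) z 0 * grad φ z 1 = -(F z 1 * grad φ z 0 - F z 0 * grad φ z 1) := fun z => by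
      simp only [Pi.neg_apply]; ring
    simp only [e, integral_neg, h2, neg_zero]

lemma IsHardyField.neg {F : ℝ × ℝ → Fin 2 → ℂ} {h : ℝ → Fin 2 → ℂ} (H : IsHardyField σ k P F h) :
    IsHardyField σ k P (-F) (-h) := by
  obtain ⟨C, hC⟩ := H.bounded
  refine ⟨H.solves.neg, fun t ht => (H.slice_memLp t ht).neg, ⟨C, fun t ht => ?_⟩, H.trace_memLp.neg, H.trace.congr fun t => ?_⟩
  · exact (eLpNorm_neg (fun x => F (σ * t, x)) P volume).trans_le (hC t ht)
  · rw [← eLpNorm_neg]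
    congr 1
    ext x i
    simp
    ring

lemma IsPair.isHardyField {p q : ℂ → ℂ} (h : IsPair k p m q n) {W : ℝ → Fin 2 → ℂ}
    (hs : IsSlice P (fun t x => pairField p m q n (σ * t, x)) W) : IsHardyField σ k P (pairField p m q n) W where
  solves := h.isFirstOrderSolution (isOpen_lt continuous_const (by fun_prop)) fun z hz h0 => by simp_all
  slice_memLp := hs.memLp
  bounded := hs.bounded
  trace_memLp := hs.trace_memLp
  trace := hs.trace

section Extension

include hpq

lemma holOff_cauchyT {a : ℝ → ℂ} (ha : MemLp a 𝔭) : HolOff (cauchyT a) := fun _ hζ =>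
  differentiableAt_cauchyT ha.1 (MemLp.integrable_div_one_add_abs hpq ha) hζ

lemma exists_hasTraces_cauchyT {a : ℝ → ℂ} (ha : MemLp a 𝔭) :
    ∃ H : ℝ → ℂ, HasTraces 𝔭 (cauchyT a) fun σ x => H x + σ * I * π * a x := by
  obtain ⟨C, hC⟩ := riesz hpq
  obtain ⟨H, hH, hHl⟩ := exists_tendsto_conjP hpq ha
  refine ⟨H, fun σ hσ => ?_⟩
  have hσ0 : σ ≠ 0 := by grind
  refine ⟨fun t ht => (hC a ha _ (by positivity)).1, ⟨C * (eLpNorm a 𝔭).toNNReal, fun t ht => ?_⟩,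
    hH.add (ha.const_mul _), tendsto_cauchyT_sub hpq ha hH hHl hσ⟩
  rw [coe_mul, coe_toNNReal ha.2.ne]
  exact (hC a ha _ (by positivity)).2

/-- The Cauchy extension of `[ψ, k sgn(x) ψ]` is a field generated by holomorphic functions. -/
lemma exists_pair_dirichletAnsatz (k : ℝ) (hψ : MemLp ψ 𝔭) :
    ∃ a b c d : ℂ → ℂ, IsPair k a b c d ∧ IsCauchyExtension k 𝔭 (dirichletAnsatz k ψ) (pairField a b c d) ∧
      ∀ t x : ℝ, 0 < t → pairField a b c d (t, x) 0 = ∫ y, (dirichletCauchyKernel k t x y : ℂ) * ψ y := by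
  have hψ' := MemLp.comp_neg hψ
  have P1 := one_le_ofReal hpq
  set a := (Ioi (0 : ℝ)).indicator ψ with ha
  set b := (Ioi (0 : ℝ)).indicator (fun x => ψ (-x)) with hb
  have ham : MemLp a 𝔭 := hψ.indicator measurableSet_Ioi
  have hbm : MemLp b 𝔭 := hψ'.indicator measurableSet_Ioi
  have hf := holOff_cauchyT hpq ham
  have hg := holOff_cauchyT hpq hbm
  obtain ⟨H, tf⟩ := exists_hasTraces_cauchyT hpq ham
  obtain ⟨H', tg⟩ := exists_hasTraces_cauchyT hpq hbm
  have hI : (2 * I)⁻¹ = -I / 2 := by rw [mul_inv, inv_I]; ring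
  have tg' : HasTraces 𝔭 (fun ζ => -1 * cauchyT b ζ) _ := fun σ hσ => (tg σ hσ).const_mul (-1)
  have pr := isPair_dirP hf hg k
  have tr := fun σ (hσ : σ = 1 ∨ σ = -1) => HasTraces.pairField P1 (tf.dirP P1 tg tf k (2 * I)⁻¹) (tf.dirP P1 tg tf k (-(2 * I)⁻¹))
    (tf.dirP P1 tg tg' k (2 * I)⁻¹) (tf.dirP P1 tg tg' k (-(2 * I)⁻¹)) hσ
  refine ⟨_, _, _, _, pr, ⟨_, _, _, pr.isHardyField (tr 1 (Or.inl rfl)), (pr.isHardyField (tr (-1) (Or.inr rfl))).neg, ?_⟩, ?_⟩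
  · filter_upwards [ae_ne_zero] with x hx
    rcases lt_or_gt_of_ne hx with h | h
    · have n1 : a x = 0 := indicator_of_notMem (by simpa using h.le) _
      have n2 : b x = 0 := indicator_of_notMem (by simpa using h.le) _
      have n3 : b (-x) = ψ x := by rw [hb, indicator_of_mem (by simpa using h), neg_neg]
      ext i
      fin_cases i <;> simp [dirichletAnsatz, not_lt.2 h.le, n1, n2, n3, hI, sign_of_neg h] <;> field_simp <;> ring_nf <;> simp
    · have n1 : a x = ψ x := indicator_of_mem (by grind) _
      have n2 : a (-x) = 0 := indicator_of_notMem (by simpa using h.le) _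
      have n3 : b (-x) = 0 := indicator_of_notMem (by simpa using h.le) _
      ext i
      fin_cases i <;> simp [dirichletAnsatz, h, n1, n2, n3, hI, sign_of_pos h] <;> field_simp <;> ring_nf <;> simp
  · intro t x ht
    have key : ∀ {ψ : ℝ → ℂ}, MemLp ψ 𝔭 → ∀ {x : ℝ}, 0 ≤ x → ∫ y, (dirichletCauchyKernel k t x y : ℂ) * ψ y =
        (1 / (2 * π) : ℂ) * ((2 * I)⁻¹ * (cauchyT ((Ioi (0 : ℝ)).indicator ψ) (cpt x t) - cauchyT ((Ioi (0 : ℝ)).indicator ψ) (cpt x (-t)) -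
          (cauchyT ((Ioi (0 : ℝ)).indicator fun x => ψ (-x)) (cpt (-x) (-t)) - cauchyT ((Ioi (0 : ℝ)).indicator fun x => ψ (-x)) (cpt (-x) t))) +
          (k / 2) * (cauchyT ((Ioi (0 : ℝ)).indicator ψ) (cpt x t) - cauchyT ((Ioi (0 : ℝ)).indicator ψ) (cpt (-x) (-t)) +
            (cauchyT ((Ioi (0 : ℝ)).indicator ψ) (cpt x (-t)) - cauchyT ((Ioi (0 : ℝ)).indicator ψ) (cpt (-x) t)))) := by
      intro ψ hψ x hx
      have z1 : (cpt x t).im ≠ 0 := by simpa using ht.ne'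
      have z2 : (cpt x (-t)).im ≠ 0 := by simpa using ht.ne'
      have v1 := hψ.restrict (Ioi 0)
      have v2 := (MemLp.comp_neg hψ).restrict (Ioi 0)
      rw [(integral_dirichletCauchyKernel hpq k hψ ht.ne' hx).2]
      simp only [imM, reM]
      rw [mop_zero_eq hpq v1 z1, mop_zero_eq hpq v1 z2, mop_zero_eq hpq v2 z1, mop_zero_eq hpq v2 z2, mop_neg_one_eq hpq v1 z1, mop_neg_one_eq hpq v1 z2,
        mop_neg_one_eq hpq v2 z1, mop_neg_one_eq hpq v2 z2, neg_cpt, neg_cpt, neg_neg, div_eq_inv_mul, div_eq_inv_mul, div_eq_inv_mul, div_eq_inv_mul]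
      ring
    by_cases hx : 0 < x
    · rw [key hψ hx.le]
      simp only [pairField, glue, if_pos hx, hf0, dirP, cons_val_zero, neg_cpt, neg_neg]
      ring
    · have := (integral_kernel_neg (dirichletCauchyKernel_neg k t) ψ (-x)).2
      rw [neg_neg] at this
      rw [this, key hψ' (neg_nonneg.2 (not_lt.1 hx))]
      simp only [pairField, glue, if_neg hx, hf0, dirP, cons_val_zero, neg_cpt, neg_neg, ← ha, ← hb]
      ring

end Extension

lemma HasWeakGrad.congr {G : ℝ × ℝ → Fin 2 → ℂ} (h : HasWeakGrad U G) (e : ∀ z ∈ halfPlane, U z = V z) : HasWeakGrad V G := by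
  refine ⟨fun z hz => ?_, h.2.1, fun φ hφ i => ?_⟩
  · obtain ⟨s, hs, hi⟩ := h.1 z hz
    refine ⟨s ∩ halfPlane, inter_mem hs self_mem_nhdsWithin, (hi.mono_set inter_subset_left).congr ?_⟩
    filter_upwards [ae_mono (restrict_mono inter_subset_right le_rfl) (ae_restrict_mem measurableSet_halfPlane)] with z hz using e z hz
  · rw [← h.2.2 φ hφ i]
    exact setIntegral_congr_fun measurableSet_halfPlane fun z hz => by simp only [e z hz]

lemma IsWeakSolution.congr (h : IsWeakSolution k U) (e : ∀ z ∈ halfPlane, U z = V z) : IsWeakSolution k V := by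
  obtain ⟨G, h1, h2⟩ := h
  exact ⟨G, h1.congr e, h2⟩

lemma cos_ne_zero_of_mem (h1 : -2 < α) (h2 : α < 1) (h3 : α ≠ -1) : cos (π * α / 2) ≠ 0 := by
  have hpi := pi_pos
  rcases lt_or_gt_of_ne h3 with h | h
  · have := cos_pos_of_mem_Ioo (x := π * α / 2 + π) ⟨by nlinarith, by nlinarith⟩
    rw [Real.cos_add_pi] at this
    linarith
  · exact (cos_pos_of_mem_Ioo ⟨by nlinarith, by nlinarith⟩).ne'

section Pair

include hpq

include hα in
/-- The Poisson integral is the first component of a field generated by holomorphic functions. -/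
lemma exists_pair_poissonIntegral (h1 : α ≠ -1)
    (hk : tan (π * α / 2) = k) (hu : MemLp u 𝔭) :
    ∃ ψ : ℝ → ℂ, MemLp ψ 𝔭 ∧ BoundaryEquation k 𝔭 u ψ ∧
      (∀ ψ' : ℝ → ℂ, MemLp ψ' 𝔭 → BoundaryEquation k 𝔭 u ψ' → ψ' =ᵐ[volume] ψ) ∧
      (∀ t x : ℝ, 0 < t → Integrable (fun y => (dirichletCauchyKernel k t x y : ℂ) * ψ y) ∧
        poissonIntegral α u (t, x) = ∫ y, (dirichletCauchyKernel k t x y : ℂ) * ψ y) ∧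
      ∃ a b c d : ℂ → ℂ, IsPair k a b c d ∧ IsCauchyExtension k 𝔭 (dirichletAnsatz k ψ) (pairField a b c d) ∧
      ∀ z ∈ halfPlane, pairField a b c d z 0 = poissonIntegral α u z := by
  obtain ⟨b1, b2, -, -⟩ := bounds_of_mem hpq hα
  have hc := cos_ne_zero_of_mem b1 b2 h1
  obtain ⟨ψ, S, T, hψ, hS, hT, e1, e2⟩ := exists_boundary_solution hpq hα hc hk hu
  have hb := (boundaryEquation_iff hpq hu hψ hS hT).2 ⟨e1, e2⟩
  have key := fun t x (ht : 0 < t) => poissonIntegral_eq_integral hpq hα hc hk hu hψ hS hT e1 e2 ht x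
  obtain ⟨a, b, c, d, h1, h2, h3⟩ := exists_pair_dirichletAnsatz hpq k hψ
  exact ⟨ψ, hψ, hb, fun ψ' h h' => boundaryEquation_unique hpq hα hc hk hu hψ h hb h', key, a, b, c, d, h1, h2,
    fun z hz => (h3 z.1 z.2 hz).trans (key z.1 z.2 hz).2.symm⟩

include hα in
lemma isWeakSolution_poissonIntegral (h1 : α ≠ -1)
    (hk : tan (π * α / 2) = k) (hu : MemLp u 𝔭) : IsWeakSolution k (poissonIntegral α u) := by
  obtain ⟨-, -, -, -, -, a, b, c, d, h, -, e⟩ := exists_pair_poissonIntegral hpq hα h1 hk hu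
  exact h.isWeakSolution.congr e

end Pair

/-! ### Smooth data with compact support -/

lemma integrable_weight_of_compact (hβ : β < 1) (hw : Continuous w) (hc : HasCompactSupport w) :
    Integrable (fun y : ℝ => y ⁻^ β * w y) halfVol := by
  obtain ⟨R, hR, hs⟩ := hc.isCompact.isBounded.subset_closedBall_lt 0 0
  obtain ⟨M, hM⟩ := hc.exists_bound_of_continuous hw
  have h1 : IntegrableOn (fun y : ℝ => y ^ (-β)) (Ioc 0 R) :=
    (intervalIntegrable_iff_integrableOn_Ioc_of_le hR.le).1 (intervalIntegrable_rpow' (by linarith))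
  have h2 : Integrable ((Ioc 0 R).indicator fun y : ℝ => M * y ^ (-β)) halfVol :=
    ((integrable_indicator_iff measurableSet_Ioc).2 (h1.const_mul M)).restrict
  refine h2.mono' (by fun_prop) (ae_halfVol_pos.mono fun y hy => ?_)
  by_cases hyR : y ≤ R
  · rw [indicator_of_mem (show y ∈ Ioc 0 R from ⟨hy, hyR⟩), norm_mul, norm_real, norm_of_nonneg (by positivity), mul_comm]
    bound
  · have : w y = 0 := image_eq_zero_of_notMem_tsupport fun h => hyR (by simpa using (abs_le.1 (by simpa using hs h)).2)
    simp [this, hyR]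

lemma Integrable.norm_div_one_add_sq {g : ℝ → ℂ} (hg : Integrable g halfVol) :
    Integrable (fun y : ℝ => ‖g y‖ / (1 + ‖(y : ℂ) ^ 2‖)) halfVol :=
  hg.norm.mono' (hg.1.norm.aemeasurable.div (by fun_prop : Measurable fun y : ℝ => 1 + ‖(y : ℂ) ^ 2‖).aemeasurable).aestronglyMeasurable
    (ae_of_all _ fun y => by
      rw [norm_of_nonneg (by positivity)]
      bound)

lemma integrable_div_sq_sub {g : ℝ → ℂ} (hg : Integrable g halfVol) (hz : z.im ≠ 0) :
    Integrable (fun y : ℝ => g y / ((y : ℂ) ^ 2 - z ^ 2)) halfVol := by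
  obtain ⟨ε, hε, hb⟩ := Metric.isOpen_iff.1 isClosed_nonneg_reals.isOpen_compl _ (sq_notMem_of_im_ne_zero hz)
  refine integrable_cauchy (by fun_prop) ae_sq_mem hg.1 (Integrable.norm_div_one_add_sq hg) hε fun s hs => ?_
  by_contra! hlt
  exact hb (by rwa [mem_ball, dist_eq_norm]) hs

lemma integrable_mKer_mul_of_compact (hβ : β < 1) (hw : Continuous w) (hc : HasCompactSupport w) (hz : z.im ≠ 0) :
    Integrable (fun y => mKer β z y * w y) halfVol := by
  refine ((integrable_div_sq_sub (integrable_weight_of_compact hβ hw hc) hz).const_mul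
    ((2 / π : ℂ) * z ^ ((β : ℂ) + 1))).congr (ae_of_all _ fun y => ?_)
  simp only [mKer]; ring

lemma integral_mKer_parts (hβ : β < 1) (hv : ContDiff ℝ 1 v) (hc : HasCompactSupport v) (hz : z.im ≠ 0) :
    ∫ y, ((y ^ (-(β - 1)) : ℝ) : ℂ) * deriv v y / ((y : ℂ) ^ 2 - z ^ 2) ∂halfVol =
      (β + 1) * (∫ y, y ⁻^ β * v y / ((y : ℂ) ^ 2 - z ^ 2) ∂halfVol) +
        2 * z ^ 2 * ∫ y, y ⁻^ β * v y / ((y : ℂ) ^ 2 - z ^ 2) / ((y : ℂ) ^ 2 - z ^ 2) ∂halfVol := by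
  have iw := integrable_weight_of_compact hβ hv.continuous hc
  have i1 := integrable_div_sq_sub iw hz
  have i2 := integrable_div_sq_sub i1 hz
  have i3 := integrable_div_sq_sub (integrable_weight_of_compact (β := β - 1) (by linarith) (by fun_prop) hc.deriv) hz
  have c1 : Continuous fun y : ℝ => ((y ^ (1 - β) : ℝ) : ℂ) := Complex.continuous_ofReal.comp (Real.continuous_rpow_const (by linarith))
  have c2 : Continuous fun y : ℝ => (y : ℂ) ^ 2 - z ^ 2 := by fun_prop
  have c3 : Continuous fun y : ℝ => ((y ^ (1 - β) : ℝ) : ℂ) * v y / ((y : ℂ) ^ 2 - z ^ 2) :=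
    (c1.mul hv.continuous).div c2 fun y => sq_sub_sq_ne_zero y hz
  have h := integral_Ioi_of_hasDerivAt_of_tendsto (a := 0) (m := 0) c3.continuousWithinAt ?_
      (((i1.const_mul (-(β + 1 : ℂ))).add i3).sub (i2.const_mul (2 * z ^ 2))) ?_
  · rw [integral_sub' ((i1.const_mul _).add i3) (i2.const_mul _), integral_add' (i1.const_mul _) i3, integral_const_mul, integral_const_mul,
      zero_rpow (by linarith)] at h
    simp only [ofReal_zero, zero_mul, zero_div, sub_zero] at h
    grind
  · intro y hy
    have hQ := sq_sub_sq_ne_zero y hz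
    have e1 : HasDerivAt (fun y : ℝ => ((y ^ (1 - β) : ℝ) : ℂ)) (((1 - β) * y ^ (-β) : ℝ) : ℂ) y := by
      have := (Real.hasDerivAt_rpow_const (p := 1 - β) (Or.inl hy.ne')).ofReal_comp
      simp_all
    have e2 : HasDerivAt (fun y : ℝ => (y : ℂ) ^ 2 - z ^ 2) (2 * y) y := by
      have := ((hasDerivAt_id y).ofReal_comp.pow 2).sub_const (z ^ 2)
      simpa using this
    refine (((e1.mul (hv.differentiable one_ne_zero y).hasDerivAt).div e2 hQ)).congr_deriv ?_
    have e3 : y ^ (1 - β) = y * y ^ (-β) := by rw [sub_eq_add_neg, rpow_add hy, Real.rpow_one]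
    have e4 : y ^ (-(β - 1)) = y * y ^ (-β) := by simp_all
    simp only [Pi.add_apply, Pi.sub_apply, Pi.mul_apply, e3, e4]
    push_cast
    grind
  · refine Tendsto.congr' ?_ tendsto_const_nhds
    obtain ⟨R, -, hs⟩ := hc.isCompact.isBounded.subset_closedBall_lt 0 0
    filter_upwards [eventually_gt_atTop R] with y hy
    have : v y = 0 := image_eq_zero_of_notMem_tsupport fun h => not_le.2 hy (abs_le.1 (by simpa using hs h)).2
    simp [this]

lemma hasDerivAt_mop (hβ : β < 1) (hv : ContDiff ℝ 1 v) (hc : HasCompactSupport v) (hz : z.im ≠ 0) :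
    HasDerivAt (mop β v) (mop (β - 1) (deriv v) z) z := by
  have hz0 : z ≠ 0 := fun h => hz (by simp [h])
  have iw := integrable_weight_of_compact hβ hv.continuous hc
  have d1 := hasDerivAt_cauchy isClosed_nonneg_reals (φ := fun y : ℝ => (y : ℂ) ^ 2) (by fun_prop) ae_sq_mem iw.1 (Integrable.norm_div_one_add_sq iw) (sq_notMem_of_im_ne_zero hz)
  have d2 : HasDerivAt (fun z : ℂ => z ^ 2) (2 * z) z := by simpa using hasDerivAt_pow 2 z
  have d3 := d1.comp z d2
  have d4 := ((hasDerivAt_id z).cpow_const (c := (β : ℂ) + 1) (mem_slitPlane_of_im hz)).const_mul (2 / π : ℂ)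
  refine ((d4.mul d3).congr_of_eventuallyEq (.of_forall fun z => mop_eq β v z)).congr_deriv ?_
  have key := integral_mKer_parts hβ hv hc hz
  rw [mop_eq]
  have e1 : ((β - 1 : ℝ) : ℂ) + 1 = β := by push_cast; ring
  have e2 : ∀ y, y ⁻^ β * v y / ((y : ℂ) ^ 2 - z ^ 2) ^ 2 =
      y ⁻^ β * v y / ((y : ℂ) ^ 2 - z ^ 2) / ((y : ℂ) ^ 2 - z ^ 2) := by grind
  simp only [id_eq, add_sub_cancel_right, e1, e2, mul_one, Function.comp_apply]
  rw [cpow_add_one' hz0 β]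
  grind

lemma exists_mop_far (hβ : β < 1) (hw : Continuous w) (hc : HasCompactSupport w) :
    ∃ C R : ℝ, 0 ≤ C ∧ 0 < R ∧ ∀ z : ℂ, R ≤ ‖z‖ → ‖mop β w z‖ ≤ C * ‖z‖ ^ (β - 1) := by
  obtain ⟨R, hR, hs⟩ := hc.isCompact.isBounded.subset_closedBall_lt 0 0
  have hi := (integrable_weight_of_compact hβ hw hc).norm
  refine ⟨4 / π * ∫ y, ‖y ⁻^ β * w y‖ ∂halfVol, 2 * R, by positivity, by positivity, fun z hz => ?_⟩
  have hr : 0 < ‖z‖ := by linarith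
  rw [mul_right_comm, ← integral_const_mul]
  refine norm_integral_le_of_norm_le (hi.const_mul _) (ae_halfVol_pos.mono fun y hy => ?_)
  by_cases h0 : w y = 0
  · simp [h0]
  have hyR : y ≤ R := (abs_le.1 (by simpa using hs (subset_tsupport _ h0))).2
  have h1 : ‖z‖ ^ 2 / 2 ≤ ‖(y : ℂ) ^ 2 - z ^ 2‖ := by
    have := norm_sub_norm_le (z ^ 2) ((y : ℂ) ^ 2)
    rw [norm_sub_rev, norm_pow, norm_pow, norm_real, norm_of_nonneg hy.le] at this
    nlinarith
  have e : ‖z‖ ^ (β + 1) = ‖z‖ ^ (β - 1) * ‖z‖ ^ 2 := by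
    rw [← Real.rpow_natCast, ← rpow_add hr]; grind
  have e1 : ‖z ^ ((β : ℂ) + 1)‖ = ‖z‖ ^ (β + 1) := by rw [← norm_cpow_real]; push_cast; rfl
  rw [mKer, norm_mul, norm_mul, norm_mul, norm_div, norm_div, e1, e, norm_real, Complex.norm_ofNat, norm_mul, norm_of_nonneg Real.pi_pos.le]
  have h2 : ‖z‖ ^ 2 / ‖(y : ℂ) ^ 2 - z ^ 2‖ ≤ 2 := by
    rw [div_le_iff₀ (lt_of_lt_of_le (by positivity) h1)]; linarith
  calc _ = 2 / π * ‖z‖ ^ (β - 1) * (‖y ⁻^ β‖ * ‖w y‖) * (‖z‖ ^ 2 / ‖(y : ℂ) ^ 2 - z ^ 2‖) := by ring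
    _ ≤ 2 / π * ‖z‖ ^ (β - 1) * (‖y ⁻^ β‖ * ‖w y‖) * 2 := by gcongr
    _ = _ := by ring

lemma radKer_le (h1 : |α| < γ) (h2 : γ < 1) (hr : 0 < r) (hy : 0 < y) :
    radKer (α - 1) r y ≤ 2 * r ^ (-γ) * y ^ (γ - 1) := by
  obtain ⟨a1, a2⟩ := abs_lt.1 h1
  have key : ∀ {a : ℝ}, 0 ≤ a → a ≤ 2 → r ^ a * y ^ (2 - a) ≤ (r + y) ^ 2 := by
    intro a h0 h2
    calc r ^ a * y ^ (2 - a) ≤ (r + y) ^ a * (r + y) ^ (2 - a) := by bound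
      _ = _ := by rw [← rpow_add (by positivity), add_sub_cancel, Real.rpow_ofNat]
  have k1 := key (a := 1 + γ) (by linarith [abs_nonneg α]) (by linarith)
  have k2 := key (a := α + γ) (by linarith) (by linarith)
  have e1 : r = r ^ (-γ) * y ^ (γ - 1) * (r ^ (1 + γ) * y ^ (2 - (1 + γ))) := by
    rw [mul_mul_mul_comm, ← rpow_add hr, ← rpow_add hy]; ring_nf; simp
  have e2 : r * (r / y) ^ (α - 1) = r ^ (-γ) * y ^ (γ - 1) * (r ^ (α + γ) * y ^ (2 - (α + γ))) := by
    rw [mul_mul_mul_comm, ← rpow_add hr, ← rpow_add hy, div_rpow hr.le hy.le, Real.rpow_sub_one hr.ne', div_eq_mul_inv,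
      ← rpow_neg hy.le]
    grind
  rw [radKer, div_le_iff₀ (by positivity), mul_add, mul_one, e2]
  have h0 : 0 ≤ r ^ (-γ) * y ^ (γ - 1) := by positivity
  nlinarith

lemma exists_mop_near (h1 : |α| < γ) (h2 : γ < 1) (hw : Continuous w) (hc : HasCompactSupport w) :
    ∃ C : ℝ, 0 ≤ C ∧ ∀ z : ℂ, 0 ≤ z.re → z.im ≠ 0 → ‖mop (α - 1) w z - mop 0 w z‖ ≤ C * ‖z‖ ^ (-γ) := by
  obtain ⟨C, hC, hk⟩ := norm_mKer_sub_le (α - 1)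
  obtain ⟨a1, a2⟩ := abs_lt.1 h1
  have hi := (integrable_weight_of_compact (β := 1 - γ) (by linarith) hw hc).norm
  refine ⟨C * 2 * ∫ y : ℝ, ‖((y ^ (-(1 - γ)) : ℝ) : ℂ) * w y‖ ∂halfVol, by positivity, fun z hz hz' => ?_⟩
  have hr : 0 < ‖z‖ := norm_pos_iff.2 fun h => hz' (by simp [h])
  rw [mop, mop, ← integral_sub (integrable_mKer_mul_of_compact (by linarith) hw hc hz') (integrable_mKer_mul_of_compact (by linarith) hw hc hz'),
    mul_right_comm, ← integral_const_mul]
  refine norm_integral_le_of_norm_le (hi.const_mul _) (ae_halfVol_pos.mono fun y hy => ?_)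
  rw [← sub_mul, norm_mul, norm_mul, norm_real, norm_of_nonneg (by positivity), ← mul_assoc]
  gcongr
  refine (hk z hz hz' y hy).trans ?_
  rw [mul_assoc, mul_assoc]
  gcongr
  have := radKer_le h1 h2 hr hy
  grind

lemma mop_neg_two (hv : ContDiff ℝ 1 v) (hc : HasCompactSupport v) (h0 : v 0 = 0) (hz : z.im ≠ 0) :
    mop (-1 - 1) (deriv v) z = mop 0 (deriv v) z := by
  have hv' := hv.continuous_deriv le_rfl
  rw [← sub_eq_zero, mop, mop, ← integral_sub (integrable_mKer_mul_of_compact (by norm_num) hv' hc.deriv hz)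
    (integrable_mKer_mul_of_compact (by simp) hv' hc.deriv hz)]
  have : ∀ᵐ y ∂halfVol, mKer (-1 - 1) z y * deriv v y - mKer 0 z y * deriv v y = (2 / π * z⁻¹ : ℂ) * deriv v y := by
    filter_upwards [ae_halfVol_pos] with y hy
    have hQ := sq_sub_sq_ne_zero y hz
    have e1 : ((-1 - 1 : ℝ) : ℂ) + 1 = -1 := by push_cast; ring
    have e2 : (-(-1 - 1) : ℝ) = 2 := by norm_num
    rw [mKer, mKer, e1, e2, Complex.cpow_neg_one, rpow_two]
    simp
    field_simp
  rw [integral_congr_ae this, integral_const_mul, hc.integral_Ioi_deriv_eq hv, h0]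
  simp

/-! ### The energy of the Poisson integral -/

lemma lintegral_prod_mul_lt_top {a : ℝ → ℝ} (ha : Integrable a halfVol) :
    ∫⁻ z, ‖a z.1‖ₑ * ‖a z.2‖ₑ ∂(halfVol.prod halfVol) < ⊤ := by
  rw [lintegral_prod_mul ha.1.enorm ha.1.enorm]
  exact mul_lt_top ha.2 ha.2

lemma lintegral_strip_lt_top (hw : MemLp w (ofReal 2) halfVol) (hσ : σ ≠ 0) (R : ℝ) :
    ∫⁻ z, (Iio R).indicator (fun _ => 2 * ‖mop 0 w (cpt z.2 (σ * z.1))‖ₑ ^ 2) z.1 ∂(halfVol.prod halfVol) < ⊤ := by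
  obtain ⟨C, hC⟩ := exists_mop_bound Real.HolderConjugate.two_two (zero_mem_range Real.HolderConjugate.two_two)
  refine (lintegral_prod_le _).trans_lt ?_
  have key : ∀ t ∈ Ioi (0 : ℝ), ∫⁻ x, (Iio R).indicator (fun _ => 2 * ‖mop 0 w (cpt x (σ * t))‖ₑ ^ 2) t ∂halfVol ≤
      (Iio R).indicator (fun _ => 2 * (C * eLpNorm w (ofReal 2) halfVol) ^ 2) t := by
    intro t ht
    by_cases h : t < R
    · simp only [indicator_of_mem (show t ∈ Iio R from h)]
      have h1 := (hC w hw (σ * t) (mul_ne_zero hσ (ne_of_gt ht))).2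
      rw [lintegral_const_mul' _ _ (by simp)]
      have e := eLpNorm_nnreal_pow_eq_lintegral (f := fun x => mop 0 w (cpt x (σ * t))) (μ := halfVol) two_ne_zero
      simp at e
      rw [← e]
      simp at h1
      rw [ofReal_ofNat]
      gcongr
    simp_all
  refine (setLIntegral_mono' measurableSet_Ioi key).trans_lt ?_
  rw [lintegral_indicator measurableSet_Iio, setLIntegral_const]
  refine mul_lt_top (mul_lt_top (by simp) (pow_lt_top (mul_lt_top (by simp) hw.2))) ?_
  rw [Measure.restrict_apply measurableSet_Iio, inter_comm, Ioi_inter_Iio, Real.volume_Ioo]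
  exact ofReal_lt_top

lemma rpow_mul_rpow_le (ht : 0 < t) (hx : 0 < x) (h1 : t ≤ r) (h2 : x ≤ r) (hs : 0 ≤ s) : (r ^ (-s)) ^ 2 ≤ t ^ (-s) * x ^ (-s) := by
  rw [sq]
  exact mul_le_mul (rpow_le_rpow_of_nonpos ht h1 (by linarith)) (rpow_le_rpow_of_nonpos hx h2 (by linarith))
    (rpow_nonneg (by linarith) _) (by positivity)

lemma lintegral_quadrant_lt_top {N : ℂ → ℂ} (hw : MemLp w (ofReal 2) halfVol) {C : ℝ} (hR : 0 < R) (hs : 1 < s)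
    (h0 : 0 ≤ γ) (h1 : γ < 1) (far : ∀ z : ℂ, R ≤ ‖z‖ → ‖N z‖ ≤ C * ‖z‖ ^ (-s))
    (near : ∀ z : ℂ, 0 ≤ z.re → z.im ≠ 0 → ‖N z - mop 0 w z‖ ≤ C * ‖z‖ ^ (-γ)) (hσ : |σ| = 1) :
    ∫⁻ z, ‖N (cpt z.2 (σ * z.1))‖ₑ ^ 2 ∂(halfVol.prod halfVol) < ⊤ := by
  have hσ0 : σ ≠ 0 := by grind
  set κ := 1 + 1 / R with hκ
  have ia : Integrable (fun t => C * κ ^ s * (1 + ‖t‖) ^ (-s)) halfVol :=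
    ((integrable_one_add_norm (by simpa using hs)).const_mul _).restrict
  have ib : Integrable ((Iio R).indicator fun t => (2 * C) * t ^ (-γ)) halfVol := by
    rw [integrable_indicator_iff measurableSet_Iio, IntegrableOn, Measure.restrict_restrict measurableSet_Iio, inter_comm, Ioi_inter_Iio]
    refine Integrable.const_mul ?_ _
    exact ((intervalIntegrable_iff_integrableOn_Ioc_of_le hR.le).1 (intervalIntegrable_rpow' (by linarith))).mono_set Ioo_subset_Ioc_self
  set a := fun t : ℝ => C * κ ^ s * (1 + ‖t‖) ^ (-s)
  set b := (Iio R).indicator fun t : ℝ => (2 * C) * t ^ (-γ) with hb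
  have key : ∀ᵐ z ∂(halfVol.prod halfVol), ‖N (cpt z.2 (σ * z.1))‖ₑ ^ 2 ≤ (‖a z.1‖ₑ * ‖a z.2‖ₑ + ‖b z.1‖ₑ * ‖b z.2‖ₑ) +
      (Iio R).indicator (fun _ => 2 * ‖mop 0 w (cpt z.2 (σ * z.1))‖ₑ ^ 2) z.1 := by
    rw [prod_restrict]
    filter_upwards [ae_restrict_mem (measurableSet_Ioi.prod measurableSet_Ioi)] with z hz
    obtain ⟨ht, hx⟩ : 0 < z.1 ∧ 0 < z.2 := hz
    set ζ := cpt z.2 (σ * z.1)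
    have hti : |ζ.im| = z.1 := by simp [ζ, abs_mul, hσ, abs_of_pos ht]
    have hxr : ζ.re = z.2 := by simp [ζ]
    have h1 : z.1 ≤ ‖ζ‖ := hti ▸ abs_im_le_norm ζ
    have h2 : z.2 ≤ ‖ζ‖ := hxr ▸ re_le_norm ζ
    have him : ζ.im ≠ 0 := by grind
    rcases le_or_gt R ‖ζ‖ with hf | hf
    · refine le_trans ?_ (le_add_right (le_add_right le_rfl))
      rw [← enorm_mul, ← enorm_pow, enorm_le_iff_norm_le, norm_pow]
      refine le_trans ?_ (le_abs_self _)
      have hk : ∀ {t : ℝ}, 0 < t → t ≤ ‖ζ‖ → 1 + ‖t‖ ≤ κ * ‖ζ‖ := fun {t} h h' => by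
        rw [norm_of_nonneg h.le, hκ, add_mul, div_mul_eq_mul_div, one_mul]
        have : 1 ≤ ‖ζ‖ / R := (one_le_div hR).2 hf
        linarith
      have hκ0 : 0 < κ := by positivity
      have hz0 : 0 < ‖ζ‖ := by linarith
      have := rpow_mul_rpow_le (s := s) (by positivity) (by positivity) (hk ht h1) (hk hx h2) (by linarith)
      calc ‖N ζ‖ ^ 2 ≤ (C * ‖ζ‖ ^ (-s)) ^ 2 := by bound
        _ = (C * κ ^ s) ^ 2 * ((κ * ‖ζ‖) ^ (-s)) ^ 2 := by
          rw [mul_rpow hκ0.le hz0.le, rpow_neg hκ0.le]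
          field_simp
        _ ≤ (C * κ ^ s) ^ 2 * ((1 + ‖z.1‖) ^ (-s) * (1 + ‖z.2‖) ^ (-s)) := by gcongr
        _ = _ := by ring
    · rw [indicator_of_mem (by grind)]
      refine le_trans ?_ (add_le_add_left (le_add_left le_rfl) _)
      rw [hb, indicator_of_mem (by grind), indicator_of_mem (by grind)]
      have hn := near ζ (by rw [hxr]; exact hx.le) him
      have := rpow_mul_rpow_le ht hx h1 h2 h0
      have e : ‖N ζ‖ ^ 2 ≤ 2 * C * z.1 ^ (-γ) * (2 * C * z.2 ^ (-γ)) + 2 * ‖mop 0 w ζ‖ ^ 2 := by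
        have h3 : ‖N ζ‖ ≤ ‖N ζ - mop 0 w ζ‖ + ‖mop 0 w ζ‖ := by simpa using norm_add_le (N ζ - mop 0 w ζ) (mop 0 w ζ)
        have h4 : ‖N ζ - mop 0 w ζ‖ ^ 2 ≤ C ^ 2 * (z.1 ^ (-γ) * z.2 ^ (-γ)) := by
          refine (pow_le_pow_left₀ (norm_nonneg _) hn 2).trans ?_
          rw [mul_pow]; gcongr
        nlinarith [sq_nonneg (‖N ζ - mop 0 w ζ‖ - ‖mop 0 w ζ‖), norm_nonneg (N ζ)]
      have e1 : ‖2 * C * z.1 ^ (-γ)‖ₑ * ‖2 * C * z.2 ^ (-γ)‖ₑ + 2 * ‖mop 0 w ζ‖ₑ ^ 2 =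
          ofReal (2 * C * z.1 ^ (-γ) * (2 * C * z.2 ^ (-γ)) + 2 * ‖mop 0 w ζ‖ ^ 2) := by
        have : 0 ≤ 2 * C * z.1 ^ (-γ) * (2 * C * z.2 ^ (-γ)) := by
          have : 0 ≤ C ^ 2 * (z.1 ^ (-γ) * z.2 ^ (-γ)) := by positivity
          linarith
        rw [ENNReal.ofReal_add this (by positivity), ← enorm_mul, ofReal_mul zero_le_two, ENNReal.ofReal_pow (norm_nonneg _), ofReal_norm,
          Real.enorm_of_nonneg this, ofReal_ofNat]
      rw [e1, ← ofReal_norm, ← ENNReal.ofReal_pow (norm_nonneg _)]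
      exact ofReal_le_ofReal e
  refine (lintegral_mono_ae key).trans_lt ?_
  have ma : AEMeasurable (fun z => ‖a z.1‖ₑ * ‖a z.2‖ₑ) (halfVol.prod halfVol) :=
    (ia.1.comp_fst.enorm).mul ia.1.comp_snd.enorm
  have mb : AEMeasurable (fun z => ‖b z.1‖ₑ * ‖b z.2‖ₑ) (halfVol.prod halfVol) :=
    (ib.1.comp_fst.enorm).mul ib.1.comp_snd.enorm
  rw [lintegral_add_left' (by exact ma.add mb), lintegral_add_left' ma]
  exact ENNReal.add_lt_top.2 ⟨ENNReal.add_lt_top.2 ⟨lintegral_prod_mul_lt_top ia, lintegral_prod_mul_lt_top ib⟩, lintegral_strip_lt_top hw hσ0 R⟩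

lemma exists_holderConjugate_range (hα : α ∈ Ioo (-1 : ℝ) 1) : ∃ p q : ℝ, p.HolderConjugate q ∧ α ∈ Ioo (1 / q - 2) (1 / q) := by
  have h := abs_lt.2 hα
  have h0 := abs_nonneg α
  refine ⟨2 / (1 - |α|), 2 / (1 + |α|), Real.holderConjugate_iff.2 ⟨?_, ?_⟩, ?_⟩
  · bound
  · grind
  · constructor <;> cases abs_cases α <;> linarith [hα.1, hα.2]

lemma enorm_sq_le {w a b : ℂ} (c : ℝ≥0) (h : ‖w‖ ^ 2 ≤ c * (‖a‖ ^ 2 + ‖b‖ ^ 2)) : ‖w‖ₑ ^ 2 ≤ c * (‖a‖ₑ ^ 2 + ‖b‖ₑ ^ 2) := by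
  simp only [enorm]
  exact_mod_cast h

/-- The function `A` is holomorphic off the real axis, and its derivative is square integrable over the right
quadrants. -/
structure IsEnergyPotential (A : ℂ → ℂ) : Prop where
  hol : HolOff A
  energy : ∀ σ : ℝ, |σ| = 1 → ∫⁻ z, ‖deriv A (cpt z.2 (σ * z.1))‖ₑ ^ 2 ∂(halfVol.prod halfVol) < ⊤

lemma IsEnergyPotential.add {A B : ℂ → ℂ} (hA : IsEnergyPotential A) (hB : IsEnergyPotential B) : IsEnergyPotential (A + B) where
  hol := hA.hol.add hB.hol
  energy σ hσ := by
    refine lt_of_le_of_lt (lintegral_mono_ae (g := fun z => 2 * (‖deriv A (cpt z.2 (σ * z.1))‖ₑ ^ 2 + ‖deriv B (cpt z.2 (σ * z.1))‖ₑ ^ 2)) ?_) ?_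
    · rw [prod_restrict]
      filter_upwards [ae_restrict_mem (measurableSet_Ioi.prod measurableSet_Ioi)] with z hz
      have him : (cpt z.2 (σ * z.1)).im ≠ 0 := by simpa using by grind
      rw [deriv_add (hA.hol _ him) (hB.hol _ him)]
      refine enorm_sq_le 2 ?_
      have := pow_le_pow_left₀ (norm_nonneg _) (norm_add_le (deriv A (cpt z.2 (σ * z.1))) (deriv B (cpt z.2 (σ * z.1)))) 2
      push_cast
      nlinarith [sq_nonneg (‖deriv A (cpt z.2 (σ * z.1))‖ - ‖deriv B (cpt z.2 (σ * z.1))‖)]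
    · rw [lintegral_const_mul' _ _ (by simp), lintegral_add_left' ?_]
      · exact mul_lt_top (by simp) (ENNReal.add_lt_top.2 ⟨hA.energy σ hσ, hB.energy σ hσ⟩)
      · exact ((((measurable_deriv A).comp (by unfold cpt; fun_prop)).enorm.pow_const 2)).aemeasurable

lemma isEnergyPotential_mop (hβ : β < 1) (h0 : 0 ≤ γ) (h1 : γ < 1) (hv : ContDiff ℝ 1 v)
    (hc : HasCompactSupport v) (near : ∃ C : ℝ, 0 ≤ C ∧ ∀ z : ℂ, 0 ≤ z.re → z.im ≠ 0 → ‖mop (β - 1) (deriv v) z - mop 0 (deriv v) z‖ ≤ C * ‖z‖ ^ (-γ)) :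
    IsEnergyPotential (mop β v) where
  hol z hz := (hasDerivAt_mop hβ hv hc hz).differentiableAt
  energy σ hσ := by
    have hv' := hv.continuous_deriv le_rfl
    obtain ⟨C, hC, hn⟩ := near
    obtain ⟨D, R, hD, hR, hf⟩ := exists_mop_far (β := β - 1) (by linarith) hv' hc.deriv
    refine lt_of_le_of_lt (lintegral_mono_ae (g := fun z : ℝ × ℝ => ‖mop (β - 1) (deriv v) (cpt z.2 (σ * z.1))‖ₑ ^ 2) ?_)
      (lintegral_quadrant_lt_top (w := deriv v) ((hv'.memLp_of_hasCompactSupport hc.deriv).restrict _) (C := C + D) (s := 2 - β) hR (by linarith) h0 h1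
        (fun z hz => (hf z hz).trans ?_) (fun z hz hz' => (hn z hz hz').trans ?_) hσ)
    · rw [prod_restrict]
      filter_upwards [ae_restrict_mem (measurableSet_Ioi.prod measurableSet_Ioi)] with z hz
      rw [(hasDerivAt_mop hβ hv hc (by simpa using by grind)).deriv]
    · rw [show -(2 - β) = β - 1 - 1 by ring]; gcongr; linarith
    · gcongr; linarith

lemma exists_energyPotential (hα : α ∈ Ioo (-1 : ℝ) 1) (hu : ContDiff ℝ 1 u) (hc : HasCompactSupport u) :
    ∃ A : ℂ → ℂ, IsEnergyPotential A ∧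
      ∀ t x : ℝ, 0 < t → 0 ≤ x → poissonIntegral α u (t, x) = hf0 (fun z => (4 * I)⁻¹ * A z) (fun z => -(4 * I)⁻¹ * A z) (t, x) := by
  obtain ⟨p, q, hpq, hr⟩ := exists_holderConjugate_range hα
  have hu' : ContDiff ℝ 1 fun y => u (-y) := hu.comp contDiff_neg
  have hc' : HasCompactSupport fun y => u (-y) := hc.comp_homeomorph (Homeomorph.neg ℝ)
  have m := (hu.continuous.memLp_of_hasCompactSupport (μ := volume) (p := ofReal p) hc)
  have m1 := m.restrict (Ioi 0)
  have m2 := (MemLp.comp_neg m).restrict (Ioi 0)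
  have cm : HasCompactSupport (u - fun y => u (-y)) := hc.sub hc'
  have hγ : (1 + |α|) / 2 < 1 := by grind
  refine ⟨mop (-1) (u - fun y => u (-y)) + mop α (u + fun y => u (-y)), .add ?_ ?_, fun t x ht hx => ?_⟩
  · refine isEnergyPotential_mop (γ := 0) (by norm_num) le_rfl one_pos (hu.sub hu') cm ⟨0, le_rfl, fun z _ hz => ?_⟩
    rw [mop_neg_two (v := u - fun y => u (-y)) (hu.sub hu') cm (by simp) hz]
    simp
  · exact isEnergyPotential_mop hα.2 (by positivity) hγ (hu.add hu') (hc.add hc')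
      (exists_mop_near (by linarith) hγ ((hu.add hu').continuous_deriv le_rfl) (hc.add hc').deriv)
  · have i1 : (cpt x t).im ≠ 0 := by simpa using ht.ne'
    have i2 : (cpt x (-t)).im ≠ 0 := by simp_all
    have e := poissonIntegral_eq hpq hr m ht.ne' hx
    rw [e.2]
    simp only [imM, hf0, Pi.add_apply, mop_sub hpq (neg_one_mem_range hpq) m1 m2 i1, mop_sub hpq (neg_one_mem_range hpq) m1 m2 i2,
      mop_add hpq hr m1 m2 i1, mop_add hpq hr m1 m2 i2]
    ring

lemma lintegral_grad_quadrant (hα : α ∈ Ioo (-1 : ℝ) 1) (hu : ContDiff ℝ 1 u) (hc : HasCompactSupport u)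
    (hf : ∀ t x : ℝ, 0 < t → 0 < x → f (t, x) = poissonIntegral α u (t, x)) :
    ∫⁻ z in Ioi 0 ×ˢ Ioi 0, (‖grad f z 0‖ₑ ^ 2 + ‖grad f z 1‖ₑ ^ 2) < ⊤ := by
  obtain ⟨A, hA, e⟩ := exists_energyPotential hα hu hc
  have h1 := hA.energy 1 (by simp)
  have h2 := hA.energy (-1) (by simp)
  rw [prod_restrict] at h1 h2
  simp at h1 h2
  have ma : AEMeasurable (fun z => ‖deriv A (cpt z.2 z.1)‖ₑ ^ 2) (volume.restrict (Ioi 0 ×ˢ Ioi 0)) :=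
    ((((measurable_deriv A).comp (by unfold cpt; fun_prop)).enorm.pow_const 2)).aemeasurable
  refine lt_of_le_of_lt (setLIntegral_mono' (measurableSet_Ioi.prod measurableSet_Ioi)
    (g := fun z => ‖deriv A (cpt z.2 z.1)‖ₑ ^ 2 + ‖deriv A (cpt z.2 (-z.1))‖ₑ ^ 2) fun z hz => ?_) ?_
  · have ht : 0 < z.1 := hz.1
    have ev : f =ᶠ[𝓝 z] hf0 (fun z => (4 * I)⁻¹ * A z) (fun z => -(4 * I)⁻¹ * A z) := by
      filter_upwards [(isOpen_Ioi.prod isOpen_Ioi).mem_nhds hz] with y hy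
      grind
    obtain ⟨-, d1, d2⟩ := fderiv_hf0 (hA.hol.const_mul (4 * I)⁻¹) (hA.hol.const_mul (-(4 * I)⁻¹)) ht.ne'
    have key : ∀ {w a b : ℂ}, ‖w‖ ≤ 1 / 4 * ‖a‖ + 1 / 4 * ‖b‖ → ‖w‖ₑ ^ 2 ≤ 2⁻¹ * (‖a‖ₑ ^ 2 + ‖b‖ₑ ^ 2) := by
      intro w a b h
      have := pow_le_pow_left₀ (norm_nonneg _) h 2
      have := enorm_sq_le (w := w) (a := a) (b := b) 2⁻¹ (by push_cast; nlinarith)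
      rwa [ENNReal.coe_inv two_ne_zero, coe_ofNat] at this
    have k1 : ‖grad f z 0‖ ≤ 1 / 4 * ‖deriv A (cpt z.2 z.1)‖ + 1 / 4 * ‖deriv A (cpt z.2 (-z.1))‖ := by
      rw [grad, ev.fderiv_eq, cons_val_zero, d1, hf1, deriv_const_mul_field, deriv_const_mul_field, norm_neg]
      refine (norm_add_le _ _).trans (by simp)
    have k2 : ‖grad f z 1‖ ≤ 1 / 4 * ‖deriv A (cpt z.2 z.1)‖ + 1 / 4 * ‖deriv A (cpt z.2 (-z.1))‖ := by
      rw [grad, ev.fderiv_eq, cons_val_one, Matrix.cons_val_fin_one, d2, hf0, deriv_const_mul_field, deriv_const_mul_field]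
      refine (norm_add_le _ _).trans (by simp)
    refine (add_le_add (key k1) (key k2)).trans_eq ?_
    rw [← add_mul, ENNReal.inv_two_add_inv_two, one_mul]
  · rw [lintegral_add_left' ma]
    exact ENNReal.add_lt_top.2 ⟨h1, h2⟩

lemma grad_comp_neg (f : ℝ × ℝ → ℂ) (z : ℝ × ℝ) : grad (fun y => f (y.1, -y.2)) z = ![grad f (z.1, -z.2) 0, -grad f (z.1, -z.2) 1] := by
  have h := (ContinuousLinearEquiv.prodCongr (ContinuousLinearEquiv.refl ℝ ℝ) (ContinuousLinearEquiv.neg ℝ)).comp_right_fderiv (f := f) (x := z)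
  have e : fderiv ℝ (fun y => f (y.1, -y.2)) z = _ := h
  rw [grad, e]
  change ![fderiv ℝ f (z.1, -z.2) (1, -0), fderiv ℝ f (z.1, -z.2) (0, -1)] = _
  rw [neg_zero, show ((0 : ℝ), (-1 : ℝ)) = -(0, 1) by simp, map_neg]
  rfl

lemma energy_glue_lt_top (hα : α ∈ Ioo (-1 : ℝ) 1) (hu : ContDiff ℝ 1 u) (hc : HasCompactSupport u)
    (hf : ∀ t x : ℝ, 0 < t → 0 < x → f (t, x) = poissonIntegral α u (t, x))
    (hg : ∀ t x : ℝ, 0 < t → x < 0 → g (t, x) = poissonIntegral α u (t, x)) : energy (glue (grad f) (grad g)) < ⊤ := by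
  have h1 := lintegral_grad_quadrant hα hu hc hf
  have h2 := lintegral_grad_quadrant hα (u := fun y => u (-y)) (hu.comp contDiff_neg) (hc.comp_homeomorph (Homeomorph.neg ℝ))
    (f := fun y => g (y.1, -y.2)) fun t x ht hx => by rw [hg t (-x) ht (by linarith), poissonIntegral_neg]
  have mp : MeasurePreserving (Prod.map id Neg.neg : ℝ × ℝ → ℝ × ℝ) volume := (MeasurePreserving.id volume).prod (measurePreserving_neg volume)
  have me : MeasurableEmbedding (Prod.map id Neg.neg : ℝ × ℝ → ℝ × ℝ) :=
    ((MeasurableEquiv.refl ℝ).prodCongr (MeasurableEquiv.neg ℝ)).measurableEmbedding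
  have h3 := mp.setLIntegral_comp_preimage_emb me (fun z => ‖grad g z 0‖ₑ ^ 2 + ‖grad g z 1‖ₑ ^ 2) (Ioi 0 ×ˢ Iio 0)
  have e3 : (Prod.map id Neg.neg : ℝ × ℝ → ℝ × ℝ) ⁻¹' (Ioi 0 ×ˢ Iio 0) = Ioi 0 ×ˢ Ioi 0 := by ext z; simp
  rw [e3] at h3
  simp only [grad_comp_neg, cons_val_zero, cons_val_one, Matrix.cons_val_fin_one, enorm_neg] at h2
  have h4 : ∫⁻ z in Ioi 0 ×ˢ Iio 0, (‖grad g z 0‖ₑ ^ 2 + ‖grad g z 1‖ₑ ^ 2) < ⊤ := h3 ▸ h2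
  have hs : halfPlane =ᵐ[volume] (Ioi 0 ×ˢ Ioi 0 ∪ Ioi 0 ×ˢ Iio 0 : Set (ℝ × ℝ)) := by
    filter_upwards [ae_snd_ne_zero] with z hz
    refine propext ⟨fun h => ?_, fun h => h.elim (fun h => h.1) fun h => h.1⟩
    rcases lt_or_gt_of_ne hz with h' | h'
    · exact Or.inr ⟨h, h'⟩
    · exact Or.inl ⟨h, h'⟩
  rw [energy, setLIntegral_congr hs]
  refine (lintegral_union_le _ _ _).trans_lt (ENNReal.add_lt_top.2 ⟨lt_of_le_of_lt (setLIntegral_mono' (measurableSet_Ioi.prod measurableSet_Ioi) fun z hz => ?_) h1,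
    lt_of_le_of_lt (setLIntegral_mono' (measurableSet_Ioi.prod measurableSet_Iio) fun z hz => ?_) h4⟩)
  · have : (0 : ℝ) < z.2 := hz.2
    simp [glue, this]
  · have : ¬ (0 : ℝ) < z.2 := not_lt.2 (le_of_lt hz.2)
    simp [glue, this]

/-! ### Positivity of the Poisson kernel -/

lemma mul_sin_le_sin_mul {l θ : ℝ} (h0 : 0 ≤ l) (h1 : l ≤ 1) (hθ : 0 ≤ θ) (hθ' : θ ≤ π) : l * Real.sin θ ≤ Real.sin (l * θ) := by
  have := strictConcaveOn_sin_Icc.concaveOn.2 (show 0 ∈ Icc 0 π from ⟨le_rfl, Real.pi_pos.le⟩) (show θ ∈ Icc 0 π from ⟨hθ, hθ'⟩)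
    (sub_nonneg.2 h1) h0 (sub_add_cancel 1 l)
  simpa using this

lemma im_cpow_mul_sq_sub (α s : ℝ) (hz : z ≠ 0) : (z ^ ((α : ℂ) + 1) * ((s : ℂ) ^ 2 - (star z) ^ 2)).im =
    s ^ 2 * ‖z‖ ^ (α + 1) * Real.sin ((1 + α) * z.arg) + ‖z‖ ^ (α + 3) * Real.sin ((1 - α) * z.arg) := by
  have hr : 0 < ‖z‖ := norm_pos_iff.2 hz
  have e1 : (α : ℂ) + 1 = ((α + 1 : ℝ) : ℂ) := by push_cast; rfl
  have e2 : ‖z‖ ^ (α + 3) = ‖z‖ ^ (α + 1) * ‖z‖ ^ 2 := by rw [← Real.rpow_ofNat, ← rpow_add hr]; ring_nf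
  have e3 : (1 - α) * z.arg = 2 * z.arg - z.arg * (α + 1) := by ring
  have h1 : z.re = ‖z‖ * cos z.arg := by simp
  have h2 : z.im = ‖z‖ * Real.sin z.arg := by simp
  rw [e1, Complex.cpow_ofReal, mul_assoc, im_ofReal_mul, e2, e3, Real.sin_sub, Real.sin_two_mul, Real.cos_two_mul', mul_comm (1 + α), add_comm 1 α]
  simp only [star_def, sq, mul_im, add_re, add_im, sub_re, sub_im, mul_re, Complex.conj_re, Complex.conj_im,
    ofReal_re, ofReal_im, I_re, I_im, h1, h2]
  ring

lemma mul_sq_le_of_amgm (hα : α ∈ Ioo (-1 : ℝ) 1) (hs : 0 < s) (hr : 0 < r) :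
    s * r ^ 2 ≤ s ^ (-α) * ((1 + α) / 2 * (s ^ 2 * r ^ (α + 1)) + (1 - α) / 2 * r ^ (α + 3)) := by
  have h := Real.geom_mean_le_arith_mean2_weighted (w₁ := (1 + α) / 2) (w₂ := (1 - α) / 2) (p₁ := s ^ (2 - α) * r ^ (α + 1)) (p₂ := s ^ (-α) * r ^ (α + 3))
    (by linarith [hα.1]) (by linarith [hα.2]) (by positivity) (by positivity) (by ring)
  rw [mul_rpow (by positivity) (by positivity), mul_rpow (by positivity) (by positivity), ← Real.rpow_mul hs.le, ← Real.rpow_mul hr.le,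
    ← Real.rpow_mul hs.le, ← Real.rpow_mul hr.le, mul_mul_mul_comm, ← rpow_add hs, ← rpow_add hr] at h
  have e1 : (2 - α) * ((1 + α) / 2) + -α * ((1 - α) / 2) = 1 := by ring
  have e2 : (α + 1) * ((1 + α) / 2) + (α + 3) * ((1 - α) / 2) = 2 := by ring
  have e3 : s ^ (2 - α) = s ^ 2 * s ^ (-α) := by rw [← rpow_two, ← rpow_add hs, sub_eq_add_neg]
  rw [e1, e2, e3, Real.rpow_one, rpow_two] at h
  linarith

lemma jumpPoissonKernel_nonneg (hα : α ∈ Ioo (-1 : ℝ) 1) (ht : 0 < t) (x y : ℝ) : 0 ≤ jumpPoissonKernel α t x y := by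
  set z := cpt |x| t with hz
  have him : z.im = t := by simp [hz]
  have hz0 : z ≠ 0 := fun h => ht.ne' (by rw [← him, h]; rfl)
  have hr : 0 < ‖z‖ := norm_pos_iff.2 hz0
  have e0 : ((|x| : ℝ) : ℂ) + I * (t : ℂ) = z := by rw [hz, cpt, mul_comm]
  have e1 : ((|x| : ℝ) : ℂ) - I * (t : ℂ) = star z := by rw [hz, ← cpt_neg, cpt]; push_cast; ring
  have a0 : 0 ≤ z.arg := Complex.arg_nonneg_iff.2 (him ▸ ht.le)
  have a1 : z.arg ≤ π / 2 := Complex.arg_le_pi_div_two_iff.2 (Or.inl (by simp [hz]))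
  have k1 := mul_sin_le_sin_mul (l := (1 + α) / 2) (θ := 2 * z.arg) (by linarith [hα.1]) (by linarith [hα.2]) (by linarith) (by linarith)
  have k2 := mul_sin_le_sin_mul (l := (1 - α) / 2) (θ := 2 * z.arg) (by linarith [hα.2]) (by linarith [hα.1]) (by linarith) (by linarith)
  rw [← mul_assoc, div_mul_cancel₀ _ two_ne_zero] at k1 k2
  have s0 : 0 ≤ Real.sin (2 * z.arg) := Real.sin_nonneg_of_nonneg_of_le_pi (by linarith) (by linarith)
  have s1 : ‖z‖ ^ 2 * Real.sin (2 * z.arg) = 2 * |x| * t := by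
    rw [Real.sin_two_mul]
    have h1 : |x| = ‖z‖ * cos z.arg := by simp_all
    have h2 : t = ‖z‖ * Real.sin z.arg := by rw [Complex.norm_mul_sin_arg, him]
    grind
  rw [jumpPoissonKernel, e0, e1, im_cpow_mul_sq_sub α y hz0, ← sq_abs y]
  refine mul_nonneg (by positivity) (div_nonneg ?_ (by positivity))
  have key : ∀ s, 0 ≤ s → ((1 + α) / 2 * (s ^ 2 * ‖z‖ ^ (α + 1)) + (1 - α) / 2 * ‖z‖ ^ (α + 3)) * Real.sin (2 * z.arg) ≤
      s ^ 2 * ‖z‖ ^ (α + 1) * Real.sin ((1 + α) * z.arg) + ‖z‖ ^ (α + 3) * Real.sin ((1 - α) * z.arg) := fun s hs => by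
    have := mul_le_mul_of_nonneg_left k1 (by positivity : 0 ≤ s ^ 2 * ‖z‖ ^ (α + 1))
    have := mul_le_mul_of_nonneg_left k2 (by positivity : 0 ≤ ‖z‖ ^ (α + 3))
    linarith
  have hy := key |y| (abs_nonneg y)
  have hp : 0 ≤ |y| ^ (-α) := by positivity
  rcases (abs_nonneg y).eq_or_lt with h0 | h0
  · have : y = 0 := abs_eq_zero.1 h0.symm
    have h1 : 0 ≤ (1 - α) / 2 * ‖z‖ ^ (α + 3) := mul_nonneg (by linarith [hα.2]) (by positivity)
    have := mul_nonneg hp ((mul_nonneg (add_nonneg (mul_nonneg (by linarith [hα.1]) (by positivity)) h1) s0).trans hy)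
    rw [show 2 * x * t * y = 0 by rw [‹y = 0›, mul_zero], zero_add]
    exact this
  · have h1 := mul_le_mul_of_nonneg_right (mul_sq_le_of_amgm hα h0 hr) s0
    have h3 : -(2 * |x| * t * |y|) ≤ 2 * x * t * y := by
      have := neg_abs_le (x * y)
      rw [abs_mul] at this
      nlinarith
    nlinarith

/-! ### Hardy's inequality -/

lemma enorm_le_lintegral_deriv {h : ℝ → ℂ} (hh : ContDiffOn ℝ 1 h (Ioi 0)) {τ : ℕ → ℝ} (h0 : ∀ n, 0 < τ n) (h1 : Tendsto τ atTop (𝓝 0))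
    (h2 : Tendsto (fun n => h (τ n)) atTop (𝓝 0)) (ht : 0 < t) : ‖h t‖ₑ ≤ ∫⁻ s in Ioc 0 t, ‖deriv h s‖ₑ := by
  have hd : ∀ s ∈ Ioi 0, HasDerivAt h (deriv h s) s := fun s hs => ((hh.contDiffAt (Ioi_mem_nhds hs)).differentiableAt one_ne_zero).hasDerivAt
  have hc : ContinuousOn (deriv h) (Ioi 0) := hh.continuousOn_deriv_of_isOpen isOpen_Ioi le_rfl
  have h3 : Tendsto (fun n => ‖h t - h (τ n)‖ₑ) atTop (𝓝 ‖h t - 0‖ₑ) := (h2.const_sub (h t)).enorm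
  rw [sub_zero] at h3
  refine le_of_tendsto h3 ?_
  filter_upwards [h1.eventually (gt_mem_nhds ht)] with n hn
  have hsub : uIcc (τ n) t ⊆ Ioi 0 := by rw [uIcc_of_le hn.le]; grind
  rw [← intervalIntegral.integral_eq_sub_of_hasDerivAt (by grind) (hc.mono hsub).intervalIntegrable,
    integral_of_le hn.le]
  exact (enorm_integral_le_lintegral_enorm _).trans (lintegral_mono_set (by grind))

lemma exists_hardy : ∃ C : ℝ≥0, ∀ h : ℝ → ℂ, ContDiffOn ℝ 1 h (Ioi 0) →
    (∃ τ : ℕ → ℝ, (∀ n, 0 < τ n) ∧ Tendsto τ atTop (𝓝 0) ∧ Tendsto (fun n => h (τ n)) atTop (𝓝 0)) →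
    ∫⁻ t, ‖(t⁻¹ : ℂ) * h t‖ₑ ^ 2 ∂halfVol ≤ C * ∫⁻ t, ‖deriv h t‖ₑ ^ 2 ∂halfVol := by
  obtain ⟨C, -, hC⟩ := exists_schur_homKer Real.HolderConjugate.two_two (a := 0) (b := 0) (by norm_num) (by norm_num)
  refine ⟨4 * C, fun h hh ⟨τ, h0, h1, h2⟩ => ?_⟩
  have key : ∀ t ∈ Ioi (0 : ℝ), ‖(t⁻¹ : ℂ) * h t‖ₑ ^ 2 ≤ 4 * (∫⁻ y, ofReal (homKer 0 0 t y) * ‖deriv h y‖ₑ ∂halfVol) ^ (2 : ℝ) := by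
    intro t ht
    have ht : (0 : ℝ) < t := ht
    have e : ‖(t⁻¹ : ℂ)‖ₑ = ofReal t⁻¹ := by
      rw [← Complex.ofReal_inv, ← ofReal_norm, norm_real, norm_of_nonneg (by positivity)]
    have : ‖(t⁻¹ : ℂ) * h t‖ₑ ≤ 2 * ∫⁻ y, ofReal (homKer 0 0 t y) * ‖deriv h y‖ₑ ∂halfVol := by
      rw [enorm_mul, e]
      refine (mul_le_mul_right (enorm_le_lintegral_deriv hh h0 h1 h2 ht) _).trans ?_
      rw [← lintegral_const_mul' _ _ ofReal_ne_top, ← lintegral_const_mul' _ _ (by simp)]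
      refine (setLIntegral_mono' measurableSet_Ioc fun y hy => ?_).trans (lintegral_mono_set Ioc_subset_Ioi_self)
      rw [← mul_assoc, ← ofReal_ofNat, ← ofReal_mul zero_le_two]
      gcongr
      have hy0 : 0 < y := hy.1
      simp only [homKer, neg_zero, rpow_zero, one_mul, add_zero, zero_sub, rpow_neg_one]
      rw [← div_eq_mul_inv, inv_eq_one_div, div_le_div_iff₀ ht (by positivity)]
      linarith [hy.2]
    calc _ ≤ (2 * ∫⁻ y, ofReal (homKer 0 0 t y) * ‖deriv h y‖ₑ ∂halfVol) ^ 2 := by gcongr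
      _ = _ := by rw [mul_pow]; norm_num
  refine (setLIntegral_mono' measurableSet_Ioi key).trans ?_
  rw [lintegral_const_mul' _ _ (by simp)]
  have := hC (deriv h) (by fun_prop)
  simp at this ⊢
  rw [mul_assoc]
  gcongr

lemma restrict_halfPlane : (volume : Measure (ℝ × ℝ)).restrict halfPlane = halfVol.prod volume := by
  have : halfPlane = Ioi 0 ×ˢ univ := by ext z; simp [halfPlane]
  rw [this, volume_eq_prod, ← prod_restrict, restrict_univ]

lemma aestronglyMeasurable_glue {E : Type*} [NormedAddCommGroup E] {f g : ℝ × ℝ → E} (hf : ContinuousOn f halfPlane)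
    (hg : ContinuousOn g halfPlane) : AEStronglyMeasurable (glue f g) (volume.restrict halfPlane) :=
  (locallyIntegrableOn_glue isOpen_halfPlane hf hg).aestronglyMeasurable

lemma hasDerivAt_slice (hf : ContDiffOn ℝ 1 f halfPlane) (x : ℝ) (ht : 0 < t) :
    HasDerivAt (fun t => f (t, x)) (grad f (t, x) 0) t := by
  have h1 := ((hf.contDiffAt (isOpen_halfPlane.mem_nhds (x := (t, x)) ht)).differentiableAt one_ne_zero).hasFDerivAt
  exact h1.comp_hasDerivAt t ((hasDerivAt_id t).prodMk (hasDerivAt_const t x))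

lemma lintegral_hardy_lt_top (hf : ContDiffOn ℝ 1 f halfPlane) (hg : ContDiffOn ℝ 1 g halfPlane)
    (hG : MemLp (glue (grad f) (grad g)) 2 (volume.restrict halfPlane))
    (h0 : ∀ᵐ x : ℝ, ∃ τ : ℕ → ℝ, (∀ n, 0 < τ n) ∧ Tendsto τ atTop (𝓝 0) ∧ Tendsto (fun n => glue f g (τ n, x)) atTop (𝓝 0)) :
    ∫⁻ z in halfPlane, ‖(z.1⁻¹ : ℂ) * glue f g z‖ₑ ^ 2 < ⊤ := by
  obtain ⟨C, hC⟩ := exists_hardy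
  have hm := hG.1.enorm.pow_const 2
  have h2 := eLpNorm_nnreal_pow_eq_lintegral (f := glue (grad f) (grad g)) (μ := volume.restrict halfPlane) (p := 2) two_ne_zero
  simp at h2
  have h3 : ∫⁻ z in halfPlane, ‖glue (grad f) (grad g) z‖ₑ ^ 2 < ⊤ := h2 ▸ pow_lt_top hG.2
  have mW := ((by fun_prop : Measurable fun z : ℝ × ℝ => (z.1⁻¹ : ℂ)).aestronglyMeasurable.mul
    (aestronglyMeasurable_glue hf.continuousOn hg.continuousOn)).enorm.pow_const 2
  simp only [Pi.mul_apply] at mW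
  rw [restrict_halfPlane] at h3 hm mW ⊢
  rw [lintegral_prod_symm _ hm] at h3
  rw [lintegral_prod_symm _ mW]
  refine lt_of_le_of_lt ?_ (mul_lt_top (coe_lt_top (r := C)) h3)
  rw [← lintegral_const_mul' _ _ (by simp)]
  refine lintegral_mono_ae ?_
  filter_upwards [h0] with x hx
  have hh : ContDiffOn ℝ 1 (fun t => glue f g (t, x)) (Ioi 0) ∧ ∀ t ∈ Ioi 0, deriv (fun t => glue f g (t, x)) t = glue (grad f) (grad g) (t, x) 0 := by
    have hl : ContDiffOn ℝ 1 (fun t : ℝ => (t, x)) (Ioi 0) := by fun_prop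
    by_cases h : 0 < x
    · simp only [glue, if_pos h]
      exact ⟨hf.comp hl fun t ht => ht, fun t ht => (hasDerivAt_slice hf x ht).deriv⟩
    · simp only [glue, if_neg h]
      exact ⟨hg.comp hl fun t ht => ht, fun t ht => (hasDerivAt_slice hg x ht).deriv⟩
  refine (hC _ hh.1 hx).trans ?_
  gcongr 1
  refine setLIntegral_mono' measurableSet_Ioi fun t ht => ?_
  rw [hh.2 t ht]
  gcongr
  exact enorm_le_iff_norm_le.2 (norm_le_pi_norm _ _)

/-! ### Cut-off functions -/

lemma deriv_smoothTransition_eq_zero (hy : y ∉ Icc (0 : ℝ) 1) : deriv smoothTransition y = 0 := by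
  rw [mem_Icc, not_and_or, not_le, not_le] at hy
  rcases hy with h | h
  · have : smoothTransition =ᶠ[𝓝 y] fun _ => 0 := (gt_mem_nhds h).mono fun z hz => Real.smoothTransition.zero_of_nonpos (le_of_lt hz)
    rw [this.deriv_eq, deriv_const]
  · have : smoothTransition =ᶠ[𝓝 y] fun _ => 1 := (lt_mem_nhds h).mono fun z hz => Real.smoothTransition.one_of_one_le (le_of_lt hz)
    rw [this.deriv_eq, deriv_const]

lemma exists_deriv_smoothTransition_le : ∃ S : ℝ, 0 ≤ S ∧ ∀ y, |deriv smoothTransition y| ≤ S ∧ |y * deriv smoothTransition y| ≤ S := by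
  have hc : Continuous (deriv smoothTransition) := by fun_prop
  obtain ⟨S, hS⟩ := (isCompact_Icc (a := (0 : ℝ)) (b := 1)).exists_bound_of_continuousOn hc.continuousOn
  have h0 : 0 ≤ S := (norm_nonneg _).trans (hS 0 (by simp))
  refine ⟨S, h0, fun y => ?_⟩
  by_cases hy : y ∈ Icc 0 1
  · refine ⟨hS y hy, ?_⟩
    rw [abs_mul, abs_of_nonneg hy.1]
    exact (mul_le_of_le_one_left (abs_nonneg _) hy.2).trans (hS y hy)
  · rw [deriv_smoothTransition_eq_zero hy]
    simpa using h0

/-- A function that is `1` for `2 / m ≤ t`, `|z| ≤ m`, and `0` for `t ≤ 1 / m` and for `|z|^2 ≥ 2 m^2`. -/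
def cutoff (m : ℝ) (z : ℝ × ℝ) : ℂ :=
  ((smoothTransition (m * z.1 - 1) * smoothTransition (2 - (z.1 ^ 2 + z.2 ^ 2) / m ^ 2) : ℝ) : ℂ)

lemma norm_cutoff_le (m : ℝ) (z : ℝ × ℝ) : ‖cutoff m z‖ ≤ 1 := by
  have h := fun x => Real.smoothTransition.nonneg x
  rw [cutoff, norm_real, norm_of_nonneg (mul_nonneg (h _) (h _))]
  exact mul_le_one₀ (Real.smoothTransition.le_one _) (h _) (Real.smoothTransition.le_one _)

lemma cutoff_eq_one {m : ℝ} (hm : 0 < m) {z : ℝ × ℝ} (h1 : 2 ≤ m * z.1) (h2 : z.1 ^ 2 + z.2 ^ 2 ≤ m ^ 2) : cutoff m z = 1 := by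
  have : (z.1 ^ 2 + z.2 ^ 2) / m ^ 2 ≤ 1 := (div_le_one (by positivity)).2 h2
  rw [cutoff, Real.smoothTransition.one_of_one_le (by linarith), Real.smoothTransition.one_of_one_le (by linarith)]
  simp

lemma isTest_cutoff {m : ℝ} (hm : 0 < m) : IsTest halfPlane (cutoff m) := by
  have hs : Function.support (cutoff m) ⊆ {z | 1 ≤ m * z.1} ∩ {z | z.1 ^ 2 + z.2 ^ 2 ≤ 2 * m ^ 2} := by
    intro z hz
    by_contra h
    rw [mem_inter_iff, not_and_or] at h
    refine hz ?_
    rcases h with h | h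
    · have : m * z.1 < 1 := not_le.1 h
      rw [cutoff, Real.smoothTransition.zero_of_nonpos (by linarith)]; simp
    · have : 2 * m ^ 2 < z.1 ^ 2 + z.2 ^ 2 := not_le.1 h
      have : 2 ≤ (z.1 ^ 2 + z.2 ^ 2) / m ^ 2 := (le_div_iff₀ (by positivity)).2 this.le
      rw [cutoff, Real.smoothTransition.zero_of_nonpos (x := 2 - _) (by linarith)]; simp
  have hc : IsClosed ({z : ℝ × ℝ | 1 ≤ m * z.1} ∩ {z | z.1 ^ 2 + z.2 ^ 2 ≤ 2 * m ^ 2}) :=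
    (isClosed_le continuous_const (by fun_prop)).inter (isClosed_le (by fun_prop) continuous_const)
  have ht := closure_minimal hs hc
  refine ⟨?_, ?_, fun z hz => ?_⟩
  · have c := Real.smoothTransition.contDiff (n := (⊤ : ℕ∞))
    exact Complex.ofRealCLM.contDiff.comp ((c.comp (by fun_prop)).mul (c.comp (by fun_prop)))
  · refine HasCompactSupport.intro (isCompact_closedBall (0 : ℝ × ℝ) (2 * m)) fun z hz => ?_
    by_contra h
    have h2 : z.1 ^ 2 + z.2 ^ 2 ≤ 2 * m ^ 2 := (hs h).2
    refine hz ?_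
    rw [mem_closedBall_zero_iff, Prod.norm_def, norm_eq_abs, norm_eq_abs]
    exact max_le (abs_le_of_sq_le_sq (by nlinarith) (by positivity)) (abs_le_of_sq_le_sq (by nlinarith) (by positivity))
  · have : 1 ≤ m * z.1 := (ht hz).1
    exact pos_of_mul_pos_right (by linarith) hm.le

lemma eventually_cutoff_eq_one (hK : IsCompact K) (hs : K ⊆ halfPlane) :
    ∀ᶠ n : ℕ in atTop, ∀ z ∈ K, cutoff (n + 1 : ℝ) z = 1 := by
  obtain ⟨M, hM⟩ := hK.exists_bound_of_continuousOn (f := fun z : ℝ × ℝ => z.1 ^ 2 + z.2 ^ 2) (by fun_prop)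
  obtain ⟨B, hB⟩ := hK.exists_bound_of_continuousOn (f := fun z : ℝ × ℝ => z.1⁻¹) (continuousOn_fst.inv₀ fun z hz => ne_of_gt (hs hz))
  filter_upwards [eventually_ge_atTop ⌈2 * B⌉₊, eventually_ge_atTop ⌈M⌉₊] with n h1 h2 z hz
  have h1 := Nat.ceil_le.1 h1
  have h2 := Nat.ceil_le.1 h2
  have hz0 : 0 < z.1 := hs hz
  have b1 := (le_abs_self _).trans (hB z hz)
  have b2 := (le_abs_self _).trans (hM z hz)
  refine cutoff_eq_one (by positivity) ?_ (by nlinarith)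
  have : 2 * z.1⁻¹ ≤ n + 1 := by linarith
  calc 2 = 2 * z.1⁻¹ * z.1 := by field_simp
    _ ≤ _ := by gcongr

lemma norm_grad_le {z : ℝ × ℝ} {C : ℝ} (h0 : ‖fderiv ℝ φ z (1, 0)‖ ≤ C) (h1 : ‖fderiv ℝ φ z (0, 1)‖ ≤ C) : ‖grad φ z‖ ≤ C := by
  refine (pi_norm_le_iff_of_nonneg ((norm_nonneg _).trans h0)).2 fun i => ?_
  fin_cases i
  · exact h0
  · exact h1

lemma exists_grad_cutoff_le : ∃ C : ℝ, 0 ≤ C ∧ ∀ m : ℝ, 0 < m → ∀ z ∈ halfPlane, ‖grad (cutoff m) z‖ ≤ C * z.1⁻¹ := by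
  obtain ⟨S, hS, hb⟩ := exists_deriv_smoothTransition_le
  refine ⟨8 * S, by positivity, fun m hm z hz => ?_⟩
  have hz : 0 < z.1 := hz
  have d := fun y => ((Real.smoothTransition.contDiff).differentiable one_ne_zero y).hasDerivAt
  have a1 : HasFDerivAt (fun z => m * z.1 - 1) (m • ContinuousLinearMap.fst ℝ ℝ ℝ) z := by fun_prop
  have a2 : HasFDerivAt (fun z => 2 - (z.1 ^ 2 + z.2 ^ 2) / m ^ 2)
      (-((m ^ 2)⁻¹ • ((2 * z.1) • ContinuousLinearMap.fst ℝ ℝ ℝ + (2 * z.2) • ContinuousLinearMap.snd ℝ ℝ ℝ))) z := by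
    have := ((((hasFDerivAt_fst (p := z)).pow 2).add ((hasFDerivAt_snd (𝕜 := ℝ) (p := z)).pow 2)).mul_const (m ^ 2)⁻¹).const_sub 2
    simpa [div_eq_mul_inv] using this
  have a3 := Complex.ofRealCLM.hasFDerivAt.comp z (((d _).comp_hasFDerivAt z a1).mul ((d _).comp_hasFDerivAt z a2))
  have e : fderiv ℝ (cutoff m) z = _ := a3.fderiv
  set ρ := 2 - (z.1 ^ 2 + z.2 ^ 2) / m ^ 2 with hρ
  set y := m * z.1 - 1 with hy
  have s1 : ∀ y, |smoothTransition y| ≤ 1 := fun y => by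
    rw [abs_of_nonneg (Real.smoothTransition.nonneg _)]; exact Real.smoothTransition.le_one _
  have k1 : |m * deriv smoothTransition y| ≤ 2 * S * z.1⁻¹ := by
    have : m * deriv smoothTransition y = (y * deriv smoothTransition y + deriv smoothTransition y) * z.1⁻¹ := by
      field_simp; ring
    rw [this, abs_mul, abs_of_pos (inv_pos.2 hz)]
    gcongr
    exact (abs_add_le _ _).trans (by linarith [(hb y).1, (hb y).2])
  have k2 : ∀ w, |w * z.1| ≤ z.1 ^ 2 + z.2 ^ 2 → |deriv smoothTransition ρ * ((m ^ 2)⁻¹ * (2 * w))| ≤ 6 * S * z.1⁻¹ := fun w hw => by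
    have e1 : deriv smoothTransition ρ * ((m ^ 2)⁻¹ * (2 * w)) = deriv smoothTransition ρ * (2 * (w * z.1) / m ^ 2) * z.1⁻¹ := by
      field_simp
    have e2 : |deriv smoothTransition ρ * (2 * (w * z.1) / m ^ 2)| ≤ 2 * |2 * deriv smoothTransition ρ - ρ * deriv smoothTransition ρ| := by
      have : 2 * deriv smoothTransition ρ - ρ * deriv smoothTransition ρ = deriv smoothTransition ρ * ((z.1 ^ 2 + z.2 ^ 2) / m ^ 2) := by
        ring
      rw [this, abs_mul, abs_mul, abs_div, abs_mul, abs_div, abs_of_nonneg (by positivity : 0 ≤ z.1 ^ 2 + z.2 ^ 2), abs_two, mul_left_comm, mul_div_assoc]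
      gcongr
    rw [e1, abs_mul, abs_of_pos (inv_pos.2 hz)]
    gcongr
    have := abs_sub (2 * deriv smoothTransition ρ) (ρ * deriv smoothTransition ρ)
    rw [abs_mul, abs_two] at this
    linarith [(hb ρ).1, (hb ρ).2]
  have hz1 : |z.1 * z.1| ≤ z.1 ^ 2 + z.2 ^ 2 := by rw [abs_mul_self]; nlinarith
  have hz2 : |z.2 * z.1| ≤ z.1 ^ 2 + z.2 ^ 2 := abs_le.2 ⟨by nlinarith,
    by nlinarith⟩
  have hp : 0 ≤ S * z.1⁻¹ := by positivity
  have fin : ∀ {a b c e : ℝ}, |a| ≤ 1 → |b| ≤ 1 → |c| ≤ 6 * S * z.1⁻¹ → |e| ≤ 2 * S * z.1⁻¹ → |a * c + b * e| ≤ 8 * S * z.1⁻¹ := fun {a b c e} ha hb hc he => by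
    refine (abs_add_le _ _).trans ?_
    rw [abs_mul, abs_mul]
    have := mul_le_mul ha hc (abs_nonneg _) zero_le_one
    have := mul_le_mul hb he (abs_nonneg _) zero_le_one
    linarith
  have h6 : |0| ≤ 2 * S * z.1⁻¹ := by linarith
  refine norm_grad_le ?_ ?_ <;> rw [e]
  · refine Eq.trans_le ?_ (fin (by rw [abs_neg]; exact s1 y) (s1 ρ) (k2 _ hz1) k1)
    rw [← norm_eq_abs, ← norm_real]
    congr 1
    simp
    ring
  · refine Eq.trans_le ?_ (fin (by rw [abs_neg]; exact s1 y) (s1 ρ) (k2 _ hz2) h6)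
    simp
    exact Or.inl rfl

/-! ### Approximation by test functions -/

lemma tendsto_eLpNorm_two {X E : Type*} [MeasurableSpace X] [NormedAddCommGroup E] {μ : Measure X} {F : ℕ → X → E} {g : X → ℝ≥0∞}
    (hF : ∀ n, AEStronglyMeasurable (F n) μ) (hg : ∫⁻ x, g x ^ 2 ∂μ ≠ ⊤) (hb : ∀ n, ∀ᵐ x ∂μ, ‖F n x‖ₑ ≤ g x)
    (hlim : ∀ᵐ x ∂μ, ∀ᶠ n in atTop, F n x = 0) : Tendsto (fun n => eLpNorm (F n) 2 μ) atTop (𝓝 0) := by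
  have := tendsto_eLpNorm_of_dominated two_pos (by simp_all) (by simp_all) (.of_forall hb)
    (hlim.mono fun x hx => tendsto_const_nhds.congr' (hx.mono fun n hn => hn.symm))
  rwa [ofReal_ofNat] at this

lemma lintegral_enorm_sq_ne_top {X E : Type*} [MeasurableSpace X] [NormedAddCommGroup E] {μ : Measure X} {f : X → E}
    (hf : MemLp f 2 μ) : ∫⁻ x, ‖f x‖ₑ ^ 2 ∂μ ≠ ⊤ := by
  have h2 := eLpNorm_nnreal_pow_eq_lintegral (f := f) (μ := μ) two_ne_zero
  simp at h2
  exact h2 ▸ (pow_lt_top hf.2).ne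

lemma grad_congr {z : ℝ × ℝ} (h : f =ᶠ[𝓝 z] g) : grad f z = grad g z := by rw [grad, grad, h.fderiv_eq]

lemma continuous_grad (hf : ContDiff ℝ 1 f) : Continuous (grad f) := by
  have h := hf.continuous_fderiv one_ne_zero
  refine continuous_pi fun i => ?_
  fin_cases i
  · exact h.clm_apply continuous_const
  · exact h.clm_apply continuous_const

/-- The function `D`, cut off smoothly near the half plane `x ≤ 0`. -/
def rightPart (N : ℝ) (D : ℝ × ℝ → ℂ) (z : ℝ × ℝ) : ℂ := ((smoothTransition (N * z.2) : ℝ) : ℂ) * D z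

lemma contDiff_rightPart {n : WithTop ℕ∞} (hn : n ≤ (⊤ : ℕ∞)) (N : ℝ) (hD : ContDiff ℝ n D) : ContDiff ℝ n (rightPart N D) :=
  (Complex.ofRealCLM.contDiff.comp ((Real.smoothTransition.contDiff.of_le hn).comp (by fun_prop))).mul hD

lemma eventually_rightPart (D : ℝ × ℝ → ℂ) {z : ℝ × ℝ} (hz : z.2 ≠ 0) :
    ∀ᶠ n : ℕ in atTop, rightPart (n + 1) D =ᶠ[𝓝 z] glue D 0 := by
  rcases lt_or_gt_of_ne hz with h | h
  · refine .of_forall fun n => ?_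
    filter_upwards [continuous_snd.continuousAt.eventually (gt_mem_nhds h)] with w hw
    rw [rightPart, glue, if_neg (not_lt.2 hw.le), Real.smoothTransition.zero_of_nonpos (mul_nonpos_of_nonneg_of_nonpos (by positivity) hw.le)]
    simp
  · filter_upwards [eventually_gt_atTop ⌈z.2⁻¹⌉₊] with n hn
    have h1 : 1 < (n + 1) * z.2 := by
      have : z.2⁻¹ < n + 1 := by have := Nat.lt_of_ceil_lt hn; linarith
      calc 1 = z.2⁻¹ * z.2 := by simp_all
        _ < _ := by gcongr
    have hc : Continuous fun w : ℝ × ℝ => ((n : ℝ) + 1) * w.2 := by fun_prop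
    filter_upwards [hc.continuousAt.eventually (lt_mem_nhds h1), continuous_snd.continuousAt.eventually (lt_mem_nhds h)] with w hw hw'
    rw [rightPart, glue, if_pos hw', Real.smoothTransition.one_of_one_le (le_of_lt hw)]
    simp

lemma grad_glue (f g : ℝ × ℝ → ℂ) {z : ℝ × ℝ} (hz : z.2 ≠ 0) : grad (glue f g) z = glue (grad f) (grad g) z := by
  rcases lt_or_gt_of_ne hz with h | h
  · rw [glue, if_neg (not_lt.2 h.le)]
    refine grad_congr ?_
    filter_upwards [continuous_snd.continuousAt.eventually (gt_mem_nhds h)] with w hw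
    rw [glue, if_neg (not_lt.2 (le_of_lt hw))]
  · rw [glue, if_pos h]
    refine grad_congr ?_
    filter_upwards [continuous_snd.continuousAt.eventually (lt_mem_nhds h)] with w hw
    rw [glue, if_pos hw]

lemma norm_grad_mul_le {a b : ℝ × ℝ → ℂ} {z : ℝ × ℝ} (ha : DifferentiableAt ℝ a z) (hb : DifferentiableAt ℝ b z) :
    ‖grad (fun z => a z * b z) z‖ ≤ ‖a z‖ * ‖grad b z‖ + ‖b z‖ * ‖grad a z‖ := by
  have h : ∀ i, ‖grad (fun z => a z * b z) z i‖ ≤ ‖a z‖ * ‖grad b z‖ + ‖b z‖ * ‖grad a z‖ := fun i => by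
    have e : grad (fun z => a z * b z) z i = a z * grad b z i + b z * grad a z i := by
      fin_cases i <;> simp [grad, fderiv_fun_mul ha hb]
    rw [e]
    refine norm_add_le_of_le ?_ ?_ <;> rw [norm_mul] <;> gcongr <;> exact norm_le_pi_norm _ _
  exact (pi_norm_le_iff_of_nonneg (by positivity)).2 h

lemma exists_grad_rightPart_le (hD : ContDiff ℝ 1 D) (hc : HasCompactSupport D) (h0 : ∀ t, D (t, 0) = 0) :
    ∃ C : ℝ, 0 ≤ C ∧ ∀ N z, ‖grad (rightPart N D) z‖ ≤ ‖grad D z‖ + (tsupport D).indicator (fun _ => C) z := by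
  obtain ⟨S, hS, hb⟩ := exists_deriv_smoothTransition_le
  obtain ⟨L, hL⟩ := hD.lipschitzWith_of_hasCompactSupport hc one_ne_zero
  refine ⟨L * S, by positivity, fun N z => ?_⟩
  have d := fun y => ((Real.smoothTransition.contDiff).differentiable one_ne_zero y).hasDerivAt
  have a1 : HasFDerivAt (fun z => N * z.2) (N • ContinuousLinearMap.snd ℝ ℝ ℝ) z := by fun_prop
  have a2 := Complex.ofRealCLM.hasFDerivAt.comp z ((d _).comp_hasFDerivAt z a1)
  have e : fderiv ℝ (fun z => ((smoothTransition (N * z.2) : ℝ) : ℂ)) z = _ := a2.fderiv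
  have hg : ‖grad (fun z => ((smoothTransition (N * z.2) : ℝ) : ℂ)) z‖ ≤ |deriv smoothTransition (N * z.2) * N| := by
    refine norm_grad_le ?_ ?_ <;> rw [e]
    · simp; positivity
    · simp
  have hs : ‖((smoothTransition (N * z.2) : ℝ) : ℂ)‖ ≤ 1 := by
    rw [norm_real, norm_of_nonneg (Real.smoothTransition.nonneg _)]
    exact Real.smoothTransition.le_one _
  refine (norm_grad_mul_le a2.differentiableAt (hD.differentiable one_ne_zero z)).trans (add_le_add (mul_le_of_le_one_left (norm_nonneg _) hs) ?_)
  by_cases hz : z ∈ tsupport D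
  · rw [indicator_of_mem hz]
    have h1 : ‖D z‖ ≤ L * |z.2| := by
      have := hL.dist_le_mul z (z.1, 0)
      rw [dist_eq_norm, h0, sub_zero, dist_eq_norm] at this
      refine this.trans_eq ?_
      bound
    calc _ ≤ L * |z.2| * |deriv smoothTransition (N * z.2) * N| := mul_le_mul h1 hg (norm_nonneg _) (by positivity)
      _ = L * |N * z.2 * deriv smoothTransition (N * z.2)| := by grind
      _ ≤ _ := by gcongr; exact (hb _).2
  · rw [indicator_of_notMem hz, image_eq_zero_of_notMem_tsupport hz]
    simp

lemma tendsto_rightPart (hD : ContDiff ℝ 1 D) (hc : HasCompactSupport D) (h0 : ∀ t, D (t, 0) = 0) :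
    Tendsto (fun n : ℕ => eLpNorm (rightPart (n + 1) D - glue D 0) 2 (volume.restrict halfPlane)) atTop (𝓝 0) ∧
    Tendsto (fun n : ℕ => eLpNorm (grad (rightPart (n + 1) D) - glue (grad D) 0) 2 (volume.restrict halfPlane)) atTop (𝓝 0) := by
  have hae : ∀ᵐ z ∂(volume.restrict halfPlane), z.2 ≠ 0 := ae_restrict_of_ae ae_snd_ne_zero
  obtain ⟨C, hC, hb⟩ := exists_grad_rightPart_le hD hc h0
  have c0 : ContinuousOn (0 : ℝ × ℝ → ℂ) halfPlane := continuousOn_const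
  have c0' : ContinuousOn (0 : ℝ × ℝ → Fin 2 → ℂ) halfPlane := continuousOn_const
  have cD := continuous_grad hD
  have hcD : HasCompactSupport (grad D) := hc.mono' fun z hz => by
    by_contra h
    exact hz (by rw [grad_congr (notMem_tsupport_iff_eventuallyEq.1 h)]; ext i; fin_cases i <;> simp [grad])
  constructor
  · refine tendsto_eLpNorm_two (fun n => ?_)
      (lintegral_enorm_sq_ne_top ((hD.continuous.memLp_of_hasCompactSupport hc).restrict _)) (fun n => ae_of_all _ fun z => ?_) ?_
    · exact (contDiff_rightPart (by simp) _ hD).continuous.aestronglyMeasurable.sub (aestronglyMeasurable_glue hD.continuous.continuousOn c0)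
    · have h1 := Real.smoothTransition.nonneg ((n + 1) * z.2)
      have h2 := Real.smoothTransition.le_one ((n + 1) * z.2)
      rw [enorm_le_iff_norm_le, Pi.sub_apply, rightPart, glue]
      split_ifs
      · rw [show ∀ a b : ℂ, a * b - b = (a - 1) * b from fun a b => by ring, norm_mul, ← ofReal_one, ← ofReal_sub, norm_real]
        exact mul_le_of_le_one_left (norm_nonneg _) (abs_le.2 ⟨by linarith, by linarith⟩)
      · rw [Pi.zero_apply, sub_zero, norm_mul, norm_real, norm_of_nonneg h1]
        exact mul_le_of_le_one_left (norm_nonneg _) h2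
    · filter_upwards [hae] with z hz
      filter_upwards [eventually_rightPart D hz] with n hn
      rw [Pi.sub_apply, hn.eq_of_nhds, sub_self]
  · have hm : MemLp ((tsupport D).indicator fun _ => C) 2 :=
      memLp_indicator_const 2 hc.isCompact.isClosed.measurableSet C (Or.inr hc.isCompact.measure_lt_top.ne)
    have hG := cD.memLp_of_hasCompactSupport (μ := volume) (p := 2) hcD
    refine tendsto_eLpNorm_two (g := fun z => ‖‖grad D z‖ + ‖grad D z‖ + (tsupport D).indicator (fun _ => C) z‖ₑ) (fun n => ?_)
      (lintegral_enorm_sq_ne_top (((hG.norm.add hG.norm).add hm).restrict _)) (fun n => ae_of_all _ fun z => ?_) ?_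
    · exact (continuous_grad (contDiff_rightPart (by simp) _ hD)).aestronglyMeasurable.sub (aestronglyMeasurable_glue cD.continuousOn c0')
    · rw [enorm_le_iff_norm_le]
      have h1 : ‖glue (grad D) 0 z‖ ≤ ‖grad D z‖ := by rw [glue]; split_ifs <;> simp
      have := norm_sub_le_of_le (hb (n + 1) z) h1
      refine le_trans ?_ (le_abs_self _)
      rw [Pi.sub_apply]
      linarith
    · filter_upwards [hae] with z hz
      filter_upwards [eventually_rightPart D hz] with n hn
      have e : grad (0 : ℝ × ℝ → ℂ) = 0 := by ext z i; fin_cases i <;> simp [grad]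
      rw [Pi.sub_apply, grad_congr hn, grad_glue D 0 hz, e, sub_self]

lemma memLp_two_of_lintegral {X E : Type*} [MeasurableSpace X] [NormedAddCommGroup E] {μ : Measure X} {f : X → E} (hf : AEStronglyMeasurable f μ)
    (h : ∫⁻ x, ‖f x‖ₑ ^ 2 ∂μ < ⊤) : MemLp f 2 μ := by
  have h2 := eLpNorm_nnreal_pow_eq_lintegral (f := f) (μ := μ) two_ne_zero
  refine ⟨hf, lt_top_iff_ne_top.2 fun h' => ?_⟩
  simp_all

lemma isTest_add_rightPart {Θ : ℝ × ℝ → ℂ} (hΘ : IsTest halfPlane Θ) (hf : ContDiffOn ℝ (⊤ : ℕ∞) f halfPlane)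
    (hg : ContDiffOn ℝ (⊤ : ℕ∞) g halfPlane) (N : ℝ) :
    IsTest halfPlane ((fun z => g z * Θ z) + rightPart N ((fun z => f z * Θ z) - fun z => g z * Θ z)) := by
  have hfΘ := hΘ.contDiff_mul_of_le isOpen_halfPlane le_rfl hf
  have hgΘ := hΘ.contDiff_mul_of_le isOpen_halfPlane le_rfl hg
  have h0 : ∀ z, z ∉ tsupport Θ → ((fun z => g z * Θ z) + rightPart N ((fun z => f z * Θ z) - fun z => g z * Θ z)) z = 0 := fun z hz => by
    simp [rightPart, image_eq_zero_of_notMem_tsupport hz]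
  refine ⟨hgΘ.add (contDiff_rightPart le_rfl N (hfΘ.sub hgΘ)), HasCompactSupport.intro hΘ.2.1 h0,
    (closure_minimal (fun z hz => ?_) (isClosed_tsupport Θ)).trans hΘ.2.2⟩
  by_contra h
  simp_all

lemma tendsto_cutoff_glue (hf : ContDiffOn ℝ 1 f halfPlane) (hg : ContDiffOn ℝ 1 g halfPlane)
    (hG : MemLp (glue (grad f) (grad g)) 2 (volume.restrict halfPlane))
    (h0 : ∀ᵐ x : ℝ, ∃ τ : ℕ → ℝ, (∀ n, 0 < τ n) ∧ Tendsto τ atTop (𝓝 0) ∧ Tendsto (fun n => glue f g (τ n, x)) atTop (𝓝 0)) :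
    Tendsto (fun n : ℕ => eLpNorm (glue (grad fun z => f z * cutoff (n + 1) z) (grad fun z => g z * cutoff (n + 1) z) - glue (grad f) (grad g)) 2
      (volume.restrict halfPlane)) atTop (𝓝 0) := by
  obtain ⟨C, hC, hb⟩ := exists_grad_cutoff_le
  have hT : ∀ n : ℕ, IsTest halfPlane (cutoff (n + 1)) := fun n => isTest_cutoff (by positivity)
  have mH : MemLp (fun z : ℝ × ℝ => (z.1⁻¹ : ℂ) * glue f g z) 2 (volume.restrict halfPlane) := memLp_two_of_lintegral
    ((by fun_prop : Measurable fun z : ℝ × ℝ => (z.1⁻¹ : ℂ)).aestronglyMeasurable.mul (aestronglyMeasurable_glue hf.continuousOn hg.continuousOn))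
    (lintegral_hardy_lt_top hf hg hG h0)
  have mD := (hG.norm.const_mul 2).add (mH.norm.const_mul C)
  refine tendsto_eLpNorm_two (fun n => ?_) (lintegral_enorm_sq_ne_top mD) (fun n => ?_) ?_
  · exact (aestronglyMeasurable_glue (continuous_grad ((hT n).contDiff_mul isOpen_halfPlane hf)).continuousOn
      (continuous_grad ((hT n).contDiff_mul isOpen_halfPlane hg)).continuousOn).sub hG.1
  · refine (ae_restrict_mem measurableSet_halfPlane).mono fun z hz => ?_
    have hz0 : 0 < z.1 := hz
    rw [enorm_le_iff_norm_le]
    refine le_trans ?_ (le_abs_self _)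
    have key : ∀ {f : ℝ × ℝ → ℂ}, ContDiffOn ℝ 1 f halfPlane →
        ‖grad (fun z => f z * cutoff (n + 1) z) z - grad f z‖ ≤ 2 * ‖grad f z‖ + C * ‖(z.1⁻¹ : ℂ) * f z‖ := fun {f} hf => by
      have h1 := norm_grad_mul_le ((hf.contDiffAt (isOpen_halfPlane.mem_nhds hz)).differentiableAt one_ne_zero) ((hT n).1.differentiable (by simp) z)
      have h2 := mul_le_mul_of_nonneg_left (hb (n + 1) (by positivity) z hz) (norm_nonneg (f z))
      have h3 := mul_le_mul_of_nonneg_right (norm_cutoff_le (n + 1) z) (norm_nonneg (grad f z))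
      rw [norm_mul, norm_inv, norm_real, norm_of_nonneg hz0.le]
      refine (norm_sub_le _ _).trans ?_
      linarith
    simp only [Pi.sub_apply, Pi.add_apply, glue]
    split_ifs
    · exact key hf
    · exact key hg
  · refine (ae_restrict_mem measurableSet_halfPlane).mono fun z hz => ?_
    obtain ⟨K, hK, hz', hs⟩ := exists_compact_subset isOpen_halfPlane hz
    filter_upwards [eventually_cutoff_eq_one hK hs] with n hn
    have key : ∀ f : ℝ × ℝ → ℂ, grad (fun z => f z * cutoff (n + 1) z) z = grad f z := fun f => grad_congr <| by
      filter_upwards [mem_interior_iff_mem_nhds.1 hz'] with w hw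
      simp_all
    simp only [Pi.sub_apply, glue, key, sub_self]

/-- Functions with finite energy and vanishing trace, that are smooth on both sides of the line `x = 0` and
continuous across it, belong to the closure of the test functions. -/
lemma isHDotZero_glue (hf : ContDiffOn ℝ (⊤ : ℕ∞) f halfPlane) (hg : ContDiffOn ℝ (⊤ : ℕ∞) g halfPlane)
    (hfg : ∀ t : ℝ, 0 < t → f (t, 0) = g (t, 0)) (hG : MemLp (glue (grad f) (grad g)) 2 (volume.restrict halfPlane))
    (h0 : ∀ᵐ x : ℝ, ∃ τ : ℕ → ℝ, (∀ n, 0 < τ n) ∧ Tendsto τ atTop (𝓝 0) ∧ Tendsto (fun n => glue f g (τ n, x)) atTop (𝓝 0)) :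
    IsHDotZero (glue f g) (glue (grad f) (grad g)) := by
  have hf1 : ContDiffOn ℝ 1 f halfPlane := hf.of_le (by simp)
  have hg1 : ContDiffOn ℝ 1 g halfPlane := hg.of_le (by simp)
  have hT : ∀ n : ℕ, IsTest halfPlane (cutoff (n + 1)) := fun n => isTest_cutoff (by positivity)
  have cf := fun n => (hT n).contDiff_mul isOpen_halfPlane hf1
  have cg := fun n => (hT n).contDiff_mul isOpen_halfPlane hg1
  set F := fun (n : ℕ) z => f z * cutoff (n + 1) z with hF
  set H := fun (n : ℕ) z => g z * cutoff (n + 1) z with hH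
  have hpos : ∀ n : ℕ, (0 : ℝ≥0∞) < ((n : ℝ≥0∞))⁻¹ := by simp
  have ex : ∀ n, ∃ N : ℕ, eLpNorm (rightPart (N + 1) (F n - H n) - glue (F n - H n) 0) 2 (volume.restrict halfPlane) < (n : ℝ≥0∞)⁻¹ ∧
      eLpNorm (grad (rightPart (N + 1) (F n - H n)) - glue (grad (F n - H n)) 0) 2 (volume.restrict halfPlane) < (n : ℝ≥0∞)⁻¹ := fun n => by
    have ht := tendsto_rightPart (D := F n - H n) ((cf n).sub (cg n)) ((hT n).2.1.mul_left.sub (hT n).2.1.mul_left) fun t => by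
      by_cases h : (t, (0 : ℝ)) ∈ halfPlane
      · simp [hF, hH, hfg t h]
      · simp [hF, hH, ((hT n).eq_zero h).1]
    exact ((ht.1.eventually (gt_mem_nhds (hpos n))).and (ht.2.eventually (gt_mem_nhds (hpos n)))).exists
  choose N hN1 hN2 using ex
  refine ⟨aestronglyMeasurable_glue hf.continuousOn hg.continuousOn, hG, fun n => H n + rightPart (N n + 1) (F n - H n),
    fun n => isTest_add_rightPart (hT n) hf hg _, fun K hK hs => ?_, ?_⟩
  · refine tendsto_zero_of_le ENNReal.tendsto_inv_nat_nhds_zero ?_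
    filter_upwards [eventually_cutoff_eq_one hK hs] with n hn
    refine le_trans (le_of_eq ?_) ((eLpNorm_mono_measure _ (restrict_mono hs le_rfl)).trans (hN1 n).le)
    refine eLpNorm_congr_ae ((ae_restrict_mem hK.measurableSet).mono fun z hz => ?_)
    simp only [Pi.sub_apply, Pi.add_apply, glue, hF, hH, hn z hz, mul_one, Pi.zero_apply]
    split_ifs <;> ring
  · have h1 := ENNReal.tendsto_inv_nat_nhds_zero.add (tendsto_cutoff_glue hf1 hg1 hG h0)
    rw [add_zero] at h1
    refine tendsto_of_tendsto_of_tendsto_of_le_of_le tendsto_const_nhds h1 (fun _ => zero_le) fun n => ?_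
    have cr : ContDiff ℝ 1 (rightPart (N n + 1) (F n - H n)) := contDiff_rightPart (by simp) _ ((cf n).sub (cg n))
    have add : ∀ {a b : ℝ × ℝ → ℂ}, ContDiff ℝ 1 a → ContDiff ℝ 1 b → grad (a + b) = grad a + grad b := fun ha hb => by
      ext z i
      have := fderiv_add (ha.differentiable one_ne_zero z) (hb.differentiable one_ne_zero z)
      fin_cases i <;> simp [grad, this]
    have e1 : grad (F n) = grad (H n) + grad (F n - H n) := by rw [← add (a := H n) (b := F n - H n) (cg n) ((cf n).sub (cg n)), add_sub_cancel]
    have e : grad (H n + rightPart (N n + 1) (F n - H n)) - glue (grad f) (grad g) =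
        (grad (rightPart (N n + 1) (F n - H n)) - glue (grad (F n - H n)) 0) + (glue (grad (F n)) (grad (H n)) - glue (grad f) (grad g)) := by
      rw [add (cg n) cr, e1]
      ext z : 1
      simp only [Pi.sub_apply, Pi.add_apply, glue, Pi.zero_apply]
      split_ifs <;> abel
    have cD := continuous_grad ((cf n).sub (cg n))
    rw [e]
    refine (eLpNorm_add_le ((continuous_grad cr).aestronglyMeasurable.sub (aestronglyMeasurable_glue cD.continuousOn continuousOn_const))
      ((aestronglyMeasurable_glue (continuous_grad (cf n)).continuousOn (continuous_grad (cg n)).continuousOn).sub hG.1) (by simp)).trans ?_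
    exact add_le_add (hN2 n).le le_rfl

/-! ### The variational identity -/

lemma coeff_mulVec_apply (k x : ℝ) (v : Fin 2 → ℂ) : coeff k x *ᵥ v = ![v 0 + k * sign x * v 1, -(k * sign x) * v 0 + v 1] := by
  rw [← coeff_mulVec]
  simp

lemma abs_sign_le (x : ℝ) : |sign x| ≤ 1 := by
  rcases Real.sign_apply_eq x with h | h | h <;> rw [h] <;> simp

lemma memLp_coeff_mulVec (k : ℝ) {G : ℝ × ℝ → Fin 2 → ℂ} (hG : MemLp G 2 (volume.restrict halfPlane)) :
    MemLp (fun z => coeff k z.2 *ᵥ G z) 2 (volume.restrict halfPlane) := by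
  have hm := fun i => (aemeasurable_pi_iff.1 hG.1.aemeasurable) i
  have hs : Measurable fun z : ℝ × ℝ => ((sign z.2 : ℝ) : ℂ) := Complex.measurable_ofReal.comp (measurable_sign.comp measurable_snd)
  refine (hG.const_smul (1 + |k|)).mono (AEMeasurable.aestronglyMeasurable (aemeasurable_pi_iff.2 fun i => ?_)) (ae_of_all _ fun z => ?_)
  · simp only [coeff_mulVec_apply]
    fin_cases i
    · exact (hm 0).add ((hs.const_mul _).aemeasurable.mul (hm 1))
    · exact ((hs.const_mul _).neg.aemeasurable.mul (hm 0)).add (hm 1)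
  · rw [Pi.smul_apply, norm_smul, norm_of_nonneg (by positivity)]
    have h0 := norm_le_pi_norm (G z) 0
    have h1 := norm_le_pi_norm (G z) 1
    have hk : ‖(k * sign z.2 : ℂ)‖ ≤ |k| := by
      rw [norm_mul, norm_real, norm_real]
      exact mul_le_of_le_one_right (norm_nonneg _) (abs_sign_le _)
    refine (pi_norm_le_iff_of_nonneg (by positivity)).2 fun i => ?_
    rw [coeff_mulVec_apply, add_mul, one_mul]
    fin_cases i
    · refine norm_add_le_of_le h0 ?_
      rw [norm_mul]; gcongr
    · refine (norm_add_le_of_le ?_ h1).trans_eq (add_comm _ _)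
      rw [norm_mul, norm_neg]; gcongr

lemma nnnorm_dotProduct_star_le (v w : Fin 2 → ℂ) : ‖v ⬝ᵥ star w‖₊ ≤ 2 * ‖v‖₊ * ‖w‖₊ := by
  have h : ∀ i, ‖v i * star w i‖₊ ≤ ‖v‖₊ * ‖w‖₊ := fun i => by
    rw [nnnorm_mul, Pi.star_apply, nnnorm_star]
    exact mul_le_mul' (nnnorm_le_pi_nnnorm _ _) (nnnorm_le_pi_nnnorm _ _)
  rw [dotProduct, Fin.sum_univ_two, mul_assoc, two_mul]
  exact (nnnorm_add_le _ _).trans (add_le_add (h 0) (h 1))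

lemma aestronglyMeasurable_dotProduct_star {V Ψ : ℝ × ℝ → Fin 2 → ℂ} (hV : AEStronglyMeasurable V μ)
    (hΨ : AEStronglyMeasurable Ψ μ) : AEStronglyMeasurable (fun z => V z ⬝ᵥ star (Ψ z)) μ :=
  by fun_prop

lemma integrable_dotProduct_star {V Ψ : ℝ × ℝ → Fin 2 → ℂ} (hV : MemLp V 2 μ) (hΨ : MemLp Ψ 2 μ) :
    Integrable (fun z => V z ⬝ᵥ star (Ψ z)) μ :=
  memLp_one_iff_integrable.1 (MemLp.of_bilin (fun v w => v ⬝ᵥ star w) 2 hV hΨ (aestronglyMeasurable_dotProduct_star hV.1 hΨ.1)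
    (ae_of_all _ fun _ => nnnorm_dotProduct_star_le _ _))

lemma form_sub (k : ℝ) {V W Ψ : ℝ × ℝ → Fin 2 → ℂ} (hV : MemLp V 2 (volume.restrict halfPlane)) (hW : MemLp W 2 (volume.restrict halfPlane))
    (hΨ : MemLp Ψ 2 (volume.restrict halfPlane)) : form k (V - W) Ψ = form k V Ψ - form k W Ψ := by
  rw [form, form, form, ← integral_sub (integrable_dotProduct_star (memLp_coeff_mulVec k hV) hΨ) (integrable_dotProduct_star (memLp_coeff_mulVec k hW) hΨ)]
  simp only [Pi.sub_apply, Matrix.mulVec_sub, sub_dotProduct]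

lemma IsTest.star (h : IsTest Ω φ) : IsTest Ω (fun z => star (φ z)) ∧ ∀ z, grad (fun z => star (φ z)) z = star (grad φ z) := by
  have e : tsupport (fun z => Star.star (φ z)) = tsupport φ := by
    rw [tsupport, tsupport]; congr 1; ext z; simp
  refine ⟨⟨(starL' ℝ).contDiff.comp h.1, ?_, e ▸ h.2.2⟩, fun z => ?_⟩
  · rw [HasCompactSupport, e]; exact h.2.1
  · have e' : fderiv ℝ (fun z => Star.star (φ z)) z = _ := fderiv_star
    ext i
    rw [grad, e']
    fin_cases i <;> rfl

lemma form_eq_zero {G : ℝ × ℝ → Fin 2 → ℂ} (hG : MemLp G 2 (volume.restrict halfPlane))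
    (hw : ∀ φ, IsTest halfPlane φ → ∫ z in halfPlane, (coeff k z.2 *ᵥ G z) ⬝ᵥ grad φ z = 0) {ψ : ℝ × ℝ → ℂ} {Ψ : ℝ × ℝ → Fin 2 → ℂ}
    (h : IsHDotZero ψ Ψ) : form k G Ψ = 0 := by
  obtain ⟨-, hΨ, φ, hφ, -, hlim⟩ := h
  have hV := memLp_coeff_mulVec k hG
  have hg : ∀ n, MemLp (grad (φ n)) 2 (volume.restrict halfPlane) := fun n => by
    have c1 : ContDiff ℝ 1 (φ n) := (hφ n).1.of_le (by simp)
    refine ((continuous_grad c1).memLp_of_hasCompactSupport ?_).restrict _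
    exact HasCompactSupport.intro (hφ n).2.1 fun z hz => by
      rw [grad_congr (notMem_tsupport_iff_eventuallyEq.1 hz)]; ext i; fin_cases i <;> simp [grad]
  refine tendsto_nhds_unique (f := fun n => form k G (grad (φ n))) (l := atTop) ?_ ?_
  · refine tendsto_integral_of_L1' _ (integrable_dotProduct_star hV hΨ).1 (Eventually.of_forall fun n => integrable_dotProduct_star hV (hg n)) ?_
    have h1 : Tendsto (fun n => 2 * eLpNorm (fun z => coeff k z.2 *ᵥ G z) 2 (volume.restrict halfPlane) *
        eLpNorm (grad (φ n) - Ψ) 2 (volume.restrict halfPlane)) atTop (𝓝 0) := by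
      have := ENNReal.Tendsto.const_mul hlim (Or.inr (mul_ne_top (a := 2) (by simp) hV.2.ne))
      grind
    refine tendsto_of_tendsto_of_tendsto_of_le_of_le tendsto_const_nhds h1 (fun _ => zero_le) fun n => ?_
    refine le_trans (le_of_eq ?_) (eLpNorm_le_eLpNorm_mul_eLpNorm_of_nnnorm (p := 2) (q := 2) (r := 1) hV.1 ((hg n).sub hΨ).1 (fun v w => v ⬝ᵥ star w) 2
      (ae_of_all _ fun _ => nnnorm_dotProduct_star_le _ _))
    refine congrArg (fun F => eLpNorm F 1 _) (funext fun z => ?_)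
    simp only [Pi.sub_apply, star_sub, dotProduct_sub]
  · refine tendsto_const_nhds.congr fun n => ?_
    rw [form, ← hw _ (hφ n).star.1]
    simp only [(hφ n).star.2]

/-! ### The Poisson integral of a smooth function is the variational solution -/

lemma pairField_zero (p m q n : ℂ → ℂ) (z : ℝ × ℝ) : pairField p m q n z 0 = glue (hf0 p m) (hf0 q n) z := by
  rw [pairField, glue, glue]
  bound

lemma IsPair.pairGrad_eq {p q : ℂ → ℂ} (h : IsPair k p m q n) {z : ℝ × ℝ} (hz : z ∈ halfPlane) :
    pairGrad p m q n z = glue (grad (hf0 p m)) (grad (hf0 q n)) z := by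
  obtain ⟨-, a1, a2⟩ := fderiv_hf0 h.hp h.hm (ne_of_gt hz)
  obtain ⟨-, b1, b2⟩ := fderiv_hf0 h.hq h.hn (ne_of_gt hz)
  rw [pairGrad, glue, glue]
  split_ifs
  · rw [grad, a1, a2]
  · rw [grad, b1, b2]

include hpq hα in
lemma exists_seq_tendsto_poissonIntegral
    (hu : MemLp u 𝔭) : ∃ τ : ℕ → ℝ, (∀ n, 0 < τ n) ∧ Tendsto τ atTop (𝓝 0) ∧
      ∀ᵐ x : ℝ, Tendsto (fun n => poissonIntegral α u (τ n, x)) atTop (𝓝 (u x)) := by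
  obtain ⟨C, hC⟩ := exists_poissonIntegral_bound hpq hα
  have h0 : ∀ n : ℕ, (0 : ℝ) < 1 / (n + 1) := fun n => Nat.one_div_pos_of_nat
  have h1 := tendsto_one_div_add_atTop_nhds_zero_nat (𝕜 := ℝ)
  have h2 : Tendsto (fun n : ℕ => (1 : ℝ) / (n + 1)) atTop (𝓝[>] 0) := tendsto_nhdsWithin_iff.2 ⟨h1, Eventually.of_forall h0⟩
  obtain ⟨ns, hns, h⟩ := (tendstoInMeasure_of_tendsto_eLpNorm (by simpa using hpq.pos) (fun n : ℕ => (hC u hu _ (h0 n)).1.1) hu.1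
    ((tendsto_poissonIntegral hpq hα hu).comp h2)).exists_seq_tendsto_ae
  exact ⟨_, fun n => h0 (ns n), h1.comp hns.tendsto_atTop, h⟩

lemma memLp_two_of_energy {G : ℝ × ℝ → Fin 2 → ℂ} (hm : AEStronglyMeasurable G (volume.restrict halfPlane)) (h : energy G < ⊤) :
    MemLp G 2 (volume.restrict halfPlane) := by
  refine memLp_two_of_lintegral hm (lt_of_le_of_lt (lintegral_mono fun z => ?_) h)
  have key : ‖G z‖ₑ ≤ max ‖G z 0‖ₑ ‖G z 1‖ₑ := by
    refine ENNReal.coe_le_coe.2 (pi_nnnorm_le_iff.2 fun i => ?_)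
    fin_cases i
    · simp
    simp
  refine (pow_le_pow_left₀ zero_le key 2).trans ?_
  rcases le_total ‖G z 0‖ₑ ‖G z 1‖ₑ with h | h
  · rw [max_eq_right h]; exact le_add_self
  · rw [max_eq_left h]; exact le_self_add

lemma isHDotSolution_poissonIntegral (hα : α ∈ Ioo (-1 : ℝ) 1) (hk : tan (π * α / 2) = k)
    (hu : ContDiff ℝ (⊤ : ℕ∞) u) (hc : HasCompactSupport u) : IsHDotSolution k u (poissonIntegral α u) ∧
      ∃ G : ℝ × ℝ → Fin 2 → ℂ, HasWeakGrad (poissonIntegral α u) G ∧ energy G < ⊤ := by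
  obtain ⟨p, q, hpq, hr⟩ := exists_holderConjugate_range hα
  have hm := hu.continuous.memLp_of_hasCompactSupport (μ := volume) (p := ofReal p) hc
  obtain ⟨-, -, -, -, -, a, b, c, d, h, -, e⟩ := exists_pair_poissonIntegral hpq hr hα.1.ne' hk hm
  obtain ⟨hw, -, hs⟩ := h.pairGrad_spec
  have eg : ∀ z ∈ halfPlane, glue (hf0 a b) (hf0 c d) z = poissonIntegral α u z := fun z hz => by rw [← pairField_zero, e z hz]
  have hE : energy (pairGrad a b c d) < ⊤ := by
    have := energy_glue_lt_top hα (hu.of_le (by simp)) hc (f := hf0 a b) (g := hf0 c d)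
      (fun t x ht hx => by rw [← eg (t, x) ht, glue, if_pos hx]) (fun t x ht hx => by rw [← eg (t, x) ht, glue, if_neg (not_lt.2 hx.le)])
    refine lt_of_eq_of_lt (setLIntegral_congr_fun measurableSet_halfPlane fun z hz => ?_) this
    simp only [h.pairGrad_eq hz]
  have hG := memLp_two_of_energy hw.2.1.aestronglyMeasurable hE
  refine ⟨?_, _, hw.congr e, hE⟩
  have hΩ : ∀ z ∈ halfPlane, z.1 ≠ 0 := fun z hz => ne_of_gt hz
  have cf := contDiffOn_hf0_of (n := (⊤ : ℕ∞)) h.hp h.hm hΩ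
  have cg := contDiffOn_hf0_of (n := (⊤ : ℕ∞)) h.hq h.hn hΩ
  set U₁ : ℝ × ℝ → ℂ := fun z => ((smoothTransition (2 - z.1 ^ 2) : ℝ) : ℂ) * u z.2 with hU
  have cU : ContDiff ℝ (⊤ : ℕ∞) U₁ := (Complex.ofRealCLM.contDiff.comp (Real.smoothTransition.contDiff.comp (by fun_prop))).mul (hu.comp contDiff_snd)
  have sU : HasCompactSupport U₁ := HasCompactSupport.intro ((isCompact_Icc (a := (-2 : ℝ)) (b := 2)).prod hc) fun z hz => by
    by_cases h2 : z.2 ∈ tsupport u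
    · have h1 : z.1 ∉ Icc (-2 : ℝ) 2 := by grind
      have : 2 - z.1 ^ 2 ≤ 0 := by
        by_contra h3
        exact h1 (abs_le.1 (abs_le_of_sq_le_sq (by linarith) zero_le_two))
      simp [hU, Real.smoothTransition.zero_of_nonpos this]
    · simp [hU, image_eq_zero_of_notMem_tsupport h2]
  have cU1 : ContDiff ℝ 1 U₁ := cU.of_le (by simp)
  have gU : MemLp (grad U₁) 2 (volume.restrict halfPlane) := by
    refine ((continuous_grad cU1).memLp_of_hasCompactSupport (HasCompactSupport.intro sU fun z hz => ?_)).restrict _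
    rw [grad_congr (notMem_tsupport_iff_eventuallyEq.1 hz)]
    ext i; fin_cases i <;> simp [grad]
  have eG : ∀ z ∈ halfPlane, glue (grad (U₁ - hf0 a b)) (grad (U₁ - hf0 c d)) z = (grad U₁ - pairGrad a b c d) z := fun z hz => by
    have key : ∀ {f : ℝ × ℝ → ℂ}, ContDiffOn ℝ (⊤ : ℕ∞) f halfPlane → grad (U₁ - f) z = grad U₁ z - grad f z := fun hf => by
      have := fderiv_sub (cU.differentiable (by simp) z) ((hf.contDiffAt (isOpen_halfPlane.mem_nhds hz)).differentiableAt (by simp))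
      ext i
      fin_cases i <;> simp [grad, this]
    rw [Pi.sub_apply, h.pairGrad_eq hz, glue, glue, key cf, key cg]
    bound
  have aG : glue (grad (U₁ - hf0 a b)) (grad (U₁ - hf0 c d)) =ᵐ[volume.restrict halfPlane] grad U₁ - pairGrad a b c d :=
    (ae_restrict_mem measurableSet_halfPlane).mono eG
  have eU : ∀ z ∈ halfPlane, glue (U₁ - hf0 a b) (U₁ - hf0 c d) z = U₁ z - poissonIntegral α u z := fun z hz => by
    rw [← eg z hz, glue, glue]
    bound
  refine ⟨U₁, _, glue (grad (U₁ - hf0 a b)) (grad (U₁ - hf0 c d)), cU, sU, fun x => ?_,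
    isHDotZero_glue (cU.contDiffOn.sub cf) (cU.contDiffOn.sub cg) (fun t ht => ?_) ((memLp_congr_ae aG).2 (gU.sub hG)) ?_,
    fun ψ Ψ hψ => ?_, fun z hz => by rw [eU z hz, sub_sub_cancel]⟩
  · simp [hU, Real.smoothTransition.one_of_one_le one_le_two]
  · rw [Pi.sub_apply, Pi.sub_apply, h.tang t ht.ne']
  · obtain ⟨τ, t0, t1, t2⟩ := exists_seq_tendsto_poissonIntegral hpq hr hm
    filter_upwards [t2] with x hx
    refine ⟨τ, t0, t1, Tendsto.congr (fun n => (eU (τ n, x) (t0 n)).symm) ?_⟩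
    have h1 : Tendsto (fun n => U₁ (τ n, x)) atTop (𝓝 (U₁ (0, x))) := (cU.continuous.tendsto (0, x)).comp (t1.prodMk_nhds tendsto_const_nhds)
    have h2 : U₁ (0, x) = u x := by simp [hU, Real.smoothTransition.one_of_one_le one_le_two]
    simpa [h2] using h1.sub hx
  · have : form k (glue (grad (U₁ - hf0 a b)) (grad (U₁ - hf0 c d))) Ψ = form k (grad U₁ - pairGrad a b c d) Ψ :=
      setIntegral_congr_fun measurableSet_halfPlane fun z hz => by simp only [eG z hz]
    rw [this, form_sub k gU hG hψ.2.1, form_eq_zero hG hs hψ, sub_zero]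

end

end HarmonicMeasure

theorem mainTheorem5 {p q : ℝ} (hpq : p.HolderConjugate q) :
    -- the boundary equation branch
    (∀ α k : ℝ, α ∈ Ioo (1 / q - 2) (1 / q) → α ≠ -1 → Real.tan (Real.pi * α / 2) = k →
      ∃ C : ℝ≥0, ∀ u : ℝ → ℂ, MemLp u (ENNReal.ofReal p) volume →
        (∀ t x : ℝ, 0 < t → Integrable (fun y => (jumpPoissonKernel α t x y : ℂ) * u y) volume) ∧
        IsWeakSolution k (poissonIntegral α u) ∧
        (∀ t : ℝ, 0 < t →
          MemLp (fun x => poissonIntegral α u (t, x)) (ENNReal.ofReal p) volume ∧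
          eLpNorm (fun x => poissonIntegral α u (t, x)) (ENNReal.ofReal p) volume
            ≤ C * eLpNorm u (ENNReal.ofReal p) volume) ∧
        Tendsto
          (fun t : ℝ =>
            eLpNorm (fun x => poissonIntegral α u (t, x) - u x) (ENNReal.ofReal p) volume)
          (𝓝[>] 0) (𝓝 0) ∧
        ∃ ψ : ℝ → ℂ, MemLp ψ (ENNReal.ofReal p) volume ∧
          BoundaryEquation k (ENNReal.ofReal p) u ψ ∧
          (∀ ψ' : ℝ → ℂ, MemLp ψ' (ENNReal.ofReal p) volume →
            BoundaryEquation k (ENNReal.ofReal p) u ψ' → ψ' =ᵐ[volume] ψ) ∧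
          (∃ F : ℝ × ℝ → Fin 2 → ℂ,
            IsCauchyExtension k (ENNReal.ofReal p) (dirichletAnsatz k ψ) F ∧
            ∀ z ∈ halfPlane, poissonIntegral α u z = F z 0) ∧
          (∀ t x : ℝ, 0 < t →
            Integrable (fun y => (dirichletCauchyKernel k t x y : ℂ) * ψ y) volume ∧
            poissonIntegral α u (t, x) = ∫ y, (dirichletCauchyKernel k t x y : ℂ) * ψ y)) ∧
    -- the Lax--Milgram branch
    (∀ α k : ℝ, α ∈ Ioo (-1 : ℝ) 1 → Real.tan (Real.pi * α / 2) = k →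
      (∀ t x y : ℝ, 0 < t → 0 ≤ jumpPoissonKernel α t x y) ∧
      ∀ u : ℝ → ℂ, ContDiff ℝ ∞ u → HasCompactSupport u →
        (∀ t x : ℝ, 0 < t → Integrable (fun y => (jumpPoissonKernel α t x y : ℂ) * u y) volume) ∧
        IsWeakSolution k (poissonIntegral α u) ∧
        IsHDotSolution k u (poissonIntegral α u) ∧
        ∃ G : ℝ × ℝ → Fin 2 → ℂ, HasWeakGrad (poissonIntegral α u) G ∧ energy G < ⊤) := by
  refine ⟨fun α k hα h1 hk => ?_, fun α k hα hk => ?_⟩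
  · obtain ⟨C, hC⟩ := exists_poissonIntegral_bound hpq hα
    refine ⟨C, fun u hu => ⟨fun t x ht => integrable_jumpPoissonKernel hpq hα hu ht.ne' x, isWeakSolution_poissonIntegral hpq hα h1 hk hu,
      hC u hu, tendsto_poissonIntegral hpq hα hu, ?_⟩⟩
    obtain ⟨ψ, hψ, hb, hun, hD, a, b, c, d, -, hF, e⟩ := exists_pair_poissonIntegral hpq hα h1 hk hu
    exact ⟨ψ, hψ, hb, hun, ⟨_, hF, fun z hz => (e z hz).symm⟩, hD⟩
  · refine ⟨fun t x y ht => jumpPoissonKernel_nonneg hα ht x y, fun u hu hc => ?_⟩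
    obtain ⟨p', q', hpq', hr⟩ := exists_holderConjugate_range hα
    have hm := hu.continuous.memLp_of_hasCompactSupport (μ := volume) (p := ENNReal.ofReal p') hc
    exact ⟨fun t x ht => integrable_jumpPoissonKernel hpq' hr hm ht.ne' x, isWeakSolution_poissonIntegral hpq' hr hα.1.ne' hk hm,
      isHDotSolution_poissonIntegral hα hk hu hc⟩
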